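/- Work over $\mathbb{C}$. **The space of curves.** Let $U$ be the space of bihomogeneous forms $F(x_0,x_1;u_0,u_1)$ of bidegree $(3,4)$ whose zero set is a smooth curve in $\mathbb{P}^1\times\mathbb{P}^1$, an open subset of the affine space of all such forms. Let $\mathcal{C}^{(3,4)}=U/(GL_2\times GL_2)$ be the variety of smooth $(3,4)$-curves modulo $PGL_2\times PGL_2$ (quotient topology; the regular functions are the functions whose pullback to $U$ is regular). **The locus.** Let $\mathcal{C}_b^{(3,4)}\subset\mathcal{C}^{(3,4)}$ be the closure of the set of classes of curves $\{F=0\}$ for which the first projection to $\mathbb{P}^1$ has a fiber of the form $2x+2y$, that is, for which $F(a;\cdot)$ is the square of a product of two nonzero linear forms for some $a\in\mathbb{P}^1$. It carries the following scheme structure. Let $B\subset\mathbb{P}^1\times U$ be the incidence scheme of pairs $(a,F)$ such that $F(a;\cdot)$ is a square, i.e. the inverse image, under $(a,F)\mapsto F(a;\cdot)$, of the integral variety of squares of quadratic forms in the space of binary quartic forms. Let $\pi:B\to U$ be the (finite) projection, and let $I=\mathrm{Fitt}_0(\pi_*\mathcal{O}_B)\subset\mathcal{O}_U$. The ideal sheaf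 of $\mathcal{C}_b^{(3,4)}$ consists of the regular functions on open subsets of $\mathcal{C}^{(3,4)}$ whose pullback to $U$ lies in $I$. **Its preimage.** Let $\mathcal{M}_6^{trig}$ be the coarse space of isomorphism classes of trigonal curves of genus $6$: smooth projective connected curves of genus $6$ with a map of degree $3$ to $\mathbb{P}^1$. A subset is open, and a function on an open subset is regular, if this holds after pullback under the classifying map of every family of such curves, with a degree $3$ covering of $\mathbb{P}^1$, over a $\mathbb{C}$-algebra of finite type. Consider the birational map $\mathcal{M}_6^{trig}\dashrightarrow\mathcal{C}^{(3,4)}$ that sends a trigonal curve isomorphic to a smooth $(3,4)$-curve to the class of the latter. The preimage of $\mathcal{C}_b^{(3,4)}$ in $\mathcal{M}_6^{trig}$ is the closure of the preimage in the domain of this map; on the domain, its ideal sheaf is generated by the pullbacks of the sections of the ideal sheaf of $\mathcal{C}_b^{(3,4)}$. **Proposition.** Both $\mathcal{C}_b^{(3,4)}\subset\mathcal{C}^{(3,4)}$ and its preimage in $\mathcal{M}_6^{trig}$ are generically reduced divisors: each is a nonempty closed subset all of whose irreducible components have codimension one, and over an open subset of the ambient space that meets it in a dense subset, its ideal sheaf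 is the ideal sheaf of all regular functions vanishing on it. -/

import Mathlib

open Polynomial

noncomputable section

namespace Bitangent34

/-! ### Generalities: regular functions, Fitting ideals, generically reduced divisors -/

/-- The Zariski topology on the set of `ℂ`-points of a `ℂ`-algebra. -/
abbrev zariskiTopology (R : Type) [CommRing R] [Algebra ℂ R] : TopologicalSpace (R →ₐ[ℂ] ℂ) :=
  TopologicalSpace.induced
    (fun p => (⟨RingHom.ker p, RingHom.ker_isPrime p⟩ : PrimeSpectrum R)) inferInstance

/-- The zeroth Fitting ideal of a finite module: the ideal generated by the maximal minors of
all matrices of relations among a finite system of generators. -/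
def fittingIdeal (S : Type) [CommRing S] (M : Type) [AddCommGroup M] [Module S M] : Ideal S :=
  Ideal.span {d | ∃ (n : ℕ) (m : Fin n → M) (A : Matrix (Fin n) (Fin n) S),
    Submodule.span S (Set.range m) = ⊤ ∧ (∀ i, ∑ j, A i j • m j = 0) ∧ d = A.det}

/-- Let `X` be a variety in the sense of spaces with functions: `reg W` is the set of functions
that are regular on the open set `W` (only the values on `W` matter). Let `ideal W` be the
sections over `W` of the ideal sheaf of a closed subscheme with underlying set `Z`.
The subscheme is a generically reduced divisor if `Z` is closed, nonempty and of pure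
codimension one, and if there is an open `U`, with `Z ∩ U` dense in `Z`, over which the ideal
sheaf is the ideal sheaf of all functions that vanish on `Z` (so that the subscheme is
reduced over `U`). -/
def IsGenericallyReducedDivisor {X : Type*} [TopologicalSpace X]
    (reg ideal : Set X → Set (X → ℂ)) (Z : Set X) : Prop :=
  IsClosed Z ∧ Z.Nonempty ∧
  (∀ Y : TopologicalSpace.IrreducibleCloseds X,
    Maximal (fun Y' : TopologicalSpace.IrreducibleCloseds X => (Y' : Set X) ⊆ Z) Y →
      Order.coheight Y = 1) ∧
  ∃ U : Set X, IsOpen U ∧ Z ⊆ closure (Z ∩ U) ∧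
    ∀ W : Set X, IsOpen W → W ⊆ U → ∀ f ∈ reg W,
      (f ∈ ideal W ↔ ∀ z ∈ Z ∩ W, f z = 0)

/-! ### Smooth curves of bidegree `(3,4)` modulo automorphisms -/

/-- The coordinate ring of the affine space of forms of bidegree `(3,4)`. The variable `(i, j)`
is the coefficient of `x₀ ^ (3 - i) * x₁ ^ i * u₀ ^ (4 - j) * u₁ ^ j`. -/
abbrev CoeffRing : Type := MvPolynomial (Fin 4 × Fin 5) ℂ

/-- The form of bidegree `(3,4)` with given coefficients. The variables `Sum.inl k` are the
coordinates `x₀, x₁` of the first line, the variables `Sum.inr k` are the coordinates `u₀, u₁`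
of the second line. -/
def formPoly (a : Fin 4 × Fin 5 → ℂ) : MvPolynomial (Fin 2 ⊕ Fin 2) ℂ :=
  ∑ i : Fin 4, ∑ j : Fin 5, MvPolynomial.C (a (i, j)) *
    (MvPolynomial.X (Sum.inl 0) ^ (3 - (i : ℕ)) * MvPolynomial.X (Sum.inl 1) ^ (i : ℕ)) *
    (MvPolynomial.X (Sum.inr 0) ^ (4 - (j : ℕ)) * MvPolynomial.X (Sum.inr 1) ^ (j : ℕ))

/-- The value of the form with coefficients `a` at `(x, u)`. -/
def evalForm (a : Fin 4 × Fin 5 → ℂ) (x u : Fin 2 → ℂ) : ℂ :=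
  MvPolynomial.eval (Sum.elim x u) (formPoly a)

/-- A form of bidegree `(3,4)` that defines a smooth curve in `ℙ¹ × ℙ¹`. -/
structure SmoothForm : Type where
  coeff : Fin 4 × Fin 5 → ℂ
  smooth : ∀ x u : Fin 2 → ℂ, x ≠ 0 → u ≠ 0 → evalForm coeff x u = 0 →
    ∃ k, MvPolynomial.eval (Sum.elim x u) (MvPolynomial.pderiv k (formPoly coeff)) ≠ 0

/-- A smooth form as a `ℂ`-point of the affine space of all forms. -/
def SmoothForm.point (F : SmoothForm) : CoeffRing →ₐ[ℂ] ℂ := MvPolynomial.aeval F.coeff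

/-- The Zariski topology on the set of smooth forms. -/
instance : TopologicalSpace SmoothForm :=
  TopologicalSpace.induced SmoothForm.point (zariskiTopology CoeffRing)

/-- Two smooth forms are equivalent if they differ by linear changes of coordinates on the two
lines. Nonzero scalar factors are included, since every scalar is a cube, so that this says
that the two curves correspond under an element of `PGL₂ × PGL₂`. -/
instance formSetoid : Setoid SmoothForm where
  r F F' := ∃ g h : GL (Fin 2) ℂ, ∀ x u : Fin 2 → ℂ,
    evalForm F'.coeff x u = evalForm F.coeff (g.1.mulVec x) (h.1.mulVec u)
  iseqv :=
    { refl := fun F => ⟨1, 1, fun x u => by simp⟩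
      symm := by
        rintro F F' ⟨g, h, H⟩
        refine ⟨g⁻¹, h⁻¹, fun x u => ?_⟩
        rw [H, Matrix.mulVec_mulVec, Matrix.mulVec_mulVec, Units.mul_inv, Units.mul_inv,
          Matrix.one_mulVec, Matrix.one_mulVec]
      trans := by
        rintro F F' F'' ⟨g, h, H⟩ ⟨g', h', H'⟩
        refine ⟨g * g', h * h', fun x u => ?_⟩
        rw [H', H, Matrix.mulVec_mulVec, Matrix.mulVec_mulVec, Units.val_mul, Units.val_mul] }

/-- `𝒞^(3,4)`: smooth curves of bidegree `(3,4)` modulo the linear transformations of both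
lines, with the quotient of the Zariski topology. -/
def C34 : Type := Quotient formSetoid

/-- The class of a smooth form. -/
def C34.mk (F : SmoothForm) : C34 := Quotient.mk formSetoid F

instance : TopologicalSpace C34 := TopologicalSpace.coinduced C34.mk inferInstance

/-- The fraction `a / b` of polynomials in the coefficients of the form represents, near the
smooth form `F`, the function `f` on `W ⊆ 𝒞^(3,4)`. -/
def C34.Represents (W : Set C34) (f : C34 → ℂ) (F : SmoothForm) (a b : CoeffRing) : Prop :=
  F.point b ≠ 0 ∧ ∀ F' : SmoothForm, F'.point b ≠ 0 → C34.mk F' ∈ W →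
    f (C34.mk F') = F'.point a / F'.point b

/-- The regular functions on an open set of the quotient `𝒞^(3,4)`: the functions whose
pullbacks to the space of smooth forms are regular. -/
def C34.reg (W : Set C34) : Set (C34 → ℂ) :=
  {f | ∀ F : SmoothForm, C34.mk F ∈ W → ∃ a b : CoeffRing, C34.Represents W f F a b}

/-! ### The bitangent locus -/

/-- The first projection has a fiber of the form `2 x + 2 y`: for some point of the first line,
the binary quartic form cutting out the fiber is the square of a product of two nonzero linear
forms. -/
def SmoothForm.HasBitangentFiber (F : SmoothForm) : Prop :=
  ∃ x : Fin 2 → ℂ, x ≠ 0 ∧ ∃ l m : Fin 2 → ℂ, l ≠ 0 ∧ m ≠ 0 ∧ ∀ u : Fin 2 → ℂ,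
    evalForm F.coeff x u = ((l 0 * u 0 + l 1 * u 1) * (m 0 * u 0 + m 1 * u 1)) ^ 2

/-- The set `𝒞_b^(3,4)`. -/
def Cb : Set C34 := closure {c | ∃ F : SmoothForm, C34.mk F = c ∧ F.HasBitangentFiber}

/-- The prime ideal of the variety of squares of binary quadratic forms in the space of binary
quartic forms `∑ j, c_j * u₀ ^ (4 - j) * u₁ ^ j`. -/
def squareIdeal : Ideal (MvPolynomial (Fin 5) ℂ) :=
  RingHom.ker (MvPolynomial.aeval (R := ℂ)
    (![MvPolynomial.X 0 ^ 2,
       2 * MvPolynomial.X 0 * MvPolynomial.X 1,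
       MvPolynomial.X 1 ^ 2 + 2 * MvPolynomial.X 0 * MvPolynomial.X 2,
       2 * MvPolynomial.X 1 * MvPolynomial.X 2,
       MvPolynomial.X 2 ^ 2] : Fin 5 → MvPolynomial (Fin 3) ℂ))

section Incidence

/-! For an algebra `S` over the coordinate ring of the space of forms, let `B_S` be the
incidence scheme in `ℙ¹ × Spec S` of pairs (point `x` of the first line, form `F`) such that the
restriction of `F` to the fiber over `x` is a square. It is defined by pulling back the equations
of the variety of squares along `(x, F) ↦ F(x, ·)`. The line is covered by the charts `x = [1 : s]`
and `x = [s⁻¹ : 1]`. -/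

variable (S : Type) [CommRing S] [Algebra ℂ S] [Algebra CoeffRing S]

/-- The image in `S` of the coefficient `(i, j)` of the universal form. -/
def univCoeff (i : Fin 4) (j : Fin 5) : S := algebraMap CoeffRing S (MvPolynomial.X (i, j))

/-- The ideal of the incidence scheme in the chart `[1 : s]`. -/
def incidenceIdeal₀ : Ideal S[X] :=
  squareIdeal.map (MvPolynomial.aeval (R := ℂ)
    (fun j : Fin 5 => ∑ i : Fin 4, Polynomial.C (univCoeff S i j) * Polynomial.X ^ (i : ℕ)))

/-- The ideal of the incidence scheme in the chart `[r : 1]`. -/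
def incidenceIdeal₁ : Ideal S[X] :=
  squareIdeal.map (MvPolynomial.aeval (R := ℂ)
    (fun j : Fin 5 => ∑ i : Fin 4, Polynomial.C (univCoeff S i j) * Polynomial.X ^ (3 - (i : ℕ))))

/-- The ideal of the incidence scheme in the intersection of the two charts. -/
def incidenceIdeal₀₁ : Ideal (LaurentPolynomial S) :=
  (incidenceIdeal₀ S).map (Polynomial.aeval (R := S) (LaurentPolynomial.T 1 : LaurentPolynomial S))

/-- Pairs of functions on the two charts that agree on the intersection of the charts with the
incidence scheme. -/
def compatiblePairs : Submodule S (S[X] × S[X]) :=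
  ((incidenceIdeal₀₁ S).restrictScalars S).comap
    ((Polynomial.aeval (LaurentPolynomial.T 1 : LaurentPolynomial S)).toLinearMap ∘ₗ
        LinearMap.fst S S[X] S[X] -
      (Polynomial.aeval (LaurentPolynomial.T (-1) : LaurentPolynomial S)).toLinearMap ∘ₗ
        LinearMap.snd S S[X] S[X])

/-- Pairs of functions on the two charts that vanish on the incidence scheme. -/
def vanishingPairs : Submodule S (S[X] × S[X]) :=
  ((incidenceIdeal₀ S).restrictScalars S).prod ((incidenceIdeal₁ S).restrictScalars S)

/-- The `S`-module of global functions on the incidence scheme `B_S`. -/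
abbrev IncidenceSections : Type :=
  compatiblePairs S ⧸ (vanishingPairs S).submoduleOf (compatiblePairs S)

end Incidence

instance (F : SmoothForm) : (RingHom.ker F.point).IsPrime := RingHom.ker_isPrime F.point

/-- The local ring, at a smooth form, of the space of forms. -/
abbrev SmoothForm.LocalRing (F : SmoothForm) : Type :=
  Localization.AtPrime (RingHom.ker F.point)

/-- The stalk at a smooth form `F` of the ideal sheaf of the bitangent locus in the space of
smooth forms: the zeroth Fitting ideal of the direct image of the structure sheaf of the
incidence scheme (which is finite over the space of smooth forms). -/
def SmoothForm.bitangentIdeal (F : SmoothForm) : Ideal F.LocalRing :=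
  fittingIdeal F.LocalRing (IncidenceSections F.LocalRing)

/-- The ideal sheaf of `𝒞_b^(3,4)`, the quotient of the bitangent locus in the space of smooth
forms: its sections are the functions whose pullbacks to the space of smooth forms lie in the
Fitting ideal. -/
def Cb.ideal (W : Set C34) : Set (C34 → ℂ) :=
  {f | ∀ F : SmoothForm, C34.mk F ∈ W → ∃ a b : CoeffRing, C34.Represents W f F a b ∧
    algebraMap CoeffRing F.LocalRing a ∈ F.bitangentIdeal}

/-! ### Trigonal curves of genus six -/

section FunctionField

variable {K : Type} [Field K] [Algebra ℂ K]

/-- The elements of `K` that are integral over the `ℂ`-algebra generated by `s`. -/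
def integralOver (s : Set K) : Subalgebra ℂ K :=
  (integralClosure (Algebra.adjoin ℂ s) K).restrictScalars ℂ

/-- For a covering `t : T → ℙ¹` by a smooth projective curve with function field `K`, the group
`H¹(T, 𝒪_T)`, through the Čech complex of the two affine open sets where `t ≠ ∞` and `t ≠ 0`. -/
abbrev CechH1 (t : K) : Type :=
  Subalgebra.toSubmodule (integralOver {t, t⁻¹}) ⧸
    (Subalgebra.toSubmodule (integralOver {t}) ⊔
      Subalgebra.toSubmodule (integralOver {t⁻¹})).submoduleOf
        (Subalgebra.toSubmodule (integralOver {t, t⁻¹}))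

end FunctionField

/-- A trigonal curve of genus six: a smooth projective connected complex curve of genus
`6 = dim H¹(T, 𝒪_T)`, given by its function field `K`, with a map `t : T → ℙ¹` of degree three. -/
structure TrigonalCurve : Type 1 where
  K : Type
  [field : Field K]
  [algebra : Algebra ℂ K]
  t : K
  transcendental : Transcendental ℂ t
  degree : Module.finrank (IntermediateField.adjoin ℂ {t}) K = 3
  genus : Module.finrank ℂ (CechH1 t) = 6

attribute [instance] TrigonalCurve.field TrigonalCurve.algebra

/-- Isomorphism of the underlying curves (the maps to `ℙ¹` are forgotten). -/
instance trigonalSetoid : Setoid TrigonalCurve where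
  r T T' := Nonempty (T.K ≃ₐ[ℂ] T'.K)
  iseqv :=
    { refl := fun _ => ⟨AlgEquiv.refl⟩
      symm := fun ⟨e⟩ => ⟨e.symm⟩
      trans := fun ⟨e⟩ ⟨e'⟩ => ⟨e.trans e'⟩ }

/-- `ℳ₆^trig`, the set of isomorphism classes of trigonal curves of genus six. -/
def M6trig : Type 1 := Quotient trigonalSetoid

/-- The isomorphism class of a trigonal curve of genus six. -/
def M6trig.mk (T : TrigonalCurve) : M6trig := Quotient.mk trigonalSetoid T

/-- A family of trigonal curves of genus six over `Spec R`: a finite flat covering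
`𝒯 → ℙ¹ × Spec R` whose fibers over the `ℂ`-points of `R` are trigonal curves of genus six.
With `t` the coordinate of `ℙ¹`, the subalgebras `A₀`, `A₁` of `L` are the rings of functions on
the open sets of `𝒯` where `t ≠ ∞`, `t ≠ 0`, and `L` is the ring of functions on the
intersection of these. -/
structure TrigonalFamily (R : Type) [CommRing R] [Algebra ℂ R] : Type 1 where
  L : Type
  [commRing : CommRing L]
  [algebraC : Algebra ℂ L]
  [algebra : Algebra R L]
  [tower : IsScalarTower ℂ R L]
  t : Lˣ
  A₀ : Subalgebra R L
  A₁ : Subalgebra R L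
  t_mem : (t : L) ∈ A₀
  t_inv_mem : ((t⁻¹ : Lˣ) : L) ∈ A₁
  /-- `L = A₀[t⁻¹]` and `L = A₁[t]` -/
  localize₀ : ∀ z : L, ∃ n : ℕ, (t : L) ^ n * z ∈ A₀
  localize₁ : ∀ z : L, ∃ n : ℕ, ((t⁻¹ : Lˣ) : L) ^ n * z ∈ A₁
  /-- `A₀` is finite and flat over `R[t]`, and `A₁` over `R[t⁻¹]`. -/
  finite₀ : (Polynomial.aeval (R := R) (⟨t, t_mem⟩ : A₀)).toRingHom.Finite
  finite₁ : (Polynomial.aeval (R := R) (⟨(t⁻¹ : Lˣ), t_inv_mem⟩ : A₁)).toRingHom.Finite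
  flat₀ : (Polynomial.aeval (R := R) (⟨t, t_mem⟩ : A₀)).toRingHom.Flat
  flat₁ : (Polynomial.aeval (R := R) (⟨(t⁻¹ : Lˣ), t_inv_mem⟩ : A₁)).toRingHom.Flat
  /-- The fiber over the point `p`, with the restriction of functions to this fiber. The charts
  of the fiber are the charts of the smooth projective curve with function field
  `(fiber p).K`. -/
  fiber : (R →ₐ[ℂ] ℂ) → TrigonalCurve
  restrict : ∀ p, L →ₐ[ℂ] (fiber p).K
  restrict_base : ∀ p r, restrict p (algebraMap R L r) = algebraMap ℂ (fiber p).K (p r)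
  restrict_t : ∀ p, restrict p t = (fiber p).t
  range₀ : ∀ p, restrict p '' A₀ = integralOver {(fiber p).t}
  range₁ : ∀ p, restrict p '' A₁ = integralOver {(fiber p).t⁻¹}
  ker₀ : ∀ p (a : A₀), restrict p a = 0 ↔ a ∈ (RingHom.ker p).map (algebraMap R A₀)
  ker₁ : ∀ p (a : A₁), restrict p a = 0 ↔ a ∈ (RingHom.ker p).map (algebraMap R A₁)

attribute [instance] TrigonalFamily.commRing TrigonalFamily.algebraC TrigonalFamily.algebra
  TrigonalFamily.tower

/-- The classifying map of a family. -/
def TrigonalFamily.classify {R : Type} [CommRing R] [Algebra ℂ R] (𝒯 : TrigonalFamily R)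
    (p : R →ₐ[ℂ] ℂ) : M6trig :=
  M6trig.mk (𝒯.fiber p)

/-- The Zariski topology of the coarse space `ℳ₆^trig`: a set is open if its preimages under the
classifying maps of all families over `ℂ`-algebras of finite type are Zariski open. -/
instance : TopologicalSpace M6trig :=
  ⨆ (R : Type) (_ : CommRing R) (_ : Algebra ℂ R) (_ : Algebra.FiniteType ℂ R)
    (𝒯 : TrigonalFamily R), TopologicalSpace.coinduced 𝒯.classify (zariskiTopology R)

/-- The regular functions on an open set of the coarse space `ℳ₆^trig`: the functions whose
pullbacks under the classifying maps of all families over `ℂ`-algebras of finite type are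
regular. -/
def M6trig.reg (W : Set M6trig) : Set (M6trig → ℂ) :=
  {f | ∀ (R : Type) [CommRing R] [Algebra ℂ R] [Algebra.FiniteType ℂ R] (𝒯 : TrigonalFamily R)
    (p : R →ₐ[ℂ] ℂ), 𝒯.classify p ∈ W → ∃ a b : R, p b ≠ 0 ∧
      ∀ q : R →ₐ[ℂ] ℂ, q b ≠ 0 → 𝒯.classify q ∈ W → f (𝒯.classify q) = q a / q b}

/-! ### The rational map from `ℳ₆^trig` to `𝒞^(3,4)` -/

/-- The equation of the curve of the form with coefficients `a` in the affine chart with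
coordinates `x₀ / x₁` and `u₀ / u₁`. -/
def affineEquation (a : Fin 4 × Fin 5 → ℂ) : MvPolynomial (Fin 2) ℂ :=
  ∑ i : Fin 4, ∑ j : Fin 5, MvPolynomial.C (a (i, j)) *
    MvPolynomial.X 0 ^ (3 - (i : ℕ)) * MvPolynomial.X 1 ^ (4 - (j : ℕ))

/-- The curve `T` is isomorphic to the smooth curve of bidegree `(3,4)` defined by `F`: the
function field of `T` is generated by two elements whose relations are the multiples of the
affine equation of `F`. -/
def IsModel (F : SmoothForm) (T : TrigonalCurve) : Prop :=
  ∃ z : Fin 2 → T.K, IntermediateField.adjoin ℂ (Set.range z) = ⊤ ∧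
    ∀ G : MvPolynomial (Fin 2) ℂ, MvPolynomial.aeval z G = 0 ↔ affineEquation F.coeff ∣ G

/-- The graph of the birational map from `ℳ₆^trig` to `𝒞^(3,4)`, which sends (the class of) a
trigonal curve to (the class of) the smooth curves of bidegree `(3,4)` isomorphic to it. -/
def ratMap (m : M6trig) (c : C34) : Prop :=
  ∃ (F : SmoothForm) (T : TrigonalCurve), C34.mk F = c ∧ M6trig.mk T = m ∧ IsModel F T

/-- The preimage of `𝒞_b^(3,4)` in `ℳ₆^trig` (the closure of the preimage in the domain of the
rational map). -/
def preimageCb : Set M6trig := closure {m | ∃ c ∈ Cb, ratMap m c}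

/-- The ideal sheaf of the preimage of the subscheme `𝒞_b^(3,4)` under the rational map, on open
sets `W` of the domain of the rational map: it is generated by the pullbacks of the sections of
the ideal sheaf of `𝒞_b^(3,4)`. -/
def preimageCb.ideal (W : Set M6trig) : Set (M6trig → ℂ) :=
  {g | ∀ m ∈ W, ∃ W' : Set M6trig, IsOpen W' ∧ m ∈ W' ∧ W' ⊆ W ∧
    ∃ (V : Set C34) (n : ℕ) (h : Fin n → M6trig → ℂ) (f : Fin n → C34 → ℂ),
      IsOpen V ∧ (∀ k, h k ∈ M6trig.reg W') ∧ (∀ k, f k ∈ Cb.ideal V) ∧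
      ∀ m' ∈ W', (∃ c, ratMap m' c) ∧
        ∀ c, ratMap m' c → c ∈ V ∧ g m' = ∑ k, h k m' * f k c}

end Bitangent34

end

noncomputable section

namespace Bitangent34

/-! ### Zariski topology, Taylor expansion and the action on smooth forms -/

/-! **The locus of forms.** A form whose fiber over `[1 : s]` is `q²` is determined by `s`, the
three coefficients of `q` and the fifteen coefficients outside the row of `x₀³`, since that row can
be solved for. This parametrization is `squareHom`. Its target is a domain, so its kernel
`bitangentPrime` is prime, and the zero set of this prime among smooth forms is the closure of the
forms with a bitangent fiber (`closure_hasBitangentFiber`; `exampleCoeff` shows that smooth ones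
exist). The quotient map `C34.mk` is open, so this set is the preimage of `Cb` (`preimage_Cb`).
There are 19 parameters for 20 coefficients, so the prime is nonzero. It contains no nonzero
polynomial in the coefficients other than `(0, 4)` (`rename_notMem_bitangentPrime`), and a Gauss
lemma argument then makes it principal (`exists_bitangent_equation`). Codimension one in the
quotient follows by dividing an equation of a larger closed set by all powers of the generator
(`eq_univ_of_Cb_ssubset`).

**The scheme structure.** The Fitting ideal annihilates the function `1` on the incidence scheme.
Evaluation at the generic point of the parametrization shows that at points of the locus such
elements lie in `bitangentPrime` (`SmoothForm.mem_bitangentPrime`). Conversely `bitangentPrime`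
always kills `1`, so it lies in the Fitting ideal wherever `1` generates the functions on the
incidence scheme. By Nakayama's lemma this holds at `F` if the binary forms of degree ten, modulo
linear forms times cubic equations of the variety of squares, are spanned by one element
(`HasCyclicIncidence.span_incidenceOne`). A nonvanishing determinant `cyclicDet` suffices for that,
and evaluation at a single form with a square fiber shows that it does not vanish on the whole locus
(`cyclicDet_notMem`). Over the resulting open set the ideal sheaf is the full vanishing ideal.

**The trigonal locus.** The rational map is the inverse of an open embedding `C34.toM6trig` of `C34`
into `M6trig`, and the statement about the preimage is transported along it.

The curve of a smooth form is described by the cubic ring of the form over the polynomial ring of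
the second line. Smoothness makes this ring integrally closed (`PlaneModel.exists_hom_eq`) and
irreducible (`IsSmooth.no_root`), so the direct image of the structure sheaf under the degree three
map is `𝒪 ⊕ 𝒪(-4)²` (`PlaneModel.scrollBasis`), which gives genus six.

Injectivity: two functions of degree three that do not generate the same field satisfy a relation of
bidegree `(3, 3)`, which forces genus at most four. So the trigonal map is unique up to Möbius
transformations (`exists_moebius`), scroll bases differ by constant matrices up to base functions,
and the index form of the cubic ring recovers the form (`PlaneModel.mk_eq`).

Continuity: smooth forms carry an algebraic family of trigonal curves (`exists_trigonalFamily`),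
because smoothness is Zariski open (`IsSmooth.exists_eval_ne_zero`).

Openness: in a family with one fiber of this kind, the `H¹` of the structure sheaf twisted by four
vanishes on that fiber, so the scroll basis lifts to neighboring fibers. Its multiplication table
is, by the Delone–Faddeev correspondence, a form of bidegree `(3, 4)` over the base
(`TrigonalFamily.exists_form`). -/

theorem isOpen_zariski_iff {R : Type} [CommRing R] [Algebra ℂ R] (O : Set (R →ₐ[ℂ] ℂ)) :
    @IsOpen _ (zariskiTopology R) O ↔ ∀ p ∈ O, ∃ e : R, p e ≠ 0 ∧ ∀ q : R →ₐ[ℂ] ℂ, q e ≠ 0 → q ∈ O := by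
  let _ := zariskiTopology R
  have hb := PrimeSpectrum.isTopologicalBasis_basic_opens (R := R)
  have hb' := hb.induced
    (fun p : R →ₐ[ℂ] ℂ => (⟨RingHom.ker p, RingHom.ker_isPrime p⟩ : PrimeSpectrum R))
  rw [hb'.isOpen_iff]
  refine forall₂_congr fun p _ => ?_
  constructor
  · rintro ⟨_, ⟨_, ⟨e, rfl⟩, rfl⟩, hp, hsub⟩
    refine ⟨e, ?_, fun q hq => hsub ?_⟩
    · simpa [RingHom.mem_ker] using hp
    · simpa [RingHom.mem_ker] using hq
  · rintro ⟨e, he, hsub⟩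
    refine ⟨_, ⟨_, ⟨e, rfl⟩, rfl⟩, ?_, fun q hq => hsub q ?_⟩
    · simpa [RingHom.mem_ker] using he
    · simpa [RingHom.mem_ker] using hq

theorem SmoothForm.point_apply (F : SmoothForm) (p : CoeffRing) :
    F.point p = MvPolynomial.eval F.coeff p := by
  rw [SmoothForm.point, MvPolynomial.aeval_eq_eval]

theorem SmoothForm.isOpen_iff (O : Set SmoothForm) :
    IsOpen O ↔ ∀ F ∈ O, ∃ e : CoeffRing, F.point e ≠ 0 ∧
      ∀ F' : SmoothForm, F'.point e ≠ 0 → F' ∈ O := by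
  let _ := zariskiTopology CoeffRing
  have hb := PrimeSpectrum.isTopologicalBasis_basic_opens (R := CoeffRing)
  have hb' := (hb.induced
    (fun p : CoeffRing →ₐ[ℂ] ℂ =>
      (⟨RingHom.ker p, RingHom.ker_isPrime p⟩ : PrimeSpectrum CoeffRing))).induced SmoothForm.point
  rw [hb'.isOpen_iff]
  refine forall₂_congr fun p _ => ?_
  constructor
  · rintro ⟨_, ⟨_, ⟨_, ⟨e, rfl⟩, rfl⟩, rfl⟩, hp, hsub⟩
    refine ⟨e, ?_, fun q hq => hsub ?_⟩
    · simpa [RingHom.mem_ker] using hp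
    · simpa [RingHom.mem_ker] using hq
  · rintro ⟨e, he, hsub⟩
    refine ⟨_, ⟨_, ⟨_, ⟨e, rfl⟩, rfl⟩, rfl⟩, ?_, fun q hq => hsub q ?_⟩
    · simpa [RingHom.mem_ker] using he
    · simpa [RingHom.mem_ker] using hq

theorem C34.isOpen_iff (O : Set C34) : IsOpen O ↔ IsOpen (C34.mk ⁻¹' O) := isOpen_coinduced

theorem C34.continuous_mk : Continuous C34.mk := continuous_coinduced_rng

theorem C34.mk_surjective : Function.Surjective C34.mk := Quotient.mk_surjective

theorem C34.mk_eq_iff (F F' : SmoothForm) : C34.mk F = C34.mk F' ↔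
    ∃ g h : GL (Fin 2) ℂ, ∀ x u : Fin 2 → ℂ,
      evalForm F'.coeff x u = evalForm F.coeff (g.1.mulVec x) (h.1.mulVec u) :=
  Quotient.eq (r := formSetoid)

/-- First order Taylor expansion of a polynomial modulo the square of an ideal. -/
theorem taylor_mem_sq {σ : Type*} [Fintype σ] [DecidableEq σ] {B : Type*} [CommRing B] [Algebra ℂ B]
    (I : Ideal B) (y : σ → B) (y₀ : σ → ℂ) (h : ∀ k, y k - algebraMap ℂ B (y₀ k) ∈ I)
    (p : MvPolynomial σ ℂ) :
    MvPolynomial.aeval y p - algebraMap ℂ B (MvPolynomial.eval y₀ p) -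
      ∑ k, algebraMap ℂ B (MvPolynomial.eval y₀ (MvPolynomial.pderiv k p)) *
        (y k - algebraMap ℂ B (y₀ k)) ∈ I ^ 2 := by
  have hI : ∀ p : MvPolynomial σ ℂ,
      MvPolynomial.aeval y p - algebraMap ℂ B (MvPolynomial.eval y₀ p) ∈ I := by
    intro p
    induction p using MvPolynomial.induction_on with
    | C c => simp [MvPolynomial.algHom_C]
    | add p q hp hq =>
      have := I.add_mem hp hq
      simp only [map_add]
      convert this using 1
      ring
    | mul_X p k hp =>
      have := I.add_mem (I.mul_mem_right (y k) hp)
        (I.mul_mem_left (algebraMap ℂ B (MvPolynomial.eval y₀ p)) (h k))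
      simp only [map_mul, MvPolynomial.aeval_X, MvPolynomial.eval_X]
      convert this using 1
      ring
  induction p using MvPolynomial.induction_on with
  | C c => simp [MvPolynomial.algHom_C]
  | add p q hp hq =>
    have := (I ^ 2).add_mem hp hq
    simp only [map_add, add_mul, Finset.sum_add_distrib]
    convert this using 1
    ring
  | mul_X p k hp =>
    have h1 := (I ^ 2).mul_mem_right (algebraMap ℂ B (y₀ k)) hp
    have h2 : (MvPolynomial.aeval y p - algebraMap ℂ B (MvPolynomial.eval y₀ p)) *
        (y k - algebraMap ℂ B (y₀ k)) ∈ I ^ 2 := by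
      rw [pow_two]; exact Ideal.mul_mem_mul (hI p) (h k)
    have h3 : ∑ i, algebraMap ℂ B (MvPolynomial.eval y₀
          (MvPolynomial.pderiv i (p * MvPolynomial.X k))) * (y i - algebraMap ℂ B (y₀ i)) =
        (∑ i, algebraMap ℂ B (MvPolynomial.eval y₀ (MvPolynomial.pderiv i p)) *
          (y i - algebraMap ℂ B (y₀ i))) * algebraMap ℂ B (y₀ k) +
        algebraMap ℂ B (MvPolynomial.eval y₀ p) * (y k - algebraMap ℂ B (y₀ k)) := by
      have : ∀ i, algebraMap ℂ B (MvPolynomial.eval y₀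
          (MvPolynomial.pderiv i (p * MvPolynomial.X k))) * (y i - algebraMap ℂ B (y₀ i)) =
          algebraMap ℂ B (MvPolynomial.eval y₀ (MvPolynomial.pderiv i p)) *
          (y i - algebraMap ℂ B (y₀ i)) * algebraMap ℂ B (y₀ k) +
          if i = k then algebraMap ℂ B (MvPolynomial.eval y₀ p) * (y i - algebraMap ℂ B (y₀ i))
          else 0 := by
        intro i
        rw [MvPolynomial.pderiv_mul]
        by_cases hik : i = k
        · subst hik
          simp only [MvPolynomial.pderiv_X_self, map_add, map_mul, MvPolynomial.eval_X, mul_one,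
            if_true]
          ring
        · rw [MvPolynomial.pderiv_X_of_ne (Ne.symm hik)]
          simp only [map_mul, MvPolynomial.eval_X, mul_zero, if_neg hik, add_zero]
          ring
      rw [Finset.sum_congr rfl fun i _ => this i, Finset.sum_add_distrib, Finset.sum_mul,
        Finset.sum_ite_eq' Finset.univ k]
      simp
    have := (I ^ 2).add_mem h1 h2
    rw [h3]
    simp only [map_mul, MvPolynomial.aeval_X, MvPolynomial.eval_X]
    convert this using 1
    ring

/-- The derivative of a polynomial at a point in a given direction. -/
def dirDeriv {σ : Type*} (p : MvPolynomial σ ℂ) (y v : σ → ℂ) : ℂ :=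
  (MvPolynomial.aeval (fun k => Polynomial.C (y k) + Polynomial.X * Polynomial.C (v k)) p :
    ℂ[X]).coeff 1

theorem dirDeriv_eq {σ : Type*} [Fintype σ] [DecidableEq σ] (p : MvPolynomial σ ℂ) (y v : σ → ℂ) :
    dirDeriv p y v = ∑ k, MvPolynomial.eval y (MvPolynomial.pderiv k p) * v k := by
  have h := taylor_mem_sq (B := ℂ[X]) (Ideal.span {Polynomial.X})
    (fun k => Polynomial.C (y k) + Polynomial.X * Polynomial.C (v k)) y
    (fun k => by
      rw [Polynomial.algebraMap_eq, add_sub_cancel_left]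
      exact Ideal.mul_mem_right _ _ (Ideal.mem_span_singleton_self _)) p
  rw [Ideal.span_singleton_pow, Ideal.mem_span_singleton, Polynomial.X_pow_dvd_iff] at h
  have h1 := h 1 one_lt_two
  simp only [Polynomial.algebraMap_eq, Polynomial.coeff_sub, Polynomial.coeff_C_succ, sub_zero,
    add_sub_cancel_left, Polynomial.finsetSum_coeff, Polynomial.coeff_C_mul,
    Polynomial.coeff_X_mul, Polynomial.coeff_C_zero, sub_eq_zero] at h1
  exact h1

/-- `dirDeriv` restricts a polynomial to a line and is therefore compatible with linear
substitutions. Expressing smoothness through it avoids the chain rule for partial derivatives. -/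
theorem exists_pderiv_ne_zero_iff {σ : Type*} [Fintype σ] [DecidableEq σ] (p : MvPolynomial σ ℂ)
    (y : σ → ℂ) :
    (∃ k, MvPolynomial.eval y (MvPolynomial.pderiv k p) ≠ 0) ↔ ∃ v, dirDeriv p y v ≠ 0 := by
  constructor
  · rintro ⟨k, hk⟩
    refine ⟨Pi.single k 1, ?_⟩
    rw [dirDeriv_eq]
    simpa [Pi.single_apply] using hk
  · rintro ⟨v, hv⟩
    by_contra! hcon
    apply hv
    rw [dirDeriv_eq]
    simp [hcon]

theorem evalForm_eq (a : Fin 4 × Fin 5 → ℂ) (x u : Fin 2 → ℂ) :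
    evalForm a x u = ∑ i : Fin 4, ∑ j : Fin 5, a (i, j) * (x 0 ^ (3 - (i : ℕ)) * x 1 ^ (i : ℕ)) *
      (u 0 ^ (4 - (j : ℕ)) * u 1 ^ (j : ℕ)) := by
  simp [evalForm, formPoly]

/-- The coefficients of the binary quartic form cutting out a fiber. -/
def fiberCoeff {S : Type*} [CommSemiring S] (a : Fin 4 × Fin 5 → S) (x : Fin 2 → S) (j : Fin 5) : S :=
  ∑ i : Fin 4, a (i, j) * (x 0 ^ (3 - (i : ℕ)) * x 1 ^ (i : ℕ))

theorem evalForm_eq_fiberCoeff (a : Fin 4 × Fin 5 → ℂ) (x u : Fin 2 → ℂ) :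
    evalForm a x u = ∑ j : Fin 5, fiberCoeff a x j * (u 0 ^ (4 - (j : ℕ)) * u 1 ^ (j : ℕ)) := by
  rw [evalForm_eq, Finset.sum_comm]
  exact Finset.sum_congr rfl fun j _ => by rw [fiberCoeff, Finset.sum_mul]

/-- A homogeneous polynomial in two variables in terms of its coefficients. -/
theorem homogeneous_expand {S : Type*} [CommSemiring S] {n : ℕ} {p : MvPolynomial (Fin 2) S}
    (hp : p.IsHomogeneous n) :
    p = ∑ k : Fin (n + 1), MvPolynomial.C
        (p.coeff (Finsupp.single 0 (n - (k : ℕ)) + Finsupp.single 1 (k : ℕ))) *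
      (MvPolynomial.X 0 ^ (n - (k : ℕ)) * MvPolynomial.X 1 ^ (k : ℕ)) := by
  classical
  simp only [MvPolynomial.X_pow_eq_monomial, MvPolynomial.monomial_mul,
    MvPolynomial.C_mul_monomial, mul_one]
  ext m
  rw [MvPolynomial.coeff_sum]
  simp only [MvPolynomial.coeff_monomial]
  by_cases hm : m 0 + m 1 = n
  · have hlt : m 1 < n + 1 := by omega
    rw [Finset.sum_eq_single (⟨m 1, hlt⟩ : Fin (n + 1))]
    · have : Finsupp.single 0 (n - m 1) + Finsupp.single 1 (m 1) = m := by
        ext i; fin_cases i <;> simp; omega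
      rw [this, if_pos rfl]
    · intro k _ hk
      rw [if_neg]
      intro h
      apply hk
      ext
      have := DFunLike.congr_fun h 1
      simpa using this
    · simp
  · rw [Finset.sum_eq_zero]
    · by_contra hne
      apply hm
      have := hp hne
      rw [← this, Finsupp.weight_apply, Finsupp.sum_fintype _ _ (by simp)]
      simp
    · intro k _
      rw [if_neg]
      rintro rfl
      apply hm
      simp
      omega

theorem mulVec_eval_homogeneous (M : Matrix (Fin 2) (Fin 2) ℂ) {n : ℕ}
    {p : MvPolynomial (Fin 2) ℂ} (hp : p.IsHomogeneous n) :
    ∃ q : MvPolynomial (Fin 2) ℂ, q.IsHomogeneous n ∧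
      ∀ x, MvPolynomial.eval x q = MvPolynomial.eval (M.mulVec x) p := by
  refine ⟨MvPolynomial.aeval (fun i => ∑ j, MvPolynomial.C (M i j) * MvPolynomial.X j) p, ?_, ?_⟩
  · have := hp.aeval (fun i => ∑ j, MvPolynomial.C (M i j) * MvPolynomial.X j) (n := 1)
      (fun i => MvPolynomial.IsHomogeneous.sum _ _ _ fun j _ =>
        (MvPolynomial.isHomogeneous_C_mul_X _ _))
    simpa using this
  · intro x
    have : (MvPolynomial.eval x).comp (MvPolynomial.aeval
        (fun i => ∑ j, MvPolynomial.C (M i j) * MvPolynomial.X j) :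
          MvPolynomial (Fin 2) ℂ →ₐ[ℂ] _).toRingHom = MvPolynomial.eval (M.mulVec x) := by
      ext i
      · simp
      · fin_cases i <;> simp
    exact congrArg (fun f => f p) this

/-- Linear substitution in the monomials of degree `n` in two variables. -/
theorem exists_substitution (n : ℕ) (M : Matrix (Fin 2) (Fin 2) ℂ) :
    ∃ A : Fin (n + 1) → Fin (n + 1) → ℂ, ∀ (x : Fin 2 → ℂ) (i : Fin (n + 1)),
      (M.mulVec x) 0 ^ (n - (i : ℕ)) * (M.mulVec x) 1 ^ (i : ℕ) =
        ∑ k, A i k * (x 0 ^ (n - (k : ℕ)) * x 1 ^ (k : ℕ)) := by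
  have h : ∀ i : Fin (n + 1), ∃ c : Fin (n + 1) → ℂ, ∀ x : Fin 2 → ℂ,
      (M.mulVec x) 0 ^ (n - (i : ℕ)) * (M.mulVec x) 1 ^ (i : ℕ) =
        ∑ k, c k * (x 0 ^ (n - (k : ℕ)) * x 1 ^ (k : ℕ)) := by
    intro i
    have hp : (MvPolynomial.X 0 ^ (n - (i : ℕ)) * MvPolynomial.X 1 ^ (i : ℕ) :
        MvPolynomial (Fin 2) ℂ).IsHomogeneous n := by
      have := (MvPolynomial.isHomogeneous_X_pow (R := ℂ) (0 : Fin 2) (n - (i : ℕ))).mul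
        (MvPolynomial.isHomogeneous_X_pow (1 : Fin 2) (i : ℕ))
      rwa [Nat.sub_add_cancel (by omega)] at this
    obtain ⟨q, hq, hqe⟩ := mulVec_eval_homogeneous M hp
    refine ⟨fun k => q.coeff (Finsupp.single 0 (n - (k : ℕ)) + Finsupp.single 1 (k : ℕ)),
      fun x => ?_⟩
    have h1 := hqe x
    rw [homogeneous_expand hq] at h1
    simp only [map_sum, map_mul, map_pow, MvPolynomial.eval_C, MvPolynomial.eval_X] at h1
    exact h1.symm
  choose A hA using h
  exact ⟨A, fun x i => hA i x⟩

/-- The effect of linear substitutions on forms, on the level of coefficients. -/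
theorem exists_act (g h : Matrix (Fin 2) (Fin 2) ℂ) :
    ∃ A : Fin 4 × Fin 5 → CoeffRing, ∀ (a : Fin 4 × Fin 5 → ℂ) (x u : Fin 2 → ℂ),
      evalForm (fun k => MvPolynomial.eval a (A k)) x u =
        evalForm a (g.mulVec x) (h.mulVec u) := by
  obtain ⟨G, hG⟩ := exists_substitution 3 g
  obtain ⟨H, hH⟩ := exists_substitution 4 h
  refine ⟨fun k => ∑ i, ∑ j, MvPolynomial.X (i, j) * MvPolynomial.C (G i k.1 * H j k.2),
    fun a x u => ?_⟩
  rw [evalForm_eq, evalForm_eq]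
  let T : Fin 4 × Fin 5 → Fin 4 × Fin 5 → ℂ := fun p k =>
    a p * (G p.1 k.1 * (x 0 ^ (3 - (k.1 : ℕ)) * x 1 ^ (k.1 : ℕ))) *
      (H p.2 k.2 * (u 0 ^ (4 - (k.2 : ℕ)) * u 1 ^ (k.2 : ℕ)))
  calc _ = ∑ k, ∑ p, T p k := by
        simp only [map_sum, map_mul, MvPolynomial.eval_X, MvPolynomial.eval_C, Finset.sum_mul,
          Fintype.sum_prod_type, T]
        exact Finset.sum_congr rfl fun _ _ => Finset.sum_congr rfl fun _ _ =>
          Finset.sum_congr rfl fun _ _ => Finset.sum_congr rfl fun _ _ => by ring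
    _ = ∑ p, ∑ k, T p k := Finset.sum_comm
    _ = _ := by
        simp only [hG, hH, Fintype.sum_prod_type, T]
        refine Finset.sum_congr rfl fun i _ => Finset.sum_congr rfl fun j _ => ?_
        rw [mul_assoc, Finset.sum_mul_sum, Finset.mul_sum]
        refine Finset.sum_congr rfl fun _ _ => ?_
        rw [Finset.mul_sum]
        exact Finset.sum_congr rfl fun _ _ => by ring

theorem eval_aeval_line (c : Fin 4 × Fin 5 → ℂ) (y w : Fin 2 ⊕ Fin 2 → ℂ) (r : ℂ) :
    Polynomial.eval r (MvPolynomial.aeval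
      (fun k => Polynomial.C (y k) + Polynomial.X * Polynomial.C (w k)) (formPoly c)) =
    evalForm c (y ∘ Sum.inl + r • (w ∘ Sum.inl)) (y ∘ Sum.inr + r • (w ∘ Sum.inr)) := by
  have : (Polynomial.evalRingHom r).comp (MvPolynomial.aeval
      (fun k => Polynomial.C (y k) + Polynomial.X * Polynomial.C (w k)) :
        MvPolynomial (Fin 2 ⊕ Fin 2) ℂ →ₐ[ℂ] _).toRingHom =
      MvPolynomial.eval (Sum.elim (y ∘ Sum.inl + r • (w ∘ Sum.inl))
        (y ∘ Sum.inr + r • (w ∘ Sum.inr))) := by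
    ext i
    · simp
    · rcases i with i | i <;> simp [mul_comm r]
  exact congrArg (fun f => f (formPoly c)) this

/-- A line through `(x, u)` is carried by the substitution to a line through `(g x, h u)`, and the
two forms restrict to the same polynomial in one variable. A direction with nonzero derivative is
pulled back by the inverse matrices. -/
theorem smooth_of_evalForm_eq {a b : Fin 4 × Fin 5 → ℂ} (g h : GL (Fin 2) ℂ)
    (hab : ∀ x u, evalForm b x u = evalForm a (g.1.mulVec x) (h.1.mulVec u))
    (ha : ∀ x u : Fin 2 → ℂ, x ≠ 0 → u ≠ 0 → evalForm a x u = 0 →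
      ∃ k, MvPolynomial.eval (Sum.elim x u) (MvPolynomial.pderiv k (formPoly a)) ≠ 0) :
    ∀ x u : Fin 2 → ℂ, x ≠ 0 → u ≠ 0 → evalForm b x u = 0 →
      ∃ k, MvPolynomial.eval (Sum.elim x u) (MvPolynomial.pderiv k (formPoly b)) ≠ 0 := by
  intro x u hx hu hb
  have hinj : ∀ (g : GL (Fin 2) ℂ) (x : Fin 2 → ℂ), g.1.mulVec x = 0 → x = 0 := by
    intro g x hgx
    have := congrArg (g⁻¹).1.mulVec hgx
    rwa [Matrix.mulVec_mulVec, Units.inv_mul, Matrix.one_mulVec, Matrix.mulVec_zero] at this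
  have h1 := ha (g.1.mulVec x) (h.1.mulVec u) (fun h => hx (hinj _ _ h))
    (fun h => hu (hinj _ _ h)) (by rw [← hab]; exact hb)
  rw [exists_pderiv_ne_zero_iff] at h1 ⊢
  obtain ⟨v, hv⟩ := h1
  refine ⟨Sum.elim ((g⁻¹).1.mulVec (v ∘ Sum.inl)) ((h⁻¹).1.mulVec (v ∘ Sum.inr)), ?_⟩
  rw [dirDeriv] at hv ⊢
  refine fun h0 => hv (Eq.trans (congrArg (fun p => Polynomial.coeff p 1) ?_) h0)
  refine Polynomial.funext fun r => ?_
  rw [eval_aeval_line, eval_aeval_line, hab]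
  simp only [Sum.elim_comp_inl, Sum.elim_comp_inr, Matrix.mulVec_add, Matrix.mulVec_smul,
    Matrix.mulVec_mulVec, Units.mul_inv, Matrix.one_mulVec]

/-- The smooth form obtained from `F` by linear substitutions. -/
def SmoothForm.act (g h : GL (Fin 2) ℂ) (F : SmoothForm) : SmoothForm where
  coeff := fun k => MvPolynomial.eval F.coeff ((exists_act g.1 h.1).choose k)
  smooth := smooth_of_evalForm_eq g h ((exists_act g.1 h.1).choose_spec F.coeff) F.smooth

theorem SmoothForm.evalForm_act (g h : GL (Fin 2) ℂ) (F : SmoothForm) (x u : Fin 2 → ℂ) :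
    evalForm (F.act g h).coeff x u = evalForm F.coeff (g.1.mulVec x) (h.1.mulVec u) :=
  (exists_act g.1 h.1).choose_spec F.coeff x u

theorem SmoothForm.mk_act (g h : GL (Fin 2) ℂ) (F : SmoothForm) :
    C34.mk (F.act g h) = C34.mk F :=
  ((C34.mk_eq_iff _ _).2 ⟨g, h, F.evalForm_act g h⟩).symm

theorem evalForm_injective {a b : Fin 4 × Fin 5 → ℂ} (h : ∀ x u, evalForm a x u = evalForm b x u) :
    a = b := by
  have hx : ∀ (x : ℂ) (j : Fin 5), fiberCoeff a ![1, x] j = fiberCoeff b ![1, x] j := by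
    intro x
    have h1 : (∑ j : Fin 5, Polynomial.C (fiberCoeff a ![1, x] j) * Polynomial.X ^ (j : ℕ)) =
        ∑ j : Fin 5, Polynomial.C (fiberCoeff b ![1, x] j) * Polynomial.X ^ (j : ℕ) := by
      refine Polynomial.funext fun r => ?_
      have := h ![1, x] ![1, r]
      rw [evalForm_eq_fiberCoeff, evalForm_eq_fiberCoeff] at this
      simpa [Polynomial.eval_finsetSum] using this
    intro j
    have := congrArg (fun p => Polynomial.coeff p (j : ℕ)) h1
    simpa [Polynomial.coeff_X_pow, Fin.val_inj] using this
  funext ⟨i, j⟩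
  have h1 : (∑ i : Fin 4, Polynomial.C (a (i, j)) * Polynomial.X ^ (i : ℕ)) =
      ∑ i : Fin 4, Polynomial.C (b (i, j)) * Polynomial.X ^ (i : ℕ) := by
    refine Polynomial.funext fun r => ?_
    have := hx r j
    simpa [fiberCoeff, Polynomial.eval_finsetSum] using this
  have := congrArg (fun p => Polynomial.coeff p (i : ℕ)) h1
  simpa [Polynomial.coeff_X_pow, Fin.val_inj] using this

theorem SmoothForm.ext_coeff {F F' : SmoothForm} (h : F.coeff = F'.coeff) : F = F' := by
  cases F; cases F'; cases h; rfl

theorem SmoothForm.mk_eq_iff_exists_act (F F' : SmoothForm) :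
    C34.mk F = C34.mk F' ↔ ∃ g h : GL (Fin 2) ℂ, F' = F.act g h := by
  rw [C34.mk_eq_iff]
  refine exists_congr fun g => exists_congr fun h => ⟨fun H => ?_, ?_⟩
  · exact SmoothForm.ext_coeff (evalForm_injective fun x u => by rw [H, F.evalForm_act])
  · rintro rfl x u
    exact F.evalForm_act g h x u

theorem SmoothForm.continuous_act (g h : GL (Fin 2) ℂ) : Continuous (SmoothForm.act g h) := by
  rw [continuous_def]
  intro O hO
  rw [SmoothForm.isOpen_iff] at hO ⊢
  intro F hF
  obtain ⟨e, he, hsub⟩ := hO _ hF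
  have key : ∀ F : SmoothForm, F.point (MvPolynomial.aeval (exists_act g.1 h.1).choose e) =
      (F.act g h).point e := by
    intro F
    have : F.point.comp (MvPolynomial.aeval (exists_act g.1 h.1).choose) = (F.act g h).point := by
      ext i
      simp only [SmoothForm.point, AlgHom.comp_apply, MvPolynomial.aeval_X]
      rw [MvPolynomial.aeval_eq_eval]
      rfl
    exact congrArg (fun f => f e) this
  exact ⟨_, (key F).symm ▸ he, fun F' hF' => hsub _ (key F' ▸ hF')⟩

/-- The saturation of an open set is the union of its translates under the group. Because of
openness, preimages under `C34.mk` commute with closures, so closures in the quotient can be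
computed on forms. -/
theorem C34.isOpenMap_mk : IsOpenMap C34.mk := by
  intro O hO
  rw [C34.isOpen_iff]
  have : C34.mk ⁻¹' (C34.mk '' O) = ⋃ g : GL (Fin 2) ℂ, ⋃ h : GL (Fin 2) ℂ,
      SmoothForm.act g h ⁻¹' O := by
    ext F
    simp only [Set.mem_preimage, Set.mem_image, Set.mem_iUnion]
    constructor
    · rintro ⟨F', hF', hmk⟩
      obtain ⟨g, h, rfl⟩ := (SmoothForm.mk_eq_iff_exists_act F F').1 hmk.symm
      exact ⟨g, h, hF'⟩
    · rintro ⟨g, h, hF⟩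
      exact ⟨_, hF, F.mk_act g h⟩
  rw [this]
  exact isOpen_iUnion fun g => isOpen_iUnion fun h => hO.preimage (SmoothForm.continuous_act g h)

/-! ### Smoothness is open in the classical topology -/

/-- The monomials of bidegree `(3,4)`. -/
def formMon (k : Fin 4 × Fin 5) : MvPolynomial (Fin 2 ⊕ Fin 2) ℂ :=
  (MvPolynomial.X (Sum.inl 0) ^ (3 - (k.1 : ℕ)) * MvPolynomial.X (Sum.inl 1) ^ (k.1 : ℕ)) *
    (MvPolynomial.X (Sum.inr 0) ^ (4 - (k.2 : ℕ)) * MvPolynomial.X (Sum.inr 1) ^ (k.2 : ℕ))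

theorem formPoly_eq_sum (a : Fin 4 × Fin 5 → ℂ) :
    formPoly a = ∑ k, MvPolynomial.C (a k) * formMon k := by
  simp only [formPoly, formMon, Fintype.sum_prod_type, mul_assoc]

theorem eval_pderiv_formPoly (a : Fin 4 × Fin 5 → ℂ) (y : Fin 2 ⊕ Fin 2 → ℂ) (k : Fin 2 ⊕ Fin 2) :
    MvPolynomial.eval y (MvPolynomial.pderiv k (formPoly a)) =
      ∑ m, a m * MvPolynomial.eval y (MvPolynomial.pderiv k (formMon m)) := by
  rw [formPoly_eq_sum, map_sum, map_sum]
  simp only [MvPolynomial.pderiv_C_mul, map_mul, MvPolynomial.eval_C]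

/-- The curve of the form with coefficients `a` has no singular points. -/
def IsSmooth (a : Fin 4 × Fin 5 → ℂ) : Prop :=
  ∀ x u : Fin 2 → ℂ, x ≠ 0 → u ≠ 0 → evalForm a x u = 0 →
    ∃ k, MvPolynomial.eval (Sum.elim x u) (MvPolynomial.pderiv k (formPoly a)) ≠ 0

theorem SmoothForm.isSmooth (F : SmoothForm) : IsSmooth F.coeff := F.smooth

theorem evalForm_smul_smul (a : Fin 4 × Fin 5 → ℂ) (c d : ℂ) (x u : Fin 2 → ℂ) :
    evalForm a (c • x) (d • u) = c ^ 3 * d ^ 4 * evalForm a x u := by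
  rw [evalForm_eq, evalForm_eq, Finset.mul_sum]
  refine Finset.sum_congr rfl fun i _ => ?_
  rw [Finset.mul_sum]
  refine Finset.sum_congr rfl fun j _ => ?_
  have hi : c ^ 3 = c ^ (3 - (i : ℕ)) * c ^ (i : ℕ) := by
    rw [← pow_add, Nat.sub_add_cancel (by omega)]
  have hj : d ^ 4 = d ^ (4 - (j : ℕ)) * d ^ (j : ℕ) := by
    rw [← pow_add, Nat.sub_add_cancel (by omega)]
  simp only [Pi.smul_apply, smul_eq_mul, mul_pow, hi, hj]
  ring

theorem exists_pderiv_smul {a : Fin 4 × Fin 5 → ℂ} {c d : ℂ} (hc : c ≠ 0) (hd : d ≠ 0)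
    {x u : Fin 2 → ℂ}
    (h : ∃ k, MvPolynomial.eval (Sum.elim (c • x) (d • u))
      (MvPolynomial.pderiv k (formPoly a)) ≠ 0) :
    ∃ k, MvPolynomial.eval (Sum.elim x u) (MvPolynomial.pderiv k (formPoly a)) ≠ 0 := by
  rw [exists_pderiv_ne_zero_iff] at h ⊢
  obtain ⟨v, hv⟩ := h
  refine ⟨Sum.elim (c⁻¹ • (v ∘ Sum.inl)) (d⁻¹ • (v ∘ Sum.inr)), fun h0 => hv ?_⟩
  have : (MvPolynomial.aeval (fun k => Polynomial.C (Sum.elim (c • x) (d • u) k) +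
      Polynomial.X * Polynomial.C (v k)) (formPoly a) : ℂ[X]) =
      Polynomial.C (c ^ 3 * d ^ 4) * MvPolynomial.aeval (fun k => Polynomial.C (Sum.elim x u k) +
      Polynomial.X * Polynomial.C
        (Sum.elim (c⁻¹ • (v ∘ Sum.inl)) (d⁻¹ • (v ∘ Sum.inr)) k)) (formPoly a) := by
    refine Polynomial.funext fun r => ?_
    rw [Polynomial.eval_mul, Polynomial.eval_C, eval_aeval_line, eval_aeval_line,
      ← evalForm_smul_smul]
    simp only [Sum.elim_comp_inl, Sum.elim_comp_inr, smul_add]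
    rw [smul_comm c r, smul_comm d r, smul_inv_smul₀ hc, smul_inv_smul₀ hd]
  rw [dirDeriv] at h0 ⊢
  rw [this, Polynomial.coeff_C_mul, h0, mul_zero]

/-- The pairs of a form and a singular point of it are closed, and by homogeneity singular points
can be normalized to lie on a product of two unit spheres. Projection along a compact factor is a
closed map. The classical topology is enough to test polynomial identities on smooth forms only. -/
theorem isOpen_isSmooth : IsOpen {a | IsSmooth a} := by
  let K : Set (Fin 2 → ℂ) := Metric.sphere 0 1
  have : CompactSpace K := isCompact_iff_compactSpace.1 (isCompact_sphere _ _)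
  let Z : Set ((K × K) × (Fin 4 × Fin 5 → ℂ)) :=
    {w | evalForm w.2 w.1.1 w.1.2 = 0 ∧ ∀ k, MvPolynomial.eval (Sum.elim w.1.1.1 w.1.2.1)
      (MvPolynomial.pderiv k (formPoly w.2)) = 0}
  have hx : ∀ k, Continuous fun w : (K × K) × (Fin 4 × Fin 5 → ℂ) => (w.1.1 : Fin 2 → ℂ) k :=
    fun k => (continuous_apply k).comp
      (continuous_subtype_val.comp (continuous_fst.comp continuous_fst))
  have hu : ∀ k, Continuous fun w : (K × K) × (Fin 4 × Fin 5 → ℂ) => (w.1.2 : Fin 2 → ℂ) k :=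
    fun k => (continuous_apply k).comp
      (continuous_subtype_val.comp (continuous_snd.comp continuous_fst))
  have hy : Continuous fun w : (K × K) × (Fin 4 × Fin 5 → ℂ) =>
      (Sum.elim w.1.1.1 w.1.2.1 : Fin 2 ⊕ Fin 2 → ℂ) := by
    refine continuous_pi fun k => ?_
    rcases k with k | k
    · exact hx k
    · exact hu k
  have ha : ∀ m, Continuous fun w : (K × K) × (Fin 4 × Fin 5 → ℂ) => w.2 m :=
    fun m => (continuous_apply m).comp continuous_snd
  have hZ : IsClosed Z := by
    have h1 : IsClosed {w : (K × K) × (Fin 4 × Fin 5 → ℂ) | evalForm w.2 w.1.1 w.1.2 = 0} := by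
      refine isClosed_eq ?_ continuous_const
      simp only [evalForm_eq]
      exact continuous_finsetSum _ fun i _ => continuous_finsetSum _ fun j _ =>
        ((ha _).mul (((hx 0).pow _).mul ((hx 1).pow _))).mul (((hu 0).pow _).mul ((hu 1).pow _))
    have h2 : ∀ k, IsClosed {w : (K × K) × (Fin 4 × Fin 5 → ℂ) |
        MvPolynomial.eval (Sum.elim w.1.1.1 w.1.2.1) (MvPolynomial.pderiv k (formPoly w.2)) = 0} := by
      intro k
      refine isClosed_eq ?_ continuous_const
      simp only [eval_pderiv_formPoly]
      exact continuous_finsetSum _ fun m _ =>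
        (ha m).mul ((MvPolynomial.continuous_eval _).comp hy)
    have : Z = {w | evalForm w.2 w.1.1 w.1.2 = 0} ∩ ⋂ k, {w |
        MvPolynomial.eval (Sum.elim w.1.1.1 w.1.2.1)
          (MvPolynomial.pderiv k (formPoly w.2)) = 0} := by
      ext w; simp [Z]
    rw [this]
    exact h1.inter (isClosed_iInter h2)
  have himg : {a | IsSmooth a}ᶜ = Prod.snd '' Z := by
    ext a
    simp only [Set.mem_compl_iff, Set.mem_ofPred_eq, Set.mem_image, IsSmooth]
    push Not
    constructor
    · rintro ⟨x, u, hx, hu, h0, hk⟩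
      have hx' : (‖x‖ : ℂ) ≠ 0 := by simpa using hx
      have hu' : (‖u‖ : ℂ) ≠ 0 := by simpa using hu
      have hnx : ((‖x‖ : ℂ)⁻¹ • x) ∈ K := by
        simp only [K, mem_sphere_zero_iff_norm, norm_smul, norm_inv, Complex.norm_real, norm_norm]
        exact inv_mul_cancel₀ (by simpa using hx)
      have hnu : ((‖u‖ : ℂ)⁻¹ • u) ∈ K := by
        simp only [K, mem_sphere_zero_iff_norm, norm_smul, norm_inv, Complex.norm_real, norm_norm]
        exact inv_mul_cancel₀ (by simpa using hu)
      refine ⟨((⟨_, hnx⟩, ⟨_, hnu⟩), a), ⟨?_, ?_⟩, rfl⟩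
      · simp only [evalForm_smul_smul, h0, mul_zero]
      · by_contra hcon
        push Not at hcon
        obtain ⟨k, hk'⟩ := exists_pderiv_smul (inv_ne_zero hx') (inv_ne_zero hu') hcon
        exact hk' (hk k)
    · rintro ⟨⟨⟨⟨x, hx⟩, ⟨u, hu⟩⟩, b⟩, ⟨h0, hk⟩, rfl⟩
      refine ⟨x, u, ?_, ?_, h0, hk⟩
      · rintro rfl; simp [K] at hx
      · rintro rfl; simp [K] at hu
  rw [← isClosed_compl_iff, himg]
  exact isClosedMap_snd_of_compactSpace _ hZ

/-! ### The prime ideal of the bitangent locus -/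

/-- The coefficients of the square of a binary quadratic form. -/
def sqCoeff {S : Type*} [CommSemiring S] (q : Fin 3 → S) : Fin 5 → S :=
  ![q 0 ^ 2, 2 * q 0 * q 1, q 1 ^ 2 + 2 * q 0 * q 2, 2 * q 1 * q 2, q 2 ^ 2]

theorem mem_squareIdeal_iff (p : MvPolynomial (Fin 5) ℂ) :
    p ∈ squareIdeal ↔ ∀ q : Fin 3 → ℂ, MvPolynomial.eval (sqCoeff q) p = 0 := by
  have h : ∀ q : Fin 3 → ℂ, MvPolynomial.eval q (MvPolynomial.aeval (R := ℂ)
      (sqCoeff (S := MvPolynomial (Fin 3) ℂ) MvPolynomial.X) p) =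
      MvPolynomial.eval (sqCoeff q) p := by
    intro q
    have : (MvPolynomial.eval q).comp (MvPolynomial.aeval (R := ℂ)
      (sqCoeff (S := MvPolynomial (Fin 3) ℂ) MvPolynomial.X)).toRingHom =
      MvPolynomial.eval (sqCoeff q) := by
      ext i
      · simp
      · fin_cases i <;> simp [sqCoeff]
    exact congrArg (fun f => f p) this
  change MvPolynomial.aeval (R := ℂ)
      (sqCoeff (S := MvPolynomial (Fin 3) ℂ) MvPolynomial.X) p = 0 ↔ _
  constructor
  · intro hp q
    rw [← h, hp, map_zero]
  · intro hp
    exact MvPolynomial.funext fun q => by rw [h, hp, map_zero]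

/-- Indices for the free parameters of a form with a square fiber: the point `s` of the line, and
the coefficients of the form outside the fiber over `0`. -/
abbrev ParamIndex : Type := Option (Fin 3 × Fin 5)

/-- The generic form whose fiber over the generic point has prescribed coefficients. -/
def genericHom : CoeffRing →ₐ[ℂ] MvPolynomial ParamIndex (MvPolynomial (Fin 5) ℂ) :=
  MvPolynomial.aeval fun k => Fin.cases
    (MvPolynomial.C (MvPolynomial.X k.2) -
      ∑ i : Fin 3, MvPolynomial.X (some (i, k.2)) * MvPolynomial.X none ^ ((i : ℕ) + 1))
    (fun i => MvPolynomial.X (some (i, k.2))) k.1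

/-- The generic form with a square fiber. -/
def squareHom : CoeffRing →+* MvPolynomial ParamIndex (MvPolynomial (Fin 3) ℂ) :=
  (MvPolynomial.map (MvPolynomial.aeval (R := ℂ)
    (sqCoeff (S := MvPolynomial (Fin 3) ℂ) MvPolynomial.X)).toRingHom).comp genericHom.toRingHom

/-- The exchange of the two coordinates of the first line. -/
def flipHom : CoeffRing →ₐ[ℂ] CoeffRing :=
  MvPolynomial.rename fun k : Fin 4 × Fin 5 => (k.1.rev, k.2)

/-- The coefficients of the form with the square fiber `q ^ 2` over `s`. -/
def thetaCoeff (w : ParamIndex ⊕ Fin 3 → ℂ) (k : Fin 4 × Fin 5) : ℂ :=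
  Fin.cases (sqCoeff (w ∘ Sum.inr) k.2 -
      ∑ i : Fin 3, w (Sum.inl (some (i, k.2))) * w (Sum.inl none) ^ ((i : ℕ) + 1))
    (fun i => w (Sum.inl (some (i, k.2)))) k.1

/-- Evaluation of the parameters. -/
def evalParam (w : ParamIndex ⊕ Fin 3 → ℂ) :
    MvPolynomial ParamIndex (MvPolynomial (Fin 3) ℂ) →+* ℂ :=
  MvPolynomial.eval₂Hom (MvPolynomial.eval (w ∘ Sum.inr)) (w ∘ Sum.inl)

theorem evalParam_squareHom (w : ParamIndex ⊕ Fin 3 → ℂ) (p : CoeffRing) :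
    evalParam w (squareHom p) = MvPolynomial.eval (thetaCoeff w) p := by
  have : (evalParam w).comp squareHom = MvPolynomial.eval (thetaCoeff w) := by
    ext k
    · simp [evalParam, squareHom, genericHom]
    · obtain ⟨i, j⟩ := k
      induction i using Fin.cases with
      | zero =>
        simp only [RingHom.comp_apply, squareHom, genericHom, AlgHom.toRingHom_eq_coe,
          RingHom.coe_coe, MvPolynomial.aeval_X, Fin.cases_zero, map_sub, map_sum, map_mul, map_pow,
          MvPolynomial.map_C, MvPolynomial.map_X, evalParam, MvPolynomial.coe_eval₂Hom,
          MvPolynomial.eval₂_C, MvPolynomial.eval₂_X, MvPolynomial.eval_X, thetaCoeff,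
          Function.comp_apply]
        congr 1
        fin_cases j <;> simp [sqCoeff]
      | succ i => simp [evalParam, squareHom, genericHom, thetaCoeff]
  exact congrArg (fun f => f p) this

/-- A nonempty open set contains a product of balls, and a polynomial that vanishes on a product of
infinite sets is zero. Membership in the kernel of `squareHom` can thus be tested on any convenient
open set of parameters. -/
theorem eq_zero_of_evalParam {O : Set (ParamIndex ⊕ Fin 3 → ℂ)} (hO : IsOpen O) (hne : O.Nonempty)
    {P : MvPolynomial ParamIndex (MvPolynomial (Fin 3) ℂ)} (h : ∀ w ∈ O, evalParam w P = 0) :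
    P = 0 := by
  let e := MvPolynomial.sumAlgEquiv ℂ ParamIndex (Fin 3)
  have key : ∀ w, evalParam w P = MvPolynomial.eval w (e.symm P) := by
    intro w
    obtain ⟨Q, rfl⟩ := e.surjective P
    rw [AlgEquiv.symm_apply_apply]
    have : (evalParam w).comp e.toAlgHom.toRingHom = MvPolynomial.eval w := by
      ext k
      · simp [evalParam, e]
      · rcases k with k | k <;> simp [evalParam, e]
    exact congrArg (fun f => f Q) this
  obtain ⟨w₀, hw₀⟩ := hne
  obtain ⟨ε, hε, hball⟩ := Metric.isOpen_iff.1 hO w₀ hw₀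
  have : e.symm P = 0 := by
    refine MvPolynomial.funext_set (fun k => Metric.ball (w₀ k) ε)
      (fun k => infinite_of_mem_nhds (w₀ k) (Metric.ball_mem_nhds _ hε)) fun w hw => ?_
    rw [map_zero, ← key]
    refine h w (hball ?_)
    rw [ball_pi _ hε]
    exact hw
  simpa using this

theorem sum_sqCoeff (q : Fin 3 → ℂ) (u : Fin 2 → ℂ) :
    ∑ j : Fin 5, sqCoeff q j * (u 0 ^ (4 - (j : ℕ)) * u 1 ^ (j : ℕ)) =
      (q 0 * u 0 ^ 2 + q 1 * (u 0 * u 1) + q 2 * u 1 ^ 2) ^ 2 := by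
  simp [Fin.sum_univ_succ, sqCoeff]
  ring

theorem quartic_coeff_eq {c d : Fin 5 → ℂ}
    (h : ∀ u : Fin 2 → ℂ, ∑ j : Fin 5, c j * (u 0 ^ (4 - (j : ℕ)) * u 1 ^ (j : ℕ)) =
      ∑ j : Fin 5, d j * (u 0 ^ (4 - (j : ℕ)) * u 1 ^ (j : ℕ))) : c = d := by
  have h1 : (∑ j : Fin 5, Polynomial.C (c j) * Polynomial.X ^ (j : ℕ)) =
      ∑ j : Fin 5, Polynomial.C (d j) * Polynomial.X ^ (j : ℕ) := by
    refine Polynomial.funext fun r => ?_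
    simpa [Polynomial.eval_finsetSum] using h ![1, r]
  funext j
  have := congrArg (fun p => Polynomial.coeff p (j : ℕ)) h1
  simpa [Polynomial.coeff_X_pow, Fin.val_inj] using this

theorem fiberCoeff_thetaCoeff (w : ParamIndex ⊕ Fin 3 → ℂ) :
    fiberCoeff (thetaCoeff w) ![1, w (Sum.inl none)] = sqCoeff (w ∘ Sum.inr) := by
  funext j
  simp [fiberCoeff, thetaCoeff, Fin.sum_univ_succ]

theorem exists_thetaCoeff {a : Fin 4 × Fin 5 → ℂ} {s : ℂ} {q : Fin 3 → ℂ}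
    (h : fiberCoeff a ![1, s] = sqCoeff q) :
    a = thetaCoeff (Sum.elim (fun o => o.elim s fun k => a (k.1.succ, k.2)) q) := by
  funext ⟨i, j⟩
  induction i using Fin.cases with
  | zero =>
    have := congrFun h j
    simp [thetaCoeff, Fin.sum_univ_succ, fiberCoeff] at this ⊢
    change _ = sqCoeff q j - _
    rw [← this]
    ring
  | succ i => simp [thetaCoeff]

theorem fiberCoeff_smul (a : Fin 4 × Fin 5 → ℂ) (c : ℂ) (x : Fin 2 → ℂ) (j : Fin 5) :
    fiberCoeff a (c • x) j = c ^ 3 * fiberCoeff a x j := by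
  simp only [fiberCoeff, Finset.mul_sum]
  refine Finset.sum_congr rfl fun i _ => ?_
  have hi : c ^ 3 = c ^ (3 - (i : ℕ)) * c ^ (i : ℕ) := by
    rw [← pow_add, Nat.sub_add_cancel (by omega)]
  simp only [Pi.smul_apply, smul_eq_mul, mul_pow, hi]
  ring

theorem sqCoeff_smul (q : Fin 3 → ℂ) (c : ℂ) (j : Fin 5) :
    sqCoeff (c • q) j = c ^ 2 * sqCoeff q j := by
  fin_cases j <;> simp [sqCoeff] <;> ring

/-- The form with coefficients `a` has a square fiber, possibly zero. -/
def HasSquareFiber (a : Fin 4 × Fin 5 → ℂ) : Prop :=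
  ∃ x : Fin 2 → ℂ, x ≠ 0 ∧ ∃ q : Fin 3 → ℂ, fiberCoeff a x = sqCoeff q

theorem SmoothForm.HasBitangentFiber.hasSquareFiber {F : SmoothForm} (h : F.HasBitangentFiber) :
    HasSquareFiber F.coeff := by
  obtain ⟨x, hx, l, m, -, -, hF⟩ := h
  refine ⟨x, hx, ![l 0 * m 0, l 0 * m 1 + l 1 * m 0, l 1 * m 1], ?_⟩
  refine quartic_coeff_eq fun u => ?_
  rw [← evalForm_eq_fiberCoeff, hF, sum_sqCoeff]
  simp
  ring

theorem fiberCoeff_flip (a : Fin 4 × Fin 5 → ℂ) (x : Fin 2 → ℂ) :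
    fiberCoeff (fun k => a (k.1.rev, k.2)) x = fiberCoeff a ![x 1, x 0] := by
  funext j
  simp [fiberCoeff, Fin.sum_univ_succ, Fin.rev]
  ring

/-- The prime ideal of the bitangent locus. -/
def bitangentPrime : Ideal CoeffRing := RingHom.ker squareHom

instance : bitangentPrime.IsPrime := RingHom.ker_isPrime squareHom

theorem eval_eq_zero_of_fiber_one {p : CoeffRing} (hp : p ∈ bitangentPrime) {a : Fin 4 × Fin 5 → ℂ}
    {s : ℂ} {q : Fin 3 → ℂ} (h : fiberCoeff a ![1, s] = sqCoeff q) :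
    MvPolynomial.eval a p = 0 := by
  rw [exists_thetaCoeff h, ← evalParam_squareHom, (RingHom.mem_ker).1 hp, map_zero]

/-- Rescaling `x` to `[1 : s]` multiplies the fiber by the cube of `1 / x₀`; a square root of this
cube is absorbed into `q`. -/
theorem eval_eq_zero_of_fiber {p : CoeffRing} (hp : p ∈ bitangentPrime) {a : Fin 4 × Fin 5 → ℂ}
    {x : Fin 2 → ℂ} (hx : x 0 ≠ 0) {q : Fin 3 → ℂ} (h : fiberCoeff a x = sqCoeff q) :
    MvPolynomial.eval a p = 0 := by
  obtain ⟨c, hc⟩ := IsAlgClosed.exists_pow_nat_eq ((x 0)⁻¹ ^ 3) two_pos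
  refine eval_eq_zero_of_fiber_one hp (s := (x 0)⁻¹ * x 1) (q := c • q) ?_
  have : (![1, (x 0)⁻¹ * x 1] : Fin 2 → ℂ) = (x 0)⁻¹ • x := by
    funext i; fin_cases i <;> simp [hx]
  funext j
  rw [this, fiberCoeff_smul, sqCoeff_smul, h, hc]

theorem eval_flipHom (a : Fin 4 × Fin 5 → ℂ) (p : CoeffRing) :
    MvPolynomial.eval a (flipHom p) = MvPolynomial.eval (fun k => a (k.1.rev, k.2)) p := by
  rw [flipHom, MvPolynomial.eval_rename]
  rfl

theorem flipHom_flipHom (p : CoeffRing) : flipHom (flipHom p) = p := by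
  simp only [flipHom, MvPolynomial.rename_rename]
  convert MvPolynomial.rename_id_apply p using 2
  congr 1
  funext k
  simp

/-- For parameters with `s ≠ 0`, exchanging the coordinates moves the square fiber from `[1 : s]` to
`[s : 1]`, which is still in the chart `x₀ ≠ 0`. These parameters form a nonempty open set. -/
theorem flipHom_mem_bitangentPrime {p : CoeffRing} (hp : p ∈ bitangentPrime) :
    flipHom p ∈ bitangentPrime := by
  refine RingHom.mem_ker.2 (eq_zero_of_evalParam (O := {w | w (Sum.inl none) ≠ 0}) ?_
    ⟨fun _ => 1, one_ne_zero⟩ fun w hw => ?_)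
  · exact isOpen_ne_fun (continuous_apply _) continuous_const
  · rw [evalParam_squareHom, eval_flipHom]
    refine eval_eq_zero_of_fiber hp (x := ![w (Sum.inl none), 1]) hw (q := w ∘ Sum.inr) ?_
    rw [fiberCoeff_flip, ← fiberCoeff_thetaCoeff]
    rfl

/-- The parametrization only reaches fibers over `x₀ ≠ 0`; the remaining fiber is handled by the
symmetry of the ideal. Smoothness plays no role here, so singular forms can serve as test points. -/
theorem eval_eq_zero_of_hasSquareFiber {p : CoeffRing} (hp : p ∈ bitangentPrime)
    {a : Fin 4 × Fin 5 → ℂ} (h : HasSquareFiber a) : MvPolynomial.eval a p = 0 := by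
  obtain ⟨x, hx, q, hq⟩ := h
  by_cases h0 : x 0 = 0
  · have h1 : x 1 ≠ 0 := fun h1 => hx (by funext i; fin_cases i <;> simp [h0, h1])
    rw [← flipHom_flipHom p, eval_flipHom]
    refine eval_eq_zero_of_fiber (flipHom_mem_bitangentPrime hp) (x := ![x 1, x 0]) h1 (q := q) ?_
    rw [fiberCoeff_flip, ← hq]
    congr 1
    funext i; fin_cases i <;> rfl
  · exact eval_eq_zero_of_fiber hp h0 hq

/-- The coefficients of a smooth form with a bitangent fiber. -/
def exampleCoeff (k : Fin 4 × Fin 5) : ℂ :=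
  (!![1, 0, 0, 0, 0; 0, 0, 0, 0, 1; 0, 0, 0, 0, 0; 1, 0, 0, 0, 1] : Matrix (Fin 4) (Fin 5) ℂ)
    k.1 k.2

theorem formPoly_exampleCoeff : formPoly exampleCoeff =
    MvPolynomial.X (Sum.inr 0) ^ 4 *
      (MvPolynomial.X (Sum.inl 0) ^ 3 + MvPolynomial.X (Sum.inl 1) ^ 3) +
    MvPolynomial.X (Sum.inr 1) ^ 4 *
      (MvPolynomial.X (Sum.inl 0) ^ 2 * MvPolynomial.X (Sum.inl 1) +
        MvPolynomial.X (Sum.inl 1) ^ 3) := by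
  simp [formPoly, Fin.sum_univ_succ, exampleCoeff]
  ring

/-- The form is `u₀⁴ A + u₁⁴ B`. A singular point with `u₀`, `u₁` both nonzero is a common root of
the cubics `A = x₀³ + x₁³` and `B = x₀² x₁ + x₁³`; one with `u₁ = 0` or `u₀ = 0` is a multiple root
of `A` or of `B`. None of these exist. -/
theorem isSmooth_exampleCoeff : IsSmooth exampleCoeff := by
  intro x u hx hu _
  by_contra! h
  rw [formPoly_exampleCoeff] at h
  have h0 := h (Sum.inl 0)
  have h1 := h (Sum.inl 1)
  have h2 := h (Sum.inr 0)
  have h3 := h (Sum.inr 1)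
  clear h
  simp [MvPolynomial.pderiv_X] at h0 h1 h2 h3
  have hx' : ¬ (x 0 = 0 ∧ x 1 = 0) := fun h => hx (by funext i; fin_cases i; exacts [h.1, h.2])
  have hu' : ¬ (u 0 = 0 ∧ u 1 = 0) := fun h => hu (by funext i; fin_cases i; exacts [h.1, h.2])
  rcases h2 with h2 | h2
  · rcases h3 with h3 | h3
    · have e1 : x 1 * (x 0 ^ 2 + x 1 ^ 2) = 0 := by linear_combination h3
      rcases mul_eq_zero.1 e1 with e1 | e1
      · rw [e1] at h2
        exact hx' ⟨by simpa using h2, e1⟩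
      · have e2 : x 1 ^ 2 * (x 1 - x 0) = 0 := by linear_combination h2 - x 0 * e1
        rcases mul_eq_zero.1 e2 with e2 | e2
        · have e3 : x 1 = 0 := by simpa using e2
          rw [e3] at h2
          exact hx' ⟨by simpa using h2, e3⟩
        · have e3 : x 1 = x 0 := by linear_combination e2
          rw [e3] at e1
          have e4 : x 0 = 0 := by
            have : x 0 ^ 2 = 0 := by linear_combination e1 / 2
            simpa using this
          exact hx' ⟨e4, by rw [e3, e4]⟩
    · have hu0 : u 0 ≠ 0 := fun h => hu' ⟨h, h3⟩
      simp only [h3, ne_eq, OfNat.ofNat_ne_zero, not_false_eq_true, zero_pow, zero_mul, add_zero,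
        mul_eq_zero, pow_eq_zero_iff, hu0, false_or] at h0 h1
      exact hx' ⟨h0, h1⟩
  · have hu1 : u 1 ≠ 0 := fun h => hu' ⟨h2, h⟩
    simp only [h2, ne_eq, OfNat.ofNat_ne_zero, not_false_eq_true, zero_pow, zero_mul, zero_add,
      mul_eq_zero, pow_eq_zero_iff, hu1, false_or] at h0 h1
    rcases h0 with h0 | h0
    · rw [h0] at h1
      exact hx' ⟨by simpa using h1, h0⟩
    · rw [h0] at h1
      exact hx' ⟨h0, by simpa using h1⟩

theorem exampleCoeff_eq : exampleCoeff = thetaCoeff (Sum.elim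
    (fun o => o.elim 0 fun k => exampleCoeff (k.1.succ, k.2)) ![1, 0, 0]) := by
  refine exists_thetaCoeff ?_
  funext j
  fin_cases j <;> simp [fiberCoeff, exampleCoeff, sqCoeff, Fin.sum_univ_succ]

theorem continuous_thetaCoeff : Continuous thetaCoeff := by
  refine continuous_pi fun ⟨i, j⟩ => ?_
  induction i using Fin.cases with
  | zero =>
    simp only [thetaCoeff, Fin.cases_zero]
    refine Continuous.sub ?_ (by fun_prop)
    fin_cases j <;> simp [sqCoeff] <;> fun_prop
  | succ i =>
    simp only [thetaCoeff, Fin.cases_succ]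
    fun_prop

/-- The quadratic formula splits `q`. The assumption `q 0 ≠ 0` allows the division and makes both
linear factors nonzero. -/
theorem hasBitangentFiber_of_fiberCoeff {F : SmoothForm} {x : Fin 2 → ℂ} (hx : x ≠ 0)
    {q : Fin 3 → ℂ} (hq : q 0 ≠ 0) (h : fiberCoeff F.coeff x = sqCoeff q) :
    F.HasBitangentFiber := by
  obtain ⟨r, hr⟩ := IsAlgClosed.exists_pow_nat_eq (q 1 ^ 2 - 4 * q 0 * q 2) two_pos
  refine ⟨x, hx, ![q 0, (q 1 + r) / 2], ![1, (q 1 - r) / (2 * q 0)], ?_, ?_, fun u => ?_⟩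
  · exact fun h0 => hq (congrFun h0 0)
  · exact fun h0 => one_ne_zero (congrFun h0 0)
  · rw [evalForm_eq_fiberCoeff, h, sum_sqCoeff]
    congr 1
    simp
    field_simp
    linear_combination (u 1 ^ 2) * hr

/-- The parameters that give a smooth form and have `q 0 ≠ 0` form an open set in the classical
topology, nonempty because it contains the parameters of `exampleCoeff`. Vanishing on this set is
enough for `squareHom p = 0`. -/
theorem mem_bitangentPrime_of_forall {p : CoeffRing}
    (h : ∀ F : SmoothForm, F.HasBitangentFiber → F.point p = 0) : p ∈ bitangentPrime := by
  refine RingHom.mem_ker.2 (eq_zero_of_evalParam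
    (O := {w | IsSmooth (thetaCoeff w)} ∩ {w | w (Sum.inr 0) ≠ 0}) ?_ ?_ fun w hw => ?_)
  · exact (isOpen_isSmooth.preimage continuous_thetaCoeff).inter
      (isOpen_ne_fun (continuous_apply _) continuous_const)
  · refine ⟨Sum.elim (fun o => o.elim 0 fun k => exampleCoeff (k.1.succ, k.2)) ![1, 0, 0], ?_, ?_⟩
    · change IsSmooth _
      rw [← exampleCoeff_eq]
      exact isSmooth_exampleCoeff
    · simp
  · rw [evalParam_squareHom]
    have := h ⟨thetaCoeff w, hw.1⟩ (hasBitangentFiber_of_fiberCoeff (x := ![1, w (Sum.inl none)])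
      (fun h0 => one_ne_zero (congrFun h0 0)) (q := w ∘ Sum.inr) hw.2 (fiberCoeff_thetaCoeff w))
    rwa [SmoothForm.point_apply] at this

/-- The bitangent locus in the space of smooth forms. -/
def bitangentSet : Set SmoothForm := {F | ∀ p ∈ bitangentPrime, F.point p = 0}

theorem SmoothForm.HasBitangentFiber.mem_bitangentSet {F : SmoothForm} (h : F.HasBitangentFiber) :
    F ∈ bitangentSet := fun p hp => by
  rw [F.point_apply]; exact eval_eq_zero_of_hasSquareFiber hp h.hasSquareFiber

theorem exists_hasBitangentFiber {e : CoeffRing} (he : e ∉ bitangentPrime) :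
    ∃ F : SmoothForm, F.HasBitangentFiber ∧ F.point e ≠ 0 := by
  by_contra! h
  exact he (mem_bitangentPrime_of_forall h)

theorem isClosed_bitangentSet : IsClosed bitangentSet := by
  rw [← isOpen_compl_iff, SmoothForm.isOpen_iff]
  intro F hF
  simp only [bitangentSet, Set.mem_compl_iff, Set.mem_ofPred_eq, not_forall] at hF
  obtain ⟨p, hp, hpF⟩ := hF
  exact ⟨p, hpF, fun F' hF' h => hF' (h p hp)⟩

theorem notMem_bitangentPrime {F : SmoothForm} (hF : F ∈ bitangentSet) {e : CoeffRing}
    (he : F.point e ≠ 0) : e ∉ bitangentPrime := fun h => he (hF e h)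

theorem closure_hasBitangentFiber :
    closure {F : SmoothForm | F.HasBitangentFiber} = bitangentSet := by
  refine subset_antisymm (closure_minimal (fun F hF => hF.mem_bitangentSet)
    isClosed_bitangentSet) fun F hF => ?_
  rw [mem_closure_iff]
  intro O hO hFO
  obtain ⟨e, he, hsub⟩ := (SmoothForm.isOpen_iff O).1 hO F hFO
  obtain ⟨F', hF', he'⟩ := exists_hasBitangentFiber (notMem_bitangentPrime hF he)
  exact ⟨F', hsub F' he', hF'⟩

theorem SmoothForm.HasBitangentFiber.act {F : SmoothForm} (hF : F.HasBitangentFiber)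
    (g h : GL (Fin 2) ℂ) : (F.act g h).HasBitangentFiber := by
  obtain ⟨x, hx, l, m, hl, hm, H⟩ := hF
  have hinj : ∀ l : Fin 2 → ℂ, l ≠ 0 → Matrix.vecMul l h.1 ≠ 0 := by
    intro l hl h0
    apply hl
    have := congrArg (fun v => Matrix.vecMul v (h⁻¹).1) h0
    simpa [Matrix.vecMul_vecMul, ← Units.val_mul] using this
  refine ⟨(g⁻¹).1.mulVec x, ?_, Matrix.vecMul l h.1, Matrix.vecMul m h.1, hinj l hl, hinj m hm,
    fun u => ?_⟩
  · intro h0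
    apply hx
    have := congrArg g.1.mulVec h0
    rwa [Matrix.mulVec_mulVec, Units.mul_inv, Matrix.one_mulVec, Matrix.mulVec_zero] at this
  · rw [F.evalForm_act, Matrix.mulVec_mulVec, Units.mul_inv, Matrix.one_mulVec, H]
    simp [Matrix.vecMul, Matrix.mulVec, dotProduct, Fin.sum_univ_two]
    ring

/-- Preimages under the open map `C34.mk` commute with closures, and the existence of a bitangent
fiber is invariant under the group. -/
theorem preimage_Cb : C34.mk ⁻¹' Cb = bitangentSet := by
  rw [Cb, C34.isOpenMap_mk.preimage_closure_eq_closure_preimage C34.continuous_mk,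
    ← closure_hasBitangentFiber]
  congr 1
  ext F
  constructor
  · rintro ⟨F', hmk, hF'⟩
    obtain ⟨g, h, rfl⟩ := (SmoothForm.mk_eq_iff_exists_act F' F).1 hmk
    exact hF'.act g h
  · exact fun hF => ⟨F, rfl, hF⟩

theorem mk_mem_Cb {F : SmoothForm} : C34.mk F ∈ Cb ↔ F ∈ bitangentSet := by
  rw [← preimage_Cb]; rfl

theorem isIrreducible_bitangentSet : IsIrreducible bitangentSet := by
  constructor
  · obtain ⟨F, hF, -⟩ := exists_hasBitangentFiber
      ((Ideal.ne_top_iff_one _).1 (Ideal.IsPrime.ne_top (I := bitangentPrime) inferInstance))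
    exact ⟨F, hF.mem_bitangentSet⟩
  · rintro O O' hO hO' ⟨F, hF, hFO⟩ ⟨F', hF', hFO'⟩
    obtain ⟨e, he, hsub⟩ := (SmoothForm.isOpen_iff O).1 hO F hFO
    obtain ⟨e', he', hsub'⟩ := (SmoothForm.isOpen_iff O').1 hO' F' hFO'
    have hee : e * e' ∉ bitangentPrime := fun h =>
      (Ideal.IsPrime.mem_or_mem inferInstance h).elim (notMem_bitangentPrime hF he)
        (notMem_bitangentPrime hF' he')
    obtain ⟨G, hG, hne⟩ := exists_hasBitangentFiber hee
    rw [map_mul] at hne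
    exact ⟨G, hG.mem_bitangentSet, hsub _ (left_ne_zero_of_mul hne),
      hsub' _ (right_ne_zero_of_mul hne)⟩

theorem isIrreducible_Cb : IsIrreducible Cb := by
  have := isIrreducible_bitangentSet.image C34.mk C34.continuous_mk.continuousOn
  rwa [← preimage_Cb, Set.image_preimage_eq _ C34.mk_surjective] at this

theorem eq_zero_of_forall_point {p : CoeffRing} (h : ∀ F : SmoothForm, F.point p = 0) : p = 0 := by
  obtain ⟨ε, hε, hball⟩ := Metric.isOpen_iff.1 isOpen_isSmooth _ isSmooth_exampleCoeff
  refine MvPolynomial.funext_set (fun k => Metric.ball (exampleCoeff k) ε)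
    (fun k => infinite_of_mem_nhds _ (Metric.ball_mem_nhds _ hε)) fun a ha => ?_
  have ha' : IsSmooth a := hball (by rw [ball_pi _ hε]; exact ha)
  have := h ⟨a, ha'⟩
  rwa [SmoothForm.point_apply] at this

theorem isIrreducible_univ_smoothForm : IsIrreducible (Set.univ : Set SmoothForm) := by
  constructor
  · exact ⟨⟨_, isSmooth_exampleCoeff⟩, trivial⟩
  · rintro O O' hO hO' ⟨F, -, hFO⟩ ⟨F', -, hFO'⟩
    obtain ⟨e, he, hsub⟩ := (SmoothForm.isOpen_iff O).1 hO F hFO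
    obtain ⟨e', he', hsub'⟩ := (SmoothForm.isOpen_iff O').1 hO' F' hFO'
    have hee : e * e' ≠ 0 := mul_ne_zero (fun h => he (by rw [h, map_zero]))
      (fun h => he' (by rw [h, map_zero]))
    by_contra hcon
    refine hee (eq_zero_of_forall_point fun G => ?_)
    by_contra hne
    rw [map_mul] at hne
    exact hcon ⟨G, trivial, hsub _ (left_ne_zero_of_mul hne), hsub' _ (right_ne_zero_of_mul hne)⟩

/-! ### The bitangent locus is a hypersurface -/

/-- An injective `squareHom` would embed a polynomial ring in 20 variables into one in 16 + 3 = 19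
variables. -/
theorem bitangentPrime_ne_bot : bitangentPrime ≠ ⊥ := by
  intro h
  have hinj : Function.Injective squareHom := (RingHom.injective_iff_ker_eq_bot _).2 h
  let f : CoeffRing →ₐ[ℂ] MvPolynomial ParamIndex (MvPolynomial (Fin 3) ℂ) :=
    { squareHom with
      commutes' := fun r => by
        change squareHom (MvPolynomial.C r) = _
        simp [squareHom, MvPolynomial.algebraMap_eq] }
  let g : CoeffRing →ₐ[ℂ] MvPolynomial (ParamIndex ⊕ Fin 3) ℂ :=
    (MvPolynomial.sumAlgEquiv ℂ ParamIndex (Fin 3)).symm.toAlgHom.comp f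
  have hg : Function.Injective g :=
    (MvPolynomial.sumAlgEquiv ℂ ParamIndex (Fin 3)).symm.injective.comp hinj
  have := trdeg_le_of_injective g hg
  rw [MvPolynomial.trdeg_of_isDomain, MvPolynomial.trdeg_of_isDomain] at this
  simp at this
  norm_cast at this

/-- A prime `f` in `I` has positive degree because `I` contains no nonzero constants; so it is
primitive and stays irreducible over the fraction field. An element of `I` not divisible by `f`
would be coprime to it there, and clearing denominators in a Bézout identity would put a nonzero
constant into `I`. -/
theorem exists_prime_generator {L : Type*} [CommRing L] [IsDomain L] [UniqueFactorizationMonoid L]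
    (I : Ideal L[X]) [hI : I.IsPrime] (h0 : I ≠ ⊥) (hC : ∀ r : L, Polynomial.C r ∈ I → r = 0) :
    ∃ f, Prime f ∧ I = Ideal.span {f} := by
  obtain ⟨f, hf, hfp⟩ := hI.exists_mem_prime_of_ne_bot h0
  refine ⟨f, hfp, le_antisymm (fun x hx => ?_) ((Ideal.span_singleton_le_iff_mem _).2 hf)⟩
  rw [Ideal.mem_span_singleton]
  let _ : NormalizedGCDMonoid L := Nonempty.some inferInstance
  have hdeg : f.natDegree ≠ 0 := by
    intro hd
    obtain ⟨r, hr⟩ := Polynomial.natDegree_eq_zero.1 hd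
    have := hC r (hr ▸ hf)
    rw [this, map_zero] at hr
    exact hfp.ne_zero hr.symm
  have hprim : f.IsPrimitive := hfp.irreducible.isPrimitive hdeg
  let K := FractionRing L
  have hirr : Irreducible (f.map (algebraMap L K)) :=
    (hprim.irreducible_iff_irreducible_map_fraction_map (K := K)).1 hfp.irreducible
  by_contra hnd
  have hcop : IsCoprime (f.map (algebraMap L K)) (x.map (algebraMap L K)) := by
    exact (hirr.coprime_iff_not_dvd).2 fun hd =>
      hnd (hprim.dvd_of_fraction_map_dvd_fraction_map hd)
  obtain ⟨u, v, huv⟩ := hcop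
  obtain ⟨r, hr, hru⟩ := IsLocalization.integerNormalization_spec (nonZeroDivisors L) u
  obtain ⟨s, hs, hsv⟩ := IsLocalization.integerNormalization_spec (nonZeroDivisors L) v
  set u' := IsLocalization.integerNormalization (nonZeroDivisors L) u
  set v' := IsLocalization.integerNormalization (nonZeroDivisors L) v
  have key : Polynomial.C (r * s) =
      Polynomial.C s * u' * f + Polynomial.C r * v' * x := by
    apply Polynomial.map_injective (algebraMap L K) (IsFractionRing.injective L K)
    simp only [Polynomial.map_add, Polynomial.map_mul, Polynomial.map_C, hru, hsv, map_mul,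
      Algebra.smul_def, Polynomial.algebraMap_apply]
    linear_combination (-(Polynomial.C (algebraMap L K r) * Polynomial.C (algebraMap L K s))) * huv
  have hmem : Polynomial.C (r * s) ∈ I := by
    rw [key]
    exact I.add_mem (I.mul_mem_left _ hf) (I.mul_mem_left _ hx)
  exact mul_ne_zero (nonZeroDivisors.ne_zero hr) (nonZeroDivisors.ne_zero hs) (hC _ hmem)

/-- Once `r² = c 0` is chosen, the first three coefficients determine `q`, and the cubic equation is
the condition that the coefficient of `u₀ u₁³` fits. The last coefficient is left free. -/
theorem exists_sqCoeff_eq {c : Fin 5 → ℂ} (h0 : c 0 ≠ 0)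
    (h : c 1 ^ 3 - 4 * c 0 * c 1 * c 2 + 8 * c 0 ^ 2 * c 3 = 0) :
    ∃ q : Fin 3 → ℂ, ∀ j : Fin 5, j ≠ 4 → c j = sqCoeff q j := by
  obtain ⟨r, hr⟩ := IsAlgClosed.exists_pow_nat_eq (c 0) two_pos
  have hr0 : r ≠ 0 := fun h => h0 (by rw [← hr, h]; simp)
  refine ⟨![r, c 1 / (2 * r), (c 2 - (c 1 / (2 * r)) ^ 2) / (2 * r)], fun j hj => ?_⟩
  fin_cases j
  · simp [sqCoeff, hr]
  · simp [sqCoeff]; field_simp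
  · simp [sqCoeff]; field_simp; ring
  · simp [sqCoeff]
    rw [← hr] at h
    field_simp
    have : r ^ 2 * (c 1 ^ 3 - 4 * r ^ 2 * c 1 * c 2 + 8 * (r ^ 2) ^ 2 * c 3) = 0 := by
      rw [h, mul_zero]
    have h' : c 1 ^ 3 - 4 * r ^ 2 * c 1 * c 2 + 8 * (r ^ 2) ^ 2 * c 3 = 0 := h
    linear_combination h'
  · exact absurd rfl hj

/-- The nineteen coefficients other than `(0, 4)` satisfy no equation on the locus. For general
values of them, the condition of `exists_sqCoeff_eq` on the fiber over `s` is a polynomial of degree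
nine in `s`. At a root, the first four coefficients of the fiber are those of a square, and the
coefficient `(0, 4)` is then chosen to make the last one fit. -/
theorem rename_notMem_bitangentPrime (l : MvPolynomial {k : Fin 4 × Fin 5 // k ≠ (0, 4)} ℂ)
    (hl : l ≠ 0) : MvPolynomial.rename Subtype.val l ∉ bitangentPrime := by
  classical
  let y : Fin 4 → (j : Fin 5) → j ≠ 4 → MvPolynomial {k : Fin 4 × Fin 5 // k ≠ (0, 4)} ℂ :=
    fun i j hj => MvPolynomial.X ⟨(i, j), fun h => hj (congrArg Prod.snd h)⟩
  -- `m` is the coefficient of `s ^ 9` in the cubic condition on the fiber over `s`.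
  let m : MvPolynomial {k : Fin 4 × Fin 5 // k ≠ (0, 4)} ℂ :=
    y 3 1 (by decide) ^ 3 - 4 * y 3 0 (by decide) * y 3 1 (by decide) * y 3 2 (by decide) +
      8 * y 3 0 (by decide) ^ 2 * y 3 3 (by decide)
  have hm : m ≠ 0 := by
    intro h
    have := congrArg (MvPolynomial.eval fun k => if k.1 = (3, 1) then 1 else 0) h
    simp [m, y] at this
  have hy : y 3 0 (by decide) ≠ 0 := MvPolynomial.X_ne_zero _
  obtain ⟨w, hw⟩ : ∃ w, MvPolynomial.eval w (l * m * y 3 0 (by decide)) ≠ 0 := by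
    by_contra! h
    exact mul_ne_zero (mul_ne_zero hl hm) hy (MvPolynomial.funext fun w => by rw [h, map_zero])
  rw [map_mul, map_mul] at hw
  have hwl := left_ne_zero_of_mul (left_ne_zero_of_mul hw)
  have hwm := right_ne_zero_of_mul (left_ne_zero_of_mul hw)
  have hwy := right_ne_zero_of_mul hw
  let b : Fin 4 × Fin 5 → ℂ := fun k => if h : k ≠ (0, 4) then w ⟨k, h⟩ else 0
  have hb : ∀ k : {k : Fin 4 × Fin 5 // k ≠ (0, 4)}, b k = w k := fun k => dif_pos k.2
  have hb30 : b (3, 0) ≠ 0 := by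
    simpa [y, hb ⟨(3, 0), by decide⟩] using hwy
  have hb3 : b (3, 1) ^ 3 - 4 * b (3, 0) * b (3, 1) * b (3, 2) + 8 * b (3, 0) ^ 2 * b (3, 3) ≠ 0 := by
    have e := hwm
    simp only [m, y, map_add, map_sub, map_mul, map_pow, MvPolynomial.eval_X, map_ofNat] at e
    rw [hb ⟨(3, 0), by decide⟩, hb ⟨(3, 1), by decide⟩, hb ⟨(3, 2), by decide⟩,
      hb ⟨(3, 3), by decide⟩]
    exact e
  let P : ℂ[X] := MvPolynomial.aeval
    (fun k => if k.1 = (0, 1) then Polynomial.X else Polynomial.C (w k)) l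
  have hP : ∀ t, P.eval t = MvPolynomial.eval (fun k => if k.1 = (0, 1) then t else w k) l := by
    intro t
    have : (Polynomial.evalRingHom t).comp (MvPolynomial.aeval
        (fun k : {k : Fin 4 × Fin 5 // k ≠ (0, 4)} =>
          if k.1 = (0, 1) then Polynomial.X else Polynomial.C (w k))).toRingHom =
        MvPolynomial.eval (fun k => if k.1 = (0, 1) then t else w k) := by
      ext k
      · simp
      · by_cases hk : k.1 = (0, 1) <;> simp [hk]
    exact congrArg (fun f => f l) this
  have hP0 : P ≠ 0 := by
    intro h
    apply hwl
    have := hP (w ⟨(0, 1), by decide⟩)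
    rw [h, Polynomial.eval_zero] at this
    rw [this]
    congr 2
    funext k
    split_ifs with hk
    · congr 1; exact Subtype.ext hk
    · rfl
  let c : Fin 5 → ℂ[X] := fun j => ∑ i : Fin 4, Polynomial.C (b (i, j)) * Polynomial.X ^ (i : ℕ)
  have hc00 : c 0 ≠ 0 := by
    intro h
    have := congrArg (fun p => Polynomial.coeff p 3) h
    simp [c, Fin.sum_univ_succ] at this
    exact hb30 this
  -- The coefficient `(0, 1)` is moved to a value `t` that keeps `l` nonzero and for which the first
  -- two fiber coefficients have no common root.
  obtain ⟨t, ht⟩ := ((P.roots.toFinset ∪ (c 0).roots.toFinset.image fun r =>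
    b (0, 1) - (c 1).eval r)).exists_notMem
  simp only [Finset.mem_union, Multiset.mem_toFinset, Finset.mem_image, not_or, not_exists,
    not_and] at ht
  have htP : P.eval t ≠ 0 := fun h => ht.1 ((Polynomial.mem_roots hP0).2 h)
  let c' : Fin 5 → ℂ[X] := Function.update c 1 (c 1 + Polynomial.C (t - b (0, 1)))
  have hc' : ∀ r, (c' 0).eval r = 0 → (c' 1).eval r ≠ 0 := by
    intro r hr h1
    refine ht.2 r ((Polynomial.mem_roots hc00).2 (by simpa [c'] using hr)) ?_
    simp [c'] at h1
    linear_combination -h1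
  have hdeg : ∀ j, (c' j).natDegree ≤ 3 := by
    have h1 : ∀ j, (c j).natDegree ≤ 3 := fun j =>
      Polynomial.natDegree_sum_le_of_forall_le _ _ fun i _ =>
        (Polynomial.natDegree_C_mul_X_pow_le _ _).trans (by omega)
    intro j
    by_cases hj : j = 1
    · subst hj
      simp only [c', Function.update_self]
      exact (Polynomial.natDegree_add_le _ _).trans (max_le (h1 1) (by simp))
    · simp only [c', Function.update_of_ne hj]; exact h1 j
  have hc3 : ∀ j, (c' j).coeff 3 = b (3, j) := by
    have h1 : ∀ j, (c j).coeff 3 = b (3, j) := by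
      intro j
      simp [c, Fin.sum_univ_succ]
    intro j
    by_cases hj : j = 1
    · subst hj
      simp only [c', Function.update_self, Polynomial.coeff_add, h1, Polynomial.coeff_C_succ,
        add_zero]
    · simp only [c', Function.update_of_ne hj]; exact h1 j
  let E : ℂ[X] := c' 1 ^ 3 - Polynomial.C 4 * (c' 0 * c' 1 * c' 2) +
    Polynomial.C 8 * (c' 0 * c' 0 * c' 3)
  have hE : E.coeff 9 ≠ 0 := by
    have hmul : ∀ i j k, (c' i * c' j * c' k).coeff (3 + 3 + 3) = b (3, i) * b (3, j) * b (3, k) := by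
      intro i j k
      rw [Polynomial.coeff_mul_add_eq_of_natDegree_le (Polynomial.natDegree_mul_le_of_le (hdeg i) (hdeg j))
        (hdeg k), Polynomial.coeff_mul_add_eq_of_natDegree_le (hdeg i) (hdeg j), hc3, hc3, hc3]
    have : E = c' 1 * c' 1 * c' 1 - Polynomial.C 4 * (c' 0 * c' 1 * c' 2) +
      Polynomial.C 8 * (c' 0 * c' 0 * c' 3) := by simp only [E]; ring
    rw [this, Polynomial.coeff_add, Polynomial.coeff_sub, Polynomial.coeff_C_mul,
      Polynomial.coeff_C_mul, hmul 1 1 1, hmul 0 1 2, hmul 0 0 3]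
    intro h
    exact hb3 (by linear_combination h)
  obtain ⟨s, hs⟩ := IsAlgClosed.exists_root E (by
    intro h
    apply hE
    rw [Polynomial.eq_C_of_degree_eq_zero h, Polynomial.coeff_C_succ])
  have hs' : (c' 1).eval s ^ 3 - 4 * (c' 0).eval s * (c' 1).eval s * (c' 2).eval s +
      8 * (c' 0).eval s ^ 2 * (c' 3).eval s = 0 := by
    have := hs
    simp only [E, Polynomial.IsRoot, Polynomial.eval_add, Polynomial.eval_sub, Polynomial.eval_mul,
      Polynomial.eval_pow, Polynomial.eval_C] at this
    linear_combination this
  -- If `c' 0` vanished at `s`, the cubic condition would reduce to the vanishing of the cube of `c'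
  -- 1`, against the choice of `t`.
  have hs0 : (c' 0).eval s ≠ 0 := by
    intro h0
    rw [h0] at hs'
    refine hc' s h0 ?_
    simpa using hs'
  obtain ⟨q, hq⟩ := exists_sqCoeff_eq (c := fun j => (c' j).eval s) hs0 hs'
  let a : Fin 4 × Fin 5 → ℂ := fun k => if k = (0, 1) then t else
    if k = (0, 4) then sqCoeff q 4 - (c' 4).eval s else b k
  intro hmem
  have h0 := eval_eq_zero_of_fiber_one hmem (a := a) (s := s) (q := q) (by
    funext j
    by_cases hj : j = 4
    · subst hj
      simp [fiberCoeff, a, c', c, Fin.sum_univ_succ, b]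
    · rw [← hq j hj]
      fin_cases j
      · simp [fiberCoeff, a, c', c, Fin.sum_univ_succ]
      · simp [fiberCoeff, a, c', c, Fin.sum_univ_succ]
        ring
      · simp [fiberCoeff, a, c', c, Fin.sum_univ_succ]
      · simp [fiberCoeff, a, c', c, Fin.sum_univ_succ]
      · exact absurd rfl hj)
  rw [MvPolynomial.eval_rename] at h0
  rw [hP] at htP
  apply htP
  rw [← h0]
  congr 2
  funext k
  simp only [Function.comp_apply, a, if_neg k.2, hb]

/-- Polynomials are regarded as polynomials in the variable `(0, 4)` over the other nineteen, where
`exists_prime_generator` applies. -/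
theorem exists_bitangent_equation : ∃ f : CoeffRing, Prime f ∧ bitangentPrime = Ideal.span {f} := by
  let e := (MvPolynomial.renameEquiv ℂ (Equiv.optionSubtypeNe ((0, 4) : Fin 4 × Fin 5)).symm).trans
    (MvPolynomial.optionEquivLeft ℂ {k : Fin 4 × Fin 5 // k ≠ (0, 4)})
  have he : ∀ l, e.symm (Polynomial.C l) = MvPolynomial.rename Subtype.val l := by
    intro l
    rw [AlgEquiv.symm_apply_eq]
    simp only [e, AlgEquiv.trans_apply, MvPolynomial.renameEquiv_apply,
      MvPolynomial.rename_rename]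
    have : (Equiv.optionSubtypeNe ((0, 4) : Fin 4 × Fin 5)).symm ∘ Subtype.val =
        (some : {k : Fin 4 × Fin 5 // k ≠ (0, 4)} → _) := by
      funext k
      simp [k.2]
    rw [this]
    induction l using MvPolynomial.induction_on with
    | C c => simp [MvPolynomial.optionEquivLeft_C]
    | add p q hp hq => simp [hp, hq]
    | mul_X p k hp =>
      simp only [map_mul, MvPolynomial.rename_X, MvPolynomial.optionEquivLeft_X_some, hp]
  let I : Ideal (Polynomial (MvPolynomial {k : Fin 4 × Fin 5 // k ≠ (0, 4)} ℂ)) :=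
    bitangentPrime.comap e.symm.toRingEquiv.toRingHom
  have hI : ∀ x, x ∈ I ↔ e.symm x ∈ bitangentPrime := fun x => Iff.rfl
  have : I.IsPrime := Ideal.comap_isPrime _ _
  obtain ⟨f, hf, hIf⟩ := exists_prime_generator I (by
      obtain ⟨p, hp, hp0⟩ := Submodule.exists_mem_ne_zero_of_ne_bot bitangentPrime_ne_bot
      intro h
      have : e p ∈ I := by rw [hI, AlgEquiv.symm_apply_apply]; exact hp
      rw [h, Ideal.mem_bot] at this
      exact hp0 ((map_eq_zero_iff e e.injective).1 this)) (by
      intro l hl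
      by_contra hl0
      rw [hI, he] at hl
      exact rename_notMem_bitangentPrime l hl0 hl)
  refine ⟨e.symm f, (MulEquiv.prime_iff e.symm.toMulEquiv).2 hf, ?_⟩
  ext p
  rw [Ideal.mem_span_singleton]
  have h1 := hI (e p)
  rw [AlgEquiv.symm_apply_apply] at h1
  rw [← h1, hIf, Ideal.mem_span_singleton]
  constructor
  · rintro ⟨x, hx⟩
    exact ⟨e.symm x, by rw [← map_mul, ← hx, AlgEquiv.symm_apply_apply]⟩
  · rintro ⟨x, rfl⟩
    exact ⟨e x, by rw [map_mul, AlgEquiv.apply_symm_apply]⟩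

/-! ### Codimension one -/

theorem coheight_eq_one_of_unique {P : Type*} [PartialOrder P] {x t : P} (hlt : x < t)
    (h : ∀ z, x < z → z = t) : Order.coheight x = 1 := by
  have hmax : ∀ z, x < z → Order.coheight z = 0 := by
    intro z hz
    rw [Order.coheight_eq_zero]
    intro w hw
    rw [h z hz, h w (hz.trans_le hw)]
  apply le_antisymm
  · refine (Order.coheight_le_coe_iff (n := 1)).2 fun z hz => ?_
    rw [hmax z hz]
    exact one_pos
  · rw [Order.one_le_iff_ne_zero, ne_eq, Order.coheight_eq_zero]
    exact fun hm => hlt.not_isMax hm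

theorem subset_closure_diff {X : Type*} [TopologicalSpace X] {Z C : Set X} (hZ : IsIrreducible Z)
    (hC : IsClosed C) (h : ¬ Z ⊆ C) : Z ⊆ closure (Z \ C) := by
  intro z hz
  rw [mem_closure_iff]
  intro O hO hzO
  obtain ⟨y, hy, hyC⟩ := Set.not_subset.1 h
  obtain ⟨w, hw, hwO, hwC⟩ := hZ.2 O Cᶜ hO hC.isOpen_compl ⟨z, hz, hzO⟩ ⟨y, hy, hyC⟩
  exact ⟨w, hwO, hw, hwC⟩

/-- A form outside `Z` gives a polynomial `e` that vanishes on the preimage of `Z`. After all powers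
of the equation `f` are divided out, the remaining factor `g` vanishes over `Z \ Cb`. By
irreducibility `Z \ Cb` is dense in `Z`, so `g` vanishes on the bitangent locus, which contradicts
that `f` does not divide `g`. The preimage of `Z` need not be irreducible for this. -/
theorem eq_univ_of_Cb_ssubset {Z : Set C34} (hZ : IsClosed Z) (hirr : IsIrreducible Z)
    (hsub : Cb ⊂ Z) : Z = Set.univ := by
  by_contra hne
  obtain ⟨c, hc⟩ := (Set.ne_univ_iff_exists_notMem _).1 hne
  obtain ⟨F, rfl⟩ := C34.mk_surjective c
  obtain ⟨e, he, hes⟩ := (SmoothForm.isOpen_iff _).1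
    (hZ.isOpen_compl.preimage C34.continuous_mk) F hc
  obtain ⟨f, hf, hfI⟩ := exists_bitangent_equation
  have he0 : e ≠ 0 := fun h => he (by rw [h, map_zero])
  obtain ⟨n, g, hg, heg⟩ := WfDvdMonoid.max_power_factor he0 hf.irreducible
  apply hg
  rw [← Ideal.mem_span_singleton, ← hfI]
  refine mem_bitangentPrime_of_forall fun F' hF' => ?_
  have hcl : IsClosed {G : SmoothForm | G.point g = 0} := by
    rw [← isOpen_compl_iff, SmoothForm.isOpen_iff]
    exact fun G hG => ⟨g, hG, fun _ h => h⟩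
  have h1 : C34.mk ⁻¹' (Z \ Cb) ⊆ {G : SmoothForm | G.point g = 0} := by
    rintro G ⟨hGZ, hGC⟩
    by_contra hGg
    have hG0 : G.point e = 0 := by
      by_contra h
      exact hes G h hGZ
    rw [heg, map_mul, map_pow] at hG0
    have hGf : G.point f ≠ 0 := by
      intro h
      apply hGC
      refine mk_mem_Cb.2 fun p hp => ?_
      rw [hfI, Ideal.mem_span_singleton] at hp
      obtain ⟨r, rfl⟩ := hp
      rw [map_mul, h, zero_mul]
    exact mul_ne_zero (pow_ne_zero _ hGf) hGg hG0
  have h2 := closure_minimal h1 hcl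
  rw [← C34.isOpenMap_mk.preimage_closure_eq_closure_preimage C34.continuous_mk] at h2
  refine h2 (subset_closure_diff hirr isClosed_closure hsub.not_subset (hsub.subset ?_))
  exact mk_mem_Cb.2 hF'.mem_bitangentSet

theorem Cb_ne_univ : Cb ≠ Set.univ := by
  intro h
  obtain ⟨p, hp, hp0⟩ := Submodule.exists_mem_ne_zero_of_ne_bot bitangentPrime_ne_bot
  refine hp0 (eq_zero_of_forall_point fun F => ?_)
  have : C34.mk F ∈ Cb := h ▸ trivial
  exact mk_mem_Cb.1 this p hp

theorem isIrreducible_univ_C34 : IsIrreducible (Set.univ : Set C34) := by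
  have := isIrreducible_univ_smoothForm.image C34.mk C34.continuous_mk.continuousOn
  rwa [Set.image_univ, C34.mk_surjective.range_eq] at this

/-- An irreducible `Z` is its only component, and `T` is the only irreducible closed set strictly
above it. -/
theorem coheight_of_irreducible {X : Type*} [TopologicalSpace X] {Z T : Set X}
    (hZ : IsIrreducible Z) (hT : IsIrreducible T) (hTc : IsClosed T)
    (hlt : Z ⊂ T) (h : ∀ Y, IsClosed Y → IsIrreducible Y → Z ⊂ Y → Y = T)
    (Y : TopologicalSpace.IrreducibleCloseds X) (hZc : IsClosed Z)
    (hY : Maximal (fun Y' : TopologicalSpace.IrreducibleCloseds X => (Y' : Set X) ⊆ Z) Y) :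
    Order.coheight Y = 1 := by
  have hYZ : (Y : Set X) = Z :=
    subset_antisymm hY.1 (hY.2 (y := ⟨Z, hZ, hZc⟩) (subset_refl Z) hY.1)
  refine coheight_eq_one_of_unique (t := ⟨T, hT, hTc⟩) ?_ fun W hW => ?_
  · rw [← SetLike.coe_ssubset_coe, hYZ]
    exact hlt
  · apply SetLike.coe_injective
    rw [← SetLike.coe_ssubset_coe, hYZ] at hW
    exact h W W.isClosed W.isIrreducible hW

/-! ### The incidence scheme -/

section IncidenceAlgebra

variable {S : Type} [CommRing S] [Algebra ℂ S]

/-- The pullback of the square ideal to the chart `[1 : s]`, for a form with coefficients `a`. -/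
def chartIdeal (a : Fin 4 × Fin 5 → S) : Ideal S[X] :=
  squareIdeal.map (MvPolynomial.aeval (R := ℂ)
    (fun j : Fin 5 => ∑ i : Fin 4, Polynomial.C (a (i, j)) * Polynomial.X ^ (i : ℕ)))

/-- The coefficients of the form with exchanged coordinates of the first line. -/
def flipCoeff (a : Fin 4 × Fin 5 → S) : Fin 4 × Fin 5 → S := fun k => a (k.1.rev, k.2)

omit [CommRing S] [Algebra ℂ S] in
theorem flipCoeff_flipCoeff (a : Fin 4 × Fin 5 → S) : flipCoeff (flipCoeff a) = a := by
  funext k; simp [flipCoeff]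

/-- Since `squareHom p = 0`, the coefficients of `genericHom p` lie in the square ideal. Substitute
the fiber of `a` over `X`, the point `X` itself, and the three remaining rows of `a`: the row that
was solved for is recovered, and `genericHom p` becomes the constant `p(a)`. Hence the equations of
the locus kill the function `1` on the incidence scheme. -/
theorem C_mem_chartIdeal {p : CoeffRing} (hp : p ∈ bitangentPrime) (a : Fin 4 × Fin 5 → S) :
    Polynomial.C (MvPolynomial.aeval a p) ∈ chartIdeal a := by
  let c : MvPolynomial (Fin 5) ℂ →ₐ[ℂ] S[X] := MvPolynomial.aeval
    (fun j : Fin 5 => ∑ i : Fin 4, Polynomial.C (a (i, j)) * Polynomial.X ^ (i : ℕ))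
  let β : MvPolynomial ParamIndex (MvPolynomial (Fin 5) ℂ) →+* S[X] :=
    MvPolynomial.eval₂Hom c.toRingHom
      (fun o => o.elim Polynomial.X fun k => Polynomial.C (a (k.1.succ, k.2)))
  have hβ : β (genericHom p) = Polynomial.C (MvPolynomial.aeval a p) := by
    have : β.comp genericHom.toRingHom =
        Polynomial.C.comp (MvPolynomial.aeval a : CoeffRing →ₐ[ℂ] S).toRingHom := by
      ext ⟨i, j⟩
      · simp [β, genericHom, c]
      · induction i using Fin.cases with
        | zero => simp [β, genericHom, c, Fin.sum_univ_succ]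
        | succ i => simp [β, genericHom]
    exact congrArg (fun f => f p) this
  have hk : genericHom p ∈ squareIdeal.map MvPolynomial.C := by
    have : squareIdeal = RingHom.ker (MvPolynomial.aeval (R := ℂ)
      (sqCoeff (S := MvPolynomial (Fin 3) ℂ) MvPolynomial.X)).toRingHom := rfl
    rw [this, ← MvPolynomial.ker_map]
    exact hp
  have := Ideal.mem_map_of_mem β hk
  rw [hβ, Ideal.map_map] at this
  have hc : β.comp MvPolynomial.C = c.toRingHom := by
    ext x <;> simp [β]
  rw [hc] at this
  exact this

omit [Algebra ℂ S] in
theorem aeval_mul_left_of_isHomogeneous {k : Type*} [CommSemiring k] [Algebra k S] {σ : Type*}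
    {p : MvPolynomial σ k} {n : ℕ} (hp : p.IsHomogeneous n) (t : S) (y : σ → S) :
    MvPolynomial.aeval (fun j => t * y j) p = t ^ n * MvPolynomial.aeval y p := by
  rw [MvPolynomial.aeval_def, MvPolynomial.aeval_def, MvPolynomial.eval₂_eq,
    MvPolynomial.eval₂_eq, Finset.mul_sum]
  refine Finset.sum_congr rfl fun d hd => ?_
  have hd' : ∑ i ∈ d.support, d i = n := by
    have := hp (MvPolynomial.mem_support_iff.1 hd)
    rwa [Finsupp.weight_apply, Finsupp.sum, Finset.sum_congr rfl fun i _ => by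
      rw [Pi.one_apply, smul_eq_mul, mul_one]] at this
  simp only [mul_pow, Finset.prod_mul_distrib]
  rw [Finset.prod_pow_eq_pow_sum, hd']
  ring

/-- Multiplying `q` by `t` multiplies its square by `t²`, and every complex number is a square, so
the variety of squares is a cone. Homogeneity is what makes the two charts of the incidence scheme
agree. -/
theorem homogeneousComponent_mem_squareIdeal {p : MvPolynomial (Fin 5) ℂ} (hp : p ∈ squareIdeal)
    (e : ℕ) : MvPolynomial.homogeneousComponent e p ∈ squareIdeal := by
  rw [mem_squareIdeal_iff] at hp ⊢
  intro q
  let P : ℂ[X] := ∑ i ∈ Finset.range (p.totalDegree + 1), Polynomial.C (MvPolynomial.eval (sqCoeff q)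
    (MvPolynomial.homogeneousComponent i p)) * Polynomial.X ^ i
  have hP : P = 0 := by
    refine Polynomial.funext fun r => ?_
    obtain ⟨t, ht⟩ := IsAlgClosed.exists_pow_nat_eq r two_pos
    have h1 := hp (t • q)
    have h2 : sqCoeff (t • q) = r • sqCoeff q := by
      funext j; rw [sqCoeff_smul, ht]; rfl
    rw [h2, ← MvPolynomial.sum_homogeneousComponent p, map_sum] at h1
    rw [Polynomial.eval_zero, ← h1, Polynomial.eval_finsetSum]
    refine Finset.sum_congr rfl fun i _ => ?_
    have := aeval_mul_left_of_isHomogeneous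
      (MvPolynomial.homogeneousComponent_isHomogeneous i p) r (sqCoeff q)
    rw [MvPolynomial.aeval_eq_eval] at this
    rw [Polynomial.eval_mul, Polynomial.eval_C, Polynomial.eval_pow, Polynomial.eval_X, mul_comm]
    exact this.symm
  by_cases he : e < p.totalDegree + 1
  · have := congrArg (fun P => Polynomial.coeff P e) hP
    simpa [P, Polynomial.coeff_X_pow, he] using this
  · rw [MvPolynomial.homogeneousComponent_eq_zero e p (by omega), map_zero]

/-- The ideals of the two charts agree on the intersection of the charts. -/
theorem invert_mem_map_chartIdeal (a : Fin 4 × Fin 5 → S) {z : LaurentPolynomial S}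
    (hz : z ∈ (chartIdeal a).map
      (aeval (R := S) (LaurentPolynomial.T 1 : LaurentPolynomial S))) :
    LaurentPolynomial.invert z ∈ (chartIdeal (flipCoeff a)).map
      (aeval (R := S) (LaurentPolynomial.T 1 : LaurentPolynomial S)) := by
  let φ : S[X] →ₐ[ℂ] LaurentPolynomial S :=
    (aeval (R := S) (LaurentPolynomial.T 1 : LaurentPolynomial S)).restrictScalars ℂ
  let ψ : LaurentPolynomial S →ₐ[ℂ] LaurentPolynomial S :=
    (LaurentPolynomial.invert (R := S)).toAlgHom.restrictScalars ℂ
  have hφX : φ Polynomial.X = LaurentPolynomial.T 1 := Polynomial.aeval_X _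
  have hφC : ∀ s, φ (Polynomial.C s) = LaurentPolynomial.C s := fun s => by
    simp [φ, LaurentPolynomial.algebraMap_apply]
  have hψC : ∀ s, ψ (LaurentPolynomial.C s) = LaurentPolynomial.C s := LaurentPolynomial.invert_C
  have hψT : ∀ s, ψ (LaurentPolynomial.T s) = LaurentPolynomial.T (-s) := LaurentPolynomial.invert_T
  suffices h : (chartIdeal a).map φ ≤ ((chartIdeal (flipCoeff a)).map φ).comap ψ from h hz
  rw [Ideal.map_le_iff_le_comap, chartIdeal, Ideal.map_le_iff_le_comap]
  intro p hp
  rw [Ideal.mem_comap, Ideal.mem_comap, Ideal.mem_comap,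
    ← MvPolynomial.sum_homogeneousComponent p, map_sum, map_sum, map_sum]
  refine Ideal.sum_mem _ fun e _ => ?_
  have he := homogeneousComponent_mem_squareIdeal hp e
  have hh := MvPolynomial.homogeneousComponent_isHomogeneous e p
  generalize MvPolynomial.homogeneousComponent e p = q at he hh
  have h1 := Ideal.mem_map_of_mem φ (Ideal.mem_map_of_mem (MvPolynomial.aeval (R := ℂ)
    (fun j : Fin 5 => ∑ i : Fin 4,
      Polynomial.C (flipCoeff a (i, j)) * Polynomial.X ^ (i : ℕ))) he)
  change _ ∈ (chartIdeal (flipCoeff a)).map φ at h1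
  rw [MvPolynomial.comp_aeval_apply] at h1 ⊢
  rw [MvPolynomial.comp_aeval_apply]
  -- Up to inversion of the coordinate, the fiber coefficients in the two charts differ by the
  -- factor `T 3`. A homogeneous equation of degree `e` therefore only changes by a unit.
  have h2 : (fun j : Fin 5 => φ (∑ i : Fin 4,
      Polynomial.C (flipCoeff a (i, j)) * Polynomial.X ^ (i : ℕ))) =
      fun j => LaurentPolynomial.T 3 * ψ (φ (∑ i : Fin 4,
        Polynomial.C (a (i, j)) * Polynomial.X ^ (i : ℕ))) := by
    funext j
    rw [map_sum, map_sum, map_sum, Finset.mul_sum]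
    refine Fintype.sum_equiv Fin.revPerm _ _ fun i => ?_
    simp only [map_mul, map_pow, hφX, hφC, hψC, hψT, LaurentPolynomial.T_pow, Fin.revPerm_apply,
      flipCoeff]
    rw [mul_left_comm, ← LaurentPolynomial.T_add]
    congr 2
    rw [Fin.val_rev]
    have := i.2
    omega
  rw [h2, aeval_mul_left_of_isHomogeneous hh] at h1
  have := Ideal.mul_mem_left _ (LaurentPolynomial.T (-3) ^ e) h1
  rwa [← mul_assoc, ← mul_pow, ← LaurentPolynomial.T_add, neg_add_cancel, LaurentPolynomial.T_zero,
    one_pow, one_mul] at this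

omit [Algebra ℂ S] in
theorem exists_X_pow_mul_mem {I : Ideal S[X]} {f : S[X]}
    (h : aeval (LaurentPolynomial.T 1 : LaurentPolynomial S) f ∈
      I.map (aeval (R := S) (LaurentPolynomial.T 1 : LaurentPolynomial S))) :
    ∃ n : ℕ, Polynomial.X ^ n * f ∈ I := by
  have h1 : (aeval (R := S) (LaurentPolynomial.T 1 : LaurentPolynomial S)).toRingHom =
      algebraMap S[X] (LaurentPolynomial S) := by
    ext <;> simp [LaurentPolynomial.algebraMap_eq_toLaurent]
  have h2 : I.map (aeval (R := S) (LaurentPolynomial.T 1 : LaurentPolynomial S)) =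
      I.map (algebraMap S[X] (LaurentPolynomial S)) := by
    rw [← h1]; rfl
  rw [h2, show aeval (LaurentPolynomial.T 1 : LaurentPolynomial S) f =
    algebraMap S[X] (LaurentPolynomial S) f from congrArg (fun g => g f) h1,
    IsLocalization.algebraMap_mem_map_algebraMap_iff (Submonoid.powers (Polynomial.X : S[X]))] at h
  obtain ⟨_, ⟨n, rfl⟩, hn⟩ := h
  exact ⟨n, hn⟩

end IncidenceAlgebra

/-! ### Functions on the incidence scheme and their Fitting ideal -/

section IncidenceSections

/-- Multiplying the relations by the adjugate matrix shows that the determinant kills every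
generator. -/
theorem fittingIdeal_le_annihilator (S : Type) [CommRing S] (M : Type) [AddCommGroup M]
    [Module S M] : fittingIdeal S M ≤ Module.annihilator S M := by
  refine Ideal.span_le.2 ?_
  rintro d ⟨n, m, A, hm, hA, rfl⟩
  have h : ∀ i, A.det • m i = 0 := fun i => by
    have h1 : A.det • m i = ∑ j, (A.adjugate * A) i j • m j := by
      simp [Matrix.adjugate_mul, Matrix.smul_apply, Matrix.one_apply]
    rw [h1]
    simp only [Matrix.mul_apply, Finset.sum_smul, mul_smul]
    rw [Finset.sum_comm]
    simp only [← Finset.smul_sum, hA, smul_zero, Finset.sum_const_zero]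
  rw [SetLike.mem_coe, Module.mem_annihilator]
  intro x
  have hx : x ∈ Submodule.span S (Set.range m) := hm ▸ Submodule.mem_top
  induction hx using Submodule.span_induction with
  | mem x hx => obtain ⟨i, rfl⟩ := hx; exact h i
  | zero => exact smul_zero _
  | add x y _ _ hx hy => rw [smul_add, hx, hy, add_zero]
  | smul c x _ hx => rw [smul_comm, hx, smul_zero]

theorem mem_fittingIdeal_of_span_singleton {S : Type} [CommRing S] {M : Type} [AddCommGroup M]
    [Module S M] {x : M} (hx : Submodule.span S {x} = ⊤) {d : S} (hd : d • x = 0) :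
    d ∈ fittingIdeal S M := by
  refine Ideal.subset_span ⟨1, fun _ => x, fun _ _ => d, ?_, fun i => ?_, ?_⟩
  · rw [Set.range_const, hx]
  · simpa using hd
  · exact (Matrix.det_fin_one (A := fun _ _ => d)).symm

section

variable {S : Type} [CommRing S] [Algebra ℂ S]

/-- By `h0` the incidence scheme lies on the section `X = s` of the first chart, and by `h1` the
coordinate `X` is invertible on it in the second chart, so nothing lies over the origin of that
chart. A compatible pair then has the constant value `f(s)` in the first chart. In the second chart
the same holds after multiplication by a power of `X`, which can be cancelled. -/
theorem exists_sub_C_mem_chartIdeal {a : Fin 4 × Fin 5 → S} {s s' : S} {n : ℕ}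
    (h0 : Polynomial.X - Polynomial.C s ∈ chartIdeal a)
    (h1 : 1 - Polynomial.C s' * Polynomial.X ^ (n + 1) ∈ chartIdeal (flipCoeff a)) {f g : S[X]}
    (hfg : aeval (LaurentPolynomial.T 1 : LaurentPolynomial S) f -
      aeval (LaurentPolynomial.T (-1) : LaurentPolynomial S) g ∈
        (chartIdeal a).map
          (aeval (R := S) (LaurentPolynomial.T 1 : LaurentPolynomial S))) :
    ∃ c, f - Polynomial.C c ∈ chartIdeal a ∧ g - Polynomial.C c ∈ chartIdeal (flipCoeff a) := by
  have hf : f - Polynomial.C (f.eval s) ∈ chartIdeal a :=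
    Ideal.mem_of_dvd _ (Polynomial.X_sub_C_dvd_sub_C_eval) h0
  refine ⟨f.eval s, hf, ?_⟩
  have h2 := Ideal.mem_map_of_mem
    (aeval (R := S) (LaurentPolynomial.T 1 : LaurentPolynomial S)) hf
  have h3 := invert_mem_map_chartIdeal a (Ideal.sub_mem _ h2 hfg)
  have h4 : LaurentPolynomial.invert
      (aeval (LaurentPolynomial.T 1 : LaurentPolynomial S)
          (f - Polynomial.C (f.eval s)) -
        (aeval (LaurentPolynomial.T 1 : LaurentPolynomial S) f -
          aeval (LaurentPolynomial.T (-1) : LaurentPolynomial S) g)) =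
      aeval (LaurentPolynomial.T 1 : LaurentPolynomial S)
        (g - Polynomial.C (f.eval s)) := by
    have h5 : LaurentPolynomial.invert
        (aeval (LaurentPolynomial.T (-1) : LaurentPolynomial S) g) =
        aeval (LaurentPolynomial.T 1 : LaurentPolynomial S) g := by
      change (LaurentPolynomial.invert (R := S)).toAlgHom _ = _
      rw [← Polynomial.aeval_algHom_apply]
      simp
    rw [map_sub, map_sub, map_sub, map_sub, map_sub, h5]
    simp [LaurentPolynomial.algebraMap_apply]
  rw [h4] at h3
  obtain ⟨k, hk⟩ := exists_X_pow_mul_mem h3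
  have h6 : ∃ w, w * Polynomial.X ^ k - 1 ∈ chartIdeal (flipCoeff a) := by
    have : (Polynomial.C s' * Polynomial.X ^ (n + 1)) ^ k - 1 ∈ chartIdeal (flipCoeff a) := by
      refine Ideal.mem_of_dvd _ ?_ h1
      rw [← dvd_neg, neg_sub]
      simpa using sub_dvd_pow_sub_pow (1 : S[X]) (Polynomial.C s' * Polynomial.X ^ (n + 1)) k
    refine ⟨Polynomial.C s' ^ k * Polynomial.X ^ (n * k), ?_⟩
    convert this using 1
    ring
  obtain ⟨w, hw⟩ := h6
  have := Ideal.sub_mem _ (Ideal.mul_mem_left _ w hk) (Ideal.mul_mem_right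
    (g - Polynomial.C (f.eval s)) _ hw)
  convert this using 1
  ring

end

variable (S : Type) [CommRing S] [Algebra ℂ S] [Algebra CoeffRing S]

theorem incidenceIdeal₀_eq :
    incidenceIdeal₀ S = chartIdeal (fun k => univCoeff S k.1 k.2) := rfl

theorem incidenceIdeal₁_eq :
    incidenceIdeal₁ S = chartIdeal (flipCoeff fun k => univCoeff S k.1 k.2) := by
  rw [incidenceIdeal₁, chartIdeal]
  congr 2
  funext j
  refine Fintype.sum_equiv Fin.revPerm _ _ fun i => ?_
  rw [Fin.revPerm_apply, flipCoeff, Fin.rev_rev, Fin.val_rev]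
  congr 2
  omega

theorem mem_compatiblePairs {x : S[X] × S[X]} : x ∈ compatiblePairs S ↔
    aeval (LaurentPolynomial.T 1 : LaurentPolynomial S) x.1 -
      aeval (LaurentPolynomial.T (-1) : LaurentPolynomial S) x.2 ∈
        (incidenceIdeal₀ S).map
          (aeval (R := S) (LaurentPolynomial.T 1 : LaurentPolynomial S)) := Iff.rfl

theorem one_mem_compatiblePairs : (1 : S[X] × S[X]) ∈ compatiblePairs S := by
  rw [mem_compatiblePairs]
  simp

/-- The function `1` on the incidence scheme. -/
def incidenceOne : IncidenceSections S :=
  Submodule.Quotient.mk ⟨1, one_mem_compatiblePairs S⟩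

variable {S}

theorem mem_submoduleOf_vanishingPairs {x : compatiblePairs S} :
    x ∈ (vanishingPairs S).submoduleOf (compatiblePairs S) ↔
      x.1.1 ∈ incidenceIdeal₀ S ∧ x.1.2 ∈ incidenceIdeal₁ S := Iff.rfl

theorem smul_incidenceOne_eq_zero_iff {d : S} : d • incidenceOne S = 0 ↔
    Polynomial.C d ∈ incidenceIdeal₀ S ∧ Polynomial.C d ∈ incidenceIdeal₁ S := by
  rw [incidenceOne, ← Submodule.Quotient.mk_smul, Submodule.Quotient.mk_eq_zero,
    mem_submoduleOf_vanishingPairs]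
  change d • (1 : S[X]) ∈ _ ∧ d • (1 : S[X]) ∈ _ ↔ _
  rw [Polynomial.smul_eq_C_mul, mul_one]

theorem algebraMap_eq_aeval_univCoeff [IsScalarTower ℂ CoeffRing S] (p : CoeffRing) :
    algebraMap CoeffRing S p =
      MvPolynomial.aeval (fun k : Fin 4 × Fin 5 => univCoeff S k.1 k.2) p := by
  have : (IsScalarTower.toAlgHom ℂ CoeffRing S) =
      MvPolynomial.aeval (fun k : Fin 4 × Fin 5 => univCoeff S k.1 k.2) := by
    ext k; simp [univCoeff]
  exact congrArg (fun f => f p) this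

theorem smul_incidenceOne_of_mem_bitangentPrime [IsScalarTower ℂ CoeffRing S] {p : CoeffRing}
    (hp : p ∈ bitangentPrime) : algebraMap CoeffRing S p • incidenceOne S = 0 := by
  rw [smul_incidenceOne_eq_zero_iff, algebraMap_eq_aeval_univCoeff]
  rw [incidenceIdeal₀_eq, incidenceIdeal₁_eq]
  refine ⟨C_mem_chartIdeal hp _, ?_⟩
  have h1 := C_mem_chartIdeal (flipHom_mem_bitangentPrime hp)
    (flipCoeff fun k => univCoeff S k.1 k.2)
  have h2 : MvPolynomial.aeval (flipCoeff fun k => univCoeff S k.1 k.2) (flipHom p) =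
      MvPolynomial.aeval (fun k : Fin 4 × Fin 5 => univCoeff S k.1 k.2) p := by
    rw [flipHom, MvPolynomial.aeval_rename]
    have : (flipCoeff fun k : Fin 4 × Fin 5 => univCoeff S k.1 k.2) ∘
        (fun k : Fin 4 × Fin 5 => (k.1.rev, k.2)) = fun k => univCoeff S k.1 k.2 := by
      funext k
      rw [Function.comp_apply, flipCoeff, Fin.rev_rev]
    rw [this]
  rw [h2] at h1
  exact h1

theorem span_incidenceOne_eq_top (h : ∀ x ∈ compatiblePairs S,
    ∃ c, x.1 - Polynomial.C c ∈ incidenceIdeal₀ S ∧ x.2 - Polynomial.C c ∈ incidenceIdeal₁ S) :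
    Submodule.span S {incidenceOne S} = ⊤ := by
  refine eq_top_iff.2 fun y _ => ?_
  obtain ⟨⟨x, hx⟩, rfl⟩ := Submodule.Quotient.mk_surjective _ y
  obtain ⟨c, hc0, hc1⟩ := h x hx
  rw [Submodule.mem_span_singleton]
  refine ⟨c, ?_⟩
  rw [incidenceOne, ← Submodule.Quotient.mk_smul, eq_comm, Submodule.Quotient.eq,
    mem_submoduleOf_vanishingPairs]
  change x.1 - c • (1 : S[X]) ∈ _ ∧ x.2 - c • (1 : S[X]) ∈ _
  rw [Polynomial.smul_eq_C_mul, mul_one]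
  exact ⟨hc0, hc1⟩

theorem span_incidenceOne_of_chart₀ {s s' : S} {n : ℕ}
    (h0 : Polynomial.X - Polynomial.C s ∈ incidenceIdeal₀ S)
    (h1 : 1 - Polynomial.C s' * Polynomial.X ^ (n + 1) ∈ incidenceIdeal₁ S) :
    Submodule.span S {incidenceOne S} = ⊤ := by
  refine span_incidenceOne_eq_top fun x hx => ?_
  have hx' := (mem_compatiblePairs S).1 hx
  rw [incidenceIdeal₀_eq] at h0 hx' ⊢
  rw [incidenceIdeal₁_eq] at h1 ⊢
  exact exists_sub_C_mem_chartIdeal h0 h1 hx'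

/-- Inversion of the Laurent variable exchanges the charts and reduces this to the other case. -/
theorem span_incidenceOne_of_chart₁ {s s' : S} {n : ℕ}
    (h0 : Polynomial.X - Polynomial.C s ∈ incidenceIdeal₁ S)
    (h1 : 1 - Polynomial.C s' * Polynomial.X ^ (n + 1) ∈ incidenceIdeal₀ S) :
    Submodule.span S {incidenceOne S} = ⊤ := by
  refine span_incidenceOne_eq_top fun x hx => ?_
  have hx' := (mem_compatiblePairs S).1 hx
  rw [incidenceIdeal₀_eq] at hx'
  replace hx' := invert_mem_map_chartIdeal _ hx'
  have h5 : ∀ (k : ℤ) (g : S[X]), LaurentPolynomial.invert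
      (aeval (LaurentPolynomial.T k : LaurentPolynomial S) g) =
      aeval (LaurentPolynomial.T (-k) : LaurentPolynomial S) g := fun k g => by
    change (LaurentPolynomial.invert (R := S)).toAlgHom _ = _
    rw [← Polynomial.aeval_algHom_apply]
    simp
  rw [map_sub, h5, h5, ← neg_mem_iff, neg_sub, neg_neg] at hx'
  rw [incidenceIdeal₁_eq] at h0 ⊢
  rw [incidenceIdeal₀_eq] at h1 ⊢
  rw [← flipCoeff_flipCoeff fun k => univCoeff S k.1 k.2] at h1
  obtain ⟨c, hc1, hc0⟩ := exists_sub_C_mem_chartIdeal h0 h1 hx'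
  rw [flipCoeff_flipCoeff] at hc0
  exact ⟨c, hc0, hc1⟩

theorem span_incidenceOne_of_eq_top (h0 : incidenceIdeal₀ S = ⊤) (h1 : incidenceIdeal₁ S = ⊤) :
    Submodule.span S {incidenceOne S} = ⊤ :=
  span_incidenceOne_of_chart₀ (s := 0) (s' := 0) (n := 0) (h0 ▸ Submodule.mem_top)
    (h1 ▸ Submodule.mem_top)

/-- If the incidence scheme is a closed subscheme of the base, then the Fitting ideal contains
the equations of the bitangent locus. -/
theorem mem_fittingIdeal_of_mem_bitangentPrime [IsScalarTower ℂ CoeffRing S]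
    (h : Submodule.span S {incidenceOne S} = ⊤) {p : CoeffRing} (hp : p ∈ bitangentPrime) :
    algebraMap CoeffRing S p ∈ fittingIdeal S (IncidenceSections S) :=
  mem_fittingIdeal_of_span_singleton h (smul_incidenceOne_of_mem_bitangentPrime hp)

end IncidenceSections

/-! ### Forms of degree ten that vanish on the incidence scheme, over a local ring -/

section BinaryForms

/-- The form of degree ten in the coordinates of the first line given by the equation `p` of the
variety of squares and a linear form. It vanishes on the incidence scheme. -/
def incidenceForm {S : Type*} [CommRing S] [Algebra ℂ S] (a : Fin 4 × Fin 5 → S) (m : Fin 2 → ℂ)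
    (p : MvPolynomial (Fin 5) ℂ) : MvPolynomial (Fin 2) S :=
  (∑ k, MvPolynomial.C (algebraMap ℂ S (m k)) * MvPolynomial.X k) *
    MvPolynomial.aeval (fiberCoeff (fun k => MvPolynomial.C (a k)) MvPolynomial.X) p

theorem algHom_incidenceForm {S T : Type*} [CommRing S] [Algebra ℂ S] [CommRing T] [Algebra ℂ T]
    (φ : MvPolynomial (Fin 2) S →ₐ[ℂ] T) {a : Fin 4 × Fin 5 → S} {b : Fin 4 × Fin 5 → T}
    {y : Fin 2 → T} (hb : ∀ k, φ (MvPolynomial.C (a k)) = b k)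
    (hy : ∀ k, φ (MvPolynomial.X k) = y k) (m : Fin 2 → ℂ) (p : MvPolynomial (Fin 5) ℂ) :
    φ (incidenceForm a m p) = (∑ k, algebraMap ℂ T (m k) * y k) *
      MvPolynomial.aeval (fiberCoeff b y) p := by
  have h : ∀ c, φ (MvPolynomial.C (algebraMap ℂ S c)) = algebraMap ℂ T c := fun c =>
    φ.commutes c
  have h1 : (fun j => φ (fiberCoeff (fun k => MvPolynomial.C (a k)) MvPolynomial.X j)) =
      fiberCoeff b y := by
    funext j
    simp only [fiberCoeff, map_sum, map_mul, map_pow, hb, hy]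
  rw [incidenceForm, map_mul, map_sum, MvPolynomial.comp_aeval_apply, h1]
  simp only [map_mul, h, hy]

theorem map_incidenceForm {S T : Type*} [CommRing S] [Algebra ℂ S] [CommRing T] [Algebra ℂ T]
    (f : S →ₐ[ℂ] T) (a : Fin 4 × Fin 5 → S) (m : Fin 2 → ℂ) (p : MvPolynomial (Fin 5) ℂ) :
    MvPolynomial.map f.toRingHom (incidenceForm a m p) = incidenceForm (fun k => f (a k)) m p :=
  algHom_incidenceForm (MvPolynomial.mapAlgHom f) (fun _ => MvPolynomial.map_C _ _)
    (fun _ => MvPolynomial.map_X _ _) m p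

theorem isHomogeneous_fiberCoeff {S : Type*} [CommRing S] (a : Fin 4 × Fin 5 → S) (j : Fin 5) :
    (fiberCoeff (fun k => MvPolynomial.C (a k)) MvPolynomial.X j :
      MvPolynomial (Fin 2) S).IsHomogeneous 3 := by
  refine MvPolynomial.IsHomogeneous.sum _ _ _ fun i _ => ?_
  have := (MvPolynomial.isHomogeneous_C (Fin 2) (a (i, j))).mul
    ((MvPolynomial.isHomogeneous_X_pow (R := S) (0 : Fin 2) (3 - (i : ℕ))).mul
      (MvPolynomial.isHomogeneous_X_pow (1 : Fin 2) (i : ℕ)))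
  rwa [zero_add, Nat.sub_add_cancel (by omega)] at this

theorem isHomogeneous_incidenceForm {S : Type*} [CommRing S] [Algebra ℂ S]
    (a : Fin 4 × Fin 5 → S) (m : Fin 2 → ℂ) {p : MvPolynomial (Fin 5) ℂ} (hp : p.IsHomogeneous 3) :
    (incidenceForm a m p).IsHomogeneous 10 := by
  have h1 : (∑ k, MvPolynomial.C (algebraMap ℂ S (m k)) * MvPolynomial.X k :
      MvPolynomial (Fin 2) S).IsHomogeneous 1 :=
    MvPolynomial.IsHomogeneous.sum _ _ _ fun k _ => MvPolynomial.isHomogeneous_C_mul_X _ _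
  exact h1.mul (hp.aeval _ fun j => isHomogeneous_fiberCoeff a j)

variable {S : Type} [CommRing S] [Algebra ℂ S]

/-- The forms that vanish on the incidence scheme in both charts. -/
def vanishingForms (a : Fin 4 × Fin 5 → S) : Submodule S (MvPolynomial (Fin 2) S) :=
  ((chartIdeal a).restrictScalars S).comap
      (MvPolynomial.aeval (R := S) ![1, Polynomial.X]).toLinearMap ⊓
    ((chartIdeal (flipCoeff a)).restrictScalars S).comap
      (MvPolynomial.aeval (R := S) ![Polynomial.X, 1]).toLinearMap

theorem mem_vanishingForms {a : Fin 4 × Fin 5 → S} {G : MvPolynomial (Fin 2) S} :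
    G ∈ vanishingForms a ↔ MvPolynomial.aeval ![1, Polynomial.X] G ∈ chartIdeal a ∧
      MvPolynomial.aeval ![Polynomial.X, 1] G ∈ chartIdeal (flipCoeff a) := Iff.rfl

theorem incidenceForm_mem_vanishingForms (a : Fin 4 × Fin 5 → S) (m : Fin 2 → ℂ)
    {p : MvPolynomial (Fin 5) ℂ} (hp : p ∈ squareIdeal) :
    incidenceForm a m p ∈ vanishingForms a := by
  have h0 := algHom_incidenceForm
    ((MvPolynomial.aeval (R := S) ![1, (Polynomial.X : S[X])]).restrictScalars ℂ)
    (a := a) (b := fun k => Polynomial.C (a k)) (y := ![1, Polynomial.X])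
    (fun k => MvPolynomial.aeval_C _ _) (fun k => MvPolynomial.aeval_X _ _) m p
  have h1 := algHom_incidenceForm
    ((MvPolynomial.aeval (R := S) ![(Polynomial.X : S[X]), 1]).restrictScalars ℂ)
    (a := a) (b := fun k => Polynomial.C (a k)) (y := ![Polynomial.X, 1])
    (fun k => MvPolynomial.aeval_C _ _) (fun k => MvPolynomial.aeval_X _ _) m p
  rw [AlgHom.restrictScalars_apply] at h0 h1
  have e0 : fiberCoeff (fun k => Polynomial.C (a k)) ![1, Polynomial.X] = fun j : Fin 5 =>
      ∑ i : Fin 4, Polynomial.C (a (i, j)) * Polynomial.X ^ (i : ℕ) := by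
    funext j
    simp [fiberCoeff]
  have e1 : fiberCoeff (fun k => Polynomial.C (a k)) ![Polynomial.X, 1] = fun j : Fin 5 =>
      ∑ i : Fin 4, Polynomial.C (flipCoeff a (i, j)) * Polynomial.X ^ (i : ℕ) := by
    funext j
    refine Fintype.sum_equiv Fin.revPerm _ _ fun i => ?_
    rw [Fin.revPerm_apply, flipCoeff, Fin.rev_rev, Fin.val_rev]
    simp only [Matrix.cons_val_zero, Matrix.cons_val_one, one_pow, mul_one]
    congr 2
    omega
  rw [mem_vanishingForms, h0, h1, e0, e1]
  exact ⟨Ideal.mul_mem_left _ _ (Ideal.mem_map_of_mem _ hp),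
    Ideal.mul_mem_left _ _ (Ideal.mem_map_of_mem _ hp)⟩

/-- The forms of degree ten in the ideal of the incidence scheme that come from cubic equations of
the variety of squares. -/
def incidenceForms (a : Fin 4 × Fin 5 → ℂ) : Submodule ℂ (MvPolynomial (Fin 2) ℂ) :=
  Submodule.span ℂ {G | ∃ (m : Fin 2 → ℂ) (p : MvPolynomial (Fin 5) ℂ),
    p ∈ squareIdeal ∧ p.IsHomogeneous 3 ∧ G = incidenceForm a m p}

/-- The generators depend on complex data `m` and `p` only, so the same expressions make sense over
`S`. -/
theorem exists_lift_incidenceForms (f : S →ₐ[ℂ] ℂ) (a : Fin 4 × Fin 5 → S)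
    {G : MvPolynomial (Fin 2) ℂ} (hG : G ∈ incidenceForms fun k => f (a k)) :
    ∃ H : MvPolynomial (Fin 2) S, H.IsHomogeneous 10 ∧ H ∈ vanishingForms a ∧
      MvPolynomial.map f.toRingHom H = G := by
  induction hG using Submodule.span_induction with
  | mem G hG =>
    obtain ⟨m, p, hp, hp3, rfl⟩ := hG
    exact ⟨_, isHomogeneous_incidenceForm a m hp3, incidenceForm_mem_vanishingForms a m hp,
      map_incidenceForm f a m p⟩
  | zero => exact ⟨0, MvPolynomial.isHomogeneous_zero _ _ _, zero_mem _, map_zero _⟩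
  | add G G' _ _ h h' =>
    obtain ⟨H, h1, h2, h3⟩ := h
    obtain ⟨H', h1', h2', h3'⟩ := h'
    exact ⟨H + H', h1.add h1', add_mem h2 h2', by rw [map_add, h3, h3']⟩
  | smul c G _ h =>
    obtain ⟨H, h1, h2, h3⟩ := h
    refine ⟨algebraMap ℂ S c • H, ?_, Submodule.smul_mem _ _ h2, ?_⟩
    · exact (MvPolynomial.homogeneousSubmodule (Fin 2) S 10).smul_mem _ h1
    · rw [MvPolynomial.smul_eq_C_mul, map_mul, MvPolynomial.map_C, h3, MvPolynomial.smul_eq_C_mul]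
      congr 2
      exact f.commutes c

theorem homogeneousSubmodule_fg (S : Type*) [CommRing S] (n : ℕ) :
    (MvPolynomial.homogeneousSubmodule (Fin 2) S n).FG := by
  have : MvPolynomial.homogeneousSubmodule (Fin 2) S n = Submodule.span S
      (Set.range fun k : Fin (n + 1) => (MvPolynomial.X 0 ^ (n - (k : ℕ)) *
        MvPolynomial.X 1 ^ (k : ℕ) : MvPolynomial (Fin 2) S)) := by
    refine le_antisymm (fun p hp => ?_) (Submodule.span_le.2 ?_)
    · rw [homogeneous_expand hp]
      refine Submodule.sum_mem _ fun k _ => ?_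
      rw [← MvPolynomial.smul_eq_C_mul]
      exact Submodule.smul_mem _ _ (Submodule.subset_span ⟨k, rfl⟩)
    · rintro _ ⟨k, rfl⟩
      have := (MvPolynomial.isHomogeneous_X_pow (R := S) (0 : Fin 2) (n - (k : ℕ))).mul
        (MvPolynomial.isHomogeneous_X_pow (1 : Fin 2) (k : ℕ))
      rwa [Nat.sub_add_cancel (by omega)] at this
  rw [this]
  exact Submodule.fg_span (Set.finite_range _)

variable [IsLocalRing S]

theorem mem_smul_homogeneousSubmodule {H : MvPolynomial (Fin 2) S} {n : ℕ} (hH : H.IsHomogeneous n)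
    (f : S →ₐ[ℂ] ℂ) (h : MvPolynomial.map f.toRingHom H = 0) :
    H ∈ IsLocalRing.maximalIdeal S • MvPolynomial.homogeneousSubmodule (Fin 2) S n := by
  rw [homogeneous_expand hH]
  refine Submodule.sum_mem _ fun k _ => ?_
  rw [← MvPolynomial.smul_eq_C_mul]
  refine Submodule.smul_mem_smul ?_ ?_
  · rw [IsLocalRing.mem_maximalIdeal, mem_nonunits_iff]
    intro hu
    refine (hu.map f).ne_zero ?_
    change f.toRingHom _ = 0
    rw [← MvPolynomial.coeff_map, h, MvPolynomial.coeff_zero]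
  · have := (MvPolynomial.isHomogeneous_X_pow (R := S) (0 : Fin 2) (n - (k : ℕ))).mul
      (MvPolynomial.isHomogeneous_X_pow (1 : Fin 2) (k : ℕ))
    rwa [Nat.sub_add_cancel (by omega)] at this

/-- The forms of degree ten modulo those that vanish on the incidence scheme are generated by one
element if this holds at the closed point. -/
theorem homogeneousSubmodule_le_vanishingForms_sup (f : S →ₐ[ℂ] ℂ) (a : Fin 4 × Fin 5 → S)
    {G₀ : MvPolynomial (Fin 2) S} (hG₀ : G₀.IsHomogeneous 10)
    (h : MvPolynomial.homogeneousSubmodule (Fin 2) ℂ 10 ≤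
      incidenceForms (fun k => f (a k)) ⊔ Submodule.span ℂ {MvPolynomial.map f.toRingHom G₀}) :
    MvPolynomial.homogeneousSubmodule (Fin 2) S 10 ≤
      vanishingForms a ⊔ Submodule.span S {G₀} := by
  refine Submodule.le_of_le_smul_of_le_jacobson_bot (homogeneousSubmodule_fg S 10)
    (IsLocalRing.maximalIdeal_le_jacobson ⊥) fun G hG => ?_
  obtain ⟨K, hK, z, hz, hKz⟩ := Submodule.mem_sup.1 (h
    ((MvPolynomial.mem_homogeneousSubmodule _ _).2 (MvPolynomial.IsHomogeneous.map hG f.toRingHom)))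
  obtain ⟨l, rfl⟩ := Submodule.mem_span_singleton.1 hz
  obtain ⟨H, hH10, hH, hHK⟩ := exists_lift_incidenceForms f a hK
  have h1 : (G - H - algebraMap ℂ S l • G₀).IsHomogeneous 10 :=
    Submodule.sub_mem (MvPolynomial.homogeneousSubmodule (Fin 2) S 10)
      (Submodule.sub_mem _ hG hH10) (Submodule.smul_mem _ _ hG₀)
  have h2 : MvPolynomial.map f.toRingHom (G - H - algebraMap ℂ S l • G₀) = 0 := by
    rw [map_sub, map_sub, hHK, ← hKz, MvPolynomial.smul_eq_C_mul, MvPolynomial.smul_eq_C_mul,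
      map_mul, MvPolynomial.map_C, show f.toRingHom (algebraMap ℂ S l) = l from f.commutes l]
    ring
  have h3 := mem_smul_homogeneousSubmodule h1 f h2
  have : G = (H + algebraMap ℂ S l • G₀) + (G - H - algebraMap ℂ S l • G₀) := by ring
  rw [this]
  exact Submodule.add_mem_sup (Submodule.add_mem_sup hH (Submodule.smul_mem _ _
    (Submodule.mem_span_singleton_self _))) h3

/-- The coefficient of `X ^ n` in `g` is a unit, so `S[X] ⧸ J` is a finite module. Since `g'`
reduces to `1`, this module is equal to its product with the maximal ideal and vanishes by
Nakayama's lemma. -/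
theorem ideal_eq_top_of_map_eq (f : S →ₐ[ℂ] ℂ) {J : Ideal S[X]} {g g' : S[X]} (hg : g ∈ J)
    (hg' : g' ∈ J) {n : ℕ} (hn : g.natDegree ≤ n)
    (h : g.map f.toRingHom = Polynomial.X ^ n) (h' : g'.map f.toRingHom = 1) : J = ⊤ := by
  have hm : ∀ s, f s = 0 → s ∈ IsLocalRing.maximalIdeal S := fun s hs => by
    rw [IsLocalRing.mem_maximalIdeal, mem_nonunits_iff]
    exact fun hu => (hu.map f).ne_zero hs
  have hu : IsUnit (g.coeff n) := by
    by_contra hu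
    have h1 := (IsLocalRing.mem_maximalIdeal _).2 hu
    have h2 : f (g.coeff n) = 1 := by
      change f.toRingHom _ = 1
      rw [← Polynomial.coeff_map, h, Polynomial.coeff_X_pow, if_pos rfl]
    have h3 := hm (g.coeff n - algebraMap ℂ S 1) (by rw [map_sub, h2, f.commutes]; simp)
    have h4 := Ideal.sub_mem _ h1 h3
    rw [sub_sub_cancel, map_one] at h4
    exact (Ideal.ne_top_iff_one _).1 (IsLocalRing.maximalIdeal.isMaximal S).ne_top h4
  obtain ⟨u, hu⟩ := hu
  have hmonic : (Polynomial.C (↑u⁻¹ : S) * g).Monic := by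
    refine Polynomial.monic_of_natDegree_le_of_coeff_eq_one n
      ((Polynomial.natDegree_C_mul_le _ _).trans hn) ?_
    rw [Polynomial.coeff_C_mul, ← hu, Units.inv_mul]
  have hfin : Module.Finite S (S[X] ⧸ J) := by
    have h1 := hmonic.finite_quotient
    have hle : Ideal.span {Polynomial.C (↑u⁻¹ : S) * g} ≤ J := by
      rw [Ideal.span_singleton_le_iff_mem]; exact Ideal.mul_mem_left _ _ hg
    exact Module.Finite.of_surjective (Ideal.Quotient.factorₐ S hle).toLinearMap
      (Ideal.Quotient.factor_surjective hle)
  have hbot : (⊤ : Submodule S (S[X] ⧸ J)) = ⊥ := by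
    refine Submodule.eq_bot_of_le_smul_of_le_jacobson_bot (IsLocalRing.maximalIdeal S) _
      hfin.fg_top ?_ (IsLocalRing.maximalIdeal_le_jacobson ⊥)
    rintro x -
    obtain ⟨q, rfl⟩ := Ideal.Quotient.mk_surjective x
    have h1 : Ideal.Quotient.mk J q = Ideal.Quotient.mk J ((1 - g') * q) := by
      rw [Ideal.Quotient.eq]
      have : q - (1 - g') * q = g' * q := by ring
      rw [this]
      exact Ideal.mul_mem_right _ _ hg'
    rw [h1, (1 - g').as_sum_support_C_mul_X_pow, Finset.sum_mul, map_sum]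
    refine Submodule.sum_mem _ fun i _ => ?_
    rw [mul_assoc, ← Polynomial.smul_eq_C_mul]
    refine Submodule.smul_mem_smul (hm _ ?_) Submodule.mem_top (n := Ideal.Quotient.mk J _)
    change f.toRingHom _ = 0
    rw [← Polynomial.coeff_map, Polynomial.map_sub, h', Polynomial.map_one, sub_self,
      Polynomial.coeff_zero]
  rw [Ideal.eq_top_iff_one, ← Ideal.Quotient.eq_zero_iff_mem]
  have : (Ideal.Quotient.mk J 1) ∈ (⊤ : Submodule S (S[X] ⧸ J)) := Submodule.mem_top
  rwa [hbot] at this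

end BinaryForms

/-! ### The Fitting ideal at points where the incidence scheme embeds into the base -/

section CyclicIncidence

/-- The forms of degree ten modulo those that vanish on the incidence scheme are generated by
one element. -/
def HasCyclicIncidence (a : Fin 4 × Fin 5 → ℂ) : Prop :=
  ∃ G₀ : MvPolynomial (Fin 2) ℂ, G₀.IsHomogeneous 10 ∧
    MvPolynomial.homogeneousSubmodule (Fin 2) ℂ 10 ≤ incidenceForms a ⊔ Submodule.span ℂ {G₀}

/-- The value at `F` of a germ of a function at `F`. -/
def SmoothForm.evalGerm (F : SmoothForm) : F.LocalRing →ₐ[ℂ] ℂ :=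
  IsLocalization.liftAlgHom (M := (RingHom.ker F.point).primeCompl) (f := F.point)
    fun y => isUnit_iff_ne_zero.2 fun h => y.2 ((RingHom.mem_ker).2 h)

theorem SmoothForm.evalGerm_algebraMap (F : SmoothForm) (p : CoeffRing) :
    F.evalGerm (algebraMap CoeffRing F.LocalRing p) = F.point p := by
  simp [evalGerm, IsLocalization.liftAlgHom_apply]

theorem SmoothForm.isUnit_algebraMap {F : SmoothForm} {p : CoeffRing} (hp : F.point p ≠ 0) :
    IsUnit (algebraMap CoeffRing F.LocalRing p) :=
  IsLocalization.map_units F.LocalRing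
    (⟨p, fun h => hp ((RingHom.mem_ker).1 h)⟩ : (RingHom.ker F.point).primeCompl)

theorem isHomogeneous_X_pow_mul_X_pow (S : Type*) [CommRing S] {i j n : ℕ} (h : i + j = n) :
    (MvPolynomial.X 0 ^ i * MvPolynomial.X 1 ^ j : MvPolynomial (Fin 2) S).IsHomogeneous n := by
  subst h
  exact (MvPolynomial.isHomogeneous_X_pow (0 : Fin 2) i).mul
    (MvPolynomial.isHomogeneous_X_pow (1 : Fin 2) j)

theorem HasCyclicIncidence.le_of_notMem {a : Fin 4 × Fin 5 → ℂ} (h : HasCyclicIncidence a)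
    {G : MvPolynomial (Fin 2) ℂ} (hG : G.IsHomogeneous 10) (hGa : G ∉ incidenceForms a) :
    MvPolynomial.homogeneousSubmodule (Fin 2) ℂ 10 ≤ incidenceForms a ⊔ Submodule.span ℂ {G} := by
  obtain ⟨G₀, -, hle⟩ := h
  obtain ⟨K, hK, z, hz, hKz⟩ := Submodule.mem_sup.1 (hle hG)
  obtain ⟨l, rfl⟩ := Submodule.mem_span_singleton.1 hz
  have hl : l ≠ 0 := by
    rintro rfl
    rw [zero_smul, add_zero] at hKz
    exact hGa (hKz ▸ hK)
  refine hle.trans (sup_le le_sup_left ?_)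
  rw [Submodule.span_singleton_le_iff_mem]
  have : G₀ = -l⁻¹ • K + l⁻¹ • G := by
    rw [← hKz, smul_add, smul_smul, inv_mul_cancel₀ hl, one_smul, ← add_assoc, ← add_smul,
      neg_add_cancel, zero_smul, zero_add]
  rw [this]
  exact Submodule.add_mem_sup (Submodule.smul_mem _ _ hK)
    (Submodule.smul_mem _ _ (Submodule.mem_span_singleton_self _))

theorem natDegree_aeval_le {S : Type} [CommRing S] {n : ℕ} {G : MvPolynomial (Fin 2) S}
    (hG : G.IsHomogeneous n) :
    (MvPolynomial.aeval (R := S) ![1, (Polynomial.X : S[X])] G).natDegree ≤ n ∧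
      (MvPolynomial.aeval (R := S) ![(Polynomial.X : S[X]), 1] G).natDegree ≤ n := by
  rw [homogeneous_expand hG, map_sum, map_sum]
  constructor
  · refine Polynomial.natDegree_sum_le_of_forall_le _ _ fun k _ => ?_
    simp only [map_mul, map_pow, MvPolynomial.aeval_X, MvPolynomial.aeval_C]
    simpa using (Polynomial.natDegree_C_mul_X_pow_le _ _).trans (Nat.lt_succ_iff.1 k.2)
  · refine Polynomial.natDegree_sum_le_of_forall_le _ _ fun k _ => ?_
    simp only [map_mul, map_pow, MvPolynomial.aeval_X, MvPolynomial.aeval_C]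
    simpa using (Polynomial.natDegree_C_mul_X_pow_le _ _).trans (Nat.sub_le n k)

theorem map_aeval_vec {S : Type} [CommRing S] [Algebra ℂ S] (f : S →ₐ[ℂ] ℂ)
    (G : MvPolynomial (Fin 2) S) :
    (MvPolynomial.aeval (R := S) ![1, (Polynomial.X : S[X])] G).map f.toRingHom =
        MvPolynomial.aeval ![1, (Polynomial.X : ℂ[X])] (MvPolynomial.map f.toRingHom G) ∧
      (MvPolynomial.aeval (R := S) ![(Polynomial.X : S[X]), 1] G).map f.toRingHom =
        MvPolynomial.aeval ![(Polynomial.X : ℂ[X]), 1] (MvPolynomial.map f.toRingHom G) := by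
  induction G using MvPolynomial.induction_on with
  | C c => simp
  | add p q hp hq => simp only [map_add, Polynomial.map_add, hp, hq, and_self]
  | mul_X p k hp =>
    simp only [map_mul, Polynomial.map_mul, hp, MvPolynomial.map_X, MvPolynomial.aeval_X]
    fin_cases k <;> simp

/-- Under the transversality condition, the incidence scheme is locally a closed subscheme of the
base. -/
theorem HasCyclicIncidence.span_incidenceOne {S : Type} [CommRing S] [Algebra ℂ S]
    [Algebra CoeffRing S] [IsLocalRing S] (f : S →ₐ[ℂ] ℂ)
    (h : HasCyclicIncidence fun k => f (univCoeff S k.1 k.2)) :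
    Submodule.span S {incidenceOne S} = ⊤ := by
  have h0 := isHomogeneous_X_pow_mul_X_pow ℂ (i := 10) (j := 0) (n := 10) rfl
  have h1 := isHomogeneous_X_pow_mul_X_pow ℂ (i := 0) (j := 10) (n := 10) rfl
  have hle : ∀ i j, i + j = 10 → (MvPolynomial.X 0 ^ i * MvPolynomial.X 1 ^ j :
      MvPolynomial (Fin 2) ℂ) ∉ incidenceForms (fun k => f (univCoeff S k.1 k.2)) →
      MvPolynomial.homogeneousSubmodule (Fin 2) S 10 ≤
        vanishingForms (fun k => univCoeff S k.1 k.2) ⊔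
          Submodule.span S {MvPolynomial.X 0 ^ i * MvPolynomial.X 1 ^ j} := by
    intro i j hij hn
    refine homogeneousSubmodule_le_vanishingForms_sup f _
      (isHomogeneous_X_pow_mul_X_pow S hij) ?_
    simpa using h.le_of_notMem (isHomogeneous_X_pow_mul_X_pow ℂ hij) hn
  have hmem : ∀ i j, i + j = 10 → (MvPolynomial.X 0 ^ i * MvPolynomial.X 1 ^ j :
      MvPolynomial (Fin 2) ℂ) ∉ incidenceForms (fun k => f (univCoeff S k.1 k.2)) →
      ∀ i' j', i' + j' = 10 → ∃ l : S,
        Polynomial.X ^ j' - Polynomial.C l * Polynomial.X ^ j ∈ incidenceIdeal₀ S ∧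
        Polynomial.X ^ i' - Polynomial.C l * Polynomial.X ^ i ∈ incidenceIdeal₁ S := by
    intro i j hij hn i' j' hij'
    obtain ⟨K, hK, z, hz, hKz⟩ := Submodule.mem_sup.1
      (hle i j hij hn (isHomogeneous_X_pow_mul_X_pow S hij'))
    obtain ⟨l, rfl⟩ := Submodule.mem_span_singleton.1 hz
    rw [← eq_sub_iff_add_eq] at hKz
    rw [hKz, mem_vanishingForms] at hK
    refine ⟨l, ?_, ?_⟩
    · rw [incidenceIdeal₀_eq]
      simpa [Polynomial.smul_eq_C_mul] using hK.1
    · rw [incidenceIdeal₁_eq]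
      simpa [Polynomial.smul_eq_C_mul] using hK.2
  -- If `x₀ ^ 10` or `x₁ ^ 10` is not an incidence form, it generates all forms of degree ten.
  -- Expressing `x₀ ^ 9 x₁` (or `x₀ x₁ ^ 9`) by it puts the incidence scheme on a section of one
  -- chart, and expressing the opposite tenth power keeps it away from the point outside that chart.
  -- If both powers are incidence forms, the incidence scheme is empty.
  by_cases hn0 : (MvPolynomial.X 0 ^ 10 * MvPolynomial.X 1 ^ 0 : MvPolynomial (Fin 2) ℂ) ∈
      incidenceForms (fun k => f (univCoeff S k.1 k.2))
  · by_cases hn1 : (MvPolynomial.X 0 ^ 0 * MvPolynomial.X 1 ^ 10 : MvPolynomial (Fin 2) ℂ) ∈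
        incidenceForms (fun k => f (univCoeff S k.1 k.2))
    · obtain ⟨K, hK10, hK, hKf⟩ := exists_lift_incidenceForms f _ hn0
      obtain ⟨K', hK10', hK', hKf'⟩ := exists_lift_incidenceForms f _ hn1
      rw [mem_vanishingForms] at hK hK'
      refine span_incidenceOne_of_eq_top ?_ ?_
      · rw [incidenceIdeal₀_eq]
        refine ideal_eq_top_of_map_eq f hK'.1 hK.1 (natDegree_aeval_le hK10').1 ?_ ?_
        · rw [(map_aeval_vec f K').1, hKf']; simp
        · rw [(map_aeval_vec f K).1, hKf]; simp
      · rw [incidenceIdeal₁_eq]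
        refine ideal_eq_top_of_map_eq f hK.2 hK'.2 (natDegree_aeval_le hK10).2 ?_ ?_
        · rw [(map_aeval_vec f K).2, hKf]; simp
        · rw [(map_aeval_vec f K').2, hKf']; simp
    · obtain ⟨s, -, hs⟩ := hmem 0 10 rfl hn1 1 9 rfl
      obtain ⟨s', hs', -⟩ := hmem 0 10 rfl hn1 10 0 rfl
      refine span_incidenceOne_of_chart₁ (s := s) (s' := s') (n := 9) ?_ ?_
      · simpa using hs
      · simpa using hs'
  · obtain ⟨s, hs, -⟩ := hmem 10 0 rfl hn0 9 1 rfl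
    obtain ⟨s', -, hs'⟩ := hmem 10 0 rfl hn0 0 10 rfl
    refine span_incidenceOne_of_chart₀ (s := s) (s' := s') (n := 9) ?_ ?_
    · simpa using hs
    · simpa using hs'

/-- Over the local ring at `F` the function `1` generates the module, and it is killed by the
equations of the locus; a relation on a single generator lies in the Fitting ideal. -/
theorem SmoothForm.algebraMap_mem_bitangentIdeal {F : SmoothForm}
    (h : HasCyclicIncidence F.coeff) {p : CoeffRing} (hp : p ∈ bitangentPrime) :
    algebraMap CoeffRing F.LocalRing p ∈ F.bitangentIdeal := by
  refine mem_fittingIdeal_of_mem_bitangentPrime ?_ hp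
  refine HasCyclicIncidence.span_incidenceOne F.evalGerm ?_
  have : (fun k : Fin 4 × Fin 5 => F.evalGerm (univCoeff F.LocalRing k.1 k.2)) = F.coeff := by
    funext k
    rw [univCoeff, F.evalGerm_algebraMap, F.point_apply, MvPolynomial.eval_X]
  rwa [this]

/-- Some equation of the locus is a unit in the local ring at `F` and lies in both chart ideals, so
the incidence scheme is empty there. -/
theorem SmoothForm.bitangentIdeal_eq_top {F : SmoothForm} (hF : F ∉ bitangentSet) :
    F.bitangentIdeal = ⊤ := by
  obtain ⟨p, hp, hpF⟩ : ∃ p ∈ bitangentPrime, F.point p ≠ 0 := by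
    simpa [bitangentSet] using hF
  have hu := SmoothForm.isUnit_algebraMap hpF
  have hk := smul_incidenceOne_of_mem_bitangentPrime (S := F.LocalRing) hp
  rw [smul_incidenceOne_eq_zero_iff] at hk
  have hu' := hu.map (Polynomial.C (R := F.LocalRing))
  refine Ideal.eq_top_of_isUnit_mem _ (mem_fittingIdeal_of_mem_bitangentPrime
    (span_incidenceOne_of_eq_top (Ideal.eq_top_of_isUnit_mem _ hk.1 hu')
      (Ideal.eq_top_of_isUnit_mem _ hk.2 hu')) hp) hu

theorem sum_squareHom_X (j : Fin 5) :
    ∑ i : Fin 4, squareHom (MvPolynomial.X (i, j)) * MvPolynomial.X none ^ (i : ℕ) =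
      MvPolynomial.C (sqCoeff (S := MvPolynomial (Fin 3) ℂ) MvPolynomial.X j) := by
  rw [Fin.sum_univ_succ]
  simp [squareHom, genericHom]

/-- The Fitting ideal lies in the annihilator, so `p` kills the function `1`, and `C p` lies in the
ideal of the first chart. As `F` is in the locus, its local ring maps to the fraction field of the
parameter ring. Sending `X` to the parameter `s` kills the chart ideal, because the generic form has
the square fiber `q²` over `s`. Therefore `squareHom p = 0`. -/
theorem SmoothForm.mem_bitangentPrime {F : SmoothForm} (hF : F ∈ bitangentSet) {p : CoeffRing}
    (hp : algebraMap CoeffRing F.LocalRing p ∈ F.bitangentIdeal) : p ∈ bitangentPrime := by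
  have h1 := (Module.mem_annihilator.1 (fittingIdeal_le_annihilator _ _ hp))
    (incidenceOne F.LocalRing)
  have h2 := (smul_incidenceOne_eq_zero_iff.1 h1).1
  let Q := FractionRing (MvPolynomial ParamIndex (MvPolynomial (Fin 3) ℂ))
  let g : CoeffRing →+* Q := (algebraMap _ Q).comp squareHom
  have hg : ∀ y : (RingHom.ker F.point).primeCompl, IsUnit (g y) := fun y => by
    refine isUnit_iff_ne_zero.2 fun h => ?_
    refine notMem_bitangentPrime hF (e := y.1) (fun h0 => y.2 ((RingHom.mem_ker).2 h0)) ?_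
    exact (RingHom.mem_ker).2 ((IsFractionRing.injective _ Q) (h.trans (map_zero _).symm))
  let l : F.LocalRing →+* Q := IsLocalization.lift hg
  have hl : ∀ y, l (algebraMap CoeffRing F.LocalRing y) = algebraMap _ Q (squareHom y) := fun y =>
    IsLocalization.lift_eq hg y
  let φ : (F.LocalRing)[X] →+* Q := Polynomial.eval₂RingHom l
    (algebraMap (MvPolynomial ParamIndex (MvPolynomial (Fin 3) ℂ)) Q (MvPolynomial.X none))
  have h3 : incidenceIdeal₀ F.LocalRing ≤ RingHom.ker φ := by
    rw [incidenceIdeal₀, Ideal.map_le_iff_le_comap]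
    intro q hq
    rw [Ideal.mem_comap, RingHom.mem_ker]
    let c : MvPolynomial (Fin 3) ℂ →+* Q := 
      (algebraMap (MvPolynomial ParamIndex (MvPolynomial (Fin 3) ℂ)) Q).comp MvPolynomial.C
    have h4 : φ.comp (MvPolynomial.aeval (R := ℂ) (fun j : Fin 5 => ∑ i : Fin 4,
        Polynomial.C (univCoeff F.LocalRing i j) * Polynomial.X ^ (i : ℕ))).toRingHom =
        c.comp (MvPolynomial.aeval (R := ℂ)
          (sqCoeff (S := MvPolynomial (Fin 3) ℂ) MvPolynomial.X)).toRingHom := by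
      refine MvPolynomial.ringHom_ext (fun z => ?_) fun j => ?_
      · have hz : algebraMap ℂ F.LocalRing z =
            algebraMap CoeffRing F.LocalRing (MvPolynomial.C z) :=
          IsScalarTower.algebraMap_apply ℂ CoeffRing F.LocalRing z
        simp [φ, c, Polynomial.algebraMap_apply, hz, hl, squareHom]
      · simp only [RingHom.comp_apply, AlgHom.toRingHom_eq_coe, RingHom.coe_coe,
          MvPolynomial.aeval_X, map_sum, map_mul, map_pow, φ, Polynomial.coe_eval₂RingHom,
          Polynomial.eval₂_C, Polynomial.eval₂_X, univCoeff, hl, c]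
        rw [← sum_squareHom_X j]
        simp only [map_sum, map_mul, map_pow]
    have h5 := congrArg (fun f => f q) h4
    refine h5.trans ?_
    have : MvPolynomial.aeval (R := ℂ) (sqCoeff (S := MvPolynomial (Fin 3) ℂ) MvPolynomial.X) q
      = 0 := hq
    exact (congrArg c this).trans (map_zero c)
  have h6 := h3 h2
  rw [RingHom.mem_ker, Polynomial.coe_eval₂RingHom, Polynomial.eval₂_C, hl] at h6
  exact (RingHom.mem_ker).2 ((IsFractionRing.injective _ Q) (h6.trans (map_zero _).symm))

end CyclicIncidence

/-! ### Cyclic incidence at a general point of the bitangent locus -/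

section GenericCyclicIncidence

theorem eval_incidenceForm (a : Fin 4 × Fin 5 → ℂ) (m : Fin 2 → ℂ) (p : MvPolynomial (Fin 5) ℂ)
    (x : Fin 2 → ℂ) : MvPolynomial.eval x (incidenceForm a m p) =
      (∑ k, m k * x k) * MvPolynomial.eval (fiberCoeff a x) p := by
  have h := algHom_incidenceForm (MvPolynomial.aeval (R := ℂ) x) (a := a) (b := a) (y := x)
    (fun k => by simp) (fun k => by simp) m p
  rw [MvPolynomial.aeval_eq_eval, MvPolynomial.aeval_eq_eval] at h
  exact h

/-- Linear substitutions act on the equations of the variety of squares. -/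
theorem exists_squareIdeal_substitution (h : Matrix (Fin 2) (Fin 2) ℂ)
    {p : MvPolynomial (Fin 5) ℂ} (hp : p ∈ squareIdeal) (hp3 : p.IsHomogeneous 3) :
    ∃ p' ∈ squareIdeal, p'.IsHomogeneous 3 ∧ ∀ c d : Fin 5 → ℂ,
      (∀ u : Fin 2 → ℂ, ∑ j : Fin 5, d j * (u 0 ^ (4 - (j : ℕ)) * u 1 ^ (j : ℕ)) =
        ∑ j : Fin 5, c j * (h.mulVec u 0 ^ (4 - (j : ℕ)) * h.mulVec u 1 ^ (j : ℕ))) →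
      MvPolynomial.eval c p' = MvPolynomial.eval d p := by
  obtain ⟨A, hA⟩ := exists_substitution 4 h
  let L : Fin 5 → MvPolynomial (Fin 5) ℂ := fun j => ∑ k, MvPolynomial.C (A k j) * MvPolynomial.X k
  have hL : ∀ c, MvPolynomial.eval c (MvPolynomial.aeval L p) =
      MvPolynomial.eval (fun j => ∑ k, c k * A k j) p := by
    intro c
    have h1 := MvPolynomial.comp_aeval_apply (R := ℂ) (f := L) (MvPolynomial.aeval c) p
    rw [MvPolynomial.aeval_eq_eval] at h1
    refine h1.trans ?_
    rw [MvPolynomial.aeval_eq_eval]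
    congr 2
    funext j
    simp [L, mul_comm]
  have key : ∀ c d : Fin 5 → ℂ,
      (∀ u : Fin 2 → ℂ, ∑ j : Fin 5, d j * (u 0 ^ (4 - (j : ℕ)) * u 1 ^ (j : ℕ)) =
        ∑ j : Fin 5, c j * (h.mulVec u 0 ^ (4 - (j : ℕ)) * h.mulVec u 1 ^ (j : ℕ))) →
      MvPolynomial.eval c (MvPolynomial.aeval L p) = MvPolynomial.eval d p := by
    intro c d hcd
    rw [hL]
    congr 2
    refine quartic_coeff_eq fun u => ?_
    rw [hcd u]
    simp only [hA, Finset.sum_mul, Finset.mul_sum]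
    rw [Finset.sum_comm]
    exact Finset.sum_congr rfl fun _ _ => Finset.sum_congr rfl fun _ _ => by ring
  refine ⟨MvPolynomial.aeval L p, ?_, ?_, key⟩
  · rw [mem_squareIdeal_iff] at hp ⊢
    intro q
    -- The three entries are the coefficients of the quadratic form `q` after the substitution `h`.
    rw [← hp ![q 0 * h 0 0 ^ 2 + q 1 * (h 0 0 * h 1 0) + q 2 * h 1 0 ^ 2,
      2 * q 0 * h 0 0 * h 0 1 + q 1 * (h 0 0 * h 1 1 + h 0 1 * h 1 0) + 2 * q 2 * h 1 0 * h 1 1,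
      q 0 * h 0 1 ^ 2 + q 1 * (h 0 1 * h 1 1) + q 2 * h 1 1 ^ 2]]
    refine key _ _ fun u => ?_
    rw [sum_sqCoeff, sum_sqCoeff]
    simp [Matrix.mulVec, dotProduct, Fin.sum_univ_two]
    ring
  · have := hp3.aeval L (n := 1) fun j => MvPolynomial.IsHomogeneous.sum _ _ _ fun k _ =>
        MvPolynomial.isHomogeneous_C_mul_X _ _
    simpa using this

/-- Substitutions carry incidence forms to incidence forms: the linear factor is transformed by the
transpose of `g`, and the cubic equation by the inverse of `h`. -/
theorem HasCyclicIncidence.act {F : SmoothForm} (g h : GL (Fin 2) ℂ)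
    (hF : HasCyclicIncidence F.coeff) : HasCyclicIncidence (F.act g h).coeff := by
  have hinv : ∀ (g : GL (Fin 2) ℂ) (x : Fin 2 → ℂ), g⁻¹.1.mulVec (g.1.mulVec x) = x := by
    intro g x
    rw [Matrix.mulVec_mulVec, ← Units.val_mul, inv_mul_cancel, Units.val_one, Matrix.one_mulVec]
  have hrel : ∀ G ∈ incidenceForms F.coeff, ∃ G' ∈ incidenceForms (F.act g h).coeff,
      ∀ x, MvPolynomial.eval x G' = MvPolynomial.eval (g.1.mulVec x) G := by
    intro G hG
    induction hG using Submodule.span_induction with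
    | mem G hG =>
      obtain ⟨m, p, hp, hp3, rfl⟩ := hG
      obtain ⟨p', hp', hp3', hpp⟩ := exists_squareIdeal_substitution h⁻¹.1 hp hp3
      refine ⟨_, Submodule.subset_span ⟨g.1.transpose.mulVec m, p', hp', hp3', rfl⟩, fun x => ?_⟩
      rw [eval_incidenceForm, eval_incidenceForm]
      congr 1
      · simp [Matrix.mulVec, dotProduct, Fin.sum_univ_two]
        ring
      · refine hpp _ _ fun u => ?_
        rw [← evalForm_eq_fiberCoeff, ← evalForm_eq_fiberCoeff, F.evalForm_act]
        congr 1
        simpa using (hinv h⁻¹ u).symm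
    | zero => exact ⟨0, zero_mem _, fun x => by simp⟩
    | add G K _ _ hG hK =>
      obtain ⟨G', hG', hG⟩ := hG
      obtain ⟨K', hK', hK⟩ := hK
      exact ⟨G' + K', add_mem hG' hK', fun x => by simp [hG, hK]⟩
    | smul c G _ hG =>
      obtain ⟨G', hG', hG⟩ := hG
      exact ⟨c • G', Submodule.smul_mem _ _ hG', fun x => by simp [hG]⟩
  obtain ⟨G₀, hG₀, hle⟩ := hF
  obtain ⟨G₁, hG₁, hG₁e⟩ := mulVec_eval_homogeneous g.1 hG₀
  refine ⟨G₁, hG₁, fun G hG => ?_⟩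
  obtain ⟨H, hH, hHe⟩ := mulVec_eval_homogeneous g⁻¹.1 hG
  obtain ⟨K, hK, z, hz, hKz⟩ := Submodule.mem_sup.1 (hle hH)
  obtain ⟨l, rfl⟩ := Submodule.mem_span_singleton.1 hz
  obtain ⟨K', hK', hK'e⟩ := hrel K hK
  have : G = K' + l • G₁ := by
    refine MvPolynomial.funext fun x => ?_
    have h1 := hHe (g.1.mulVec x)
    rw [hinv, ← hKz] at h1
    rw [← h1]
    simp [hK'e, hG₁e]
  rw [this]
  exact Submodule.add_mem_sup hK' (Submodule.smul_mem _ _ (Submodule.mem_span_singleton_self _))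

/-- A monomial of degree three. -/
def cubicTerm (c : ℂ) (i j k : Fin 5) : MvPolynomial (Fin 5) ℂ :=
  MvPolynomial.C c * MvPolynomial.X i * MvPolynomial.X j * MvPolynomial.X k

/-- Cubic equations of the variety of squares. -/
def squareCubic : Fin 6 → MvPolynomial (Fin 5) ℂ :=
  ![cubicTerm 1 1 1 1 + cubicTerm (-4) 0 1 2 + cubicTerm 8 0 0 3,
    cubicTerm 1 1 1 2 + cubicTerm 2 0 1 3 + cubicTerm (-4) 0 2 2 +
      cubicTerm 16 0 0 4,
    cubicTerm 1 1 1 3 + cubicTerm 8 0 1 4 + cubicTerm (-4) 0 2 3,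
    cubicTerm 1 1 1 4 + cubicTerm (-1) 0 3 3,
    cubicTerm 1 3 3 2 + cubicTerm 2 4 3 1 + cubicTerm (-4) 4 2 2 +
      cubicTerm 16 4 4 0,
    cubicTerm 1 3 3 3 + cubicTerm (-4) 4 3 2 + cubicTerm 8 4 4 1]

theorem squareCubic_mem (k : Fin 6) : squareCubic k ∈ squareIdeal := by
  rw [mem_squareIdeal_iff]
  intro q
  fin_cases k <;> simp [squareCubic, cubicTerm, sqCoeff] <;> ring

theorem squareCubic_isHomogeneous (k : Fin 6) : (squareCubic k).IsHomogeneous 3 := by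
  have h : ∀ (c : ℂ) (i j k : Fin 5), (cubicTerm c i j k).IsHomogeneous 3 := fun c i j k =>
    ((MvPolynomial.isHomogeneous_C_mul_X c i).mul (MvPolynomial.isHomogeneous_X _ j)).mul
      (MvPolynomial.isHomogeneous_X _ k)
  fin_cases k
  · exact ((h _ _ _ _).add (h _ _ _ _)).add (h _ _ _ _)
  · exact (((h _ _ _ _).add (h _ _ _ _)).add (h _ _ _ _)).add (h _ _ _ _)
  · exact ((h _ _ _ _).add (h _ _ _ _)).add (h _ _ _ _)
  · exact (h _ _ _ _).add (h _ _ _ _)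
  · exact (((h _ _ _ _).add (h _ _ _ _)).add (h _ _ _ _)).add (h _ _ _ _)
  · exact ((h _ _ _ _).add (h _ _ _ _)).add (h _ _ _ _)

/-- Ten forms of degree ten in the ideal of the incidence scheme. -/
def cyclicForm {S : Type*} [CommRing S] [Algebra ℂ S] (a : Fin 4 × Fin 5 → S) (k : Fin 10) :
    MvPolynomial (Fin 2) S :=
  incidenceForm a (![![1, 0], ![0, 1], ![0, 1], ![1, 0], ![0, 1], ![0, 1], ![1, 0], ![0, 1],
    ![1, 0], ![0, 1]] k) (squareCubic (![1, 1, 4, 2, 2, 5, 3, 3, 0, 0] k))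

/-- The coefficients of the ten forms, except that of the first monomial. -/
def cyclicMatrix {S : Type*} [CommRing S] [Algebra ℂ S] (a : Fin 4 × Fin 5 → S) :
    Matrix (Fin 10) (Fin 10) S :=
  fun k l => (cyclicForm a k).coeff (Finsupp.single 0 (9 - (l : ℕ)) + Finsupp.single 1 (l + 1 : ℕ))

/-- If the matrix is invertible, a combination of the ten forms matches all coefficients of a given
form except that of `x₀ ^ 10`. -/
theorem hasCyclicIncidence_of_det {a : Fin 4 × Fin 5 → ℂ} (h : (cyclicMatrix a).det ≠ 0) :
    HasCyclicIncidence a := by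
  refine ⟨MvPolynomial.X 0 ^ 10 * MvPolynomial.X 1 ^ 0, isHomogeneous_X_pow_mul_X_pow ℂ rfl,
    fun G hG => ?_⟩
  have hmem : ∀ k, cyclicForm a k ∈ incidenceForms a := fun k =>
    Submodule.subset_span ⟨_, _, squareCubic_mem _, squareCubic_isHomogeneous _, rfl⟩
  have hhom : ∀ k, cyclicForm a k ∈ MvPolynomial.homogeneousSubmodule (Fin 2) ℂ 10 := fun k =>
    isHomogeneous_incidenceForm a _ (squareCubic_isHomogeneous _)
  let γ : Fin 10 → ℂ := fun l =>
    G.coeff (Finsupp.single 0 (9 - (l : ℕ)) + Finsupp.single 1 (l + 1 : ℕ))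
  let c := Matrix.vecMul γ (cyclicMatrix a)⁻¹
  have hc : Matrix.vecMul c (cyclicMatrix a) = γ := by
    rw [Matrix.vecMul_vecMul, Matrix.nonsing_inv_mul _ (isUnit_iff_ne_zero.2 h), Matrix.vecMul_one]
  let K := ∑ k, c k • cyclicForm a k
  have hK : K ∈ incidenceForms a := Submodule.sum_mem _ fun k _ => Submodule.smul_mem _ _ (hmem k)
  have hKG : (G - K).IsHomogeneous 10 := Submodule.sub_mem _ hG
    (Submodule.sum_mem _ fun k _ => Submodule.smul_mem _ _ (hhom k))
  have h0 : ∀ l : Fin 10, (G - K).coeff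
      (Finsupp.single 0 (9 - (l : ℕ)) + Finsupp.single 1 (l + 1 : ℕ)) = 0 := fun l => by
    have h1 := congrFun hc l
    rw [MvPolynomial.coeff_sub, MvPolynomial.coeff_sum, sub_eq_zero]
    refine h1.symm.trans ?_
    simp [Matrix.vecMul, dotProduct, cyclicMatrix]
  have h1 := homogeneous_expand hKG
  rw [Fin.sum_univ_succ, Finset.sum_eq_zero (s := Finset.univ), add_zero,
    ← MvPolynomial.smul_eq_C_mul] at h1
  · have : G = K + (G - K) := by ring
    rw [this, h1]
    exact Submodule.add_mem_sup hK
      (Submodule.smul_mem _ _ (Submodule.mem_span_singleton_self _))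
  · intro l _
    have h2 := h0 l
    rw [Fin.val_succ, show 10 - ((l : ℕ) + 1) = 9 - l by omega, h2, map_zero, zero_mul]

/-- The discriminant of the condition of cyclicity. -/
def cyclicDet : CoeffRing := (cyclicMatrix (S := CoeffRing) MvPolynomial.X).det

theorem eval_cyclicDet (a : Fin 4 × Fin 5 → ℂ) :
    MvPolynomial.eval a cyclicDet = (cyclicMatrix a).det := by
  rw [cyclicDet, RingHom.map_det]
  congr 1
  ext k l
  have h := map_incidenceForm (MvPolynomial.aeval (R := ℂ) a) (MvPolynomial.X (R := ℂ))
  simp only [MvPolynomial.aeval_X] at h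
  simp only [RingHom.mapMatrix_apply, Matrix.map_apply, cyclicMatrix, cyclicForm, ← h,
    MvPolynomial.coeff_map]
  change _ = MvPolynomial.aeval a _
  rw [MvPolynomial.aeval_eq_eval]

/-- The test form is `x₀³ u₀⁴ + x₁³ u₀³ u₁ + x₀² x₁ u₁⁴`, with the square fiber `u₀⁴` over `[1 :
0]`. For it the ten forms are nonzero multiples of the ten monomials other than `x₀ ^ 10`, in their
natural order; the indices in `cyclicForm` are chosen for this. The matrix becomes diagonal.
Smoothness of the test form is not needed. -/
theorem cyclicDet_notMem : cyclicDet ∉ bitangentPrime := by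
  let a : Fin 4 × Fin 5 → ℂ := fun k => if k = (0, 0) ∨ k = (3, 1) ∨ k = (1, 4) then 1 else 0
  intro hmem
  have hsq : HasSquareFiber a := by
    refine ⟨![1, 0], fun h => one_ne_zero (congrFun h 0), ![1, 0, 0], ?_⟩
    funext j
    fin_cases j <;> simp [fiberCoeff, sqCoeff, a]
  have h0 := eval_eq_zero_of_hasSquareFiber hmem hsq
  rw [eval_cyclicDet] at h0
  have hf : (fiberCoeff (fun k => MvPolynomial.C (a k)) MvPolynomial.X :
      Fin 5 → MvPolynomial (Fin 2) ℂ) = ![MvPolynomial.X 0 ^ 3, MvPolynomial.X 1 ^ 3, 0, 0,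
        MvPolynomial.X 0 ^ 2 * MvPolynomial.X 1] := by
    funext j
    fin_cases j <;> simp [fiberCoeff, a]
  let d : Fin 10 → ℂ := ![16, 16, 16, 8, 8, 8, 1, 1, 1, 1]
  have hd : ∀ k, cyclicForm a k = MvPolynomial.monomial
      (Finsupp.single 0 (9 - (k : ℕ)) + Finsupp.single 1 (k + 1 : ℕ)) (d k) := by
    intro k
    have hm : ∀ k : Fin 10, (MvPolynomial.monomial (Finsupp.single (0 : Fin 2) (9 - (k : ℕ)) +
        Finsupp.single 1 (k + 1 : ℕ)) (d k) : MvPolynomial (Fin 2) ℂ) =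
        MvPolynomial.C (d k) * (MvPolynomial.X 0 ^ (9 - (k : ℕ)) * MvPolynomial.X 1 ^ (k + 1 : ℕ)) := by
      intro k
      rw [MvPolynomial.X_pow_eq_monomial, MvPolynomial.X_pow_eq_monomial,
        MvPolynomial.monomial_mul, MvPolynomial.C_mul_monomial]
      simp
    rw [hm]
    fin_cases k <;> simp [cyclicForm, incidenceForm, hf, squareCubic, cubicTerm, d, Fin.sum_univ_succ] <;> ring
  have hdiag : cyclicMatrix a = Matrix.diagonal d := by
    ext k l
    rw [cyclicMatrix, hd, MvPolynomial.coeff_monomial, Matrix.diagonal_apply]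
    refine if_congr ⟨fun h => ?_, fun h => by rw [h]⟩ rfl rfl
    have := DFunLike.congr_fun h 1
    ext
    simpa using this
  rw [hdiag, Matrix.det_diagonal, Finset.prod_eq_zero_iff] at h0
  obtain ⟨k, -, hk⟩ := h0
  fin_cases k <;> simp [d] at hk

end GenericCyclicIncidence

/-! ### The divisor in the space of smooth curves -/

section GenericallyReduced

/-- An open set of `𝒞^(3,4)` over which the bitangent locus is reduced. -/
def cyclicLocus : Set C34 := C34.mk '' {F | F.point cyclicDet ≠ 0}

theorem isOpen_cyclicLocus : IsOpen cyclicLocus := by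
  refine C34.isOpenMap_mk _ ?_
  rw [SmoothForm.isOpen_iff]
  exact fun F hF => ⟨cyclicDet, hF, fun _ h => h⟩

theorem hasCyclicIncidence_of_mem_cyclicLocus {F : SmoothForm} (h : C34.mk F ∈ cyclicLocus) :
    HasCyclicIncidence F.coeff := by
  obtain ⟨F', hF', hmk⟩ := h
  obtain ⟨g, h, rfl⟩ := (SmoothForm.mk_eq_iff_exists_act _ _).1 hmk
  refine HasCyclicIncidence.act g h (hasCyclicIncidence_of_det ?_)
  rw [← eval_cyclicDet, ← SmoothForm.point_apply]
  exact hF'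

theorem Cb_inter_cyclicLocus_nonempty : (Cb ∩ cyclicLocus).Nonempty := by
  obtain ⟨F, hF, hFd⟩ := exists_hasBitangentFiber cyclicDet_notMem
  exact ⟨C34.mk F, mk_mem_Cb.2 hF.mem_bitangentSet, F, hFd, rfl⟩

/-- At a point of the locus the numerator lies in the Fitting ideal, hence in the prime ideal of the
locus. -/
theorem eq_zero_of_mem_ideal {W : Set C34} {f : C34 → ℂ} (hf : f ∈ Cb.ideal W) {z : C34}
    (hz : z ∈ Cb ∩ W) : f z = 0 := by
  obtain ⟨hzC, hzW⟩ := hz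
  obtain ⟨F, rfl⟩ := C34.mk_surjective z
  obtain ⟨a, b, ⟨hb, hab⟩, ha⟩ := hf F hzW
  rw [hab F hb hzW, mk_mem_Cb.1 hzC a (SmoothForm.mem_bitangentPrime (mk_mem_Cb.1 hzC) ha),
    zero_div]

/-- Off the locus the Fitting ideal is everything. On the locus, a numerator `a` outside the prime
ideal would be nonzero at some form with a bitangent fiber; the factors `b` and `e` keep this form
in the domain of the fraction and over `W`, where `f` vanishes. So `a` is in the prime ideal, which
over `cyclicLocus` is contained in the Fitting ideal. -/
theorem mem_ideal_of_forall_eq_zero {W : Set C34} (hW : IsOpen W) (hWc : W ⊆ cyclicLocus)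
    {f : C34 → ℂ} (hf : f ∈ C34.reg W) (h : ∀ z ∈ Cb ∩ W, f z = 0) : f ∈ Cb.ideal W := by
  intro F hFW
  obtain ⟨a, b, hb, hab⟩ := hf F hFW
  refine ⟨a, b, ⟨hb, hab⟩, ?_⟩
  by_cases hF : F ∈ bitangentSet
  · refine SmoothForm.algebraMap_mem_bitangentIdeal
      (hasCyclicIncidence_of_mem_cyclicLocus (hWc hFW)) ?_
    by_contra ha
    obtain ⟨e, he, hes⟩ := (SmoothForm.isOpen_iff _).1 (hW.preimage C34.continuous_mk) F hFW
    have hprod : a * b * e ∉ bitangentPrime := fun hm => by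
      have hP : bitangentPrime.IsPrime := inferInstance
      rcases hP.mem_or_mem hm with hm | hm
      · rcases hP.mem_or_mem hm with hm | hm
        · exact ha hm
        · exact notMem_bitangentPrime hF hb hm
      · exact notMem_bitangentPrime hF he hm
    obtain ⟨F', hF', hne⟩ := exists_hasBitangentFiber hprod
    rw [map_mul, map_mul, mul_ne_zero_iff, mul_ne_zero_iff] at hne
    have hW' := hes F' hne.2
    have := h _ ⟨mk_mem_Cb.2 hF'.mem_bitangentSet, hW'⟩
    rw [hab F' hne.1.2 hW', div_eq_zero_iff] at this
    exact this.elim hne.1.1 hne.1.2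
  · rw [SmoothForm.bitangentIdeal_eq_top hF]
    exact Submodule.mem_top

theorem isGenericallyReducedDivisor_Cb : IsGenericallyReducedDivisor C34.reg Cb.ideal Cb := by
  refine ⟨isClosed_closure, isIrreducible_Cb.nonempty, fun Y hY => ?_, cyclicLocus,
    isOpen_cyclicLocus, ?_, fun W hW hWc f hf => ⟨fun h z hz => eq_zero_of_mem_ideal h hz,
      mem_ideal_of_forall_eq_zero hW hWc hf⟩⟩
  · exact coheight_of_irreducible isIrreducible_Cb isIrreducible_univ_C34 isClosed_univ
      (Set.ssubset_univ_iff.2 Cb_ne_univ) (fun Y hY hYi h => eq_univ_of_Cb_ssubset hY hYi h) Y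
      isClosed_closure hY
  · have := subset_closure_diff isIrreducible_Cb isOpen_cyclicLocus.isClosed_compl (fun h => by
      obtain ⟨z, hz, hzc⟩ := Cb_inter_cyclicLocus_nonempty
      exact h hz hzc)
    rwa [Set.sdiff_compl] at this

end GenericallyReduced

/-! ### Function fields -/

section FunctionField

variable {K : Type} [Field K] [Algebra ℂ K]

theorem mem_integralOver {s : Set K} {z : K} :
    z ∈ integralOver s ↔ IsIntegral (Algebra.adjoin ℂ s) z := Iff.rfl

theorem subset_integralOver (s : Set K) : s ⊆ integralOver s := fun z hz =>
  mem_integralOver.2 (isIntegral_algebraMap (R := Algebra.adjoin ℂ s)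
    (x := ⟨z, Algebra.subset_adjoin hz⟩))

theorem self_mem_integralOver (t : K) : t ∈ integralOver {t} :=
  subset_integralOver _ (Set.mem_singleton t)

theorem aeval_mem_integralOver (t : K) (p : ℂ[X]) : aeval t p ∈ integralOver {t} := by
  rw [← Polynomial.aeval_subalgebra_coe p (integralOver {t}) ⟨t, self_mem_integralOver t⟩]
  exact Subtype.property _

theorem integralOver_mono {s s' : Set K} (h : s ⊆ s') : integralOver s ≤ integralOver s' :=
  fun _ hz => IsIntegral.tower_top_of_subset (Algebra.adjoin_mono h) hz
where
  IsIntegral.tower_top_of_subset {A B : Subalgebra ℂ K} (h : A ≤ B) {z : K}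
      (hz : IsIntegral A z) : IsIntegral B z := by
    obtain ⟨p, hp, hpz⟩ := hz
    refine ⟨p.map (Subalgebra.inclusion h).toRingHom, hp.map _, ?_⟩
    rw [Polynomial.eval₂_map]
    exact hpz

/-- Elements that are integral over the integral closure of a subalgebra lie in it. -/
theorem mem_integralOver_of_isIntegral {s : Set K} {z : K} (h : IsIntegral (integralOver s) z) :
    z ∈ integralOver s := by
  rw [mem_integralOver]
  have h1 : IsIntegral (integralClosure (Algebra.adjoin ℂ s) K) z := h
  exact isIntegral_trans (R := Algebra.adjoin ℂ s) z h1

theorem mem_integralOver_of_monic {s : Set K} {p : K[X]} (hp : p.Monic)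
    (hc : ∀ i, p.coeff i ∈ integralOver s) {z : K} (hz : p.eval z = 0) : z ∈ integralOver s := by
  refine mem_integralOver_of_isIntegral ?_
  have hl : p ∈ Polynomial.lifts (integralOver s).val.toRingHom := by
    rw [Polynomial.lifts_iff_coeff_lifts]
    exact fun i => ⟨⟨_, hc i⟩, rfl⟩
  obtain ⟨q, hq, -, hqm⟩ := Polynomial.lifts_and_natDegree_eq_and_monic hl hp
  refine ⟨q, hqm, ?_⟩
  rw [← hq, Polynomial.eval_map] at hz
  exact hz

theorem mem_integralOver_of_cubic {s : Set K} {a b c z : K} (ha : a ∈ integralOver s)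
    (hb : b ∈ integralOver s) (hc : c ∈ integralOver s)
    (h : z ^ 3 + a * z ^ 2 + b * z + c = 0) : z ∈ integralOver s := by
  let p : K[X] := Polynomial.X ^ 3 + (Polynomial.C a * Polynomial.X ^ 2 +
    Polynomial.C b * Polynomial.X ^ 1 + Polynomial.C c * Polynomial.X ^ 0)
  refine mem_integralOver_of_monic (p := p) ?_ (fun i => ?_) (z := z) ?_
  · refine Polynomial.monic_X_pow_add ?_
    refine lt_of_le_of_lt (Polynomial.degree_add_le _ _) (max_lt (lt_of_le_of_lt
      (Polynomial.degree_add_le _ _) (max_lt ?_ ?_)) ?_) <;>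
    exact lt_of_le_of_lt (Polynomial.degree_C_mul_X_pow_le _ _) (by norm_num)
  · simp only [p, Polynomial.coeff_add, Polynomial.coeff_X_pow, Polynomial.coeff_C_mul]
    refine add_mem ?_ (add_mem (add_mem (mul_mem ha ?_) (mul_mem hb ?_)) (mul_mem hc ?_)) <;>
    · split_ifs
      exacts [one_mem _, zero_mem _]
  · simp only [p, Polynomial.eval_add, Polynomial.eval_mul, Polynomial.eval_pow, Polynomial.eval_X,
      Polynomial.eval_C, pow_zero, pow_one, mul_one]
    rw [← h]
    ring

/-- A power `t ^ N` clears the denominators of all coefficients of a monic equation of `z`. Scaling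
the roots by `t ^ N` then gives a monic equation of `t ^ N * z` with integral coefficients. -/
theorem exists_pow_mul_mem_integralOver {t : K} (ht : t ≠ 0) {z : K}
    (hz : z ∈ integralOver {t, t⁻¹}) : ∃ n : ℕ, t ^ n * z ∈ integralOver {t} := by
  have h1 : ∀ c ∈ Algebra.adjoin ℂ {t, t⁻¹}, ∃ n : ℕ, ∀ m, n ≤ m → t ^ m * c ∈ integralOver {t} := by
    intro c hc
    induction hc using Algebra.adjoin_induction with
    | mem c hc =>
      rcases hc with rfl | hc
      · exact ⟨0, fun m _ => mul_mem (pow_mem (self_mem_integralOver c) m) (self_mem_integralOver c)⟩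
      · rw [Set.mem_singleton_iff] at hc
        subst hc
        refine ⟨1, fun m hm => ?_⟩
        obtain ⟨k, rfl⟩ := Nat.exists_eq_add_of_le' hm
        rw [pow_succ, mul_assoc, mul_inv_cancel₀ ht, mul_one]
        exact pow_mem (self_mem_integralOver t) k
    | algebraMap r => exact ⟨0, fun m _ =>
        mul_mem (pow_mem (self_mem_integralOver t) m) ((integralOver {t}).algebraMap_mem r)⟩
    | add x y _ _ hx hy =>
      obtain ⟨n, hn⟩ := hx
      obtain ⟨n', hn'⟩ := hy
      refine ⟨max n n', fun m hm => ?_⟩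
      rw [mul_add]
      exact add_mem (hn m (le_of_max_le_left hm)) (hn' m (le_of_max_le_right hm))
    | mul x y _ _ hx hy =>
      obtain ⟨n, hn⟩ := hx
      obtain ⟨n', hn'⟩ := hy
      refine ⟨n + n', fun m hm => ?_⟩
      obtain ⟨k, rfl⟩ := Nat.exists_eq_add_of_le hm
      have : t ^ (n + n' + k) * (x * y) = t ^ n * x * (t ^ (n' + k) * y) := by ring
      rw [this]
      exact mul_mem (hn n le_rfl) (hn' _ (Nat.le_add_right _ _))
  obtain ⟨p, hp, hpz⟩ := hz
  have h2 : ∃ N : ℕ, ∀ i, ∀ m, N ≤ m → t ^ m * (p.coeff i : K) ∈ integralOver {t} := by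
    choose n hn using fun i => h1 (p.coeff i : K) (p.coeff i).2
    refine ⟨p.support.sup n, fun i m hm => ?_⟩
    by_cases hi : i ∈ p.support
    · exact hn i m ((Finset.le_sup hi).trans hm)
    · rw [Polynomial.notMem_support_iff.1 hi]
      simp
  obtain ⟨N, hN⟩ := h2
  refine ⟨N, ?_⟩
  let q : K[X] := (p.map (algebraMap (Algebra.adjoin ℂ {t, t⁻¹}) K)).scaleRoots (t ^ N)
  refine mem_integralOver_of_monic (p := q) ?_ (fun i => ?_) ?_
  · exact (Polynomial.monic_scaleRoots_iff _).2 (hp.map _)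
  · have hd : (p.map (algebraMap (Algebra.adjoin ℂ {t, t⁻¹}) K)).natDegree = p.natDegree :=
      hp.natDegree_map _
    rw [Polynomial.coeff_scaleRoots, Polynomial.coeff_map, hd, ← pow_mul, mul_comm]
    rcases lt_trichotomy i p.natDegree with hi | hi | hi
    · exact hN i _ (Nat.le_mul_of_pos_right N (Nat.sub_pos_of_lt hi))
    · rw [hi, Nat.sub_self, mul_zero, pow_zero, one_mul, hp.coeff_natDegree]
      exact one_mem _
    · rw [Polynomial.coeff_eq_zero_of_natDegree_lt hi]
      simp
  · have := Polynomial.scaleRoots_eval₂_eq_zero (p := p.map (algebraMap (Algebra.adjoin ℂ {t, t⁻¹}) K))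
      (RingHom.id K) (r := z) (s := t ^ N) (by rw [Polynomial.eval₂_map]; exact hpz)
    exact this

theorem mem_integralOver_pair_iff {t : K} (ht : t ≠ 0) {z : K} :
    z ∈ integralOver {t, t⁻¹} ↔ ∃ n : ℕ, t ^ n * z ∈ integralOver {t} := by
  refine ⟨exists_pow_mul_mem_integralOver ht, fun ⟨n, hn⟩ => ?_⟩
  have h1 : t⁻¹ ∈ integralOver {t, t⁻¹} := subset_integralOver _ (by simp)
  have h2 := mul_mem (pow_mem h1 n) (integralOver_mono (s' := {t, t⁻¹}) (by simp) hn)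
  rwa [← mul_assoc, ← mul_pow, inv_mul_cancel₀ ht, one_pow, one_mul] at h2

theorem transcendental_ne_zero {t : K} (ht : Transcendental ℂ t) : t ≠ 0 := by
  rintro rfl
  exact ht isAlgebraic_zero

theorem aeval_eq_zero_of_transcendental {t : K} (ht : Transcendental ℂ t) {p : ℂ[X]}
    (h : aeval t p = 0) : p = 0 :=
  (transcendental_iff.1 ht) p h

theorem transcendental_inv {t : K} (ht : Transcendental ℂ t) : Transcendental ℂ t⁻¹ := fun h =>
  ht (by simpa using h.inv)

/-- The value of a Laurent polynomial. -/
def laurentEval (t : Kˣ) : LaurentPolynomial ℂ →ₐ[ℂ] K :=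
  { LaurentPolynomial.eval₂ (algebraMap ℂ K) t with
    commutes' := fun r => by
      simp [LaurentPolynomial.algebraMap_apply] }

theorem laurentEval_T (t : Kˣ) (n : ℤ) : laurentEval t (LaurentPolynomial.T n) = (t : K) ^ n := by
  rw [← Units.val_zpow_eq_zpow_val]
  exact LaurentPolynomial.eval₂_T _ _ n

theorem laurentEval_toLaurent (t : Kˣ) (p : ℂ[X]) :
    laurentEval t (Polynomial.toLaurent p) = aeval (t : K) p :=
  LaurentPolynomial.eval₂_toLaurent _ _ p

theorem laurentEval_invert (t : Kˣ) (p : ℂ[X]) :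
    laurentEval t (LaurentPolynomial.invert (Polynomial.toLaurent p)) =
      aeval (t⁻¹ : K) p := by
  induction p using Polynomial.induction_on' with
  | add p q hp hq => simp only [map_add, hp, hq]
  | monomial n a =>
    rw [← Polynomial.C_mul_X_pow_eq_monomial, Polynomial.toLaurent_C_mul_X_pow, map_mul, map_mul,
      LaurentPolynomial.invert_C, LaurentPolynomial.invert_T, laurentEval_T, ← Polynomial.toLaurent_C,
      laurentEval_toLaurent]
    simp

/-- Every Laurent polynomial is the sum of a polynomial in `T`, a part with exponents between
`-n` and `-1`, and a part with exponents at most `-n - 1`. -/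
theorem exists_laurent_split (n : ℕ) (l : LaurentPolynomial ℂ) : ∃ (p q : ℂ[X]) (c : Fin n → ℂ),
    l = Polynomial.toLaurent p +
      ∑ j : Fin n, LaurentPolynomial.C (c j) * LaurentPolynomial.T (-((j : ℕ) + 1)) +
      LaurentPolynomial.T (-(n + 1)) * LaurentPolynomial.invert (Polynomial.toLaurent q) := by
  induction l using LaurentPolynomial.induction_on' with
  | add l l' h h' =>
    obtain ⟨p, q, c, h⟩ := h
    obtain ⟨p', q', c', h'⟩ := h'
    refine ⟨p + p', q + q', c + c', ?_⟩
    simp only [Pi.add_apply, map_add, add_mul, Finset.sum_add_distrib, mul_add]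
    nth_rw 1 [h, h']
    ring
  | C_mul_T k a =>
    rcases le_or_gt 0 k with hk | hk
    · obtain ⟨m, rfl⟩ := Int.eq_ofNat_of_zero_le hk
      exact ⟨Polynomial.C a * Polynomial.X ^ m, 0, 0, by simp⟩
    · obtain ⟨m, rfl⟩ : ∃ m : ℕ, k = -(m + 1) := ⟨(-k - 1).toNat, by omega⟩
      by_cases hm : m < n
      · refine ⟨0, 0, Pi.single ⟨m, hm⟩ a, ?_⟩
        rw [Finset.sum_eq_single ⟨m, hm⟩]
        · simp
        · intro j _ hj
          simp [Pi.single_eq_of_ne hj]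
        · simp
      · obtain ⟨r, rfl⟩ := Nat.exists_eq_add_of_le (not_lt.1 hm)
        refine ⟨0, Polynomial.C a * Polynomial.X ^ r, 0, ?_⟩
        rw [Polynomial.toLaurent_C_mul_X_pow, map_mul, LaurentPolynomial.invert_C,
          LaurentPolynomial.invert_T, mul_left_comm, ← LaurentPolynomial.T_add]
        rw [show (-((n + r : ℕ) + 1 : ℤ)) = -(n + 1) + -r by push_cast; ring]
        simp

end FunctionField

/-! ### Direct images of type `𝒪 ⊕ 𝒪(-4)²` and the genus -/

section ScrollBasis

/-- A coefficient of a Laurent polynomial, as a linear functional. -/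
def laurentCoeff (k : ℤ) : LaurentPolynomial ℂ →ₗ[ℂ] ℂ where
  toFun l := l.coeff k
  map_add' _ _ := rfl
  map_smul' _ _ := rfl

theorem laurentCoeff_C_mul_T (k m : ℤ) (a : ℂ) :
    laurentCoeff k (LaurentPolynomial.C a * LaurentPolynomial.T m) = if m = k then a else 0 := by
  rw [← LaurentPolynomial.single_eq_C_mul_T]
  exact Finsupp.single_apply

theorem laurentCoeff_toLaurent {k : ℤ} (hk : k < 0) (p : ℂ[X]) :
    laurentCoeff k (Polynomial.toLaurent p) = 0 := by
  induction p using Polynomial.induction_on' with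
  | add p q hp hq => rw [map_add, map_add, hp, hq, add_zero]
  | monomial n a =>
    rw [← Polynomial.C_mul_X_pow_eq_monomial, Polynomial.toLaurent_C_mul_X_pow,
      laurentCoeff_C_mul_T, if_neg (by omega)]

theorem laurentCoeff_invert {k m : ℤ} (hk : m < k) (q : ℂ[X]) :
    laurentCoeff k (LaurentPolynomial.T m * LaurentPolynomial.invert (Polynomial.toLaurent q)) =
      0 := by
  induction q using Polynomial.induction_on' with
  | add p q hp hq => rw [map_add, map_add, mul_add, map_add, hp, hq, add_zero]
  | monomial n a =>
    rw [← Polynomial.C_mul_X_pow_eq_monomial, Polynomial.toLaurent_C_mul_X_pow,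
      map_mul LaurentPolynomial.invert, LaurentPolynomial.invert_C, LaurentPolynomial.invert_T,
      mul_left_comm,
      ← LaurentPolynomial.T_add, laurentCoeff_C_mul_T, if_neg (by omega)]

variable {K : Type} [Field K] [Algebra ℂ K]

/-- The elements `1, w₀, w₁` are a basis of the functions without pole outside the poles of `t`,
and `1, t⁻⁴ w₀, t⁻⁴ w₁` are a basis of the functions without pole outside the zeros of `t`. -/
structure ScrollBasis (t : K) (w : Fin 2 → K) : Prop where
  indep : ∀ (P : ℂ[X]) (Q : Fin 2 → ℂ[X]),
    aeval t P + ∑ i, aeval t (Q i) * w i = 0 → P = 0 ∧ Q = 0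
  mem₀ : ∀ z, z ∈ integralOver {t} ↔ ∃ (P : ℂ[X]) (Q : Fin 2 → ℂ[X]),
    z = aeval t P + ∑ i, aeval t (Q i) * w i
  mem₁ : ∀ z, z ∈ integralOver {t⁻¹} ↔ ∃ (P : ℂ[X]) (Q : Fin 2 → ℂ[X]),
    z = aeval t⁻¹ P + ∑ i, aeval t⁻¹ (Q i) * (t⁻¹ ^ 4 * w i)

variable {t : K} {w : Fin 2 → K}

theorem ScrollBasis.transcendental (h : ScrollBasis t w) : Transcendental ℂ t := by
  rw [transcendental_iff]
  intro p hp
  exact (h.indep p 0 (by simp [hp])).1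

theorem ScrollBasis.ne_zero (h : ScrollBasis t w) : t ≠ 0 := transcendental_ne_zero h.transcendental

theorem laurent_indep {t : Kˣ} (h : ∀ (P : ℂ[X]) (Q : Fin 2 → ℂ[X]),
      aeval (t : K) P + ∑ i, aeval (t : K) (Q i) * w i = 0 → P = 0 ∧ Q = 0)
    {l : LaurentPolynomial ℂ} {m : Fin 2 → LaurentPolynomial ℂ}
    (hl : laurentEval t l + ∑ i, laurentEval t (m i) * w i = 0) : l = 0 ∧ m = 0 := by
  have hex : ∀ l : LaurentPolynomial ℂ, ∃ n : ℕ, ∀ k, n ≤ k → ∃ p : ℂ[X],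
      Polynomial.toLaurent p = l * LaurentPolynomial.T k := fun l => by
    obtain ⟨n, p, hp⟩ := LaurentPolynomial.exists_T_pow l
    refine ⟨n, fun k hk => ?_⟩
    obtain ⟨r, rfl⟩ := Nat.exists_eq_add_of_le hk
    refine ⟨p * Polynomial.X ^ r, ?_⟩
    rw [map_mul, hp, Polynomial.toLaurent_X_pow, Nat.cast_add, LaurentPolynomial.T_add, mul_assoc]
  obtain ⟨n, hn⟩ := hex l
  choose n' hn' using fun i => hex (m i)
  let N := max n (max (n' 0) (n' 1))
  obtain ⟨p, hp⟩ := hn N (le_max_left _ _)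
  have hN : ∀ i, n' i ≤ N := fun i => by fin_cases i <;> simp [N]
  choose q hq using fun i => hn' i N (hN i)
  have hz : ∀ l : LaurentPolynomial ℂ, l * LaurentPolynomial.T N = 0 → l = 0 := fun l hl =>
    ((LaurentPolynomial.isUnit_T (N : ℤ)).mul_left_eq_zero).1 hl
  have := h p q (by
    rw [← laurentEval_toLaurent, hp]
    simp only [← laurentEval_toLaurent, hq, map_mul]
    have h1 : laurentEval t l * laurentEval t (LaurentPolynomial.T N) +
      ∑ i, laurentEval t (m i) * laurentEval t (LaurentPolynomial.T N) * w i =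
      (laurentEval t l + ∑ i, laurentEval t (m i) * w i) *
        laurentEval t (LaurentPolynomial.T N) := by
      rw [add_mul, Finset.sum_mul]
      congr 1
      exact Finset.sum_congr rfl fun _ _ => by ring
    rw [h1, hl, zero_mul])
  refine ⟨hz _ ?_, funext fun i => hz _ ?_⟩
  · rw [← hp, this.1, map_zero]
  · rw [← hq i, this.2, Pi.zero_apply, map_zero]

theorem ScrollBasis.w_mem₀ (h : ScrollBasis t w) (i : Fin 2) : w i ∈ integralOver {t} :=
  (h.mem₀ _).2 ⟨0, Pi.single i 1, by fin_cases i <;> simp⟩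

theorem ScrollBasis.w_mem₁ (h : ScrollBasis t w) (i : Fin 2) :
    t⁻¹ ^ 4 * w i ∈ integralOver {t⁻¹} :=
  (h.mem₁ _).2 ⟨0, Pi.single i 1, by fin_cases i <;> simp⟩

/-- The functions with poles at the poles and zeros of `t` only. -/
theorem ScrollBasis.exists_laurent (h : ScrollBasis t w) {z : K} (hz : z ∈ integralOver {t, t⁻¹}) :
    ∃ (l : LaurentPolynomial ℂ) (m : Fin 2 → LaurentPolynomial ℂ),
      z = laurentEval (Units.mk0 t h.ne_zero) l +
        ∑ i, laurentEval (Units.mk0 t h.ne_zero) (m i) * w i := by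
  obtain ⟨n, hn⟩ := (mem_integralOver_pair_iff h.ne_zero).1 hz
  obtain ⟨P, Q, hPQ⟩ := (h.mem₀ _).1 hn
  refine ⟨LaurentPolynomial.T (-n) * Polynomial.toLaurent P,
    fun i => LaurentPolynomial.T (-n) * Polynomial.toLaurent (Q i), ?_⟩
  simp only [map_mul, laurentEval_T, laurentEval_toLaurent, Units.val_mk0]
  have h1 : z = t ^ (-(n : ℤ)) * (t ^ n * z) := by
    rw [← mul_assoc, zpow_neg, zpow_natCast, inv_mul_cancel₀ (pow_ne_zero _ h.ne_zero), one_mul]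
  rw [h1, hPQ, mul_add, Finset.mul_sum]
  congr 1
  exact Finset.sum_congr rfl fun _ _ => by ring

/-- The group is `H¹(𝒪) ⊕ H¹(𝒪(-4))²`. The first summand is zero, and `H¹(𝒪(-4))` has the basis
`t⁻¹`, `t⁻²`, `t⁻³`: Laurent coefficients with exponents from `-3` to `-1` are seen by neither
chart, all others by one of them. -/
theorem ScrollBasis.finrank_cechH1 (h : ScrollBasis t w) : Module.finrank ℂ (CechH1 t) = 6 := by
  let u := Units.mk0 t h.ne_zero
  have h5 : (u : K) = t := rfl
  have h4 : (u : K) ^ (-4 : ℤ) = t⁻¹ ^ 4 := by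
    rw [h5, zpow_neg, inv_pow]
    exact congrArg _ (zpow_natCast t 4)
  have hL₀ : integralOver {t} ≤ integralOver {t, t⁻¹} := integralOver_mono (by simp)
  have hL₁ : integralOver {t⁻¹} ≤ integralOver {t, t⁻¹} := integralOver_mono (by simp)
  let e : Fin 2 → Fin 3 → Subalgebra.toSubmodule (integralOver {t, t⁻¹}) := fun i j =>
    ⟨t⁻¹ ^ ((j : ℕ) + 1) * w i, (integralOver {t, t⁻¹}).mul_mem
      (pow_mem (hL₁ (self_mem_integralOver _)) _) (hL₀ (h.w_mem₀ i))⟩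
  let σ₀ : (Fin 2 → Fin 3 → ℂ) →ₗ[ℂ] Subalgebra.toSubmodule (integralOver {t, t⁻¹}) :=
    { toFun := fun c => ∑ i, ∑ j, c i j • e i j
      map_add' := fun c d => by simp [add_smul, Finset.sum_add_distrib]
      map_smul' := fun r c => by simp [Finset.smul_sum, mul_smul] }
  have hσ₀ : ∀ c, (σ₀ c : K) = ∑ i, laurentEval u (∑ j : Fin 3, LaurentPolynomial.C (c i j) *
      LaurentPolynomial.T (-((j : ℕ) + 1))) * w i := by
    intro c
    change ((∑ i, ∑ j, c i j • e i j : Subalgebra.toSubmodule (integralOver {t, t⁻¹})) : K) = _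
    rw [Submodule.coe_sum]
    refine Finset.sum_congr rfl fun i _ => ?_
    rw [Submodule.coe_sum, map_sum, Finset.sum_mul]
    refine Finset.sum_congr rfl fun j _ => ?_
    rw [Submodule.coe_smul, map_mul, laurentEval_T, ← Polynomial.toLaurent_C,
      laurentEval_toLaurent, Polynomial.aeval_C, Algebra.smul_def, mul_assoc]
    congr 1
    change t⁻¹ ^ ((j : ℕ) + 1) * w i = _
    congr 1
    rw [zpow_neg, ← Nat.cast_succ, zpow_natCast, inv_pow]
    rfl
  let N := (Subalgebra.toSubmodule (integralOver {t}) ⊔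
      Subalgebra.toSubmodule (integralOver {t⁻¹})).submoduleOf
        (Subalgebra.toSubmodule (integralOver {t, t⁻¹}))
  let σ : (Fin 2 → Fin 3 → ℂ) →ₗ[ℂ] CechH1 t := N.mkQ ∘ₗ σ₀
  have hinj : Function.Injective σ := by
    rw [← LinearMap.ker_eq_bot, LinearMap.ker_eq_bot']
    intro c hc
    have h1 : σ₀ c ∈ N := (Submodule.Quotient.mk_eq_zero N).1 hc
    obtain ⟨z₀, hz₀, z₁, hz₁, hz⟩ := Submodule.mem_sup.1
      (show (σ₀ c : K) ∈ Subalgebra.toSubmodule (integralOver {t}) ⊔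
        Subalgebra.toSubmodule (integralOver {t⁻¹}) from h1)
    obtain ⟨P, Q, rfl⟩ := (h.mem₀ _).1 hz₀
    obtain ⟨P', Q', rfl⟩ := (h.mem₁ _).1 hz₁
    rw [hσ₀] at hz
    have h2 := (laurent_indep (t := u) h.indep
      (l := Polynomial.toLaurent P + LaurentPolynomial.invert (Polynomial.toLaurent P'))
      (m := fun i => Polynomial.toLaurent (Q i) + LaurentPolynomial.T (-4) *
        LaurentPolynomial.invert (Polynomial.toLaurent (Q' i)) -
        ∑ j : Fin 3, LaurentPolynomial.C (c i j) * LaurentPolynomial.T (-((j : ℕ) + 1))) (by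
        simp only [sub_mul, Finset.sum_sub_distrib, ← hz, map_sub, map_add, laurentEval_toLaurent,
          laurentEval_invert, map_mul, laurentEval_T, add_mul, Finset.sum_add_distrib]
        rw [h4, h5, show ∑ i, t⁻¹ ^ 4 * aeval t⁻¹ (Q' i) * w i =
          ∑ i, aeval t⁻¹ (Q' i) * (t⁻¹ ^ 4 * w i) from
            Finset.sum_congr rfl fun _ _ => by ring]
        ring)).2
    funext i k
    have h3 := congrArg (laurentCoeff (-((k : ℕ) + 1))) (congrFun h2 i)
    rw [map_sub, map_add, laurentCoeff_toLaurent (by omega), laurentCoeff_invert (by omega),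
      map_sum, Finset.sum_eq_single k, laurentCoeff_C_mul_T, if_pos rfl] at h3
    · simpa using h3
    · intro j _ hj
      rw [laurentCoeff_C_mul_T, if_neg]
      intro h
      exact hj (Fin.ext (by omega))
    · simp
  have hsurj : Function.Surjective σ := by
    intro x
    obtain ⟨⟨z, hz⟩, rfl⟩ := Submodule.Quotient.mk_surjective _ x
    obtain ⟨l, m, hlm⟩ := h.exists_laurent hz
    obtain ⟨P, P', c', hP⟩ := exists_laurent_split 0 l
    choose Q Q' c hQ using fun i => exists_laurent_split 3 (m i)
    refine ⟨c, ?_⟩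
    symm
    refine (Submodule.Quotient.eq N).2 ?_
    change z - (σ₀ c : K) ∈ Subalgebra.toSubmodule (integralOver {t}) ⊔
        Subalgebra.toSubmodule (integralOver {t⁻¹})
    have h1 : z - (σ₀ c : K) = (aeval t P + ∑ i, aeval t (Q i) * w i) +
        (aeval t⁻¹ (Polynomial.X * P') +
          ∑ i, aeval t⁻¹ (Q' i) * (t⁻¹ ^ 4 * w i)) := by
      have hm : ∀ i, laurentEval u (m i) * w i = laurentEval u (∑ j : Fin 3,
          LaurentPolynomial.C (c i j) * LaurentPolynomial.T (-((j : ℕ) + 1))) * w i +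
          (aeval t (Q i) * w i + aeval t⁻¹ (Q' i) * (t⁻¹ ^ 4 * w i)) := by
        intro i
        rw [hQ i, map_add, map_add, map_mul, laurentEval_toLaurent, laurentEval_invert,
          laurentEval_T, Nat.cast_ofNat, show (-(3 + 1) : ℤ) = -4 by norm_num, h4, h5]
        ring
      have hl : laurentEval u l = aeval t P +
          aeval t⁻¹ (Polynomial.X * P') := by
        rw [hP, Finset.univ_eq_empty, Finset.sum_empty, add_zero, map_add, map_mul,
          laurentEval_toLaurent, laurentEval_invert, laurentEval_T, map_mul, Polynomial.aeval_X, h5]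
        simp
      change z = laurentEval u l + ∑ i, laurentEval u (m i) * w i at hlm
      rw [hlm, hl, hσ₀]
      simp only [hm, Finset.sum_add_distrib]
      ring
    rw [h1]
    exact Submodule.add_mem_sup ((h.mem₀ _).2 ⟨P, Q, rfl⟩) ((h.mem₁ _).2 ⟨_, Q', rfl⟩)
  rw [← (LinearEquiv.ofBijective σ ⟨hinj, hsurj⟩).finrank_eq, Module.finrank_pi_fintype]
  simp

end ScrollBasis

/-! ### Changes of scroll bases, and the cubic form of a multiplication table -/

section ScrollBasisForm

variable {K : Type} [Field K] [Algebra ℂ K] {t : K} {w w' : Fin 2 → K}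

theorem laurentCoeff_toLaurent_natCast (k : ℕ) (p : ℂ[X]) :
    laurentCoeff k (Polynomial.toLaurent p) = p.coeff k := by
  induction p using Polynomial.induction_on' with
  | add p q hp hq => rw [map_add, map_add, hp, hq, Polynomial.coeff_add]
  | monomial n a =>
    rw [← Polynomial.C_mul_X_pow_eq_monomial, Polynomial.toLaurent_C_mul_X_pow,
      laurentCoeff_C_mul_T, Polynomial.coeff_C_mul_X_pow]
    exact if_congr (by omega) rfl rfl

theorem natDegree_le_of_toLaurent_eq {n : ℕ} {p q : ℂ[X]}
    (h : Polynomial.toLaurent p =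
      LaurentPolynomial.T n * LaurentPolynomial.invert (Polynomial.toLaurent q)) :
    p.natDegree ≤ n := by
  rw [Polynomial.natDegree_le_iff_coeff_eq_zero]
  intro k hk
  rw [← laurentCoeff_toLaurent_natCast, h, laurentCoeff_invert (by omega)]

/-- The two expressions of a function with bounded poles at the poles of `t`. -/
theorem ScrollBasis.exists_coeff (h : ScrollBasis t w) {z : K} {n : ℕ}
    (h0 : z ∈ integralOver {t}) (h1 : t⁻¹ ^ (n + 4) * z ∈ integralOver {t⁻¹}) :
    ∃ (P : ℂ[X]) (Q : Fin 2 → ℂ[X]), (∀ i, (Q i).natDegree ≤ n) ∧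
      z = aeval t P + ∑ i, aeval t (Q i) * w i := by
  obtain ⟨P, Q, hPQ⟩ := (h.mem₀ _).1 h0
  obtain ⟨P', Q', hPQ'⟩ := (h.mem₁ _).1 h1
  refine ⟨P, Q, fun i => ?_, hPQ⟩
  let u := Units.mk0 t h.ne_zero
  have h5 : (u : K) = t := rfl
  have hp : ∀ n : ℕ, t ^ n * t⁻¹ ^ n = 1 := fun n => by
    rw [← mul_pow, mul_inv_cancel₀ h.ne_zero, one_pow]
  have hz : z = t ^ (n + 4) * aeval t⁻¹ P' +
      ∑ i, t ^ n * aeval t⁻¹ (Q' i) * w i := by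
    have : z = t ^ (n + 4) * (t⁻¹ ^ (n + 4) * z) := by rw [← mul_assoc, hp, one_mul]
    rw [this, hPQ', mul_add, Finset.mul_sum]
    congr 1
    refine Finset.sum_congr rfl fun i _ => ?_
    rw [pow_add]
    linear_combination t ^ n * aeval t⁻¹ (Q' i) * w i * hp 4
  have h2 := (laurent_indep (t := u) h.indep
    (l := Polynomial.toLaurent P - LaurentPolynomial.T (n + 4 : ℕ) *
      LaurentPolynomial.invert (Polynomial.toLaurent P'))
    (m := fun i => Polynomial.toLaurent (Q i) - LaurentPolynomial.T n *
      LaurentPolynomial.invert (Polynomial.toLaurent (Q' i))) (by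
      simp only [map_sub, map_mul, laurentEval_toLaurent, laurentEval_invert, laurentEval_T,
        zpow_natCast, sub_mul, Finset.sum_sub_distrib, h5]
      linear_combination hz - hPQ)).2
  have h3 := congrFun h2 i
  exact natDegree_le_of_toLaurent_eq (sub_eq_zero.1 h3)

/-- This is the case `n = 0` of `ScrollBasis.exists_coeff`: endomorphisms of `𝒪(-4)²` are constant
matrices. -/
theorem ScrollBasis.exists_matrix (h : ScrollBasis t w) (h' : ScrollBasis t w') :
    ∃ (γ : Matrix (Fin 2) (Fin 2) ℂ) (a : Fin 2 → ℂ[X]),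
      ∀ i, w' i = aeval t (a i) + ∑ j, algebraMap ℂ K (γ i j) * w j := by
  have h1 : ∀ i, ∃ (P : ℂ[X]) (c : Fin 2 → ℂ),
      w' i = aeval t P + ∑ j, algebraMap ℂ K (c j) * w j := by
    intro i
    obtain ⟨P, Q, hQ, hPQ⟩ := h.exists_coeff (n := 0) (h'.w_mem₀ i) (by simpa using h'.w_mem₁ i)
    refine ⟨P, fun j => (Q j).coeff 0, ?_⟩
    rw [hPQ]
    congr 1
    refine Finset.sum_congr rfl fun j _ => ?_
    conv_lhs => rw [Polynomial.eq_C_of_natDegree_le_zero (hQ j), Polynomial.aeval_C]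
  choose a γ hγ using h1
  exact ⟨γ, a, hγ⟩

/-- Two bases differ by constants, up to multiples of `1`. -/
theorem ScrollBasis.exists_matrix_det (h : ScrollBasis t w) (h' : ScrollBasis t w') :
    ∃ (γ : Matrix (Fin 2) (Fin 2) ℂ) (a : Fin 2 → ℂ[X]), γ.det ≠ 0 ∧
      ∀ i, w' i = aeval t (a i) + ∑ j, algebraMap ℂ K (γ i j) * w j := by
  obtain ⟨γ, a, hγ⟩ := h.exists_matrix h'
  obtain ⟨δ, b, hδ⟩ := h'.exists_matrix h
  refine ⟨γ, a, ?_, hγ⟩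
  have h1 : δ * γ = 1 := by
    ext i k
    have h2 := (h.indep (b i + ∑ j, Polynomial.C (δ i j) * a j)
      (fun k => Polynomial.C ((δ * γ) i k) - Polynomial.C ((1 : Matrix (Fin 2) (Fin 2) ℂ) i k)) (by
        have h3 := hδ i
        have h4 : ∑ k, algebraMap ℂ K ((1 : Matrix (Fin 2) (Fin 2) ℂ) i k) * w k = w i := by
          simp [Matrix.one_apply]
        simp only [hγ, Fin.sum_univ_two] at h3
        simp only [Fin.sum_univ_two] at h4
        simp only [Fin.sum_univ_two, Matrix.mul_apply, map_add, map_sub, map_mul,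
          Polynomial.aeval_C]
        linear_combination -h3 - h4)).2
    have h3 := congrFun h2 k
    rw [Pi.zero_apply, sub_eq_zero] at h3
    exact Polynomial.C_injective h3
  intro h0
  have := congrArg Matrix.det h1
  rw [Matrix.det_mul, h0, mul_zero, Matrix.det_one] at this
  exact zero_ne_one this

/-- This is the Delone–Faddeev correspondence. Translating `w 0` and `w 1` by base functions gives
`η`, `ζ` with `η ζ` a base function. Comparing `η (η ζ)` with `(η η) ζ` determines the constant
terms of the table. The coefficient `A 2` is nonzero, since otherwise `η ζ = 0` in a field, and `η /
A 2` is the root of the cubic form. -/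
theorem sum_aeval_eq_zero_of_table (hind : ∀ (P : ℂ[X]) (Q : Fin 2 → ℂ[X]),
      aeval t P + ∑ i, aeval t (Q i) * w i = 0 → P = 0 ∧ Q = 0)
    {A B C : Fin 3 → ℂ[X]}
    (hA : w 0 * w 0 = aeval t (A 0) + aeval t (A 1) * w 0 +
      aeval t (A 2) * w 1)
    (hB : w 0 * w 1 = aeval t (B 0) + aeval t (B 1) * w 0 +
      aeval t (B 2) * w 1)
    (hC : w 1 * w 1 = aeval t (C 0) + aeval t (C 1) * w 0 +
      aeval t (C 2) * w 1) :
    ∃ θ : K, aeval t (A 2) ≠ 0 ∧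
      aeval t (A 2) * θ = w 0 - aeval t (B 2) ∧
      aeval t (A 2) * θ ^ 3 + aeval t (2 * B 2 - A 1) * θ ^ 2 +
        aeval t (C 2 - 2 * B 1) * θ + aeval t (-C 1) = 0 := by
  set η : K := w 0 - aeval t (B 2) with hη
  set ζ : K := w 1 - aeval t (B 1) with hζ
  let n : ℂ[X] := B 0 + B 1 * B 2
  let k₁ : ℂ[X] := A 0 + A 1 * B 2 + A 2 * B 1 - B 2 ^ 2
  let k₂ : ℂ[X] := C 0 + C 1 * B 2 + C 2 * B 1 - B 1 ^ 2
  have hηζ : η * ζ = aeval t n := by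
    simp only [hη, hζ, n, map_add, map_mul]; linear_combination hB
  have hηη : η * η = aeval t (A 2) * ζ - aeval t (2 * B 2 - A 1) * η +
      aeval t k₁ := by
    simp only [hη, hζ, k₁, map_add, map_mul, map_sub, map_pow, map_ofNat]; linear_combination hA
  have hζζ : ζ * ζ = aeval t (C 1) * η + aeval t (C 2 - 2 * B 1) * ζ +
      aeval t k₂ := by
    simp only [hη, hζ, k₂, map_add, map_mul, map_sub, map_pow, map_ofNat]; linear_combination hC
  have hind' : ∀ p q r : ℂ[X], aeval t p + aeval t q * η +
      aeval t r * ζ = 0 → p = 0 ∧ q = 0 ∧ r = 0 := by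
    intro p q r h
    have h1 := hind (p - q * B 2 - r * B 1) ![q, r] (by
      simp only [Fin.sum_univ_two, map_sub, map_mul, Matrix.cons_val_zero, Matrix.cons_val_one]
      rw [← h, hη, hζ]
      ring)
    have hq : q = 0 := congrFun h1.2 0
    have hr : r = 0 := congrFun h1.2 1
    refine ⟨?_, hq, hr⟩
    simpa [hq, hr] using h1.1
  have hrel := hind' (A 2 * k₂ - (2 * B 2 - A 1) * n) (A 2 * C 1 - n)
    (A 2 * (C 2 - 2 * B 1) + k₁) (by
      simp only [map_sub, map_mul, map_add, map_ofNat] at hηη hζζ ⊢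
      linear_combination (-aeval t (A 2)) * hζζ + (η + (2 *
        aeval t (B 2) - aeval t (A 1))) * hηζ - ζ * hηη)
  obtain ⟨-, h1, h2⟩ := hrel
  have hne : ∀ p q : ℂ[X], (q ≠ 0) → aeval t p + aeval t q * η ≠ 0 :=
    fun p q hq h => hq (hind' p q 0 (by simpa using h)).2.1
  have hA2 : aeval t (A 2) ≠ 0 := by
    intro h0
    have hA0 : A 2 = 0 := (hind' (A 2) 0 0 (by simp [h0])).1
    have hn : n = 0 := by rw [hA0, zero_mul, zero_sub, neg_eq_zero] at h1; exact h1
    rw [hn, map_zero, mul_eq_zero] at hηζ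
    rcases hηζ with h | h
    · exact one_ne_zero (hind' 0 1 0 (by simp [h])).2.1
    · exact one_ne_zero (hind' 0 0 1 (by simp [h])).2.2
  refine ⟨η / aeval t (A 2), hA2, mul_div_cancel₀ _ hA2, ?_⟩
  have hn : aeval t n = aeval t (A 2) * aeval t (C 1) := by
    rw [← map_mul, ← sub_eq_zero.1 h1]
  have hk : aeval t k₁ = -(aeval t (A 2) *
      aeval t (C 2 - 2 * B 1)) := by
    rw [← map_mul, ← map_neg, ← eq_neg_of_add_eq_zero_right h2]
  have h3 : η ^ 3 + aeval t (2 * B 2 - A 1) * η ^ 2 +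
      aeval t (A 2) * aeval t (C 2 - 2 * B 1) * η -
      aeval t (A 2) ^ 2 * aeval t (C 1) = 0 := by
    linear_combination η * hηη + aeval t (A 2) * hηζ + η * hk +
      aeval t (A 2) * hn
  rw [map_neg]
  field_simp
  linear_combination h3

end ScrollBasisForm

/-! ### Relations between functions of degree three -/

section RelationDegree

variable {K : Type} [Field K] [Algebra ℂ K] {t θ : K}

theorem aevalAeval_eq_sum (t θ : K) {G : ℂ[X][X]} {n : ℕ} (hG : G.natDegree < n) :
    Polynomial.aevalAeval t θ G = ∑ i ∈ Finset.range n, aeval t (G.coeff i) * θ ^ i := by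
  conv_lhs => rw [Polynomial.as_sum_range_C_mul_X_pow' G hG, map_sum]
  refine Finset.sum_congr rfl fun i _ => ?_
  rw [map_mul, map_pow, Polynomial.aevalAeval_C, Polynomial.aevalAeval_Y]

theorem aeval_mem_adjoin (t : K) (p : ℂ[X]) :
    aeval t p ∈ IntermediateField.adjoin ℂ {t} :=
  (IntermediateField.mem_adjoin_simple_iff ℂ _).2 ⟨p, 1, by simp⟩

theorem exists_denom (x : IntermediateField.adjoin ℂ {t}) :
    ∃ r s : ℂ[X], aeval t s ≠ 0 ∧
      aeval t s * (x : K) = aeval t r := by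
  obtain ⟨r, s, h⟩ := (IntermediateField.mem_adjoin_simple_iff ℂ _).1 x.2
  by_cases hs : aeval t s = 0
  · exact ⟨0, 1, by simp, by rw [h, hs]; simp⟩
  · exact ⟨r, s, hs, by rw [h, mul_div_cancel₀ _ hs]⟩

/-- Linear dependence, with polynomial coefficients. -/
theorem exists_aeval_relation {n : ℕ}
    (hd : Module.finrank (IntermediateField.adjoin ℂ {t}) K = n) (hn : n ≠ 0)
    (v : Fin (n + 1) → K) :
    ∃ P : Fin (n + 1) → ℂ[X], P ≠ 0 ∧ ∑ i, aeval t (P i) * v i = 0 := by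
  have hfin : FiniteDimensional (IntermediateField.adjoin ℂ {t}) K :=
    FiniteDimensional.of_finrank_pos (by omega)
  have hdep : ¬ LinearIndependent (IntermediateField.adjoin ℂ {t}) v := fun h => by
    have := h.fintype_card_le_finrank
    rw [Fintype.card_fin, hd] at this
    omega
  obtain ⟨c, hc, i₀, hi₀⟩ := Fintype.not_linearIndependent_iff.1 hdep
  choose r s hs hr using fun i => exists_denom (c i)
  refine ⟨fun i => r i * ∏ j ∈ Finset.univ.erase i, s j, fun h => ?_, ?_⟩
  · have h1 := congrArg (aeval t) (congrFun h i₀)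
    rw [Pi.zero_apply, map_zero, map_mul, map_prod, ← hr i₀] at h1
    refine mul_ne_zero (mul_ne_zero (hs i₀) fun h => hi₀ (Subtype.ext h))
      (Finset.prod_ne_zero_iff.2 fun j _ => hs j) h1
  · have h1 : ∀ i, aeval t (r i * ∏ j ∈ Finset.univ.erase i, s j) * v i =
        (∏ j, aeval t (s j)) * (c i • v i) := fun i => by
      rw [← Finset.mul_prod_erase _ _ (Finset.mem_univ i), map_mul, ← hr i, map_prod,
        IntermediateField.smul_def, smul_eq_mul]
      ring
    rw [Finset.sum_congr rfl fun i _ => h1 i, ← Finset.mul_sum, hc, mul_zero]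

theorem isIntegral_of_finrank {n : ℕ}
    (hd : Module.finrank (IntermediateField.adjoin ℂ {t}) K = n) (hn : n ≠ 0) (θ : K) :
    IsIntegral (IntermediateField.adjoin ℂ {t}) θ := by
  have hfin : FiniteDimensional (IntermediateField.adjoin ℂ {t}) K :=
    FiniteDimensional.of_finrank_pos (by omega)
  exact Algebra.IsIntegral.isIntegral θ

/-- The degree divides the prime number three and is not one. -/
theorem minpoly_natDegree_of_notMem (hd : Module.finrank (IntermediateField.adjoin ℂ {t}) K = 3)
    (hθ : θ ∉ IntermediateField.adjoin ℂ {t}) :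
    (minpoly (IntermediateField.adjoin ℂ {t}) θ).natDegree = 3 := by
  have hi := isIntegral_of_finrank hd (by norm_num) θ
  have h1 := minpoly.degree_dvd hi
  rw [hd] at h1
  rcases (Nat.dvd_prime Nat.prime_three).1 h1 with h | h
  · obtain ⟨x, hx⟩ := minpoly.natDegree_eq_one_iff.1 h
    exact absurd (hx ▸ x.2) hθ
  · exact h

theorem adjoin_pair_eq_top (hd : Module.finrank (IntermediateField.adjoin ℂ {t}) K = 3)
    (hθ : θ ∉ IntermediateField.adjoin ℂ {t}) : IntermediateField.adjoin ℂ {t, θ} = ⊤ := by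
  have hi := isIntegral_of_finrank hd (by norm_num) θ
  have hfin : FiniteDimensional (IntermediateField.adjoin ℂ {t}) K :=
    FiniteDimensional.of_finrank_pos (by omega)
  have h1 : IntermediateField.adjoin (IntermediateField.adjoin ℂ {t}) {θ} = ⊤ :=
    IntermediateField.eq_of_le_of_finrank_eq le_top (by
      rw [IntermediateField.adjoin.finrank hi, IntermediateField.finrank_top', hd,
        minpoly_natDegree_of_notMem hd hθ])
  have h2 := IntermediateField.adjoin_adjoin_left ℂ (E := K) {t} {θ}
  rw [h1, Set.singleton_union] at h2
  rw [← h2]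
  rfl

theorem eq_zero_of_natDegree_lt_three (ht : Transcendental ℂ t)
    (hd : Module.finrank (IntermediateField.adjoin ℂ {t}) K = 3)
    (hθ : θ ∉ IntermediateField.adjoin ℂ {t}) {G : ℂ[X][X]} (hG : G.natDegree < 3)
    (h : Polynomial.aevalAeval t θ G = 0) : G = 0 := by
  let φ : ℂ[X] →+* IntermediateField.adjoin ℂ {t} :=
    (aeval (⟨t, IntermediateField.mem_adjoin_simple_self ℂ t⟩ :
      IntermediateField.adjoin ℂ {t})).toRingHom
  have hφ : ∀ p, ((φ p : IntermediateField.adjoin ℂ {t}) : K) = aeval t p := fun p => by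
    exact (Polynomial.aeval_algebraMap_apply K (⟨t, IntermediateField.mem_adjoin_simple_self ℂ t⟩ :
      IntermediateField.adjoin ℂ {t}) p).symm
  have hinj : Function.Injective φ := (injective_iff_map_eq_zero φ).2 fun p hp =>
    aeval_eq_zero_of_transcendental ht (by rw [← hφ, hp]; rfl)
  by_contra hne
  have h1 : aeval θ (G.map φ) = 0 := by
    rw [aevalAeval_eq_sum t θ hG] at h
    rw [Polynomial.aeval_eq_sum_range' (lt_of_le_of_lt Polynomial.natDegree_map_le hG), ← h]
    refine Finset.sum_congr rfl fun i _ => ?_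
    rw [Polynomial.coeff_map, IntermediateField.smul_def, hφ, smul_eq_mul]
  have h2 := minpoly.degree_le_of_ne_zero _ θ
    ((Polynomial.map_ne_zero_iff hinj).2 hne) h1
  have h3 := Polynomial.natDegree_le_natDegree h2
  rw [minpoly_natDegree_of_notMem hd hθ] at h3
  have := Polynomial.natDegree_map_le (f := φ) (p := G)
  omega

/-- A primitive polynomial relation of minimal degree divides all relations. -/
theorem isPrimitive_dvd_of_aevalAeval_eq_zero {n : ℕ}
    (hind : ∀ G : ℂ[X][X], G.natDegree < n → Polynomial.aevalAeval t θ G = 0 → G = 0)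
    {P : ℂ[X][X]} (hP : P.IsPrimitive) (hn : P.natDegree = n) (h0 : Polynomial.aevalAeval t θ P = 0)
    {G : ℂ[X][X]} (hG : Polynomial.aevalAeval t θ G = 0) : P ∣ G := by
  have hP0 : P ≠ 0 := hP.ne_zero
  induction hm : G.natDegree using Nat.strong_induction_on generalizing G with
  | _ m ih =>
    by_cases hGz : G = 0
    · rw [hGz]; exact dvd_zero _
    by_cases hlt : m < n
    · rw [hind G (hm ▸ hlt) hG]; exact dvd_zero _
    have hle : n ≤ m := not_lt.1 hlt
    set a := P.leadingCoeff with ha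
    set b := G.leadingCoeff with hb
    have ha0 : a ≠ 0 := Polynomial.leadingCoeff_ne_zero.2 hP0
    have hb0 : b ≠ 0 := Polynomial.leadingCoeff_ne_zero.2 hGz
    -- One step of pseudo-division lowers the degree. The factor `a` is removed afterwards by
    -- Gauss's lemma for the primitive polynomial `P`.
    have hdvd : P ∣ Polynomial.C a * G := by
      by_cases hz : Polynomial.C a * G - Polynomial.C b * Polynomial.X ^ (m - n) * P = 0
      · rw [sub_eq_zero.1 hz]; exact dvd_mul_left _ _
      have hd2 : (Polynomial.C b * Polynomial.X ^ (m - n) * P).natDegree = m := by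
        rw [Polynomial.natDegree_mul (mul_ne_zero (Polynomial.C_ne_zero.2 hb0)
          (pow_ne_zero _ Polynomial.X_ne_zero)) hP0, Polynomial.natDegree_C_mul_X_pow _ _ hb0, hn]
        omega
      have hd1 : (Polynomial.C a * G).natDegree = m := by
        rw [Polynomial.natDegree_C_mul ha0, hm]
      have hlt : (Polynomial.C a * G - Polynomial.C b * Polynomial.X ^ (m - n) * P).natDegree < m := by
        have hle : (Polynomial.C a * G - Polynomial.C b * Polynomial.X ^ (m - n) * P).natDegree ≤ m :=
          (Polynomial.natDegree_sub_le _ _).trans (by rw [hd1, hd2, max_self])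
        refine lt_of_le_of_ne hle fun he => hz ?_
        rw [← Polynomial.leadingCoeff_eq_zero, Polynomial.leadingCoeff, he, Polynomial.coeff_sub]
        have e1 : (Polynomial.C a * G).coeff m = a * b := by
          rw [Polynomial.coeff_C_mul, hb, Polynomial.leadingCoeff, hm]
        have e2 : (Polynomial.C b * Polynomial.X ^ (m - n) * P).coeff m = b * a := by
          have e3 := Polynomial.coeff_natDegree (p := Polynomial.C b * Polynomial.X ^ (m - n) * P)
          rwa [hd2, Polynomial.leadingCoeff_mul, Polynomial.leadingCoeff_mul_X_pow,
            Polynomial.leadingCoeff_C] at e3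
        rw [e1, e2, mul_comm, sub_self]
      have h3 := ih _ hlt (G := Polynomial.C a * G - Polynomial.C b * Polynomial.X ^ (m - n) * P)
        (by rw [map_sub, map_mul, map_mul, hG, h0]; simp) rfl
      have h4 := dvd_add h3 (dvd_mul_left P (Polynomial.C b * Polynomial.X ^ (m - n)))
      rwa [sub_add_cancel] at h4
    refine hP.dvd_of_fraction_map_dvd_fraction_map (K := RatFunc ℂ) ?_
    have h5 := Polynomial.map_dvd (algebraMap ℂ[X] (RatFunc ℂ)) hdvd
    rw [Polynomial.map_mul, Polynomial.map_C] at h5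
    refine (IsUnit.dvd_mul_left (Polynomial.isUnit_C.2 (isUnit_iff_ne_zero.2 ?_))).1 h5
    exact (map_ne_zero_iff _ (FaithfulSMul.algebraMap_injective _ _)).2 ha0

theorem mem_adjoin_of_mem_adjoin {t' : K}
    (hd : Module.finrank (IntermediateField.adjoin ℂ {t}) K = 3)
    (hd' : Module.finrank (IntermediateField.adjoin ℂ {t'}) K = 3)
    (h : t' ∈ IntermediateField.adjoin ℂ {t}) :
    IntermediateField.adjoin ℂ {t'} = IntermediateField.adjoin ℂ {t} := by
  have hfin : FiniteDimensional (IntermediateField.adjoin ℂ {t'}) K :=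
    FiniteDimensional.of_finrank_pos (by omega)
  exact IntermediateField.eq_of_le_of_finrank_eq'
    (IntermediateField.adjoin_simple_le_iff.2 h) (hd'.trans hd.symm)

/-- The powers `1, t', t'², t'³` are dependent over `ℂ(t)`; clear denominators and divide by the
content. -/
theorem exists_natDegree_le_three {t' : K} (ht : Transcendental ℂ t)
    (hd : Module.finrank (IntermediateField.adjoin ℂ {t}) K = 3) :
    ∃ P : ℂ[X][X], P.IsPrimitive ∧ P.natDegree ≤ 3 ∧ Polynomial.aevalAeval t t' P = 0 := by
  obtain ⟨p, hp0, hp⟩ := exists_aeval_relation hd (by norm_num) (fun i => t' ^ (i : ℕ))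
  let P : ℂ[X][X] := ∑ i : Fin 4, Polynomial.C (p i) * Polynomial.X ^ (i : ℕ)
  have hP0 : P ≠ 0 := by
    intro h
    refine hp0 (funext fun i => ?_)
    have := congrArg (fun Q : ℂ[X][X] => Q.coeff i) h
    simpa [P, Polynomial.finsetSum_coeff, Polynomial.coeff_C_mul_X_pow, Fin.val_inj] using this
  have hPd : P.natDegree ≤ 3 := Polynomial.natDegree_sum_le_of_forall_le _ _ fun i _ =>
    (Polynomial.natDegree_C_mul_X_pow_le _ _).trans (by omega)
  have hPv : Polynomial.aevalAeval t t' P = 0 := by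
    rw [← hp, map_sum]
    exact Finset.sum_congr rfl fun i _ => by
      rw [map_mul, map_pow, Polynomial.aevalAeval_C, Polynomial.aevalAeval_Y]
  let _ : NormalizedGCDMonoid ℂ[X] := Classical.choice inferInstance
  refine ⟨P.primPart, P.isPrimitive_primPart, by rwa [Polynomial.natDegree_primPart], ?_⟩
  rw [P.eq_C_content_mul_primPart, map_mul, Polynomial.aevalAeval_C, mul_eq_zero] at hPv
  refine hPv.resolve_left fun h => hP0 ?_
  rw [← Polynomial.content_eq_zero_iff]
  exact aeval_eq_zero_of_transcendental ht h

/-- Two functions of degree three, neither of which is a function of the other, satisfy a relation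
of bidegree `(3, 3)`. -/
theorem exists_relation_three_three {t' : K} (ht : Transcendental ℂ t)
    (ht' : Transcendental ℂ t')
    (hd : Module.finrank (IntermediateField.adjoin ℂ {t}) K = 3)
    (hd' : Module.finrank (IntermediateField.adjoin ℂ {t'}) K = 3)
    (h : t' ∉ IntermediateField.adjoin ℂ {t}) :
    ∃ p : Fin 4 → ℂ[X], (∀ i, (p i).natDegree ≤ 3) ∧ p 3 ≠ 0 ∧
      ∑ i : Fin 4, aeval t (p i) * t' ^ (i : ℕ) = 0 := by
  obtain ⟨P, hP, hPd, hPv⟩ := exists_natDegree_le_three (t' := t') ht hd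
  have hd3 : P.natDegree = 3 := by
    by_contra hne
    exact hP.ne_zero (eq_zero_of_natDegree_lt_three ht hd h (by omega) hPv)
  obtain ⟨G, hG, hGd, hGv⟩ := exists_natDegree_le_three (t' := t) ht' hd'
  -- The relation `P` is cubic in `t'` and divides the analogous relation that is cubic in `t`. This
  -- bounds its degree in `t` as well.
  obtain ⟨q, hq⟩ := isPrimitive_dvd_of_aevalAeval_eq_zero
    (fun G hG hGv => eq_zero_of_natDegree_lt_three ht hd h hG hGv) hP hd3 hPv
    (G := Polynomial.Bivariate.swap G) (by rwa [Polynomial.Bivariate.aevalAeval_swap])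
  have hG' : G = Polynomial.Bivariate.swap P * Polynomial.Bivariate.swap q := by
    rw [← map_mul, ← hq, Polynomial.Bivariate.swap_swap_apply]
  have hsd : (Polynomial.Bivariate.swap P).natDegree ≤ 3 :=
    (Polynomial.natDegree_le_of_dvd ⟨_, hG'⟩ hG.ne_zero).trans hGd
  refine ⟨fun i => P.coeff i, fun i => ?_, ?_, ?_⟩
  · rw [Polynomial.natDegree_le_iff_coeff_eq_zero]
    intro k hk
    have h1 : ∀ Q : ℂ[X][X], ∀ i k : ℕ,
        (Q.coeff i).coeff k = ((Polynomial.Bivariate.swap Q).coeff k).coeff i := by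
      intro Q i k
      induction Q using Polynomial.induction_on' with
      | add p q hp hq => simp only [Polynomial.coeff_add, map_add, hp, hq]
      | monomial n f =>
        rw [Polynomial.Bivariate.swap_monomial, Polynomial.coeff_mul_C, Polynomial.coeff_map,
          Polynomial.coeff_C_mul_X_pow, Polynomial.coeff_monomial]
        simp only [eq_comm]
        split_ifs <;> simp
    rw [h1, Polynomial.coeff_eq_zero_of_natDegree_lt (lt_of_le_of_lt hsd hk), Polynomial.coeff_zero]
  · change P.coeff 3 ≠ 0
    rw [← hd3]
    exact Polynomial.leadingCoeff_ne_zero.2 hP.ne_zero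
  · rw [aevalAeval_eq_sum t t' (n := 4) (by omega), Finset.sum_range] at hPv
    exact hPv

end RelationDegree

/-! ### Uniqueness of the trigonal map in genus six -/

section TrigonalUniqueness

variable {K : Type} [Field K] [Algebra ℂ K] {t θ : K}

theorem aeval_inv_reflect (ht : t ≠ 0) {p : ℂ[X]} {N : ℕ} (hp : p.natDegree ≤ N) :
    aeval t⁻¹ (p.reflect N) = t⁻¹ ^ N * aeval t p := by
  let _ : Invertible t := invertibleOfNonzero ht
  have h := Polynomial.eval₂_reflect_mul_pow (algebraMap ℂ K) t N p hp
  rw [invOf_eq_inv] at h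
  change aeval t⁻¹ (p.reflect N) * t ^ N = aeval t p at h
  rw [← h, mul_comm, mul_assoc, ← mul_pow, mul_inv_cancel₀ ht, one_pow, mul_one]

/-- The products of a root of a cubic polynomial with the partial leading parts are integral. -/
theorem mem_integralOver_of_root {s : Set K} {p : Fin 4 → K} (hp : ∀ i, p i ∈ integralOver s)
    (h : p 3 * θ ^ 3 + p 2 * θ ^ 2 + p 1 * θ + p 0 = 0) :
    p 3 * θ ∈ integralOver s ∧ p 3 * θ ^ 2 + p 2 * θ ∈ integralOver s := by
  by_cases hθ : θ = 0
  · subst hθ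
    simp
  constructor
  · refine mem_integralOver_of_cubic (hp 2) (mul_mem (hp 1) (hp 3))
      (mul_mem (hp 0) (pow_mem (hp 3) 2)) ?_
    linear_combination p 3 ^ 2 * h
  · have h1 : p 0 / θ ∈ integralOver s := by
      refine mem_integralOver_of_cubic (hp 1) (mul_mem (hp 0) (hp 2))
        (mul_mem (pow_mem (hp 0) 2) (hp 3)) ?_
      field_simp
      linear_combination p 0 ^ 2 * h
    have h2 : p 3 * θ ^ 2 + p 2 * θ = -(p 1 + p 0 / θ) := by
      field_simp
      linear_combination h
    rw [h2]
    exact neg_mem (add_mem (hp 1) h1)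

theorem sum_mul_pow_fin_four {K : Type*} [CommRing K] (p : Fin 4 → K) (θ : K) :
    ∑ i : Fin 4, p i * θ ^ (i : ℕ) = p 3 * θ ^ 3 + p 2 * θ ^ 2 + p 1 * θ + p 0 := by
  simp only [Fin.sum_univ_four, Fin.val_zero, Fin.val_one, Fin.val_two,
    show ((3 : Fin 4) : ℕ) = 3 from rfl]
  ring

/-- A curve of bidegree `(3, 3)` has arithmetic genus four. The relation gives a lattice of type `𝒪
⊕ 𝒪(-3)²` inside the direct image of the structure sheaf, and since the ranks agree, its `H¹` maps
onto `H¹` of the curve. So the four classes of `t⁻¹ w i` and `t⁻² w i` span. -/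
theorem finrank_cechH1_le_four (ht : Transcendental ℂ t)
    (hd : Module.finrank (IntermediateField.adjoin ℂ {t}) K = 3)
    (hθ : θ ∉ IntermediateField.adjoin ℂ {t}) {p : Fin 4 → ℂ[X]}
    (hp : ∀ i, (p i).natDegree ≤ 3) (hp3 : p 3 ≠ 0)
    (h : ∑ i : Fin 4, aeval t (p i) * θ ^ (i : ℕ) = 0) :
    Module.finrank ℂ (CechH1 t) ≤ 4 := by
  have ht0 := transcendental_ne_zero ht
  let u := Units.mk0 t ht0
  have h5 : (u : K) = t := rfl
  have hL₀ : integralOver {t} ≤ integralOver {t, t⁻¹} := integralOver_mono (by simp)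
  have hL₁ : integralOver {t⁻¹} ≤ integralOver {t, t⁻¹} := integralOver_mono (by simp)
  rw [sum_mul_pow_fin_four] at h
  let w : Fin 2 → K := ![aeval t (p 3) * θ,
    aeval t (p 3) * θ ^ 2 + aeval t (p 2) * θ]
  have hw₀ : ∀ i, w i ∈ integralOver {t} := by
    obtain ⟨h1, h2⟩ := mem_integralOver_of_root (s := {t})
      (p := fun i => aeval t (p i)) (fun i => aeval_mem_integralOver t _) h
    intro i
    fin_cases i
    exacts [h1, h2]
  have hw₁ : ∀ i, t⁻¹ ^ 3 * w i ∈ integralOver {t⁻¹} := by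
    obtain ⟨h1, h2⟩ := mem_integralOver_of_root (s := {t⁻¹}) (θ := θ)
      (p := fun i => t⁻¹ ^ 3 * aeval t (p i)) (fun i => by
        rw [← aeval_inv_reflect ht0 (hp i)]
        exact aeval_mem_integralOver _ _) (by linear_combination t⁻¹ ^ 3 * h)
    intro i
    fin_cases i
    · have : t⁻¹ ^ 3 * w 0 = t⁻¹ ^ 3 * aeval t (p 3) * θ := (mul_assoc _ _ _).symm
      exact this ▸ h1
    · have : t⁻¹ ^ 3 * w 1 = t⁻¹ ^ 3 * aeval t (p 3) * θ ^ 2 +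
        t⁻¹ ^ 3 * aeval t (p 2) * θ := by
          change t⁻¹ ^ 3 * (_ + _) = _
          ring
      exact this ▸ h2
  let e : Fin 2 → Fin 2 → Subalgebra.toSubmodule (integralOver {t, t⁻¹}) := fun i j =>
    ⟨t⁻¹ ^ ((j : ℕ) + 1) * w i, (integralOver {t, t⁻¹}).mul_mem
      (pow_mem (hL₁ (self_mem_integralOver _)) _) (hL₀ (hw₀ i))⟩
  let N := (Subalgebra.toSubmodule (integralOver {t}) ⊔
      Subalgebra.toSubmodule (integralOver {t⁻¹})).submoduleOf
        (Subalgebra.toSubmodule (integralOver {t, t⁻¹}))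
  let σ : (Fin 2 × Fin 2 → ℂ) →ₗ[ℂ] CechH1 t :=
    N.mkQ ∘ₗ Fintype.linearCombination ℂ (fun k : Fin 2 × Fin 2 => e k.1 k.2)
  have hσ : ∀ c : Fin 2 × Fin 2 → ℂ,
      ((Fintype.linearCombination ℂ (fun k : Fin 2 × Fin 2 => e k.1 k.2) c :
        Subalgebra.toSubmodule (integralOver {t, t⁻¹})) : K) =
      ∑ i, laurentEval u (∑ j : Fin 2, LaurentPolynomial.C (c (i, j)) *
        LaurentPolynomial.T (-((j : ℕ) + 1))) * w i := by
    intro c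
    rw [Fintype.linearCombination_apply, Fintype.sum_prod_type, Submodule.coe_sum]
    refine Finset.sum_congr rfl fun i _ => ?_
    rw [Submodule.coe_sum, map_sum, Finset.sum_mul]
    refine Finset.sum_congr rfl fun j _ => ?_
    rw [Submodule.coe_smul, map_mul, laurentEval_T, ← Polynomial.toLaurent_C,
      laurentEval_toLaurent, Polynomial.aeval_C, Algebra.smul_def, mul_assoc]
    congr 1
    change t⁻¹ ^ ((j : ℕ) + 1) * w i = _
    congr 1
    rw [zpow_neg, ← Nat.cast_succ, zpow_natCast, inv_pow]
    rfl
  have hden : ∀ z : K, ∃ (d a : ℂ[X]) (b : Fin 2 → ℂ[X]), d ≠ 0 ∧ aeval t d * z =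
      aeval t a + ∑ i, aeval t (b i) * w i := by
    intro z
    obtain ⟨P, hP0, hP⟩ := exists_aeval_relation hd (by norm_num) ![1, θ, θ ^ 2, z]
    rw [Fin.sum_univ_four] at hP
    change aeval t (P 0) * 1 + aeval t (P 1) * θ +
      aeval t (P 2) * θ ^ 2 + aeval t (P 3) * z = 0 at hP
    have hP3 : P 3 ≠ 0 := by
      intro h3
      refine hP0 ?_
      let G : ℂ[X][X] := ∑ i : Fin 3, Polynomial.C (P i.castSucc) * Polynomial.X ^ (i : ℕ)
      have hG : G = 0 := by
        refine eq_zero_of_natDegree_lt_three ht hd hθ (Nat.lt_succ_of_le ?_) ?_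
        · exact Polynomial.natDegree_sum_le_of_forall_le _ _ fun i _ =>
            (Polynomial.natDegree_C_mul_X_pow_le _ _).trans (by omega)
        · rw [h3, map_zero, zero_mul, add_zero] at hP
          simp only [G, Fin.sum_univ_three, map_add, map_mul, map_pow, Polynomial.aevalAeval_C,
            Polynomial.aevalAeval_Y]
          rw [← hP]
          simp
      funext i
      refine Fin.lastCases h3 (fun i => ?_) i
      have := congrArg (fun Q : ℂ[X][X] => Q.coeff i) hG
      simpa [G, Polynomial.finsetSum_coeff, Polynomial.coeff_C_mul_X_pow, Fin.val_inj] using this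
    refine ⟨p 3 ^ 2 * P 3, -(p 3 ^ 2 * P 0), ![P 2 * p 2 - p 3 * P 1, -(P 2 * p 3)],
      mul_ne_zero (pow_ne_zero _ hp3) hP3, ?_⟩
    simp only [Fin.sum_univ_two, w, Matrix.cons_val_zero, Matrix.cons_val_one, map_mul, map_pow,
      map_neg, map_sub]
    linear_combination (aeval t (p 3)) ^ 2 * hP
  have hsurj : Function.Surjective σ := by
    intro x
    obtain ⟨⟨z, hz⟩, rfl⟩ := Submodule.Quotient.mk_surjective _ x
    obtain ⟨d, a, b, hd0, hab⟩ := hden z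
    obtain ⟨n, hn⟩ := exists_pow_mul_mem_integralOver ht0 hz
    obtain ⟨d', hd', hnd⟩ := Polynomial.exists_eq_pow_rootMultiplicity_mul_and_not_dvd d hd0 0
    rw [Polynomial.C_0, sub_zero] at hd' hnd
    set m := Polynomial.rootMultiplicity 0 d
    -- The denominator of `z` with respect to the lattice is `t ^ m * d'` with `d'` prime to `t`.
    -- This Bézout identity writes `z` as a function on the first chart plus a combination of the
    -- lattice with Laurent polynomials as coefficients.
    obtain ⟨f, g, hfg⟩ : IsCoprime (Polynomial.X ^ n) d' :=
      IsCoprime.pow_left ((Polynomial.irreducible_X).coprime_iff_not_dvd.2 hnd)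
    have hz1 : z = aeval t f * (t ^ n * z) +
        (laurentEval u (LaurentPolynomial.T (-m) * Polynomial.toLaurent (g * a)) +
        ∑ i, laurentEval u (LaurentPolynomial.T (-m) * Polynomial.toLaurent (g * b i)) * w i) := by
      simp only [map_mul, laurentEval_T, laurentEval_toLaurent, zpow_neg, zpow_natCast, h5]
      have e1 : (t ^ m)⁻¹ * (aeval t g * aeval t a) +
          ∑ i, (t ^ m)⁻¹ * (aeval t g * aeval t (b i)) * w i =
          (t ^ m)⁻¹ * aeval t g *
            (aeval t a + ∑ i, aeval t (b i) * w i) := by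
        rw [mul_add, Finset.mul_sum]
        congr 1
        · ring
        · exact Finset.sum_congr rfl fun _ _ => by ring
      have e2 := congrArg (aeval t) hfg
      rw [map_add, map_mul, map_mul, map_pow, Polynomial.aeval_X, map_one] at e2
      rw [e1, ← hab, hd', map_mul, map_pow, Polynomial.aeval_X]
      have e3 : (t ^ m)⁻¹ * t ^ m = 1 := inv_mul_cancel₀ (pow_ne_zero _ ht0)
      linear_combination (-z) * e2 - aeval t g * aeval t d' * z * e3
    obtain ⟨P, P', c', hP⟩ := exists_laurent_split 0
      (LaurentPolynomial.T (-m) * Polynomial.toLaurent (g * a))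
    choose Q Q' c hQ using fun i => exists_laurent_split 2
      (LaurentPolynomial.T (-m) * Polynomial.toLaurent (g * b i))
    refine ⟨fun k => c k.1 k.2, ?_⟩
    symm
    refine (Submodule.Quotient.eq N).2 ?_
    change z - ((Fintype.linearCombination ℂ (fun k : Fin 2 × Fin 2 => e k.1 k.2)
      (fun k => c k.1 k.2) : Subalgebra.toSubmodule (integralOver {t, t⁻¹})) : K) ∈
        Subalgebra.toSubmodule (integralOver {t}) ⊔ Subalgebra.toSubmodule (integralOver {t⁻¹})
    have h4 : (u : K) ^ (-3 : ℤ) = t⁻¹ ^ 3 := by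
      rw [h5, zpow_neg, inv_pow]
      exact congrArg _ (zpow_natCast t 3)
    have h1 : z - ((Fintype.linearCombination ℂ (fun k : Fin 2 × Fin 2 => e k.1 k.2)
        (fun k => c k.1 k.2) : Subalgebra.toSubmodule (integralOver {t, t⁻¹})) : K) =
        (aeval t f * (t ^ n * z) +
          (aeval t P + ∑ i, aeval t (Q i) * w i)) +
        (aeval t⁻¹ (Polynomial.X * P') +
          ∑ i, aeval t⁻¹ (Q' i) * (t⁻¹ ^ 3 * w i)) := by
      have hm : ∀ i, laurentEval u (LaurentPolynomial.T (-m) * Polynomial.toLaurent (g * b i)) * w i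
          = laurentEval u (∑ j : Fin 2,
          LaurentPolynomial.C (c i j) * LaurentPolynomial.T (-((j : ℕ) + 1))) * w i +
          (aeval t (Q i) * w i + aeval t⁻¹ (Q' i) * (t⁻¹ ^ 3 * w i)) := by
        intro i
        rw [hQ i, map_add, map_add, map_mul, laurentEval_toLaurent, laurentEval_invert,
          laurentEval_T, Nat.cast_ofNat, show (-(2 + 1) : ℤ) = -3 by norm_num, h4, h5]
        ring
      have hl : laurentEval u (LaurentPolynomial.T (-m) * Polynomial.toLaurent (g * a)) =
          aeval t P + aeval t⁻¹ (Polynomial.X * P') := by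
        rw [hP, Finset.univ_eq_empty, Finset.sum_empty, add_zero, map_add, map_mul,
          laurentEval_toLaurent, laurentEval_invert, laurentEval_T, map_mul, Polynomial.aeval_X, h5]
        simp
      rw [hl, Finset.sum_congr rfl fun i _ => hm i, Finset.sum_add_distrib,
        Finset.sum_add_distrib] at hz1
      rw [hσ]
      linear_combination hz1
    rw [h1]
    refine Submodule.add_mem_sup ((Subalgebra.mem_toSubmodule _).2 ?_)
      ((Subalgebra.mem_toSubmodule _).2 ?_)
    · exact add_mem (mul_mem (aeval_mem_integralOver t f) hn)
        (add_mem (aeval_mem_integralOver t P)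
          (sum_mem fun i _ => mul_mem (aeval_mem_integralOver t _) (hw₀ i)))
    · exact add_mem (aeval_mem_integralOver _ _)
          (sum_mem fun i _ => mul_mem (aeval_mem_integralOver _ _) (hw₁ i))
  have := LinearMap.finrank_le_finrank_of_surjective hsurj
  rwa [Module.finrank_fintype_fun_eq_card, Fintype.card_prod, Fintype.card_fin] at this

/-- On a curve of genus six all functions of degree three differ by Möbius transformations
(first step). -/
theorem mem_adjoin_of_finrank_cechH1 {t' : K} (ht : Transcendental ℂ t)
    (ht' : Transcendental ℂ t')
    (hd : Module.finrank (IntermediateField.adjoin ℂ {t}) K = 3)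
    (hd' : Module.finrank (IntermediateField.adjoin ℂ {t'}) K = 3)
    (hg : Module.finrank ℂ (CechH1 t) = 6) : t' ∈ IntermediateField.adjoin ℂ {t} := by
  by_contra h
  obtain ⟨p, hp, hp3, hrel⟩ := exists_relation_three_three ht ht' hd hd' h
  have := finrank_cechH1_le_four ht hd h hp hp3 hrel
  omega

/-- As a rational function of `t`, the element `t'` generates the whole field, so numerator and
denominator have degree at most one. The determinant does not vanish because `t'` is not constant.
-/
theorem exists_moebius_of_adjoin_eq {t' : K} (ht : Transcendental ℂ t)
    (ht' : Transcendental ℂ t')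
    (h : IntermediateField.adjoin ℂ {t'} = IntermediateField.adjoin ℂ {t}) :
    ∃ a b c d : ℂ, a * d - b * c ≠ 0 ∧
      t' * (algebraMap ℂ K c * t + algebraMap ℂ K d) = algebraMap ℂ K a * t + algebraMap ℂ K b := by
  have hinj : Function.Injective (aeval (R := ℂ) t) :=
    (injective_iff_map_eq_zero _).2 fun p hp => aeval_eq_zero_of_transcendental ht hp
  let φ : RatFunc ℂ →ₐ[ℂ] K := RatFunc.liftAlgHom (aeval t)
    (nonZeroDivisors_le_comap_nonZeroDivisors_of_injective _ hinj)
  have hφ : ∀ p : ℂ[X], φ (algebraMap ℂ[X] (RatFunc ℂ) p) = aeval t p := fun p => by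
    have := RatFunc.liftAlgHom_apply_div (aeval t)
      (nonZeroDivisors_le_comap_nonZeroDivisors_of_injective _ hinj) p 1
    simpa using this
  have hX : φ RatFunc.X = t := by rw [← RatFunc.algebraMap_X, hφ, Polynomial.aeval_X]
  have hφtop : IntermediateField.map φ ⊤ = IntermediateField.adjoin ℂ {t} := by
    rw [← RatFunc.adjoin_X, IntermediateField.adjoin_map, Set.image_singleton, hX]
  obtain ⟨f, -, hf⟩ : t' ∈ IntermediateField.map φ ⊤ := by
    rw [hφtop, ← h]
    exact IntermediateField.mem_adjoin_simple_self ℂ t'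
  change φ f = t' at hf
  have hftop : IntermediateField.adjoin ℂ {f} = ⊤ := by
    refine IntermediateField.map_injective φ ?_
    rw [hφtop, IntermediateField.adjoin_map, Set.image_singleton, hf, h]
  have hmax := RatFunc.finrank_eq_max_natDegree f
  rw [hftop, IntermediateField.finrank_top] at hmax
  have hn : f.num.natDegree ≤ 1 := hmax ▸ le_max_left _ _
  have hdn : f.denom.natDegree ≤ 1 := hmax ▸ le_max_right _ _
  have hev : t' * aeval t f.denom = aeval t f.num := by
    rw [← hf, ← hφ, ← hφ, ← map_mul]
    congr 1
    exact (div_eq_iff (RatFunc.algebraMap_ne_zero f.denom_ne_zero)).1 f.num_div_denom |>.symm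
  rw [Polynomial.eq_X_add_C_of_natDegree_le_one hn, Polynomial.eq_X_add_C_of_natDegree_le_one hdn]
    at hev
  simp only [map_add, map_mul, Polynomial.aeval_C, Polynomial.aeval_X] at hev
  set a := f.num.coeff 1
  set b := f.num.coeff 0
  set c := f.denom.coeff 1 with hc
  set d := f.denom.coeff 0 with hdd
  refine ⟨a, b, c, d, fun hdet => ?_, hev⟩
  have hdet' := congrArg (algebraMap ℂ K) hdet
  simp only [map_sub, map_mul, map_zero] at hdet'
  have halg : ∀ x y : ℂ, y ≠ 0 → t' * algebraMap ℂ K y ≠ algebraMap ℂ K x := by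
    intro x y hy hxy
    refine ht' ?_
    have : t' = algebraMap ℂ K (x / y) := by
      rw [map_div₀, ← hxy, mul_div_cancel_right₀ _ ((_root_.map_ne_zero _).2 hy)]
    rw [this]
    exact isAlgebraic_algebraMap _
  have hne : algebraMap ℂ K c * t + algebraMap ℂ K d ≠ 0 := by
    intro h0
    have h1 : aeval t f.denom = 0 := by
      rw [Polynomial.eq_X_add_C_of_natDegree_le_one hdn]
      simpa using h0
    exact f.denom_ne_zero (aeval_eq_zero_of_transcendental ht h1)
  by_cases hc0 : c = 0
  · have hd0 : d ≠ 0 := by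
      intro hd0
      rw [hc0, hd0] at hne
      simp at hne
    have ha0 : a = 0 := by
      rw [hc0, mul_zero, sub_zero] at hdet
      exact (mul_eq_zero.1 hdet).resolve_right hd0
    rw [hc0, ha0] at hev
    exact halg b d hd0 (by simpa using hev)
  · refine halg a c hc0 (mul_right_cancel₀ hne ?_)
    linear_combination algebraMap ℂ K c * hev - hdet'

/-- On a curve of genus six all functions of degree three differ by Möbius transformations. -/
theorem exists_moebius {t' : K} (ht : Transcendental ℂ t) (ht' : Transcendental ℂ t')
    (hd : Module.finrank (IntermediateField.adjoin ℂ {t}) K = 3)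
    (hd' : Module.finrank (IntermediateField.adjoin ℂ {t'}) K = 3)
    (hg : Module.finrank ℂ (CechH1 t) = 6) :
    ∃ a b c d : ℂ, a * d - b * c ≠ 0 ∧
      t' * (algebraMap ℂ K c * t + algebraMap ℂ K d) = algebraMap ℂ K a * t + algebraMap ℂ K b :=
  exists_moebius_of_adjoin_eq ht ht' (mem_adjoin_of_mem_adjoin hd hd'
    (mem_adjoin_of_finrank_cechH1 ht ht' hd hd' hg))

end TrigonalUniqueness

/-! ### Cubic rings of binary cubic forms -/

section CubicRing

/-- The cubic ring of the binary cubic form with coefficients `f 0, …, f 3`: a free module with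
basis `1, ω₁, ω₂`, where `ω₁ = f₀ θ` and `ω₂ = f₀ θ ^ 2 + f₁ θ` for the root `θ` of the form. -/
@[ext]
structure CubicRing {S : Type*} (f : Fin 4 → S) where
  c₀ : S
  c₁ : S
  c₂ : S

namespace CubicRing

variable {S S' : Type*} [CommRing S] [CommRing S'] {f : Fin 4 → S}

instance : Zero (CubicRing f) := ⟨⟨0, 0, 0⟩⟩
instance : One (CubicRing f) := ⟨⟨1, 0, 0⟩⟩
instance : Add (CubicRing f) := ⟨fun x y => ⟨x.c₀ + y.c₀, x.c₁ + y.c₁, x.c₂ + y.c₂⟩⟩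
instance : Neg (CubicRing f) := ⟨fun x => ⟨-x.c₀, -x.c₁, -x.c₂⟩⟩
instance : Mul (CubicRing f) := ⟨fun x y =>
  ⟨x.c₀ * y.c₀ - f 0 * f 3 * (x.c₁ * y.c₂ + x.c₂ * y.c₁) - f 1 * f 3 * (x.c₂ * y.c₂),
    x.c₀ * y.c₁ + x.c₁ * y.c₀ - f 1 * (x.c₁ * y.c₁) - f 2 * (x.c₁ * y.c₂ + x.c₂ * y.c₁) -
      f 3 * (x.c₂ * y.c₂),
    x.c₀ * y.c₂ + x.c₂ * y.c₀ + f 0 * (x.c₁ * y.c₁) - f 2 * (x.c₂ * y.c₂)⟩⟩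

@[simp] theorem zero_c₀ : (0 : CubicRing f).c₀ = 0 := rfl
@[simp] theorem zero_c₁ : (0 : CubicRing f).c₁ = 0 := rfl
@[simp] theorem zero_c₂ : (0 : CubicRing f).c₂ = 0 := rfl
@[simp] theorem one_c₀ : (1 : CubicRing f).c₀ = 1 := rfl
@[simp] theorem one_c₁ : (1 : CubicRing f).c₁ = 0 := rfl
@[simp] theorem one_c₂ : (1 : CubicRing f).c₂ = 0 := rfl
@[simp] theorem add_c₀ (x y : CubicRing f) : (x + y).c₀ = x.c₀ + y.c₀ := rfl
@[simp] theorem add_c₁ (x y : CubicRing f) : (x + y).c₁ = x.c₁ + y.c₁ := rfl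
@[simp] theorem add_c₂ (x y : CubicRing f) : (x + y).c₂ = x.c₂ + y.c₂ := rfl
@[simp] theorem neg_c₀ (x : CubicRing f) : (-x).c₀ = -x.c₀ := rfl
@[simp] theorem neg_c₁ (x : CubicRing f) : (-x).c₁ = -x.c₁ := rfl
@[simp] theorem neg_c₂ (x : CubicRing f) : (-x).c₂ = -x.c₂ := rfl
@[simp] theorem mul_c₀ (x y : CubicRing f) : (x * y).c₀ = x.c₀ * y.c₀ -
    f 0 * f 3 * (x.c₁ * y.c₂ + x.c₂ * y.c₁) - f 1 * f 3 * (x.c₂ * y.c₂) := rfl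
@[simp] theorem mul_c₁ (x y : CubicRing f) : (x * y).c₁ = x.c₀ * y.c₁ + x.c₁ * y.c₀ -
    f 1 * (x.c₁ * y.c₁) - f 2 * (x.c₁ * y.c₂ + x.c₂ * y.c₁) - f 3 * (x.c₂ * y.c₂) := rfl
@[simp] theorem mul_c₂ (x y : CubicRing f) : (x * y).c₂ = x.c₀ * y.c₂ + x.c₂ * y.c₀ +
    f 0 * (x.c₁ * y.c₁) - f 2 * (x.c₂ * y.c₂) := rfl

instance : CommRing (CubicRing f) where
  add_assoc x y z := by ext <;> simp [add_assoc]
  zero_add x := by ext <;> simp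
  add_zero x := by ext <;> simp
  add_comm x y := by ext <;> simp [add_comm]
  neg_add_cancel x := by ext <;> simp
  mul_assoc x y z := by ext <;> simp <;> ring
  one_mul x := by ext <;> simp
  mul_one x := by ext <;> simp
  mul_comm x y := by ext <;> simp <;> ring
  left_distrib x y z := by ext <;> simp <;> ring
  right_distrib x y z := by ext <;> simp <;> ring
  zero_mul x := by ext <;> simp
  mul_zero x := by ext <;> simp
  nsmul := nsmulRec
  zsmul := zsmulRec

/-- The structure map of the cubic ring. -/
def base : S →+* CubicRing f where
  toFun s := ⟨s, 0, 0⟩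
  map_one' := rfl
  map_zero' := rfl
  map_add' s s' := by ext <;> simp
  map_mul' s s' := by ext <;> simp

@[simp] theorem base_c₀ (s : S) : (base s : CubicRing f).c₀ = s := rfl
@[simp] theorem base_c₁ (s : S) : (base s : CubicRing f).c₁ = 0 := rfl
@[simp] theorem base_c₂ (s : S) : (base s : CubicRing f).c₂ = 0 := rfl

/-- Base change of cubic rings. -/
def map (φ : S →+* S') {g : Fin 4 → S'} (h : ∀ i, φ (f i) = g i) : CubicRing f →+* CubicRing g where
  toFun x := ⟨φ x.c₀, φ x.c₁, φ x.c₂⟩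
  map_one' := by ext <;> simp
  map_zero' := by ext <;> simp
  map_add' x y := by ext <;> simp
  map_mul' x y := by ext <;> simp [h]

@[simp] theorem map_c₀ (φ : S →+* S') {g : Fin 4 → S'} (h : ∀ i, φ (f i) = g i) (x : CubicRing f) :
    (map φ h x).c₀ = φ x.c₀ := rfl
@[simp] theorem map_c₁ (φ : S →+* S') {g : Fin 4 → S'} (h : ∀ i, φ (f i) = g i) (x : CubicRing f) :
    (map φ h x).c₁ = φ x.c₁ := rfl
@[simp] theorem map_c₂ (φ : S →+* S') {g : Fin 4 → S'} (h : ∀ i, φ (f i) = g i) (x : CubicRing f) :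
    (map φ h x).c₂ = φ x.c₂ := rfl

/-- The homomorphism given by a root of the cubic form. -/
def lift (φ : S →+* S') (θ : S')
    (h : φ (f 0) * θ ^ 3 + φ (f 1) * θ ^ 2 + φ (f 2) * θ + φ (f 3) = 0) : CubicRing f →+* S' where
  toFun x := φ x.c₀ + φ x.c₁ * (φ (f 0) * θ) + φ x.c₂ * (φ (f 0) * θ ^ 2 + φ (f 1) * θ)
  map_one' := by simp
  map_zero' := by simp
  map_add' x y := by simp; ring
  map_mul' x y := by
    simp only [mul_c₀, mul_c₁, mul_c₂, map_add, map_mul, map_sub]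
    linear_combination (-(φ (f 0) * (φ x.c₁ * φ y.c₂ + φ x.c₂ * φ y.c₁)) -
      φ x.c₂ * φ y.c₂ * (φ (f 0) * θ + φ (f 1))) * h

theorem lift_apply (φ : S →+* S') (θ : S')
    (h : φ (f 0) * θ ^ 3 + φ (f 1) * θ ^ 2 + φ (f 2) * θ + φ (f 3) = 0) (x : CubicRing f) :
    lift φ θ h x = φ x.c₀ + φ x.c₁ * (φ (f 0) * θ) +
      φ x.c₂ * (φ (f 0) * θ ^ 2 + φ (f 1) * θ) := rfl

theorem lift_base (φ : S →+* S') (θ : S')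
    (h : φ (f 0) * θ ^ 3 + φ (f 1) * θ ^ 2 + φ (f 2) * θ + φ (f 3) = 0) (s : S) :
    lift φ θ h (base s) = φ s := by
  simp [lift_apply]

/-- The index form. -/
theorem index_sq (x : CubicRing f) : x.c₁ * (x * x).c₂ - x.c₂ * (x * x).c₁ =
    f 0 * x.c₁ ^ 3 + f 1 * x.c₁ ^ 2 * x.c₂ + f 2 * x.c₁ * x.c₂ ^ 2 + f 3 * x.c₂ ^ 3 := by
  simp only [mul_c₁, mul_c₂]
  ring

/-- An element of square zero is a double root of the cubic form. -/
theorem double_root_of_sq_eq_zero {f : Fin 4 → ℂ} {x : CubicRing f} (hx : x * x = 0) :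
    3 * f 0 * x.c₁ ^ 2 + 2 * f 1 * x.c₁ * x.c₂ + f 2 * x.c₂ ^ 2 = 0 ∧
      f 1 * x.c₁ ^ 2 + 2 * f 2 * x.c₁ * x.c₂ + 3 * f 3 * x.c₂ ^ 2 = 0 ∧
      3 * x.c₀ = f 1 * x.c₁ + 2 * f 2 * x.c₂ := by
  obtain ⟨a, b, c⟩ := x
  have h0 := congrArg c₀ hx
  have h1 := congrArg c₁ hx
  have h2 := congrArg c₂ hx
  simp only [mul_c₀, mul_c₁, mul_c₂, zero_c₀, zero_c₁, zero_c₂] at h0 h1 h2 ⊢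
  -- `M` is the matrix of multiplication by `x`. It has square zero, so its trace vanishes, and this
  -- determines `c₀`.
  let M : Matrix (Fin 3) (Fin 3) ℂ :=
    !![a, -(f 0 * f 3 * c), -(f 0 * f 3 * b) - f 1 * f 3 * c;
      b, a - f 1 * b - f 2 * c, -(f 2 * b) - f 3 * c;
      c, f 0 * b, a - f 2 * c]
  have hM : M * M = 0 := by
    ext i j
    fin_cases i <;> fin_cases j <;>
      simp only [M, Matrix.mul_apply, Fin.sum_univ_three, Matrix.of_apply, Matrix.cons_val',
        Matrix.cons_val_zero, Matrix.cons_val_one, Matrix.cons_val, Matrix.zero_apply,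
        Fin.zero_eta, Fin.mk_one, Fin.reduceFinMk]
    · linear_combination h0
    · linear_combination -(f 0 * f 3) * h2
    · linear_combination -(f 0 * f 3) * h1 - f 1 * f 3 * h2
    · linear_combination h1
    · linear_combination h0 - f 1 * h1 - f 2 * h2
    · linear_combination -(f 2) * h1 - f 3 * h2
    · linear_combination h2
    · linear_combination f 0 * h1
    · linear_combination h0 - f 2 * h2
  have htr : M.trace = 0 := by
    refine (Matrix.isNilpotent_trace_of_isNilpotent ⟨2, ?_⟩).eq_zero
    rw [pow_two, hM]
  have htr' : 3 * a = f 1 * b + 2 * f 2 * c := by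
    simp only [M, Matrix.trace, Matrix.diag, Fin.sum_univ_three, Matrix.of_apply, Matrix.cons_val',
      Matrix.cons_val_zero, Matrix.cons_val_one, Matrix.cons_val] at htr
    linear_combination htr
  exact ⟨by linear_combination 3 * h2 - 2 * c * htr', by linear_combination -3 * h1 + 2 * b * htr',
    htr'⟩

end CubicRing

end CubicRing

/-! ### The form as a binary cubic with polynomial coefficients -/

section CoeffPoly

/-- The coefficients of the form as a binary cubic form, in the affine coordinate `u₀ / u₁`. -/
def coeffPoly {S : Type*} [CommSemiring S] (a : Fin 4 × Fin 5 → S) (i : Fin 4) : S[X] :=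
  ∑ j : Fin 5, Polynomial.C (a (i, j)) * Polynomial.X ^ (4 - (j : ℕ))

theorem natDegree_coeffPoly_le {S : Type*} [CommSemiring S] (a : Fin 4 × Fin 5 → S) (i : Fin 4) :
    (coeffPoly a i).natDegree ≤ 4 :=
  Polynomial.natDegree_sum_le_of_forall_le _ _ fun j _ =>
    (Polynomial.natDegree_C_mul_X_pow_le _ _).trans (by omega)

/-- Exchange of the coordinates of the second line. -/
def flipU {S : Type*} (a : Fin 4 × Fin 5 → S) : Fin 4 × Fin 5 → S := fun k => a (k.1, k.2.rev)

theorem coeffPoly_flipU {S : Type*} [CommSemiring S] (a : Fin 4 × Fin 5 → S) (i : Fin 4) :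
    coeffPoly (flipU a) i = (coeffPoly a i).reflect 4 := by
  ext k
  rw [Polynomial.coeff_reflect]
  simp only [coeffPoly, Polynomial.finsetSum_coeff, Polynomial.coeff_C_mul_X_pow, flipU]
  rw [← Equiv.sum_comp Fin.revPerm]
  refine Finset.sum_congr rfl fun j _ => ?_
  simp only [Fin.revPerm_apply, Fin.rev_rev]
  refine if_congr ?_ rfl rfl
  rw [Fin.val_rev]
  by_cases hk : k ≤ 4
  · rw [Polynomial.revAt_le hk]; omega
  · rw [Polynomial.revAt_eq_self_of_lt (not_le.1 hk)]; omega

theorem evalForm_flipU (a : Fin 4 × Fin 5 → ℂ) (x u : Fin 2 → ℂ) :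
    evalForm (flipU a) x u = evalForm a x (fun i => u i.rev) := by
  rw [evalForm_eq, evalForm_eq]
  refine Finset.sum_congr rfl fun i _ => ?_
  rw [← Equiv.sum_comp Fin.revPerm]
  refine Finset.sum_congr rfl fun j _ => ?_
  simp only [flipU, Fin.revPerm_apply, Fin.rev_rev, Fin.val_rev]
  rw [show (0 : Fin 2).rev = 1 from rfl, show (1 : Fin 2).rev = 0 from rfl,
    show 4 - (5 - ((j : ℕ) + 1)) = j by omega, show 5 - ((j : ℕ) + 1) = 4 - j by omega]
  ring

theorem isSmooth_flipU {a : Fin 4 × Fin 5 → ℂ} (h : IsSmooth a) : IsSmooth (flipU a) := by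
  let P : GL (Fin 2) ℂ := ⟨!![0, 1; 1, 0], !![0, 1; 1, 0], by simp [Matrix.one_fin_two],
    by simp [Matrix.one_fin_two]⟩
  refine smooth_of_evalForm_eq (a := a) 1 P (fun x u => ?_) h
  rw [evalForm_flipU]
  congr 1
  · simp
  · funext i
    fin_cases i <;> simp [P, Matrix.mulVec, dotProduct, Fin.sum_univ_two]

theorem evalForm_chart (a : Fin 4 × Fin 5 → ℂ) (x : Fin 2 → ℂ) (s : ℂ) :
    evalForm a x ![s, 1] = ∑ i : Fin 4, (coeffPoly a i).eval s *
      (x 0 ^ (3 - (i : ℕ)) * x 1 ^ (i : ℕ)) := by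
  rw [evalForm_eq]
  refine Finset.sum_congr rfl fun i _ => ?_
  rw [coeffPoly, Polynomial.eval_finsetSum, Finset.sum_mul]
  refine Finset.sum_congr rfl fun j _ => ?_
  simp
  try ring

/-- Smoothness in terms of the binary cubic form. -/
theorem IsSmooth.exists_derivative_ne_zero {a : Fin 4 × Fin 5 → ℂ} (h : IsSmooth a) {x y s : ℂ}
    (hxy : x ≠ 0 ∨ y ≠ 0)
    (hx : 3 * (coeffPoly a 0).eval s * x ^ 2 + 2 * (coeffPoly a 1).eval s * x * y +
      (coeffPoly a 2).eval s * y ^ 2 = 0)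
    (hy : (coeffPoly a 1).eval s * x ^ 2 + 2 * (coeffPoly a 2).eval s * x * y +
      3 * (coeffPoly a 3).eval s * y ^ 2 = 0) :
    (coeffPoly a 0).derivative.eval s * x ^ 3 + (coeffPoly a 1).derivative.eval s * x ^ 2 * y +
      (coeffPoly a 2).derivative.eval s * x * y ^ 2 +
      (coeffPoly a 3).derivative.eval s * y ^ 3 ≠ 0 := by
  intro hs
  have hne : (![x, y] : Fin 2 → ℂ) ≠ 0 := fun h0 => by
    rcases hxy with h | h
    · exact h (congrFun h0 0)
    · exact h (congrFun h0 1)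
  have hF : evalForm a ![x, y] ![s, 1] = 0 := by
    rw [evalForm_chart]
    simp only [Fin.sum_univ_four, Matrix.cons_val_zero, Matrix.cons_val_one, Fin.val_zero,
      Fin.val_one, Fin.val_two, show ((3 : Fin 4) : ℕ) = 3 from rfl]
    linear_combination (1 / 3 : ℂ) * (x * hx + y * hy)
  obtain ⟨k, hk⟩ := h ![x, y] ![s, 1] hne (fun h0 => one_ne_zero (congrFun h0 1)) hF
  refine hk ?_
  rw [evalForm_eq] at hF
  simp only [coeffPoly, Fin.sum_univ_four, Fin.sum_univ_five, Matrix.cons_val_zero,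
    Matrix.cons_val_one, Fin.val_zero, Fin.val_one, Fin.val_two,
    show ((3 : Fin 4) : ℕ) = 3 from rfl, show ((3 : Fin 5) : ℕ) = 3 from rfl,
    show ((4 : Fin 5) : ℕ) = 4 from rfl] at hx hy hs hF
  norm_num at hx hy hs hF
  rw [eval_pderiv_formPoly]
  rcases k with k | k <;> fin_cases k <;>
    simp [formMon, Fintype.sum_prod_type, Fin.sum_univ_four, Fin.sum_univ_five,
      MvPolynomial.pderiv_X]
  · linear_combination hx
  · linear_combination hy
  · linear_combination hs
  -- Euler's relation in the variables `u`, at the point `(s, 1)`.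
  · linear_combination 4 * hF - s * hs

end CoeffPoly

/-! ### A smooth curve has no rational section over the second line -/

section NoRoot

theorem eval_reflect {p : ℂ[X]} {N : ℕ} (hp : p.natDegree ≤ N) {s : ℂ} (hs : s ≠ 0) :
    (p.reflect N).eval s = s ^ N * p.eval s⁻¹ := by
  have := aeval_inv_reflect (K := ℂ) (inv_ne_zero hs) hp
  simpa using this

theorem exists_isCoprime_of_ne_zero {A B : ℂ[X]} (h : A ≠ 0 ∨ B ≠ 0) :
    ∃ g A' B' : ℂ[X], g ≠ 0 ∧ IsCoprime A' B' ∧ A = g * A' ∧ B = g * B' := by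
  classical
  obtain ⟨A', hA⟩ := EuclideanDomain.gcd_dvd_left A B
  obtain ⟨B', hB⟩ := EuclideanDomain.gcd_dvd_right A B
  have hg : EuclideanDomain.gcd A B ≠ 0 := fun h0 => by
    rw [EuclideanDomain.gcd_eq_zero_iff] at h0
    exact h.elim (fun h => h h0.1) fun h => h h0.2
  refine ⟨_, A', B', hg, ⟨EuclideanDomain.gcdA A B, EuclideanDomain.gcdB A B,
    mul_left_cancel₀ hg ?_⟩, hA, hB⟩
  have := EuclideanDomain.gcd_eq_gcd_ab A B
  rw [mul_one]
  linear_combination -this - EuclideanDomain.gcdA A B * hA - EuclideanDomain.gcdB A B * hB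

variable {a : Fin 4 × Fin 5 → ℂ}

/-- Along a section of the first projection of a smooth curve, the derivatives in the direction
of the fiber do not vanish in the affine part. -/
theorem IsSmooth.exists_const (h : IsSmooth a) {A B : ℂ[X]} (hAB : IsCoprime A B)
    (hF : coeffPoly a 0 * A ^ 3 + coeffPoly a 1 * A ^ 2 * B + coeffPoly a 2 * A * B ^ 2 +
      coeffPoly a 3 * B ^ 3 = 0) :
    ∃ c : ℂ, c ≠ 0 ∧
      3 * coeffPoly a 0 * A ^ 2 + 2 * coeffPoly a 1 * A * B + coeffPoly a 2 * B ^ 2 =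
        Polynomial.C c * B ∧
      coeffPoly a 1 * A ^ 2 + 2 * coeffPoly a 2 * A * B + 3 * coeffPoly a 3 * B ^ 2 =
        -(Polynomial.C c * A) := by
  obtain ⟨p, q, hpq⟩ := hAB
  set Fx := 3 * coeffPoly a 0 * A ^ 2 + 2 * coeffPoly a 1 * A * B + coeffPoly a 2 * B ^ 2 with hFx
  set Fy := coeffPoly a 1 * A ^ 2 + 2 * coeffPoly a 2 * A * B + 3 * coeffPoly a 3 * B ^ 2 with hFy
  have hE : A * Fx + B * Fy = 0 := by rw [hFx, hFy]; linear_combination 3 * hF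
  -- By Euler's relation the gradient in `x` along the section is a multiple of `(B, -A)`; since `A`
  -- and `B` are coprime, the factor `w` is a polynomial.
  set w := q * Fx - p * Fy with hw
  have h1 : Fx = w * B := by rw [hw]; linear_combination p * hE - Fx * hpq
  have h2 : Fy = -(w * A) := by rw [hw]; linear_combination q * hE - Fy * hpq
  have hD : (coeffPoly a 0).derivative * A ^ 3 + (coeffPoly a 1).derivative * A ^ 2 * B +
      (coeffPoly a 2).derivative * A * B ^ 2 + (coeffPoly a 3).derivative * B ^ 3 +
      Fx * A.derivative + Fy * B.derivative = 0 := by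
    have := congrArg Polynomial.derivative hF
    simp only [Polynomial.derivative_add, Polynomial.derivative_mul, Polynomial.derivative_pow,
      Polynomial.derivative_zero, Nat.cast_ofNat, map_ofNat, Nat.add_one_sub_one, pow_one] at this
    rw [hFx, hFy]
    linear_combination this
  -- At a zero of `w` the gradient in `x` vanishes. By `hD`, the derivative of the equation of the
  -- section, the derivative along the base then vanishes too, and the point is singular.
  have hroot : ∀ s, w.eval s ≠ 0 := by
    intro s hs
    have e0 := congrArg (Polynomial.eval s) hpq
    have e1 := congrArg (Polynomial.eval s) h1
    have e2 := congrArg (Polynomial.eval s) h2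
    have e3 := congrArg (Polynomial.eval s) hD
    have e4 : Fx.eval s = 0 := by rw [e1, Polynomial.eval_mul, hs, zero_mul]
    have e5 : Fy.eval s = 0 := by rw [e2, Polynomial.eval_neg, Polynomial.eval_mul, hs]; simp
    rw [Polynomial.eval_add, Polynomial.eval_add, Polynomial.eval_mul, Polynomial.eval_mul, e4, e5]
      at e3
    refine h.exists_derivative_ne_zero (x := A.eval s) (y := B.eval s) (s := s) ?_ ?_ ?_ ?_
    · by_contra! hcon
      rw [Polynomial.eval_add, Polynomial.eval_mul, Polynomial.eval_mul, hcon.1, hcon.2] at e0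
      simp at e0
    · rw [← e4, hFx]; simp
    · rw [← e5, hFy]; simp
    · simpa using e3
  have hdeg : w.degree ≤ 0 := by
    by_contra hlt
    obtain ⟨s, hs⟩ := Complex.exists_root (not_le.1 hlt)
    exact hroot s hs
  have hwc := Polynomial.eq_C_of_degree_le_zero hdeg
  refine ⟨w.coeff 0, fun h0 => hroot 0 ?_, ?_, ?_⟩
  · rw [hwc, h0]; simp
  · rw [h1, ← hwc]
  · rw [h2, ← hwc]

/-- The first projection of a smooth curve has no sections. -/
theorem IsSmooth.no_root (h : IsSmooth a) {A B : ℂ[X]}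
    (hF : coeffPoly a 0 * A ^ 3 + coeffPoly a 1 * A ^ 2 * B + coeffPoly a 2 * A * B ^ 2 +
      coeffPoly a 3 * B ^ 3 = 0) : A = 0 ∧ B = 0 := by
  by_contra hne
  obtain ⟨g, A', B', hg, hcop, rfl, rfl⟩ := exists_isCoprime_of_ne_zero
    (not_and_or.1 hne)
  have hF' : coeffPoly a 0 * A' ^ 3 + coeffPoly a 1 * A' ^ 2 * B' + coeffPoly a 2 * A' * B' ^ 2 +
      coeffPoly a 3 * B' ^ 3 = 0 :=
    mul_left_cancel₀ (pow_ne_zero 3 hg) (by linear_combination hF)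
  clear hF hne
  obtain ⟨c, hc, hx, hy⟩ := h.exists_const hcop hF'
  set n := max A'.natDegree B'.natDegree with hn
  have hA : A'.natDegree ≤ n := le_max_left _ _
  have hB : B'.natDegree ≤ n := le_max_right _ _
  have hcop0 : ∀ s, A'.eval s ≠ 0 ∨ B'.eval s ≠ 0 := by
    obtain ⟨p, q, hpq⟩ := hcop
    intro s
    by_contra! hcon
    have e0 := congrArg (Polynomial.eval s) hpq
    rw [Polynomial.eval_add, Polynomial.eval_mul, Polynomial.eval_mul, hcon.1, hcon.2] at e0
    simp at e0
  -- The section is continued to infinity. At the origin of the other chart one of the reflected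
  -- polynomials is nonzero because `n` is the larger of the two degrees.
  have hcop' : IsCoprime (A'.reflect n) (B'.reflect n) := by
    rw [Polynomial.isCoprime_iff_aeval_ne_zero_of_isAlgClosed ℂ ℂ]
    intro s
    rw [Polynomial.coe_aeval_eq_eval]
    by_cases hs : s = 0
    · subst hs
      rw [← Polynomial.coeff_zero_eq_eval_zero, ← Polynomial.coeff_zero_eq_eval_zero,
        Polynomial.coeff_reflect, Polynomial.coeff_reflect, Polynomial.revAt_le (Nat.zero_le _),
        Nat.sub_zero]
      rcases max_choice A'.natDegree B'.natDegree with h1 | h1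
      · by_cases hA0 : A' = 0
        · right
          have hB0 : B' ≠ 0 := by
            rintro rfl
            exact (hcop0 0).elim (fun h => h (by rw [hA0]; simp)) fun h => h (by simp)
          have : n = B'.natDegree := by
            rw [hn, hA0]; simp
          rw [this]
          exact Polynomial.leadingCoeff_ne_zero.2 hB0
        · left
          rw [hn, h1]
          exact Polynomial.leadingCoeff_ne_zero.2 hA0
      · by_cases hB0 : B' = 0
        · left
          have hA0 : A' ≠ 0 := by
            rintro rfl
            exact (hcop0 0).elim (fun h => h (by simp)) fun h => h (by rw [hB0]; simp)
          have : n = A'.natDegree := by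
            rw [hn, hB0]; simp
          rw [this]
          exact Polynomial.leadingCoeff_ne_zero.2 hA0
        · right
          rw [hn, h1]
          exact Polynomial.leadingCoeff_ne_zero.2 hB0
    · rw [eval_reflect hA hs, eval_reflect hB hs]
      exact (hcop0 s⁻¹).imp (mul_ne_zero (pow_ne_zero _ hs)) (mul_ne_zero (pow_ne_zero _ hs))
  have hF2 : coeffPoly (flipU a) 0 * (A'.reflect n) ^ 3 +
      coeffPoly (flipU a) 1 * (A'.reflect n) ^ 2 * B'.reflect n +
      coeffPoly (flipU a) 2 * A'.reflect n * (B'.reflect n) ^ 2 +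
      coeffPoly (flipU a) 3 * (B'.reflect n) ^ 3 = 0 := by
    refine Polynomial.eq_zero_of_infinite_isRoot _ (Set.Infinite.mono (s := {0}ᶜ) ?_
      (Set.finite_singleton (0 : ℂ)).infinite_compl)
    intro s hs
    change Polynomial.eval s _ = 0
    have e := congrArg (Polynomial.eval s⁻¹) hF'
    simp only [Polynomial.eval_add, Polynomial.eval_mul, Polynomial.eval_pow, coeffPoly_flipU,
      eval_reflect hA hs, eval_reflect hB hs, eval_reflect (natDegree_coeffPoly_le a _) hs,
      Polynomial.eval_zero] at e ⊢
    linear_combination s ^ 4 * (s ^ n) ^ 3 * e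
  obtain ⟨c', hc', hx', hy'⟩ := (isSmooth_flipU h).exists_const hcop' hF2
  -- The factor `w` is a nowhere vanishing section of `𝒪(n + 4)`, a bundle of positive degree.
  -- Concretely, its constant values in the two charts would have to differ by `s ^ (n + 4)` for
  -- every nonzero `s`.
  have hcc : ∀ s : ℂ, s ≠ 0 → c' = s ^ (n + 4) * c := by
    intro s hs
    have ex := congrArg (Polynomial.eval s⁻¹) hx
    have ey := congrArg (Polynomial.eval s⁻¹) hy
    have ex' := congrArg (Polynomial.eval s) hx'
    have ey' := congrArg (Polynomial.eval s) hy'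
    simp only [Polynomial.eval_add, Polynomial.eval_mul, Polynomial.eval_pow, coeffPoly_flipU,
      eval_reflect hA hs, eval_reflect hB hs, eval_reflect (natDegree_coeffPoly_le a _) hs,
      Polynomial.eval_C, Polynomial.eval_neg, Polynomial.eval_ofNat] at ex ey ex' ey'
    have hsn : s ^ n ≠ 0 := pow_ne_zero _ hs
    rcases hcop0 s⁻¹ with h1 | h1
    · refine mul_right_cancel₀ (mul_ne_zero hsn h1) ?_
      rw [pow_add]
      linear_combination ey' - s ^ 4 * (s ^ n) ^ 2 * ey
    · refine mul_right_cancel₀ (mul_ne_zero hsn h1) ?_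
      rw [pow_add]
      linear_combination s ^ 4 * (s ^ n) ^ 2 * ex - ex'
  have e1 := hcc 1 one_ne_zero
  have e2 := hcc 2 two_ne_zero
  rw [one_pow, one_mul] at e1
  rw [e1] at e2
  have e3 : (2 : ℂ) ^ (n + 4) = 1 := mul_right_cancel₀ hc (by rw [one_mul]; exact e2.symm)
  have e4 : (2 : ℕ) ^ (n + 4) = 1 := by exact_mod_cast e3
  exact absurd e4 (Nat.one_lt_two_pow (by omega)).ne'

end NoRoot

/-! ### Function fields of smooth curves -/

section PlaneModel

variable {K : Type} [Field K] [Algebra ℂ K] {a : Fin 4 × Fin 5 → ℂ} {t θ : K}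

/-- The field `K` is the function field of the curve with affine equation given by `a`. -/
structure PlaneModel (a : Fin 4 × Fin 5 → ℂ) (t θ : K) : Prop where
  smooth : IsSmooth a
  transcendental : Transcendental ℂ t
  root : aeval t (coeffPoly a 0) * θ ^ 3 + aeval t (coeffPoly a 1) * θ ^ 2 +
    aeval t (coeffPoly a 2) * θ + aeval t (coeffPoly a 3) = 0
  adjoin : IntermediateField.adjoin ℂ {t, θ} = ⊤

/-- A root in `ℂ(t)`, written as a fraction of polynomials, is a section excluded by
`IsSmooth.no_root`. -/
theorem IsSmooth.ne_zero_of_mem_adjoin (h : IsSmooth a) (ht : Transcendental ℂ t)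
    {x : K} (hx : x ∈ IntermediateField.adjoin ℂ {t}) :
    aeval t (coeffPoly a 0) * x ^ 3 + aeval t (coeffPoly a 1) * x ^ 2 +
      aeval t (coeffPoly a 2) * x + aeval t (coeffPoly a 3) ≠ 0 := by
  intro h0
  obtain ⟨r, s, hs, hrs⟩ := exists_denom ⟨x, hx⟩
  change aeval t s * x = _ at hrs
  have h1 : coeffPoly a 0 * r ^ 3 + coeffPoly a 1 * r ^ 2 * s + coeffPoly a 2 * r * s ^ 2 +
      coeffPoly a 3 * s ^ 3 = 0 := by
    refine aeval_eq_zero_of_transcendental ht ?_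
    simp only [map_add, map_mul, map_pow, ← hrs]
    linear_combination aeval t s ^ 3 * h0
  exact hs (by rw [(h.no_root h1).2, map_zero])

theorem IsSmooth.coeffPoly_zero_ne_zero (h : IsSmooth a) : coeffPoly a 0 ≠ 0 := by
  intro h0
  exact one_ne_zero (h.no_root (A := 1) (B := 0) (by simp [h0])).1

theorem PlaneModel.notMem (h : PlaneModel a t θ) : θ ∉ IntermediateField.adjoin ℂ {t} := fun hθ =>
  h.smooth.ne_zero_of_mem_adjoin h.transcendental hθ h.root

/-- A cubic polynomial without a root in `ℂ(t)` is irreducible, so it is the minimal polynomial of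
`θ` up to a constant factor. -/
theorem PlaneModel.finrank (h : PlaneModel a t θ) :
    Module.finrank (IntermediateField.adjoin ℂ {t}) K = 3 := by
  let E := IntermediateField.adjoin ℂ {t}
  let g : Fin 4 → E := fun i => ⟨aeval t (coeffPoly a i), aeval_mem_adjoin t _⟩
  let q : Cubic E := ⟨g 0, g 1, g 2, g 3⟩
  have hg0 : q.a ≠ 0 := fun h0 => h.smooth.coeffPoly_zero_ne_zero
    (aeval_eq_zero_of_transcendental h.transcendental (congrArg Subtype.val h0))
  have hqd : q.toPoly.natDegree = 3 := Cubic.natDegree_of_a_ne_zero hg0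
  have hirr : Irreducible q.toPoly := by
    refine Polynomial.irreducible_of_degree_le_three_of_not_isRoot
      (by rw [hqd]; simp) fun x hx => ?_
    refine h.smooth.ne_zero_of_mem_adjoin h.transcendental x.2 ?_
    have := congrArg (Subtype.val) hx
    simpa [Cubic.toPoly, q, g] using this
  have hroot : aeval θ q.toPoly = 0 := by
    rw [← h.root]
    simp [Cubic.toPoly, q, g]
  have hmin := minpoly.eq_of_irreducible hirr hroot
  have hint : IsIntegral E θ := by
    by_contra hni
    rw [minpoly.eq_zero hni] at hmin
    rcases mul_eq_zero.1 hmin with h1 | h1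
    · exact hirr.ne_zero h1
    · rw [Polynomial.C_eq_zero, inv_eq_zero, Polynomial.leadingCoeff_eq_zero] at h1
      exact hirr.ne_zero h1
  have h2 := IntermediateField.adjoin.finrank hint
  rw [← hmin, Polynomial.natDegree_mul_C (inv_ne_zero (Polynomial.leadingCoeff_ne_zero.2
    hirr.ne_zero)), hqd] at h2
  have h3 : IntermediateField.adjoin E {θ} = ⊤ := by
    have h4 := IntermediateField.adjoin_adjoin_left ℂ (E := K) {t} {θ}
    rw [Set.singleton_union, h.adjoin] at h4
    rw [eq_top_iff]
    intro x _
    have : x ∈ IntermediateField.restrictScalars ℂ (IntermediateField.adjoin E {θ}) := by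
      rw [h4]; trivial
    exact this
  rw [h3, IntermediateField.finrank_top'] at h2
  exact h2

end PlaneModel

/-! ### The cubic ring of a smooth curve is integrally closed -/

section Normality

variable {K : Type} [Field K] [Algebra ℂ K] {a : Fin 4 × Fin 5 → ℂ} {t θ : K}

theorem exists_monic_of_mem_integralOver {z : K} (hz : z ∈ integralOver {t}) :
    ∃ G : ℂ[X][X], G.Monic ∧ G.eval₂ (aeval t : ℂ[X] →ₐ[ℂ] K).toRingHom z = 0 := by
  obtain ⟨p, hp, hpz⟩ := hz
  let q : K[X] := p.map (algebraMap (Algebra.adjoin ℂ {t}) K)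
  have hl : q ∈ Polynomial.lifts (aeval t : ℂ[X] →ₐ[ℂ] K).toRingHom := by
    rw [Polynomial.lifts_iff_coeff_lifts]
    intro i
    obtain ⟨g, hg⟩ := (Algebra.adjoin_singleton_eq_range_aeval ℂ t).le (p.coeff i).2
    exact ⟨g, by rw [Polynomial.coeff_map]; exact hg⟩
  obtain ⟨G, hG, -, hGm⟩ := Polynomial.lifts_and_natDegree_eq_and_monic hl (hp.map _)
  refine ⟨G, hGm, ?_⟩
  rw [← Polynomial.eval_map, hG, Polynomial.eval_map]
  exact hpz

/-- Integral functions satisfy a monic cubic equation. -/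
theorem exists_cubic_of_mem_integralOver (ht : Transcendental ℂ t)
    (hd : Module.finrank (IntermediateField.adjoin ℂ {t}) K = 3) {z : K}
    (hz : z ∈ integralOver {t}) (hzt : z ∉ IntermediateField.adjoin ℂ {t}) :
    ∃ e₁ e₂ e₃ : ℂ[X], z ^ 3 + aeval t e₁ * z ^ 2 + aeval t e₂ * z +
      aeval t e₃ = 0 := by
  obtain ⟨P, hP, hPd, hPv⟩ := exists_natDegree_le_three (t' := z) ht hd
  have hd3 : P.natDegree = 3 := by
    by_contra hne
    exact hP.ne_zero (eq_zero_of_natDegree_lt_three ht hd hzt (by omega) hPv)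
  obtain ⟨G, hG, hGv⟩ := exists_monic_of_mem_integralOver hz
  have hGv' : Polynomial.aevalAeval t z G = 0 := by
    rw [aevalAeval_eq_sum t z (Nat.lt_succ_self _), ← hGv, Polynomial.eval₂_eq_sum_range]
    rfl
  obtain ⟨q, hq⟩ := isPrimitive_dvd_of_aevalAeval_eq_zero
    (fun G hG hGv => eq_zero_of_natDegree_lt_three ht hd hzt hG hGv) hP hd3 hPv hGv'
  have hu : P.leadingCoeff * q.leadingCoeff = 1 := by
    rw [← Polynomial.leadingCoeff_mul, ← hq, hG]
  rw [aevalAeval_eq_sum t z (n := 4) (by omega)] at hPv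
  simp only [Finset.sum_range_succ, Finset.sum_range_zero] at hPv
  have hu' := congrArg (aeval t) hu
  rw [Polynomial.leadingCoeff, hd3, map_mul, map_one] at hu'
  refine ⟨q.leadingCoeff * P.coeff 2, q.leadingCoeff * P.coeff 1, q.leadingCoeff * P.coeff 0, ?_⟩
  simp only [map_mul]
  linear_combination aeval t q.leadingCoeff * hPv - z ^ 3 * hu'

theorem exists_zero_binary_cubic (c : Fin 4 → ℂ) : ∃ p q : ℂ, (p ≠ 0 ∨ q ≠ 0) ∧
    c 0 * p ^ 3 + c 1 * p ^ 2 * q + c 2 * p * q ^ 2 + c 3 * q ^ 3 = 0 := by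
  by_cases h0 : c 0 = 0
  · exact ⟨1, 0, Or.inl one_ne_zero, by simp [h0]⟩
  · let P : Cubic ℂ := ⟨c 0, c 1, c 2, c 3⟩
    obtain ⟨x, hx⟩ := Complex.exists_root (f := P.toPoly)
      (by rw [Cubic.degree_of_a_ne_zero h0]; norm_num)
    refine ⟨x, 1, Or.inr one_ne_zero, ?_⟩
    have : Polynomial.eval x P.toPoly = 0 := hx
    simp only [Cubic.toPoly, P, Polynomial.eval_add, Polynomial.eval_mul, Polynomial.eval_C,
      Polynomial.eval_pow, Polynomial.eval_X] at this
    linear_combination this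

/-- The restriction of the cubic ring to the fiber over a point. -/
def cubicEval (a : Fin 4 × Fin 5 → ℂ) (s : ℂ) :
    CubicRing (coeffPoly a) →+* CubicRing (fun i => (coeffPoly a i).eval s) :=
  CubicRing.map (Polynomial.evalRingHom s) fun _ => rfl

@[simp] theorem cubicEval_c₀ (s : ℂ) (x : CubicRing (coeffPoly a)) :
    (cubicEval a s x).c₀ = x.c₀.eval s := rfl

@[simp] theorem cubicEval_c₁ (s : ℂ) (x : CubicRing (coeffPoly a)) :
    (cubicEval a s x).c₁ = x.c₁.eval s := rfl

@[simp] theorem cubicEval_c₂ (s : ℂ) (x : CubicRing (coeffPoly a)) :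
    (cubicEval a s x).c₂ = x.c₂.eval s := rfl

theorem exists_eq_mul_of_cubicEval_eq_zero {s : ℂ} {x : CubicRing (coeffPoly a)}
    (hx : cubicEval a s x = 0) :
    ∃ y : CubicRing (coeffPoly a), x = CubicRing.base (Polynomial.X - Polynomial.C s) * y := by
  have h : ∀ p : ℂ[X], p.eval s = 0 → ∃ q, p = (Polynomial.X - Polynomial.C s) * q := fun p hp =>
    Polynomial.dvd_iff_isRoot.2 hp
  obtain ⟨y₀, h₀⟩ := h x.c₀ (congrArg CubicRing.c₀ hx)
  obtain ⟨y₁, h₁⟩ := h x.c₁ (congrArg CubicRing.c₁ hx)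
  obtain ⟨y₂, h₂⟩ := h x.c₂ (congrArg CubicRing.c₂ hx)
  refine ⟨⟨y₀, y₁, y₂⟩, ?_⟩
  ext1 <;> simp [h₀, h₁, h₂, -map_sub]

theorem cubicEval_base_mul {s : ℂ} (x : CubicRing (coeffPoly a)) :
    cubicEval a s (CubicRing.base (Polynomial.X - Polynomial.C s) * x) = 0 := by
  have h : cubicEval a s (CubicRing.base (Polynomial.X - Polynomial.C s)) =
      CubicRing.base ((Polynomial.X - Polynomial.C s).eval s) := by
    ext1 <;> simp [-map_sub]
  rw [map_mul, h, Polynomial.eval_sub, Polynomial.eval_X, Polynomial.eval_C, sub_self, map_zero,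
    zero_mul]

/-- On a smooth curve the derivative along the base does not vanish at double points. -/
theorem IsSmooth.derivative_ne_zero_of_sq_eq_zero (h : IsSmooth a) {s : ℂ}
    {x : CubicRing (fun i => (coeffPoly a i).eval s)} (hx : x ≠ 0) (hxx : x * x = 0) :
    (coeffPoly a 0).derivative.eval s * x.c₁ ^ 3 +
      (coeffPoly a 1).derivative.eval s * x.c₁ ^ 2 * x.c₂ +
      (coeffPoly a 2).derivative.eval s * x.c₁ * x.c₂ ^ 2 +
      (coeffPoly a 3).derivative.eval s * x.c₂ ^ 3 ≠ 0 := by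
  obtain ⟨h1, h2, h3⟩ := CubicRing.double_root_of_sq_eq_zero hxx
  refine h.exists_derivative_ne_zero ?_ h1 h2
  by_contra! hcon
  refine hx (CubicRing.ext ?_ hcon.1 hcon.2)
  rw [hcon.1, hcon.2] at h3
  simpa using h3

namespace PlaneModel

/-- The cubic ring of a plane model, as a ring of functions on the curve. -/
def hom (h : PlaneModel a t θ) : CubicRing (coeffPoly a) →+* K :=
  CubicRing.lift (aeval t : ℂ[X] →ₐ[ℂ] K).toRingHom θ h.root

theorem hom_apply (h : PlaneModel a t θ) (x : CubicRing (coeffPoly a)) :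
    h.hom x = aeval t x.c₀ +
      aeval t x.c₁ * (aeval t (coeffPoly a 0) * θ) +
      aeval t x.c₂ * (aeval t (coeffPoly a 0) * θ ^ 2 +
        aeval t (coeffPoly a 1) * θ) := rfl

theorem hom_base (h : PlaneModel a t θ) (p : ℂ[X]) :
    h.hom (CubicRing.base p) = aeval t p := CubicRing.lift_base _ _ _ _

theorem eq_zero_of_sum (h : PlaneModel a t θ) {p q r : ℂ[X]}
    (h0 : aeval t p + aeval t q * θ + aeval t r * θ ^ 2 = 0) :
    p = 0 ∧ q = 0 ∧ r = 0 := by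
  let G : ℂ[X][X] := Polynomial.C r * Polynomial.X ^ 2 + Polynomial.C q * Polynomial.X +
    Polynomial.C p
  have hG : G = 0 := by
    refine eq_zero_of_natDegree_lt_three h.transcendental h.finrank h.notMem
      (Nat.lt_succ_of_le Polynomial.natDegree_quadratic_le) ?_
    simp only [G, map_add, map_mul, map_pow, Polynomial.aevalAeval_C, Polynomial.aevalAeval_Y]
    linear_combination h0
  have hc : ∀ i, G.coeff i = 0 := fun i => by rw [hG, Polynomial.coeff_zero]
  have h0 := hc 0
  have h1 := hc 1
  have h2 := hc 2
  simp [G, Polynomial.coeff_X, Polynomial.coeff_C] at h0 h1 h2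
  exact ⟨h0, h1, h2⟩

theorem hom_injective (h : PlaneModel a t θ) : Function.Injective h.hom := by
  refine (injective_iff_map_eq_zero _).2 fun x hx => ?_
  rw [hom_apply] at hx
  obtain ⟨h0, h1, h2⟩ := h.eq_zero_of_sum (p := x.c₀)
    (q := x.c₁ * coeffPoly a 0 + x.c₂ * coeffPoly a 1) (r := x.c₂ * coeffPoly a 0) (by
      simp only [map_add, map_mul]
      linear_combination hx)
  have h3 : x.c₂ = 0 := (mul_eq_zero.1 h2).resolve_right h.smooth.coeffPoly_zero_ne_zero
  rw [h3, zero_mul, add_zero] at h1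
  exact CubicRing.ext h0 ((mul_eq_zero.1 h1).resolve_right h.smooth.coeffPoly_zero_ne_zero) h3

theorem hom_mem (h : PlaneModel a t θ) (x : CubicRing (coeffPoly a)) :
    h.hom x ∈ integralOver {t} := by
  obtain ⟨h1, h2⟩ := mem_integralOver_of_root (s := {t}) (θ := θ)
    (p := fun i => aeval t (coeffPoly a i.rev)) (fun i => aeval_mem_integralOver t _)
    h.root
  rw [hom_apply]
  exact add_mem (add_mem (aeval_mem_integralOver t _) (mul_mem (aeval_mem_integralOver t _) h1))
    (mul_mem (aeval_mem_integralOver t _) h2)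

/-- Scaling the roots of a monic equation of `y` by `t - s` gives a monic equation of `x` whose
lower coefficients vanish on the fiber over `s`. -/
theorem isNilpotent_cubicEval (h : PlaneModel a t θ) {s : ℂ} {x : CubicRing (coeffPoly a)} {y : K}
    (hy : y ∈ integralOver {t})
    (hxy : h.hom x = aeval t (Polynomial.X - Polynomial.C s) * y) :
    IsNilpotent (cubicEval a s x) := by
  obtain ⟨G, hG, hGv⟩ := exists_monic_of_mem_integralOver hy
  have h1 := Polynomial.scaleRoots_eval₂_eq_zero (s := Polynomial.X - Polynomial.C s) _ hGv
  change Polynomial.eval₂ _ (aeval t _ * y) _ = 0 at h1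
  have hφ : (aeval t : ℂ[X] →ₐ[ℂ] K).toRingHom = h.hom.comp CubicRing.base :=
    RingHom.ext fun p => (h.hom_base p).symm
  rw [← hxy, hφ, ← Polynomial.hom_eval₂] at h1
  have h2 := congrArg (cubicEval a s) ((injective_iff_map_eq_zero _).1 h.hom_injective _ h1)
  rw [map_zero, Polynomial.hom_eval₂, Polynomial.eval₂_eq_sum_range,
    Polynomial.natDegree_scaleRoots, Finset.sum_range_succ, Finset.sum_eq_zero] at h2
  · rw [zero_add, Polynomial.coeff_scaleRoots_natDegree, hG, map_one, one_mul] at h2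
    exact ⟨_, h2⟩
  · intro i hi
    rw [Finset.mem_range] at hi
    obtain ⟨k, hk⟩ := Nat.exists_eq_add_of_lt hi
    rw [Polynomial.coeff_scaleRoots, show G.natDegree - i = k + 1 by omega, pow_succ, RingHom.comp_apply,
      ← mul_assoc, mul_comm, map_mul, mul_comm (CubicRing.base _), cubicEval_base_mul, mul_zero]

/-- Suppose the value of `β` at `s` is nonzero. With `π = t - s`, both `β = π y` and `γ = π y²` lie
in the cubic ring, and a monic cubic equation of `y` shows that their values at `s` have pairwise
products zero. By the index form, `π (β ∧ γ)` is the cubic form at `β`. Differentiating at `s`,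
where `β` gives a double root, and using smoothness, `β ∧ γ` is nonzero at `s`. So every direction
`(p, q)` comes from an element of square zero, in particular a zero of the derivative of the form
along the base. That contradicts smoothness. -/
theorem cubicEval_eq_zero_of_sq (h : PlaneModel a t θ) {s : ℂ} {β : CubicRing (coeffPoly a)} {y : K}
    (hy : y ∈ integralOver {t})
    (hβy : h.hom β = aeval t (Polynomial.X - Polynomial.C s) * y)
    (hsq : cubicEval a s β * cubicEval a s β = 0) : cubicEval a s β = 0 := by
  by_contra hβ
  set π : ℂ[X] := Polynomial.X - Polynomial.C s with hπ
  have hπ0 : aeval t π ≠ 0 := fun h0 => Polynomial.X_sub_C_ne_zero s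
    (aeval_eq_zero_of_transcendental h.transcendental h0)
  obtain ⟨γ, hγ⟩ := exists_eq_mul_of_cubicEval_eq_zero (a := a) (s := s) (x := β * β)
    (by rw [map_mul, hsq])
  have hγy : h.hom γ = aeval t π * y ^ 2 := by
    refine mul_left_cancel₀ hπ0 ?_
    rw [← h.hom_base, ← map_mul, ← hγ, map_mul, hβy, h.hom_base]
    ring
  have hyt : y ∉ IntermediateField.adjoin ℂ {t} := by
    intro hmem
    obtain ⟨r, d, hd, hrd⟩ := exists_denom ⟨y, hmem⟩
    change aeval t d * y = _ at hrd
    have h1 : CubicRing.base d * β = CubicRing.base (π * r) := h.hom_injective (by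
      rw [map_mul, h.hom_base, h.hom_base, hβy, map_mul, ← hrd]
      ring)
    have hd0 : d ≠ 0 := fun h0 => hd (by rw [h0, map_zero])
    have e1 := congrArg CubicRing.c₁ h1
    have e2 := congrArg CubicRing.c₂ h1
    simp [hd0] at e1 e2
    have := h.smooth.derivative_ne_zero_of_sq_eq_zero hβ hsq
    simp [e1, e2] at this
  obtain ⟨e₁, e₂, e₃, he⟩ := exists_cubic_of_mem_integralOver h.transcendental h.finrank hy hyt
  have hβγ' : β * γ = CubicRing.base π *
      (-(CubicRing.base e₁ * γ) - CubicRing.base e₂ * β - CubicRing.base (e₃ * π)) :=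
    h.hom_injective (by
      simp only [map_mul, map_sub, map_neg, h.hom_base, hβy, hγy]
      linear_combination aeval t π ^ 2 * he)
  have hγγ' : γ * γ = -(CubicRing.base e₁ * (β * γ)) - CubicRing.base π *
      (CubicRing.base e₂ * γ + CubicRing.base e₃ * β) :=
    h.hom_injective (by
      simp only [map_mul, map_sub, map_neg, map_add, h.hom_base, hβy, hγy]
      linear_combination aeval t π ^ 2 * y * he)
  have hβγ : cubicEval a s β * cubicEval a s γ = 0 := by
    rw [← map_mul, hβγ', cubicEval_base_mul]
  have hγγ : cubicEval a s γ * cubicEval a s γ = 0 := by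
    rw [← map_mul, hγγ', map_sub, cubicEval_base_mul, map_neg, map_mul, map_mul, hβγ]
    simp
  have hindex : π * (β.c₁ * γ.c₂ - β.c₂ * γ.c₁) = coeffPoly a 0 * β.c₁ ^ 3 +
      coeffPoly a 1 * β.c₁ ^ 2 * β.c₂ + coeffPoly a 2 * β.c₁ * β.c₂ ^ 2 +
      coeffPoly a 3 * β.c₂ ^ 3 := by
    rw [← CubicRing.index_sq, hγ]
    simp [-map_sub, hπ]
    ring
  have hD : β.c₁.eval s * γ.c₂.eval s - β.c₂.eval s * γ.c₁.eval s ≠ 0 := by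
    obtain ⟨h1, h2, -⟩ := CubicRing.double_root_of_sq_eq_zero hsq
    have h3 := h.smooth.derivative_ne_zero_of_sq_eq_zero hβ hsq
    have h4 := congrArg (fun p => Polynomial.eval s (Polynomial.derivative p)) hindex
    simp [Polynomial.derivative_pow, hπ] at h1 h2 h3 h4
    rw [h4]
    refine fun h0 => h3 ?_
    linear_combination h0 - β.c₁.derivative.eval s * h1 - β.c₂.derivative.eval s * h2
  -- A direction in which the derivative of the form along the base vanishes; `δ` below is the
  -- combination of `β` and `γ` with this direction.
  obtain ⟨p, q, hpq, hzero⟩ := exists_zero_binary_cubic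
    (fun i => (coeffPoly a i).derivative.eval s)
  set D := β.c₁.eval s * γ.c₂.eval s - β.c₂.eval s * γ.c₁.eval s
  let δ : CubicRing (fun i => (coeffPoly a i).eval s) :=
    CubicRing.base ((p * γ.c₂.eval s - q * γ.c₁.eval s) / D) * cubicEval a s β +
      CubicRing.base ((q * β.c₁.eval s - p * β.c₂.eval s) / D) * cubicEval a s γ
  have hδ1 : δ.c₁ = p := by
    simp [δ]
    field_simp
    ring
  have hδ2 : δ.c₂ = q := by
    simp [δ]
    field_simp
    ring
  have hδδ : δ * δ = 0 := by
    simp only [δ]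
    linear_combination CubicRing.base ((p * γ.c₂.eval s - q * γ.c₁.eval s) / D) ^ 2 * hsq +
      CubicRing.base ((q * β.c₁.eval s - p * β.c₂.eval s) / D) ^ 2 * hγγ +
      2 * CubicRing.base ((p * γ.c₂.eval s - q * γ.c₁.eval s) / D) *
        CubicRing.base ((q * β.c₁.eval s - p * β.c₂.eval s) / D) * hβγ
  have hδ0 : δ ≠ 0 := by
    intro h0
    rw [h0] at hδ1 hδ2
    exact hpq.elim (fun h => h hδ1.symm) fun h => h hδ2.symm
  refine h.smooth.derivative_ne_zero_of_sq_eq_zero hδ0 hδδ ?_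
  rw [hδ1, hδ2]
  exact hzero

/-- The value is nilpotent. If it were nonzero, its last nonzero power would have square zero and
would again come from a multiple of `t - s` by an integral function, against
`cubicEval_eq_zero_of_sq`. -/
theorem cubicEval_eq_zero (h : PlaneModel a t θ) {s : ℂ} {x : CubicRing (coeffPoly a)} {y : K}
    (hy : y ∈ integralOver {t})
    (hxy : h.hom x = aeval t (Polynomial.X - Polynomial.C s) * y) :
    cubicEval a s x = 0 := by
  classical
  have hnil := h.isNilpotent_cubicEval hy hxy
  by_contra hx
  have hmin : ∀ m < Nat.find hnil, (cubicEval a s x) ^ m ≠ 0 := fun m hm => Nat.find_min hnil hm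
  have hspec := Nat.find_spec hnil
  rcases hk : Nat.find hnil with _ | _ | k
  · rw [hk, pow_zero] at hspec
    exact hx (by rw [← one_mul (cubicEval a s x), hspec, zero_mul])
  · rw [hk, zero_add, pow_one] at hspec
    exact hx hspec
  · rw [hk] at hmin hspec
    refine hmin (k + 1) (by omega) ?_
    rw [← map_pow]
    refine h.cubicEval_eq_zero_of_sq (y := y * h.hom x ^ k)
      (mul_mem hy (pow_mem (h.hom_mem x) k)) ?_ ?_
    · rw [map_pow, pow_succ]
      linear_combination h.hom x ^ k * hxy
    · rw [map_pow, ← pow_add, show k + 1 + (k + 1) = k + 1 + 1 + k by omega, pow_add, hspec, zero_mul]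

/-- The cubic ring of a smooth curve is integrally closed. -/
theorem exists_hom_eq (h : PlaneModel a t θ) {z : K} (hz : z ∈ integralOver {t}) :
    ∃ x, h.hom x = z := by
  have hden : ∃ (d : ℂ[X]) (x : CubicRing (coeffPoly a)), d ≠ 0 ∧
      aeval t d * z = h.hom x := by
    obtain ⟨P, hP0, hP⟩ := exists_aeval_relation h.finrank (by norm_num) ![1, θ, θ ^ 2, z]
    rw [Fin.sum_univ_four] at hP
    change aeval t (P 0) * 1 + aeval t (P 1) * θ +
      aeval t (P 2) * θ ^ 2 + aeval t (P 3) * z = 0 at hP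
    have hP3 : P 3 ≠ 0 := by
      intro h3
      rw [h3, map_zero, zero_mul, add_zero, mul_one] at hP
      obtain ⟨h0, h1, h2⟩ := h.eq_zero_of_sum hP
      refine hP0 (funext fun i => ?_)
      fin_cases i
      exacts [h0, h1, h2, h3]
    refine ⟨coeffPoly a 0 ^ 2 * P 3, ⟨-(coeffPoly a 0 ^ 2 * P 0),
      P 2 * coeffPoly a 1 - coeffPoly a 0 * P 1, -(P 2 * coeffPoly a 0)⟩,
      mul_ne_zero (pow_ne_zero _ h.smooth.coeffPoly_zero_ne_zero) hP3, ?_⟩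
    rw [hom_apply]
    simp only [map_mul, map_pow, map_neg, map_sub]
    linear_combination (aeval t (coeffPoly a 0)) ^ 2 * hP
  obtain ⟨d, x, hd, hx⟩ := hden
  -- The denominator is removed one linear factor at a time by `cubicEval_eq_zero`.
  induction hn : d.natDegree generalizing d x with
  | zero =>
    rw [Polynomial.eq_C_of_natDegree_eq_zero hn] at hd hx
    have hc : d.coeff 0 ≠ 0 := fun h0 => hd (by rw [h0, map_zero])
    refine ⟨CubicRing.base (Polynomial.C (d.coeff 0)⁻¹) * x, ?_⟩
    rw [map_mul, h.hom_base, ← hx, ← mul_assoc, ← map_mul, ← map_mul, inv_mul_cancel₀ hc]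
    simp
  | succ n ih =>
    obtain ⟨s, hs⟩ := Complex.exists_root (f := d)
      (Polynomial.natDegree_pos_iff_degree_pos.1 (by omega))
    obtain ⟨d', hd'⟩ := Polynomial.dvd_iff_isRoot.2 hs
    have hd0 : d' ≠ 0 := by
      rintro rfl
      exact hd (by rw [hd', mul_zero])
    have hxy : h.hom x = aeval t (Polynomial.X - Polynomial.C s) *
        (aeval t d' * z) := by
      rw [← hx, hd', map_mul, mul_assoc]
    obtain ⟨x', hx'⟩ := exists_eq_mul_of_cubicEval_eq_zero
      (h.cubicEval_eq_zero (mul_mem (aeval_mem_integralOver t d') hz) hxy)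
    have hdeg : d'.natDegree = n := by
      rw [hd', Polynomial.natDegree_mul (Polynomial.X_sub_C_ne_zero s) hd0,
        Polynomial.natDegree_X_sub_C] at hn
      omega
    refine ih d' x' hd0 (mul_left_cancel₀ (a := aeval t (Polynomial.X - Polynomial.C s))
      (fun h0 => Polynomial.X_sub_C_ne_zero s
        (aeval_eq_zero_of_transcendental h.transcendental h0)) ?_) hdeg
    rw [← hxy, hx', map_mul, h.hom_base]

theorem aeval_inv_coeffPoly_flipU (ht : t ≠ 0) (i : Fin 4) :
    aeval t⁻¹ (coeffPoly (flipU a) i) =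
      t⁻¹ ^ 4 * aeval t (coeffPoly a i) := by
  rw [coeffPoly_flipU, aeval_inv_reflect ht (natDegree_coeffPoly_le a i)]

theorem flip (h : PlaneModel a t θ) : PlaneModel (flipU a) t⁻¹ θ where
  smooth := isSmooth_flipU h.smooth
  transcendental := transcendental_inv h.transcendental
  root := by
    simp only [aeval_inv_coeffPoly_flipU (transcendental_ne_zero h.transcendental)]
    linear_combination t⁻¹ ^ 4 * h.root
  adjoin := by
    rw [eq_top_iff, ← h.adjoin, IntermediateField.adjoin_le_iff]
    rintro x (rfl | hx)
    · exact inv_inv x ▸ inv_mem (IntermediateField.subset_adjoin ℂ _ (by simp))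
    · exact IntermediateField.subset_adjoin ℂ _ (Or.inr hx)

theorem mem_integralOver_iff (h : PlaneModel a t θ) (z : K) :
    z ∈ integralOver {t} ↔ ∃ (P : ℂ[X]) (Q : Fin 2 → ℂ[X]), z = aeval t P +
      ∑ i, aeval t (Q i) * (![aeval t (coeffPoly a 0) * θ,
        aeval t (coeffPoly a 0) * θ ^ 2 +
          aeval t (coeffPoly a 1) * θ] : Fin 2 → K) i := by
  refine ⟨fun hz => ?_, ?_⟩
  · obtain ⟨x, rfl⟩ := h.exists_hom_eq hz
    refine ⟨x.c₀, ![x.c₁, x.c₂], ?_⟩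
    rw [hom_apply, Fin.sum_univ_two]
    simp [add_assoc]
  · rintro ⟨P, Q, rfl⟩
    have := h.hom_mem ⟨P, Q 0, Q 1⟩
    rw [hom_apply] at this
    rw [Fin.sum_univ_two, ← add_assoc]
    exact this

/-- The second chart is the first chart of the form with `u₀` and `u₁` exchanged. Its coefficients
in `t⁻¹` are `t⁻¹ ^ 4` times the old ones, and this is the twist by four. -/
theorem scrollBasis (h : PlaneModel a t θ) : ScrollBasis t ![aeval t (coeffPoly a 0) * θ,
    aeval t (coeffPoly a 0) * θ ^ 2 + aeval t (coeffPoly a 1) * θ] where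
  indep P Q h0 := by
    have h1 := (injective_iff_map_eq_zero _).1 h.hom_injective ⟨P, Q 0, Q 1⟩ (by
      rw [hom_apply, ← h0, Fin.sum_univ_two, ← add_assoc]
      rfl)
    refine ⟨congrArg CubicRing.c₀ h1, funext fun i => ?_⟩
    fin_cases i
    exacts [congrArg CubicRing.c₁ h1, congrArg CubicRing.c₂ h1]
  mem₀ := h.mem_integralOver_iff
  mem₁ z := by
    rw [h.flip.mem_integralOver_iff]
    simp only [aeval_inv_coeffPoly_flipU (transcendental_ne_zero h.transcendental),
      Fin.sum_univ_two, Matrix.cons_val_zero, Matrix.cons_val_one, mul_assoc, ← mul_add]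

end PlaneModel

end Normality

/-! ### Models of trigonal curves by forms -/

section Models

/-- The affine equation as a polynomial in the fiber coordinate. -/
def cubicPoly (a : Fin 4 × Fin 5 → ℂ) : ℂ[X][X] :=
  ∑ i : Fin 4, Polynomial.C (coeffPoly a i) * Polynomial.X ^ (3 - (i : ℕ))

theorem coeff_cubicPoly (a : Fin 4 × Fin 5 → ℂ) (i : Fin 4) :
    (cubicPoly a).coeff (3 - (i : ℕ)) = coeffPoly a i := by
  rw [cubicPoly, Polynomial.finsetSum_coeff, Finset.sum_eq_single i]
  · rw [Polynomial.coeff_C_mul_X_pow, if_pos rfl]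
  · intro j _ hj
    rw [Polynomial.coeff_C_mul_X_pow, if_neg]
    intro h
    exact hj (Fin.ext (by omega))
  · simp

theorem natDegree_cubicPoly_le (a : Fin 4 × Fin 5 → ℂ) : (cubicPoly a).natDegree ≤ 3 :=
  Polynomial.natDegree_sum_le_of_forall_le _ _ fun i _ =>
    (Polynomial.natDegree_C_mul_X_pow_le _ _).trans (by omega)

theorem IsSmooth.natDegree_cubicPoly {a : Fin 4 × Fin 5 → ℂ} (h : IsSmooth a) :
    (cubicPoly a).natDegree = 3 := by
  refine le_antisymm (natDegree_cubicPoly_le a) (Polynomial.le_natDegree_of_ne_zero ?_)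
  have := coeff_cubicPoly a 0
  rw [Fin.val_zero, Nat.sub_zero] at this
  rw [this]
  exact h.coeffPoly_zero_ne_zero

/-- At a common root `s` of the coefficients the whole line over `s` lies on the curve. The
derivative along the base is a binary cubic on this line, and any zero of it is a singular point. -/
theorem IsSmooth.isPrimitive_cubicPoly {a : Fin 4 × Fin 5 → ℂ} (h : IsSmooth a) :
    (cubicPoly a).IsPrimitive := by
  intro r hr
  rw [Polynomial.C_dvd_iff_dvd_coeff] at hr
  have hr' : ∀ i, r ∣ coeffPoly a i := fun i => coeff_cubicPoly a i ▸ hr _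
  by_contra hu
  have hr0 : r ≠ 0 := by
    rintro rfl
    exact h.coeffPoly_zero_ne_zero (zero_dvd_iff.1 (hr' 0))
  obtain ⟨s, hs⟩ := Complex.exists_root (f := r) (by
    rw [← Polynomial.natDegree_pos_iff_degree_pos, Nat.pos_iff_ne_zero]
    intro hd
    exact hu (Polynomial.isUnit_iff_degree_eq_zero.2 (by
      rw [Polynomial.degree_eq_natDegree hr0, hd]; rfl)))
  have hs0 : ∀ i, (coeffPoly a i).eval s = 0 := fun i => by
    obtain ⟨q, hq⟩ := hr' i
    rw [hq, Polynomial.eval_mul, hs, zero_mul]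
  obtain ⟨p, q, hpq, hz⟩ := exists_zero_binary_cubic (fun i => (coeffPoly a i).derivative.eval s)
  exact h.exists_derivative_ne_zero hpq (by simp [hs0]) (by simp [hs0]) hz

section

variable {K : Type} [Field K] [Algebra ℂ K] {t θ : K} {a : Fin 4 × Fin 5 → ℂ}

theorem aevalAeval_cubicPoly {A : Type*} [CommRing A] [Algebra ℂ A] (a : Fin 4 × Fin 5 → ℂ)
    (t θ : A) : Polynomial.aevalAeval t θ (cubicPoly a) =
      aeval t (coeffPoly a 0) * θ ^ 3 + aeval t (coeffPoly a 1) * θ ^ 2 +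
        aeval t (coeffPoly a 2) * θ + aeval t (coeffPoly a 3) := by
  simp only [cubicPoly, Fin.sum_univ_four, map_add, map_mul, map_pow, Polynomial.aevalAeval_C,
    Polynomial.aevalAeval_Y, Fin.val_zero, Fin.val_one, Fin.val_two,
    show ((3 : Fin 4) : ℕ) = 3 from rfl]
  norm_num

theorem PlaneModel.cubicPoly_dvd_iff (h : PlaneModel a t θ) (G : ℂ[X][X]) :
    cubicPoly a ∣ G ↔ Polynomial.aevalAeval t θ G = 0 := by
  have h0 : Polynomial.aevalAeval t θ (cubicPoly a) = 0 := by
    rw [aevalAeval_cubicPoly, h.root]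
  refine ⟨?_, fun hG => ?_⟩
  · rintro ⟨q, rfl⟩
    rw [map_mul, h0, zero_mul]
  · exact isPrimitive_dvd_of_aevalAeval_eq_zero
      (fun G hG hGv => eq_zero_of_natDegree_lt_three h.transcendental h.finrank h.notMem hG hGv)
      h.smooth.isPrimitive_cubicPoly h.smooth.natDegree_cubicPoly h0 hG

/-- Polynomials in two variables as polynomials in the first variable. -/
def toBivariate : MvPolynomial (Fin 2) ℂ →ₐ[ℂ] ℂ[X][X] :=
  MvPolynomial.aeval ![Polynomial.X, Polynomial.C Polynomial.X]

theorem aevalAeval_toBivariate {A : Type*} [CommRing A] [Algebra ℂ A] (z : Fin 2 → A)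
    (G : MvPolynomial (Fin 2) ℂ) :
    Polynomial.aevalAeval (z 1) (z 0) (toBivariate G) = MvPolynomial.aeval z G := by
  have : (Polynomial.aevalAeval (z 1) (z 0)).comp toBivariate = MvPolynomial.aeval z := by
    refine MvPolynomial.algHom_ext fun i => ?_
    fin_cases i <;> simp [toBivariate]
  exact DFunLike.congr_fun this G

theorem toBivariate_affineEquation (a : Fin 4 × Fin 5 → ℂ) :
    toBivariate (affineEquation a) = cubicPoly a := by
  simp only [toBivariate, affineEquation, map_sum, map_mul, map_pow, MvPolynomial.aeval_X,
    cubicPoly, coeffPoly, Finset.sum_mul, MvPolynomial.aeval_C]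
  refine Finset.sum_congr rfl fun i _ => Finset.sum_congr rfl fun j _ => ?_
  simp only [Matrix.cons_val_zero, Matrix.cons_val_one]
  rw [mul_right_comm]
  rfl

theorem affineEquation_dvd_iff (a : Fin 4 × Fin 5 → ℂ) (G : MvPolynomial (Fin 2) ℂ) :
    affineEquation a ∣ G ↔ cubicPoly a ∣ toBivariate G := by
  rw [← toBivariate_affineEquation]
  refine ⟨map_dvd toBivariate, fun h => ?_⟩
  have h1 := map_dvd (Polynomial.aevalAeval (R := ℂ)
    (MvPolynomial.X 1 : MvPolynomial (Fin 2) ℂ) (MvPolynomial.X 0)) h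
  rw [aevalAeval_toBivariate, aevalAeval_toBivariate, MvPolynomial.aeval_X_left_apply,
    MvPolynomial.aeval_X_left_apply] at h1
  exact h1

theorem PlaneModel.aeval_eq_zero_iff (h : PlaneModel a t θ) (G : MvPolynomial (Fin 2) ℂ) :
    MvPolynomial.aeval ![θ, t] G = 0 ↔ affineEquation a ∣ G := by
  rw [affineEquation_dvd_iff, h.cubicPoly_dvd_iff, ← aevalAeval_toBivariate]
  rfl

theorem isModel_iff (F : SmoothForm) (T : TrigonalCurve) :
    IsModel F T ↔ ∃ t θ : T.K, PlaneModel F.coeff t θ := by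
  constructor
  · rintro ⟨z, hz, hG⟩
    refine ⟨z 1, z 0, F.isSmooth, ?_, ?_, ?_⟩
    · rw [transcendental_iff]
      intro p hp
      have h1 := (hG (aeval (MvPolynomial.X 1) p)).1 (by
        rw [← Polynomial.aeval_algHom_apply, MvPolynomial.aeval_X, hp])
      rw [affineEquation_dvd_iff, ← Polynomial.aeval_algHom_apply] at h1
      have h2 : aeval (toBivariate (MvPolynomial.X 1)) p = Polynomial.C p := by
        rw [toBivariate, MvPolynomial.aeval_X]
        change aeval (Polynomial.C Polynomial.X : ℂ[X][X]) p = _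
        have := Polynomial.aeval_algebraMap_apply ℂ[X][X] (Polynomial.X : ℂ[X]) p
        rw [Polynomial.aeval_X_left_apply] at this
        exact this
      rw [h2] at h1
      by_contra hp0
      -- The affine equation has degree three in the first coordinate, so it divides no nonzero
      -- polynomial in the second coordinate alone.
      have h3 := Polynomial.natDegree_le_of_dvd h1 (Polynomial.C_ne_zero.2 hp0)
      rw [F.isSmooth.natDegree_cubicPoly, Polynomial.natDegree_C] at h3
      omega
    · rw [← aevalAeval_cubicPoly, ← toBivariate_affineEquation, aevalAeval_toBivariate]
      exact (hG _).2 dvd_rfl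
    · rw [← hz]
      congr 1
      ext x
      simp [Fin.exists_fin_two, eq_comm, or_comm]
  · rintro ⟨t, θ, h⟩
    refine ⟨![θ, t], ?_, h.aeval_eq_zero_iff⟩
    rw [← h.adjoin]
    congr 1
    ext x
    simp [eq_comm]

end

section FunctionField

variable {a : Fin 4 × Fin 5 → ℂ}

/-- The equation of the curve over the field of rational functions on the second line. -/
def functionFieldPoly (a : Fin 4 × Fin 5 → ℂ) : (RatFunc ℂ)[X] :=
  (cubicPoly a).map (algebraMap ℂ[X] (RatFunc ℂ))

theorem IsSmooth.irreducible_functionFieldPoly (h : IsSmooth a) :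
    Irreducible (functionFieldPoly a) := by
  refine Polynomial.irreducible_of_degree_le_three_of_not_isRoot ?_ fun x hx => ?_
  · rw [functionFieldPoly, Polynomial.natDegree_map_eq_of_injective
      (FaithfulSMul.algebraMap_injective _ _), h.natDegree_cubicPoly]
    simp
  · have ht : Transcendental ℂ (RatFunc.X : RatFunc ℂ) := RatFunc.transcendental_X
    refine h.ne_zero_of_mem_adjoin ht (x := x) (by rw [RatFunc.adjoin_X]; trivial) ?_
    rw [← aevalAeval_cubicPoly, aevalAeval_eq_sum _ _ (Nat.lt_succ_self _)]
    have h1 : Polynomial.eval x (functionFieldPoly a) = 0 := hx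
    rw [functionFieldPoly, Polynomial.eval_map, Polynomial.eval₂_eq_sum_range] at h1
    rw [← h1]
    refine Finset.sum_congr rfl fun i _ => ?_
    congr 1
    rw [← RatFunc.algebraMap_X, Polynomial.aeval_algebraMap_apply, Polynomial.aeval_X_left_apply]

theorem IsSmooth.exists_planeModel (h : IsSmooth a) :
    ∃ (K : Type) (_ : Field K) (_ : Algebra ℂ K) (t θ : K), PlaneModel a t θ := by
  have : Fact (Irreducible (functionFieldPoly a)) := ⟨h.irreducible_functionFieldPoly⟩
  let φ : RatFunc ℂ →ₐ[ℂ] AdjoinRoot (functionFieldPoly a) :=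
    IsScalarTower.toAlgHom ℂ (RatFunc ℂ) (AdjoinRoot (functionFieldPoly a))
  let t := φ RatFunc.X
  let θ := AdjoinRoot.root (functionFieldPoly a)
  have hφ : ∀ p : ℂ[X], φ (algebraMap ℂ[X] (RatFunc ℂ) p) = aeval t p := fun p => by
    rw [Polynomial.aeval_algHom_apply, ← RatFunc.algebraMap_X, Polynomial.aeval_algebraMap_apply,
      Polynomial.aeval_X_left_apply]
  refine ⟨AdjoinRoot (functionFieldPoly a), inferInstance, inferInstance, t, θ, h, ?_, ?_, ?_⟩
  · exact (transcendental_algebraMap_iff (R := ℂ) φ.toRingHom.injective).2 RatFunc.transcendental_X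
  · rw [← aevalAeval_cubicPoly, aevalAeval_eq_sum _ _ (Nat.lt_succ_self _)]
    have h1 := AdjoinRoot.eval₂_root (functionFieldPoly a)
    rw [functionFieldPoly, Polynomial.eval₂_map, Polynomial.eval₂_eq_sum_range] at h1
    refine Eq.trans (Finset.sum_congr rfl fun i _ => ?_) h1
    rw [← hφ]
    rfl
  · rw [eq_top_iff]
    rintro x -
    obtain ⟨p, rfl⟩ := AdjoinRoot.mk_surjective x
    have hmem : ∀ y : RatFunc ℂ, φ y ∈ IntermediateField.adjoin ℂ {t, θ} := by
      intro y
      have h1 : φ y ∈ IntermediateField.map φ ⊤ := ⟨y, trivial, rfl⟩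
      rw [← RatFunc.adjoin_X, IntermediateField.adjoin_map, Set.image_singleton] at h1
      exact IntermediateField.adjoin.mono ℂ _ _ (by simp [t]) h1
    induction p using Polynomial.induction_on' with
    | add p q hp hq => rw [map_add]; exact add_mem hp hq
    | monomial n y =>
      rw [← Polynomial.C_mul_X_pow_eq_monomial, map_mul, map_pow, AdjoinRoot.mk_X]
      exact mul_mem (hmem y) (pow_mem (IntermediateField.subset_adjoin ℂ _ (by simp [θ])) n)

/-- The trigonal curve with a given plane model. -/
def PlaneModel.curve {K : Type} [Field K] [Algebra ℂ K] {t θ : K} (h : PlaneModel a t θ) :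
    TrigonalCurve where
  K := K
  t := t
  transcendental := h.transcendental
  degree := h.finrank
  genus := h.scrollBasis.finrank_cechH1

end FunctionField

end Models

/-! ### The curve determines the form -/

section Injectivity

theorem eq_of_forall_sum_fin_four {c d : Fin 4 → ℂ}
    (h : ∀ x : ℂ, ∑ i : Fin 4, c i * x ^ (3 - (i : ℕ)) = ∑ i : Fin 4, d i * x ^ (3 - (i : ℕ))) :
    c = d := by
  have h1 : (∑ i : Fin 4, Polynomial.C (c i) * Polynomial.X ^ (3 - (i : ℕ))) =
      ∑ i : Fin 4, Polynomial.C (d i) * Polynomial.X ^ (3 - (i : ℕ)) := by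
    refine Polynomial.funext fun r => ?_
    simpa [Polynomial.eval_finsetSum] using h r
  funext i
  have hc : ∀ c : Fin 4 → ℂ, (∑ i : Fin 4, Polynomial.C (c i) *
      (Polynomial.X : ℂ[X]) ^ (3 - (i : ℕ))).coeff (3 - (i : ℕ)) = c i := by
    intro c
    rw [Polynomial.finsetSum_coeff, Finset.sum_eq_single i]
    · rw [Polynomial.coeff_C_mul_X_pow, if_pos rfl]
    · intro j _ hj
      rw [Polynomial.coeff_C_mul_X_pow, if_neg]
      intro h
      exact hj (Fin.ext (by omega))
    · simp
  rw [← hc c, h1, hc d]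

/-- Forms are determined by their values in a chart of the second line. -/
theorem evalForm_eq_of_chart {a b : Fin 4 × Fin 5 → ℂ} {x y : Fin 2 → ℂ}
    (h : ∀ s : ℂ, evalForm a x ![s, 1] = evalForm b y ![s, 1]) (u : Fin 2 → ℂ) :
    evalForm a x u = evalForm b y u := by
  have h1 : (∑ j : Fin 5, Polynomial.C (fiberCoeff a x j) * Polynomial.X ^ (4 - (j : ℕ))) =
      ∑ j : Fin 5, Polynomial.C (fiberCoeff b y j) * Polynomial.X ^ (4 - (j : ℕ)) := by
    refine Polynomial.funext fun r => ?_
    have := h r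
    rw [evalForm_eq_fiberCoeff, evalForm_eq_fiberCoeff] at this
    simpa [Polynomial.eval_finsetSum] using this
  have h2 : ∀ j, fiberCoeff a x j = fiberCoeff b y j := by
    intro j
    have hc : ∀ c : Fin 5 → ℂ, (∑ i : Fin 5, Polynomial.C (c i) *
        (Polynomial.X : ℂ[X]) ^ (4 - (i : ℕ))).coeff (4 - (j : ℕ)) = c j := by
      intro c
      rw [Polynomial.finsetSum_coeff, Finset.sum_eq_single j]
      · rw [Polynomial.coeff_C_mul_X_pow, if_pos rfl]
      · intro k _ hk
        rw [Polynomial.coeff_C_mul_X_pow, if_neg]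
        intro h
        exact hk (Fin.ext (by omega))
      · simp
    rw [← hc (fiberCoeff a x), h1, hc]
  rw [evalForm_eq_fiberCoeff, evalForm_eq_fiberCoeff]
  exact Finset.sum_congr rfl fun j _ => by rw [h2]

/-- The binary cubic form after a substitution on the second line. -/
theorem coeffPoly_eq_of_evalForm {a b : Fin 4 × Fin 5 → ℂ} {M : Matrix (Fin 2) (Fin 2) ℂ}
    (h : ∀ x u, evalForm b x u = evalForm a x (M.mulVec u)) (i : Fin 4) :
    coeffPoly b i = ∑ j : Fin 5, Polynomial.C (a (i, j)) *
      ((Polynomial.C (M 0 0) * Polynomial.X + Polynomial.C (M 0 1)) ^ (4 - (j : ℕ)) *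
      (Polynomial.C (M 1 0) * Polynomial.X + Polynomial.C (M 1 1)) ^ (j : ℕ)) := by
  refine Polynomial.funext fun s => ?_
  refine congrFun (eq_of_forall_sum_fin_four (c := fun i => (coeffPoly b i).eval s)
    (d := fun i => (∑ j : Fin 5, Polynomial.C (a (i, j)) *
      ((Polynomial.C (M 0 0) * Polynomial.X + Polynomial.C (M 0 1)) ^ (4 - (j : ℕ)) *
      (Polynomial.C (M 1 0) * Polynomial.X + Polynomial.C (M 1 1)) ^ (j : ℕ))).eval s)
    fun x => ?_) i
  have h1 := h ![x, 1] ![s, 1]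
  rw [evalForm_chart, evalForm_eq] at h1
  simp only [Matrix.cons_val_zero, Matrix.cons_val_one, one_pow, mul_one] at h1
  rw [h1]
  refine Finset.sum_congr rfl fun i _ => ?_
  rw [Polynomial.eval_finsetSum, Finset.sum_mul]
  refine Finset.sum_congr rfl fun j _ => ?_
  simp [Matrix.mulVec, dotProduct, Fin.sum_univ_two]
  ring

variable {K : Type} [Field K] [Algebra ℂ K] {t θ : K} {a a' : Fin 4 × Fin 5 → ℂ}

theorem PlaneModel.map {K' : Type} [Field K'] [Algebra ℂ K'] (h : PlaneModel a t θ)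
    (e : K ≃ₐ[ℂ] K') : PlaneModel a (e t) (e θ) where
  smooth := h.smooth
  transcendental := by
    rw [transcendental_iff]
    intro p hp
    change aeval ((e : K →ₐ[ℂ] K') t) p = 0 at hp
    rw [Polynomial.aeval_algHom_apply (e : K →ₐ[ℂ] K') t p] at hp
    exact aeval_eq_zero_of_transcendental h.transcendental
      ((map_eq_zero_iff (e : K →ₐ[ℂ] K') e.injective).1 hp)
  root := by
    have := congrArg (e : K →ₐ[ℂ] K') h.root
    simp only [map_add, map_mul, map_pow, map_zero, ← Polynomial.aeval_algHom_apply] at this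
    exact this
  adjoin := by
    have h1 := IntermediateField.adjoin_map ℂ {t, θ} (e : K →ₐ[ℂ] K')
    rw [h.adjoin, Set.image_pair] at h1
    rw [eq_top_iff]
    intro x _
    have h2 : x ∈ IntermediateField.map (e : K →ₐ[ℂ] K') ⊤ := ⟨e.symm x, trivial, by simp⟩
    rw [h1] at h2
    exact h2

/-- A plane model after a Möbius transformation on the second line. -/
theorem PlaneModel.moebius {b : Fin 4 × Fin 5 → ℂ} {M : GL (Fin 2) ℂ}
    (hb : ∀ x u, evalForm b x u = evalForm a x (M.1.mulVec u)) {s : K}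
    (h : PlaneModel a t θ) (hs : Transcendental ℂ s)
    (hst : t * (algebraMap ℂ K (M.1 1 0) * s + algebraMap ℂ K (M.1 1 1)) =
      algebraMap ℂ K (M.1 0 0) * s + algebraMap ℂ K (M.1 0 1)) : PlaneModel b s θ where
  smooth := smooth_of_evalForm_eq 1 M (fun x u => by simpa using hb x u) h.smooth
  transcendental := hs
  root := by
    set v := algebraMap ℂ K (M.1 1 0) * s + algebraMap ℂ K (M.1 1 1) with hv
    have h1 : ∀ i, aeval s (coeffPoly b i) =
        v ^ 4 * aeval t (coeffPoly a i) := by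
      intro i
      rw [coeffPoly_eq_of_evalForm hb, coeffPoly, map_sum, map_sum, Finset.mul_sum]
      refine Finset.sum_congr rfl fun j _ => ?_
      simp only [map_mul, map_pow, map_add, Polynomial.aeval_C, Polynomial.aeval_X]
      rw [← hst, ← hv, mul_pow]
      have : v ^ 4 = v ^ (4 - (j : ℕ)) * v ^ (j : ℕ) := by
        rw [← pow_add]; congr 1; omega
      rw [this]
      ring
    simp only [h1]
    linear_combination v ^ 4 * h.root
  adjoin := by
    have hv : algebraMap ℂ K (M.1 1 0) * s + algebraMap ℂ K (M.1 1 1) ≠ 0 := by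
      intro h0
      rw [h0, mul_zero] at hst
      have h1 : Polynomial.C (M.1 1 0) * Polynomial.X + Polynomial.C (M.1 1 1) = 0 :=
        aeval_eq_zero_of_transcendental hs (by simpa using h0)
      have h2 : Polynomial.C (M.1 0 0) * Polynomial.X + Polynomial.C (M.1 0 1) = 0 :=
        aeval_eq_zero_of_transcendental hs (by simpa using hst.symm)
      have e1 := congrArg (fun p => Polynomial.coeff p 1) h1
      have e2 := congrArg (fun p => Polynomial.coeff p 1) h2
      simp at e1 e2
      have hdet := (Matrix.isUnit_iff_isUnit_det _).1 M.isUnit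
      rw [Matrix.det_fin_two, e1, e2] at hdet
      simp at hdet
    rw [eq_top_iff, ← h.adjoin, IntermediateField.adjoin_le_iff]
    have hsm : s ∈ IntermediateField.adjoin ℂ {s, θ} :=
      IntermediateField.subset_adjoin ℂ _ (by simp)
    rintro x (rfl | hx)
    · rw [eq_div_of_mul_eq hv hst]
      exact div_mem (add_mem (mul_mem (algebraMap_mem _ _) hsm) (algebraMap_mem _ _))
        (add_mem (mul_mem (algebraMap_mem _ _) hsm) (algebraMap_mem _ _))
    · exact IntermediateField.subset_adjoin ℂ _ (Or.inr hx)

/-- Two plane models with the same covering of the second line differ by a linear substitution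
on the first line. -/
theorem PlaneModel.exists_evalForm_eq {θ' : K} (h : PlaneModel a t θ) (h' : PlaneModel a' t θ') :
    ∃ g : GL (Fin 2) ℂ, ∀ x u, evalForm a' x u = evalForm a (g.1.mulVec x) u := by
  obtain ⟨γ, p, hγ, hp⟩ := h.scrollBasis.exists_matrix_det h'.scrollBasis
  have hform : ∀ x : Fin 2 → ℂ, ∀ s,
      evalForm a (γ.transpose.mulVec x) ![s, 1] = γ.det * evalForm a' x ![s, 1] := by
    intro x
    set y := γ.transpose.mulVec x with hy
    have hy0 : y 0 = γ 0 0 * x 0 + γ 1 0 * x 1 := by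
      simp [hy]
    have hy1 : y 1 = γ 0 1 * x 0 + γ 1 1 * x 1 := by
      simp [hy]
    -- Both cubic rings are identified with subrings of the same field, and `τ` is the change of
    -- basis between them. The index form, the minor of the coordinates of `δ` and `δ²`, recovers
    -- the cubic form, and under `τ` it is multiplied by `γ.det`.
    let δ' : CubicRing (coeffPoly a') := ⟨0, Polynomial.C (x 0), Polynomial.C (x 1)⟩
    let τ : CubicRing (coeffPoly a') → CubicRing (coeffPoly a) := fun z =>
      ⟨z.c₀ + z.c₁ * p 0 + z.c₂ * p 1, z.c₁ * Polynomial.C (γ 0 0) + z.c₂ * Polynomial.C (γ 1 0),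
        z.c₁ * Polynomial.C (γ 0 1) + z.c₂ * Polynomial.C (γ 1 1)⟩
    have hτ : ∀ z, h.hom (τ z) = h'.hom z := by
      intro z
      have e0 := hp 0
      have e1 := hp 1
      rw [Fin.sum_univ_two] at e0 e1
      simp only [Matrix.cons_val_zero, Matrix.cons_val_one] at e0 e1
      rw [hom_apply, hom_apply]
      simp only [τ, map_add, map_mul, Polynomial.aeval_C]
      linear_combination -(aeval t z.c₁) * e0 - aeval t z.c₂ * e1
    have hmul : τ δ' * τ δ' = τ (δ' * δ') := h.hom_injective (by
      rw [map_mul, hτ, hτ, map_mul])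
    have h1 := CubicRing.index_sq (τ δ')
    have h2 := CubicRing.index_sq δ'
    rw [hmul] at h1
    intro s
    have e1 := congrArg (Polynomial.eval s) h1
    have e2 := congrArg (Polynomial.eval s) h2
    simp only [τ, δ', Polynomial.eval_add, Polynomial.eval_sub, Polynomial.eval_mul,
      Polynomial.eval_C, Polynomial.eval_pow] at e1 e2
    rw [evalForm_chart, evalForm_chart, Matrix.det_fin_two]
    simp only [Fin.sum_univ_four, Fin.val_zero, Fin.val_one, Fin.val_two,
      show ((3 : Fin 4) : ℕ) = 3 from rfl, hy0, hy1]
    norm_num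
    linear_combination -e1 + (γ 0 0 * γ 1 1 - γ 0 1 * γ 1 0) * e2
  -- The form is cubic in `x`, so a cube root of the inverse determinant absorbs the factor.
  obtain ⟨c, hc⟩ := IsAlgClosed.exists_pow_nat_eq γ.det⁻¹ (show 0 < 3 by norm_num)
  have hc0 : c ≠ 0 := by
    rintro rfl
    rw [zero_pow (by norm_num)] at hc
    exact inv_ne_zero hγ hc.symm
  have hdet : (c • γ.transpose).det ≠ 0 := by
    rw [Matrix.det_smul, Matrix.det_transpose]
    exact mul_ne_zero (pow_ne_zero _ hc0) hγ
  refine ⟨Matrix.GeneralLinearGroup.mkOfDetNeZero _ hdet, fun x u => ?_⟩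
  refine evalForm_eq_of_chart (fun s => ?_) u
  change _ = evalForm a ((c • γ.transpose).mulVec x) ![s, 1]
  have h3 := evalForm_smul_smul a c 1 (γ.transpose.mulVec x) ![s, 1]
  rw [one_smul, hform, hc, one_pow, mul_one, ← mul_assoc, inv_mul_cancel₀ hγ, one_mul] at h3
  rw [Matrix.smul_mulVec, h3]

/-- Smooth curves of bidegree `(3, 4)` with isomorphic function fields are equivalent. -/
theorem PlaneModel.mk_eq {F F' : SmoothForm} {t' θ' : K} (h : PlaneModel F.coeff t θ)
    (h' : PlaneModel F'.coeff t' θ') : C34.mk F = C34.mk F' := by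
  obtain ⟨p, q, r, s, hdet, hM⟩ := exists_moebius h.transcendental h'.transcendental h.finrank
    h'.finrank h.scrollBasis.finrank_cechH1
  have hdet' : (!![p, q; r, s] : Matrix (Fin 2) (Fin 2) ℂ).det ≠ 0 := by
    rwa [Matrix.det_fin_two_of]
  let M : GL (Fin 2) ℂ := Matrix.GeneralLinearGroup.mkOfDetNeZero _ hdet'
  have h1 : PlaneModel (F'.act 1 M).coeff t θ' := h'.moebius (M := M)
    (fun x u => by rw [F'.evalForm_act]; simp) h.transcendental hM
  obtain ⟨g, hg⟩ := h.exists_evalForm_eq h1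
  rw [← F'.mk_act 1 M, C34.mk_eq_iff]
  exact ⟨g, 1, fun x u => by rw [hg]; simp⟩

theorem C34.mk_eq_of_isModel {F F' : SmoothForm} {T T' : TrigonalCurve} (h : IsModel F T)
    (h' : IsModel F' T') (hT : M6trig.mk T = M6trig.mk T') : C34.mk F = C34.mk F' := by
  obtain ⟨e⟩ : Nonempty (T.K ≃ₐ[ℂ] T'.K) := Quotient.exact hT
  obtain ⟨t, θ, hF⟩ := (isModel_iff F T).1 h
  obtain ⟨t', θ', hF'⟩ := (isModel_iff F' T').1 h'
  exact (hF.map e).mk_eq hF'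

/-- Trigonal curves with the same plane model are isomorphic. -/
theorem PlaneModel.nonempty_algEquiv {K' : Type} [Field K'] [Algebra ℂ K'] {t' θ' : K'}
    (h : PlaneModel a t θ) (h' : PlaneModel a t' θ') : Nonempty (K ≃ₐ[ℂ] K') := by
  have key : ∀ {K : Type} [Field K] [Algebra ℂ K] {t θ : K} (h : PlaneModel a t θ),
      ∃ B : Subalgebra ℂ K, IsFractionRing B K ∧
        Nonempty ((ℂ[X][X] ⧸ Ideal.span {cubicPoly a}) ≃ₐ[ℂ] B) := by
    intro K _ _ t θ h
    have hker : RingHom.ker (Polynomial.aevalAeval (R := ℂ) t θ).rangeRestrict =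
        Ideal.span {cubicPoly a} := by
      ext G
      rw [RingHom.mem_ker, Ideal.mem_span_singleton, h.cubicPoly_dvd_iff]
      exact Subtype.ext_iff
    refine ⟨(Polynomial.aevalAeval (R := ℂ) t θ).range, ?_, ⟨(Ideal.quotientEquivAlgOfEq ℂ
      hker.symm).trans (Ideal.quotientKerAlgEquivOfSurjective
        (AlgHom.rangeRestrict_surjective _))⟩⟩
    refine IsFractionRing.of_field _ _ fun z => ?_
    have hz : z ∈ IntermediateField.adjoin ℂ {t, θ} := by rw [h.adjoin]; trivial
    obtain ⟨x, hx, y, hy, hxy⟩ := IntermediateField.mem_adjoin_iff_div.1 hz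
    have hle : Algebra.adjoin ℂ {t, θ} ≤ (Polynomial.aevalAeval (R := ℂ) t θ).range := by
      rw [Algebra.adjoin_le_iff]
      rintro w (rfl | hw)
      · exact ⟨Polynomial.C Polynomial.X,
          (Polynomial.aevalAeval_C _ _ _).trans (Polynomial.aeval_X _)⟩
      · rw [Set.mem_singleton_iff] at hw
        subst hw
        exact ⟨Polynomial.X, Polynomial.aevalAeval_Y _ _⟩
    exact ⟨⟨x, hle hx⟩, ⟨y, hle hy⟩, hxy⟩
  obtain ⟨B, hB, ⟨e⟩⟩ := key h
  obtain ⟨B', hB', ⟨e'⟩⟩ := key h'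
  exact ⟨IsFractionRing.fieldEquivOfAlgEquiv ℂ K K' (e.symm.trans e')⟩

end Injectivity

/-! ### Zariski openness of smoothness -/

theorem formPoly_isHomogeneous (a : Fin 4 × Fin 5 → ℂ) : (formPoly a).IsHomogeneous 7 := by
  rw [formPoly_eq_sum]
  refine MvPolynomial.IsHomogeneous.sum _ _ _ fun k _ => ?_
  have h := (((MvPolynomial.isHomogeneous_X ℂ (Sum.inl 0 : Fin 2 ⊕ Fin 2)).pow (3 - (k.1 : ℕ))).mul
    ((MvPolynomial.isHomogeneous_X ℂ (Sum.inl 1)).pow (k.1 : ℕ))).mul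
    (((MvPolynomial.isHomogeneous_X ℂ (Sum.inr 0)).pow (4 - (k.2 : ℕ))).mul
    ((MvPolynomial.isHomogeneous_X ℂ (Sum.inr 1)).pow (k.2 : ℕ)))
  have h7 : 0 + (1 * (3 - (k.1 : ℕ)) + 1 * (k.1 : ℕ) +
      (1 * (4 - (k.2 : ℕ)) + 1 * (k.2 : ℕ))) = 7 := by omega
  exact h7 ▸ (MvPolynomial.isHomogeneous_C _ (a k)).mul h

/-- By Euler's relation the form vanishes wherever all its partial derivatives do, so the condition
on its value can be dropped. -/
theorem IsSmooth.exists_pderiv_ne_zero {a : Fin 4 × Fin 5 → ℂ} (ha : IsSmooth a)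
    {x u : Fin 2 → ℂ} (hx : x ≠ 0) (hu : u ≠ 0) :
    ∃ k, MvPolynomial.eval (Sum.elim x u) (MvPolynomial.pderiv k (formPoly a)) ≠ 0 := by
  by_contra! h
  obtain ⟨k, hk⟩ := ha x u hx hu (by
    have h7 := congrArg (MvPolynomial.eval (Sum.elim x u))
      (formPoly_isHomogeneous a).sum_X_mul_pderiv
    rw [map_sum, Finset.sum_eq_zero fun k _ => by rw [map_mul, h k, mul_zero], map_nsmul] at h7
    simpa [evalForm] using h7.symm)
  exact hk (h k)

/-- By the Nullstellensatz it suffices that the partial derivatives have no common zero with `x i`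
and `u j` both nonzero. -/
theorem IsSmooth.mul_mem_radical {a : Fin 4 × Fin 5 → ℂ} (ha : IsSmooth a) (i j : Fin 2) :
    MvPolynomial.X (Sum.inl i) * MvPolynomial.X (Sum.inr j) ∈
      (Ideal.span (Set.range fun k => MvPolynomial.pderiv k (formPoly a))).radical := by
  rw [← MvPolynomial.vanishingIdeal_zeroLocus_eq_radical (K := ℂ),
    MvPolynomial.mem_vanishingIdeal_iff]
  intro y hy
  by_contra h
  rw [map_mul, MvPolynomial.aeval_X, MvPolynomial.aeval_X, mul_eq_zero, not_or] at h
  obtain ⟨k, hk⟩ := ha.exists_pderiv_ne_zero (x := y ∘ Sum.inl) (u := y ∘ Sum.inr)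
    (fun h0 => h.1 (congrFun h0 i)) (fun h0 => h.2 (congrFun h0 j))
  rw [Sum.elim_comp_inl_inr] at hk
  exact hk (MvPolynomial.mem_zeroLocus_iff.1 hy _ (Ideal.subset_span ⟨k, rfl⟩))

/-- The exponent of the monomial `x₀ ^ p * x₁ ^ (D - p) * u₀ ^ q * u₁ ^ (D - q)`. -/
def biExponent {D : ℕ} (β : Fin (D + 1) × Fin (D + 1)) : (Fin 2 ⊕ Fin 2) →₀ ℕ :=
  Finsupp.equivFunOnFinite.symm
    (Sum.elim ![(β.1 : ℕ), D - (β.1 : ℕ)] ![(β.2 : ℕ), D - (β.2 : ℕ)])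

theorem biExponent_injective (D : ℕ) :
    Function.Injective (biExponent : Fin (D + 1) × Fin (D + 1) → _) := by
  intro β γ h
  have h0 := DFunLike.congr_fun h (Sum.inl 0)
  have h1 := DFunLike.congr_fun h (Sum.inr 0)
  simp only [biExponent, Finsupp.coe_equivFunOnFinite_symm, Sum.elim_inl, Sum.elim_inr,
    Matrix.cons_val_zero] at h0 h1
  exact Prod.ext (Fin.ext h0) (Fin.ext h1)

/-- The two exponents of `x` add up to `2 * N`, so one of them is at least `N`, and likewise for
`u`. -/
theorem monomial_biExponent_mem {I : Ideal (MvPolynomial (Fin 2 ⊕ Fin 2) ℂ)} {N : ℕ}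
    (h : ∀ i j, (MvPolynomial.X (Sum.inl i) * MvPolynomial.X (Sum.inr j)) ^ N ∈ I)
    (β : Fin (2 * N + 1) × Fin (2 * N + 1)) :
    MvPolynomial.monomial (biExponent β) (1 : ℂ) ∈ I := by
  obtain ⟨i, hi⟩ : ∃ i : Fin 2, N ≤ ![(β.1 : ℕ), 2 * N - (β.1 : ℕ)] i := by
    rcases le_total N β.1 with h | h
    · exact ⟨0, h⟩
    · exact ⟨1, show N ≤ 2 * N - (β.1 : ℕ) by omega⟩
  obtain ⟨j, hj⟩ : ∃ j : Fin 2, N ≤ ![(β.2 : ℕ), 2 * N - (β.2 : ℕ)] j := by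
    rcases le_total N β.2 with h | h
    · exact ⟨0, h⟩
    · exact ⟨1, show N ≤ 2 * N - (β.2 : ℕ) by omega⟩
  refine I.mem_of_dvd ?_ (h i j)
  rw [MvPolynomial.monomial_eq, map_one, one_mul, Finsupp.prod_fintype _ _ fun _ => pow_zero _,
    Fintype.prod_sum_type, mul_pow]
  exact mul_dvd_mul
    ((pow_dvd_pow _ hi).trans (Finset.dvd_prod_of_mem (fun i => MvPolynomial.X (Sum.inl i) ^
      biExponent β (Sum.inl i)) (Finset.mem_univ i)))
    ((pow_dvd_pow _ hj).trans (Finset.dvd_prod_of_mem (fun j => MvPolynomial.X (Sum.inr j) ^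
      biExponent β (Sum.inr j)) (Finset.mem_univ j)))

/-- The restriction of a polynomial in `x, u` to the points `(c • x, d • u)`. -/
def biScale (x u : Fin 2 → ℂ) : MvPolynomial (Fin 2 ⊕ Fin 2) ℂ →ₐ[ℂ] ℂ[X][X] :=
  MvPolynomial.aeval (Sum.elim (fun i => Polynomial.C (Polynomial.C (x i) * Polynomial.X))
    (fun j => Polynomial.C (Polynomial.C (u j)) * Polynomial.X))

/-- Restriction to the points `(c x, d u)` separates bidegrees, so this coefficient is the value at
`(x, u)` of the part of bidegree `(D, D)`. -/
theorem coeff_biScale (x u : Fin 2 → ℂ) (D : ℕ) (p : MvPolynomial (Fin 2 ⊕ Fin 2) ℂ) :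
    ((biScale x u p).coeff D).coeff D = ∑ β : Fin (D + 1) × Fin (D + 1),
      p.coeff (biExponent β) *
        MvPolynomial.eval (Sum.elim x u) (MvPolynomial.monomial (biExponent β) 1) := by
  induction p using MvPolynomial.induction_on' with
  | add p q hp hq =>
    rw [map_add, Polynomial.coeff_add, Polynomial.coeff_add, hp, hq, ← Finset.sum_add_distrib]
    exact Finset.sum_congr rfl fun β _ => by rw [MvPolynomial.coeff_add, add_mul]
  | monomial m c =>
    have h : biScale x u (MvPolynomial.monomial m c) = Polynomial.C (Polynomial.C
        (c * MvPolynomial.eval (Sum.elim x u) (MvPolynomial.monomial m 1)) *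
        Polynomial.X ^ (m (Sum.inl 0) + m (Sum.inl 1))) *
        Polynomial.X ^ (m (Sum.inr 0) + m (Sum.inr 1)) := by
      rw [biScale, MvPolynomial.aeval_monomial, MvPolynomial.eval_monomial,
        Finsupp.prod_fintype _ _ fun _ => pow_zero _, Finsupp.prod_fintype _ _ fun _ => pow_zero _]
      simp only [Fintype.prod_sum_type, Fin.prod_univ_two, Sum.elim_inl, Sum.elim_inr, map_mul,
        map_pow, mul_pow, pow_add, Polynomial.algebraMap_apply, Algebra.algebraMap_self,
        RingHom.id_apply, one_mul]
      ring
    rw [h, Polynomial.coeff_C_mul_X_pow, apply_ite (fun q : ℂ[X] => q.coeff D),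
      Polynomial.coeff_C_mul_X_pow, Polynomial.coeff_zero]
    by_cases hD : D = m (Sum.inr 0) + m (Sum.inr 1) ∧ D = m (Sum.inl 0) + m (Sum.inl 1)
    · rw [if_pos hD.1, if_pos hD.2]
      have hm : biExponent (⟨(⟨m (Sum.inl 0), by omega⟩ : Fin (D + 1)),
          (⟨m (Sum.inr 0), by omega⟩ : Fin (D + 1))⟩) = m := by
        ext (k | k) <;> fin_cases k <;> simp [biExponent] <;> omega
      rw [Finset.sum_eq_single (⟨(⟨m (Sum.inl 0), by omega⟩ : Fin (D + 1)),
          (⟨m (Sum.inr 0), by omega⟩ : Fin (D + 1))⟩), hm, MvPolynomial.coeff_monomial, if_pos rfl]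
      · intro β _ hβ
        rw [MvPolynomial.coeff_monomial, if_neg fun h => hβ (biExponent_injective D
          (h.symm.trans hm.symm)), zero_mul]
      · exact fun h => absurd (Finset.mem_univ _) h
    · rw [Finset.sum_eq_zero]
      · rw [not_and_or] at hD
        rcases hD with hD | hD
        · rw [if_neg hD]
        · rw [if_neg hD, ite_self]
      · intro β _
        rw [MvPolynomial.coeff_monomial, if_neg, zero_mul]
        rintro rfl
        have := β.1.2
        have := β.2.2
        simp [biExponent] at hD
        omega

theorem eq_zero_of_forall_ne_zero {p : ℂ[X]} (h : ∀ c ≠ 0, p.eval c = 0) : p = 0 :=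
  Polynomial.eq_zero_of_infinite_isRoot p ((Set.finite_singleton (0 : ℂ)).infinite_compl.mono
    fun c hc => h c hc)

theorem biScale_eq_zero {x u : Fin 2 → ℂ} {p : MvPolynomial (Fin 2 ⊕ Fin 2) ℂ}
    (h : ∀ c d : ℂ, c ≠ 0 → d ≠ 0 → MvPolynomial.eval (Sum.elim (c • x) (d • u)) p = 0) :
    biScale x u p = 0 := by
  ext1 n
  refine eq_zero_of_forall_ne_zero fun c hc => ?_
  rw [← Polynomial.coe_evalRingHom, ← Polynomial.coeff_map, eq_zero_of_forall_ne_zero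
    (p := (biScale x u p).map (Polynomial.evalRingHom c)), Polynomial.coeff_zero]
  intro d hd
  rw [← h c d hc hd, ← Polynomial.coe_evalRingHom, ← Polynomial.coe_mapRingHom]
  change (((Polynomial.evalRingHom d).comp (Polynomial.mapRingHom (Polynomial.evalRingHom c))).comp
    (biScale x u).toRingHom) p = _
  congr 1
  refine MvPolynomial.ringHom_ext (fun z => ?_) fun k => ?_
  · simp [biScale]
  · rcases k with k | k <;> simp only [biScale, AlgHom.toRingHom_eq_coe, RingHom.coe_comp,
      RingHom.coe_coe, Function.comp_apply, MvPolynomial.aeval_X, Sum.elim_inl, Sum.elim_inr] <;>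
      simp [mul_comm (x _), mul_comm (u _)]

/-- Smoothness is a Zariski open condition. -/
theorem IsSmooth.exists_eval_ne_zero {a₀ : Fin 4 × Fin 5 → ℂ} (ha₀ : IsSmooth a₀) :
    ∃ Δ : CoeffRing, MvPolynomial.eval a₀ Δ ≠ 0 ∧
      ∀ a, MvPolynomial.eval a Δ ≠ 0 → IsSmooth a := by
  choose n hn using ha₀.mul_mem_radical
  obtain ⟨N, hN⟩ : ∃ N, ∀ i j, n i j ≤ N := ⟨∑ i, ∑ j, n i j, fun i j =>
    (Finset.single_le_sum (f := fun j => n i j) (fun _ _ => Nat.zero_le _) (Finset.mem_univ j)).trans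
      (Finset.single_le_sum (f := fun i => ∑ j, n i j) (fun _ _ => Nat.zero_le _)
        (Finset.mem_univ i))⟩
  have hmem := monomial_biExponent_mem (N := N) fun i j =>
    Ideal.pow_mem_of_pow_mem _ (hn i j) (hN i j)
  simp only [Ideal.mem_span_range_iff_exists_fun] at hmem
  choose G hG using hmem
  -- Row `β` lists the coefficients of bidegree `(2 N, 2 N)` of the combination of partial
  -- derivatives that equals the monomial `β` for `a₀`. The matrix is linear in the form and is the
  -- identity at `a₀`.
  let M : Matrix (Fin (2 * N + 1) × Fin (2 * N + 1)) (Fin (2 * N + 1) × Fin (2 * N + 1)) CoeffRing :=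
    fun β γ => ∑ m, MvPolynomial.X m * MvPolynomial.C (MvPolynomial.coeff (biExponent γ)
      (∑ k, G β k * MvPolynomial.pderiv k (formMon m)))
  have hM : ∀ a, M.map (MvPolynomial.eval a) = fun β γ => MvPolynomial.coeff (biExponent γ)
      (∑ k, G β k * MvPolynomial.pderiv k (formPoly a)) := by
    intro a
    ext β γ
    change MvPolynomial.eval a (∑ m, MvPolynomial.X m * MvPolynomial.C (MvPolynomial.coeff
      (biExponent γ) (∑ k, G β k * MvPolynomial.pderiv k (formMon m)))) = _
    simp only [map_sum, map_mul, MvPolynomial.eval_X, MvPolynomial.eval_C]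
    simp only [formPoly_eq_sum, map_sum, MvPolynomial.pderiv_C_mul, Finset.mul_sum]
    rw [Finset.sum_comm, MvPolynomial.coeff_sum]
    refine Finset.sum_congr rfl fun m _ => ?_
    rw [MvPolynomial.coeff_sum, MvPolynomial.coeff_sum, Finset.mul_sum]
    refine Finset.sum_congr rfl fun k _ => ?_
    rw [mul_left_comm, MvPolynomial.coeff_C_mul]
  have hdet : ∀ a, MvPolynomial.eval a M.det = (M.map (MvPolynomial.eval a)).det := fun a =>
    RingHom.map_det _ _
  refine ⟨M.det, ?_, fun a ha x u hx hu _ => ?_⟩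
  · have h1 : M.map (MvPolynomial.eval a₀) = 1 := by
      rw [hM]
      ext β γ
      rw [hG, MvPolynomial.coeff_monomial, Matrix.one_apply]
      exact if_congr (biExponent_injective _).eq_iff rfl rfl
    rw [hdet, h1, Matrix.det_one]
    exact one_ne_zero
  · by_contra! h
    rw [hdet] at ha
    -- At a singular point the matrix kills the vector of values of the monomials. All rescalings of
    -- the point are singular too, so the part of bidegree `(2 N, 2 N)` of each combination vanishes
    -- there. But `x i ^ (2 N) * u j ^ (2 N)` is a nonzero entry of that vector for suitable `i` and
    -- `j`.
    refine (?_ : (fun γ => MvPolynomial.eval (Sum.elim x u)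
      (MvPolynomial.monomial (biExponent γ) (1 : ℂ))) ≠ 0) (Matrix.eq_zero_of_mulVec_eq_zero ha ?_)
    · obtain ⟨i, hi⟩ := Function.ne_iff.1 hx
      obtain ⟨j, hj⟩ := Function.ne_iff.1 hu
      intro h0
      have h1 : ∀ i : Fin 2, ∃ p : Fin (2 * N + 1),
          ![(p : ℕ), 2 * N - (p : ℕ)] = Pi.single i (2 * N) := by
        intro i
        fin_cases i
        · exact ⟨Fin.last _, by ext k; fin_cases k <;> simp⟩
        · exact ⟨0, by ext k; fin_cases k <;> simp⟩
      obtain ⟨p, hp⟩ := h1 i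
      obtain ⟨q, hq⟩ := h1 j
      have h2 := congrFun h0 (p, q)
      simp only [MvPolynomial.eval_monomial, biExponent, hp, hq] at h2
      rw [Finsupp.prod_fintype _ _ fun _ => pow_zero _, Fintype.prod_sum_type] at h2
      simp only [Finsupp.coe_equivFunOnFinite_symm, Sum.elim_inl, Sum.elim_inr, Pi.single_apply,
        pow_ite, pow_zero, Finset.prod_ite_eq', Finset.mem_univ, if_true, one_mul,
        Pi.zero_apply] at h2
      exact mul_ne_zero (pow_ne_zero _ hi) (pow_ne_zero _ hj) h2
    · ext β
      rw [hM, Pi.zero_apply]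
      refine (coeff_biScale x u (2 * N) _).symm.trans ?_
      rw [biScale_eq_zero, Polynomial.coeff_zero, Polynomial.coeff_zero]
      intro c d hc hd
      rw [map_sum]
      refine Finset.sum_eq_zero fun k _ => ?_
      rw [map_mul, not_not.1 fun hk => (exists_pderiv_smul hc hd ⟨k, hk⟩).elim fun l hl => hl (h l),
        mul_zero]

/-! ### Freeness and base change of cubic rings -/

namespace CubicRing

variable {S S' : Type*} [CommRing S] [CommRing S'] {f : Fin 4 → S} {g : Fin 4 → S'}

instance {R : Type*} [CommRing R] [Algebra R S] : Algebra R (CubicRing f) :=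
  (base.comp (algebraMap R S)).toAlgebra

theorem algebraMap_eq {R : Type*} [CommRing R] [Algebra R S] (r : R) :
    algebraMap R (CubicRing f) r = base (algebraMap R S r) := rfl

theorem base_mul (s : S) (x : CubicRing f) : base s * x = ⟨s * x.c₀, s * x.c₁, s * x.c₂⟩ := by
  ext <;> simp

theorem eq_sum (x : CubicRing f) :
    x = base x.c₀ + base x.c₁ * ⟨0, 1, 0⟩ + base x.c₂ * ⟨0, 0, 1⟩ := by
  ext <;> simp

/-- The cubic ring is a free module of rank three. -/
def equivFun (f : Fin 4 → S) : CubicRing f ≃ₗ[S] (Fin 3 → S) where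
  toFun x := ![x.c₀, x.c₁, x.c₂]
  invFun v := ⟨v 0, v 1, v 2⟩
  left_inv _ := rfl
  right_inv v := by ext i; fin_cases i <;> rfl
  map_add' x y := by ext i; fin_cases i <;> rfl
  map_smul' s x := by
    rw [Algebra.smul_def, algebraMap_eq, Algebra.algebraMap_self, RingHom.id_apply, base_mul]
    ext i
    fin_cases i <;> rfl

theorem finite_base : (base : S →+* CubicRing f).Finite :=
  Module.Finite.equiv (equivFun f).symm

theorem flat_base : (base : S →+* CubicRing f).Flat :=
  have : Module.Free S (CubicRing f) := Module.Free.of_equiv (equivFun f).symm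
  (inferInstance : Module.Flat S (CubicRing f))

/-- Base change of cubic rings, combined with a rescaling of the basis. -/
def scale (φ : S →+* S') (u : S') (h : ∀ i, φ (f i) = u * g i) : CubicRing f →+* CubicRing g where
  toFun x := ⟨φ x.c₀, u * φ x.c₁, u * φ x.c₂⟩
  map_one' := by ext <;> simp
  map_zero' := by ext <;> simp
  map_add' x y := by ext <;> simp <;> ring
  map_mul' x y := by ext <;> simp [h] <;> ring

theorem scale_apply (φ : S →+* S') (u : S') (h : ∀ i, φ (f i) = u * g i) (x : CubicRing f) :
    scale φ u h x = ⟨φ x.c₀, u * φ x.c₁, u * φ x.c₂⟩ := rfl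

theorem scale_injective {φ : S →+* S'} {u : S'} (h : ∀ i, φ (f i) = u * g i)
    (hφ : Function.Injective φ) (hu : IsUnit u) : Function.Injective (scale φ u h) := by
  intro x y hxy
  rw [scale_apply, scale_apply, CubicRing.mk.injEq] at hxy
  exact CubicRing.ext (hφ hxy.1) (hφ (hu.mul_left_cancel hxy.2.1)) (hφ (hu.mul_left_cancel hxy.2.2))

theorem mem_map_base (I : Ideal S) {x : CubicRing f} (h₀ : x.c₀ ∈ I) (h₁ : x.c₁ ∈ I)
    (h₂ : x.c₂ ∈ I) : x ∈ I.map (base : S →+* CubicRing f) := by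
  rw [eq_sum x]
  exact add_mem (add_mem (Ideal.mem_map_of_mem _ h₀) (Ideal.mul_mem_right _ _
    (Ideal.mem_map_of_mem _ h₁))) (Ideal.mul_mem_right _ _ (Ideal.mem_map_of_mem _ h₂))

end CubicRing

/-! ### The family of trigonal curves over a base with a form -/

section UniversalFamily

variable {R : Type} [CommRing R] {a : Fin 4 × Fin 5 → R}

theorem map_coeffPoly {S S' : Type*} [CommSemiring S] [CommSemiring S'] (φ : S →+* S')
    (a : Fin 4 × Fin 5 → S) (i : Fin 4) : (coeffPoly a i).map φ = coeffPoly (φ ∘ a) i := by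
  simp [coeffPoly, Polynomial.map_sum]

theorem apply_mem_map_comp_iff {A B : Type*} [CommRing A] [CommRing B] (e : A ≃+* B) (φ : R →+* A)
    (I : Ideal R) (x : A) : e x ∈ I.map (e.toRingHom.comp φ) ↔ x ∈ I.map φ := by
  rw [← Ideal.map_map]
  refine ⟨fun hx => ?_, fun hx => Ideal.mem_map_of_mem e.toRingHom hx⟩
  obtain ⟨x', hx', hxx⟩ := (Ideal.mem_map_iff_of_surjective e.toRingHom e.surjective).1 hx
  rwa [← e.injective hxx]

section Chart

variable {L : Type} [CommRing L] [Algebra R L] (ψ : CubicRing (coeffPoly a) →+* L)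
  (hψ : ∀ r, ψ (CubicRing.base (Polynomial.C r)) = algebraMap R L r)

/-- The image of a cubic ring, as a ring of functions on a chart of a family. -/
def chartRange : Subalgebra R L :=
  { ψ.range with algebraMap_mem' := fun r => ⟨_, hψ r⟩ }

/-- A cubic ring is isomorphic to its image under an injective homomorphism. -/
def chartEquiv (hinj : Function.Injective ψ) :
    CubicRing (coeffPoly a) ≃+* chartRange ψ hψ :=
  RingEquiv.ofBijective ψ.rangeRestrict
    ⟨fun _ _ h => hinj (congrArg Subtype.val h), ψ.rangeRestrict_surjective⟩

theorem coe_chartEquiv (hinj : Function.Injective ψ) (x : CubicRing (coeffPoly a)) :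
    (chartEquiv ψ hψ hinj x : L) = ψ x := rfl

theorem aeval_chartRange (hinj : Function.Injective ψ) {τ : L} (hτ : τ ∈ chartRange ψ hψ)
    (hX : ψ (CubicRing.base Polynomial.X) = τ) :
    (aeval (R := R) (⟨τ, hτ⟩ : chartRange ψ hψ)).toRingHom =
      (chartEquiv ψ hψ hinj).toRingHom.comp CubicRing.base := by
  refine Polynomial.ringHom_ext (fun r => Subtype.ext ?_) (Subtype.ext ?_)
  · change ((aeval _ (Polynomial.C r) : chartRange ψ hψ) : L) = _
    rw [Polynomial.aeval_C]
    exact (hψ r).symm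
  · change ((aeval _ Polynomial.X : chartRange ψ hψ) : L) = _
    rw [Polynomial.aeval_X]
    exact hX.symm

theorem finite_chartRange (hinj : Function.Injective ψ) {τ : L} (hτ : τ ∈ chartRange ψ hψ)
    (hX : ψ (CubicRing.base Polynomial.X) = τ) :
    (aeval (R := R) (⟨τ, hτ⟩ : chartRange ψ hψ)).toRingHom.Finite := by
  rw [aeval_chartRange ψ hψ hinj hτ hX]
  exact (RingHom.Finite.of_surjective _ (chartEquiv ψ hψ hinj).surjective).comp
    CubicRing.finite_base

theorem flat_chartRange (hinj : Function.Injective ψ) {τ : L} (hτ : τ ∈ chartRange ψ hψ)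
    (hX : ψ (CubicRing.base Polynomial.X) = τ) :
    (aeval (R := R) (⟨τ, hτ⟩ : chartRange ψ hψ)).toRingHom.Flat := by
  rw [aeval_chartRange ψ hψ hinj hτ hX]
  exact CubicRing.flat_base.comp (RingHom.Flat.of_bijective (chartEquiv ψ hψ hinj).bijective)

variable [Algebra ℂ R] {p : R →ₐ[ℂ] ℂ} {K : Type} [Field K] [Algebra ℂ K] {s θ : K}

/-- The restriction of a cubic ring to a fiber. -/
def fiberMap (a : Fin 4 × Fin 5 → R) (p : R →ₐ[ℂ] ℂ) :
    CubicRing (coeffPoly a) →+* CubicRing (coeffPoly (p ∘ a)) :=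
  CubicRing.map (Polynomial.mapRingHom (p : R →+* ℂ)) fun i => map_coeffPoly (p : R →+* ℂ) a i

theorem fiberMap_surjective : Function.Surjective (fiberMap a p) := by
  intro x
  have hp : Function.Surjective (p : R →+* ℂ) := fun z =>
    ⟨algebraMap ℂ R z, by simp⟩
  obtain ⟨y₀, h₀⟩ := Polynomial.map_surjective _ hp x.c₀
  obtain ⟨y₁, h₁⟩ := Polynomial.map_surjective _ hp x.c₁
  obtain ⟨y₂, h₂⟩ := Polynomial.map_surjective _ hp x.c₂
  exact ⟨⟨y₀, y₁, y₂⟩, CubicRing.ext h₀ h₁ h₂⟩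

theorem fiberMap_eq_zero_iff (x : CubicRing (coeffPoly a)) : fiberMap a p x = 0 ↔
    x ∈ (RingHom.ker p).map (CubicRing.base.comp Polynomial.C :
      R →+* CubicRing (coeffPoly a)) := by
  constructor
  · intro h
    have key : ∀ q : R[X], q.map (p : R →+* ℂ) = 0 → q ∈ (RingHom.ker p).map Polynomial.C := by
      intro q hq
      rw [Ideal.mem_map_C_iff]
      intro n
      have := congrArg (fun q : ℂ[X] => q.coeff n) hq
      simpa [Polynomial.coeff_map] using this
    rw [← Ideal.map_map]
    exact CubicRing.mem_map_base _ (key _ (congrArg CubicRing.c₀ h))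
      (key _ (congrArg CubicRing.c₁ h)) (key _ (congrArg CubicRing.c₂ h))
  · intro h
    have hle : (RingHom.ker p).map (CubicRing.base.comp Polynomial.C :
        R →+* CubicRing (coeffPoly a)) ≤ RingHom.ker (fiberMap a p) := by
      rw [Ideal.map_le_iff_le_comap]
      intro r hr
      have hr' : p r = 0 := hr
      refine CubicRing.ext ?_ (Polynomial.map_zero _) (Polynomial.map_zero _)
      change (Polynomial.C r).map (p : R →+* ℂ) = 0
      rw [Polynomial.map_C, RingHom.coe_coe, hr', map_zero]
    exact hle h

variable (h : PlaneModel (p ∘ a) s θ) (ρ : L →+* K)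

theorem image_chartRange (hρ : ∀ x, ρ (ψ x) = h.hom (fiberMap a p x)) :
    ρ '' (chartRange ψ hψ) = integralOver {s} := by
  ext z
  constructor
  · rintro ⟨_, ⟨x, rfl⟩, rfl⟩
    rw [hρ]
    exact h.hom_mem _
  · intro hz
    obtain ⟨y, rfl⟩ := h.exists_hom_eq hz
    obtain ⟨x, rfl⟩ := fiberMap_surjective (p := p) y
    exact ⟨_, ⟨x, rfl⟩, hρ x⟩

theorem ker_chartRange (hinj : Function.Injective ψ)
    (hρ : ∀ x, ρ (ψ x) = h.hom (fiberMap a p x)) (y : chartRange ψ hψ) :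
    ρ y = 0 ↔ y ∈ (RingHom.ker p).map (algebraMap R (chartRange ψ hψ)) := by
  obtain ⟨x, rfl⟩ := (chartEquiv ψ hψ hinj).surjective y
  have halg : algebraMap R (chartRange ψ hψ) =
      (chartEquiv ψ hψ hinj).toRingHom.comp (CubicRing.base.comp Polynomial.C) :=
    RingHom.ext fun r => Subtype.ext (hψ r).symm
  rw [coe_chartEquiv, hρ, map_eq_zero_iff _ h.hom_injective, fiberMap_eq_zero_iff, halg,
    apply_mem_map_comp_iff]

end Chart

/-- The ring of functions on the intersection of the charts of the universal family. -/
abbrev OverlapRing (a : Fin 4 × Fin 5 → R) : Type :=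
  CubicRing fun i => Polynomial.toLaurent (coeffPoly a i)

/-- The restriction of functions on the first chart. -/
def overlap₀ (a : Fin 4 × Fin 5 → R) : CubicRing (coeffPoly a) →+* OverlapRing a :=
  CubicRing.scale Polynomial.toLaurent 1 fun _ => (one_mul _).symm

/-- The form has degree four in `u`, so the two charts see the same cubic up to `T (-4)`. The map
`CubicRing.scale` with this unit is the transition between the charts. -/
theorem invert_toLaurent_coeffPoly_flipU (a : Fin 4 × Fin 5 → R) (i : Fin 4) :
    (LaurentPolynomial.invert (R := R)).toRingEquiv.toRingHom.comp Polynomial.toLaurent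
      (coeffPoly (flipU a) i) = LaurentPolynomial.T (-4) * Polynomial.toLaurent (coeffPoly a i) := by
  change LaurentPolynomial.invert (Polynomial.toLaurent (coeffPoly (flipU a) i)) = _
  simp only [coeffPoly, flipU, map_sum, map_mul, Polynomial.toLaurent_C, Polynomial.toLaurent_X_pow,
    LaurentPolynomial.invert_C, LaurentPolynomial.invert_T, Finset.mul_sum]
  refine Fintype.sum_equiv Fin.revPerm _ _ fun j => ?_
  rw [Fin.revPerm_apply, mul_left_comm, ← LaurentPolynomial.T_add]
  congr 2
  rw [Fin.val_rev]
  have := j.2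
  omega

/-- The restriction of functions on the second chart. -/
def overlap₁ (a : Fin 4 × Fin 5 → R) : CubicRing (coeffPoly (flipU a)) →+* OverlapRing a :=
  CubicRing.scale ((LaurentPolynomial.invert (R := R)).toRingEquiv.toRingHom.comp
    Polynomial.toLaurent) (LaurentPolynomial.T (-4)) (invert_toLaurent_coeffPoly_flipU a)

theorem overlap₀_injective (a : Fin 4 × Fin 5 → R) : Function.Injective (overlap₀ a) :=
  CubicRing.scale_injective _ Polynomial.toLaurent_injective isUnit_one

theorem overlap₁_injective (a : Fin 4 × Fin 5 → R) : Function.Injective (overlap₁ a) :=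
  CubicRing.scale_injective _ ((LaurentPolynomial.invert (R := R)).injective.comp
    Polynomial.toLaurent_injective) (LaurentPolynomial.isUnit_T _)

theorem overlap₀_C (a : Fin 4 × Fin 5 → R) (r : R) :
    overlap₀ a (CubicRing.base (Polynomial.C r)) = algebraMap R (OverlapRing a) r := by
  refine CubicRing.ext ?_ ?_ ?_ <;>
    simp [overlap₀, CubicRing.scale_apply, CubicRing.algebraMap_eq, 
      ← LaurentPolynomial.C_eq_algebraMap]

theorem overlap₁_C (a : Fin 4 × Fin 5 → R) (r : R) :
    overlap₁ a (CubicRing.base (Polynomial.C r)) = algebraMap R (OverlapRing a) r := by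
  refine CubicRing.ext ?_ ?_ ?_ <;>
    simp [overlap₁, CubicRing.scale_apply, CubicRing.algebraMap_eq,
      ← LaurentPolynomial.C_eq_algebraMap]

/-- The coordinate of the line on the overlap. -/
def overlapCoord (a : Fin 4 × Fin 5 → R) : (OverlapRing a)ˣ where
  val := CubicRing.base (LaurentPolynomial.T 1)
  inv := CubicRing.base (LaurentPolynomial.T (-1))
  val_inv := by rw [← map_mul, ← LaurentPolynomial.T_add, add_neg_cancel, LaurentPolynomial.T_zero,
    map_one]
  inv_val := by rw [← map_mul, ← LaurentPolynomial.T_add, neg_add_cancel, LaurentPolynomial.T_zero,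
    map_one]

theorem overlap₀_X (a : Fin 4 × Fin 5 → R) :
    overlap₀ a (CubicRing.base Polynomial.X) = overlapCoord a := by
  refine CubicRing.ext ?_ ?_ ?_ <;> simp [overlap₀, CubicRing.scale_apply, overlapCoord]

theorem overlap₁_X (a : Fin 4 × Fin 5 → R) :
    overlap₁ a (CubicRing.base Polynomial.X) = ((overlapCoord a)⁻¹ : (OverlapRing a)ˣ) := by
  refine CubicRing.ext ?_ ?_ ?_ <;> simp [overlap₁, CubicRing.scale_apply, overlapCoord]

theorem exists_toLaurent_eq_mul_T (f : LaurentPolynomial R) :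
    ∃ n : ℕ, ∀ m ≥ n, ∃ q : R[X], Polynomial.toLaurent q = LaurentPolynomial.T m * f := by
  obtain ⟨n, q, hq⟩ := LaurentPolynomial.exists_T_pow f
  refine ⟨n, fun m hm => ⟨Polynomial.X ^ (m - n) * q, ?_⟩⟩
  rw [map_mul, Polynomial.toLaurent_X_pow, hq, mul_comm f, ← mul_assoc, ← LaurentPolynomial.T_add]
  congr 2
  omega

theorem exists_overlap₀_eq (z : OverlapRing a) :
    ∃ (n : ℕ) (x : _), overlap₀ a x = (overlapCoord a : OverlapRing a) ^ n * z := by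
  obtain ⟨n₀, h₀⟩ := exists_toLaurent_eq_mul_T z.c₀
  obtain ⟨n₁, h₁⟩ := exists_toLaurent_eq_mul_T z.c₁
  obtain ⟨n₂, h₂⟩ := exists_toLaurent_eq_mul_T z.c₂
  obtain ⟨x₀, hx₀⟩ := h₀ (n₀ + n₁ + n₂) (by omega)
  obtain ⟨x₁, hx₁⟩ := h₁ (n₀ + n₁ + n₂) (by omega)
  obtain ⟨x₂, hx₂⟩ := h₂ (n₀ + n₁ + n₂) (by omega)
  refine ⟨n₀ + n₁ + n₂, ⟨x₀, x₁, x₂⟩, ?_⟩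
  rw [overlapCoord, ← map_pow, LaurentPolynomial.T_pow, mul_one, CubicRing.base_mul, overlap₀,
    CubicRing.scale_apply, one_mul, one_mul]
  exact CubicRing.ext hx₀ hx₁ hx₂

theorem exists_overlap₁_eq (z : OverlapRing a) :
    ∃ (n : ℕ) (x : _), overlap₁ a x = (((overlapCoord a)⁻¹ : (OverlapRing a)ˣ) : OverlapRing a) ^ n * z := by
  have hinv : ∀ (f : LaurentPolynomial R) (n : ℕ) (q : R[X]), Polynomial.toLaurent q =
      LaurentPolynomial.T n * LaurentPolynomial.invert f → LaurentPolynomial.invert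
        (Polynomial.toLaurent q) = LaurentPolynomial.T (-n) * f := by
    intro f n q h
    rw [h, map_mul, LaurentPolynomial.invert_T, LaurentPolynomial.involutive_invert]
  obtain ⟨n₀, h₀⟩ := exists_toLaurent_eq_mul_T (LaurentPolynomial.invert z.c₀)
  obtain ⟨n₁, h₁⟩ := exists_toLaurent_eq_mul_T
    (LaurentPolynomial.invert (LaurentPolynomial.T 4 * z.c₁))
  obtain ⟨n₂, h₂⟩ := exists_toLaurent_eq_mul_T
    (LaurentPolynomial.invert (LaurentPolynomial.T 4 * z.c₂))
  obtain ⟨x₀, hx₀⟩ := h₀ (n₀ + n₁ + n₂) (by omega)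
  obtain ⟨x₁, hx₁⟩ := h₁ (n₀ + n₁ + n₂) (by omega)
  obtain ⟨x₂, hx₂⟩ := h₂ (n₀ + n₁ + n₂) (by omega)
  have hT : ∀ f : LaurentPolynomial R, LaurentPolynomial.T (-4) *
      (LaurentPolynomial.T (-(n₀ + n₁ + n₂ : ℕ)) * (LaurentPolynomial.T 4 * f)) =
      LaurentPolynomial.T (-(n₀ + n₁ + n₂ : ℕ)) * f := by
    intro f
    rw [mul_left_comm, ← mul_assoc (LaurentPolynomial.T (-4)), ← LaurentPolynomial.T_add,
      neg_add_cancel, LaurentPolynomial.T_zero, one_mul]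
  refine ⟨n₀ + n₁ + n₂, ⟨x₀, x₁, x₂⟩, ?_⟩
  rw [overlapCoord, Units.inv_mk, ← map_pow, LaurentPolynomial.T_pow, mul_neg, mul_one,
    CubicRing.base_mul, overlap₁, CubicRing.scale_apply]
  exact CubicRing.ext (hinv _ _ _ hx₀) ((congrArg _ (hinv _ _ _ hx₁)).trans (hT _))
    ((congrArg _ (hinv _ _ _ hx₂)).trans (hT _))

section Restrict

variable [Algebra ℂ R] {p : R →ₐ[ℂ] ℂ} {K : Type} [Field K] [Algebra ℂ K] {t θ : K}

/-- The values of Laurent polynomials at a fiber. -/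
def fiberEval (p : R →ₐ[ℂ] ℂ) (t : Kˣ) : LaurentPolynomial R →+* K :=
  LaurentPolynomial.eval₂ ((algebraMap ℂ K).comp (p : R →+* ℂ)) t

theorem fiberEval_toLaurent (t : Kˣ) (q : R[X]) : fiberEval p t (Polynomial.toLaurent q) =
    aeval (t : K) (q.map (p : R →+* ℂ)) := by
  rw [fiberEval, LaurentPolynomial.eval₂_toLaurent, Polynomial.aeval_def, Polynomial.eval₂_map]

theorem fiberEval_invert (t : Kˣ) (q : R[X]) :
    fiberEval p t (LaurentPolynomial.invert (Polynomial.toLaurent q)) =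
      aeval (t⁻¹ : K) (q.map (p : R →+* ℂ)) := by
  change ((fiberEval p t).comp ((LaurentPolynomial.invert (R := R)).toRingEquiv.toRingHom.comp
    Polynomial.toLaurent)) q = ((aeval (t⁻¹ : K) : ℂ[X] →ₐ[ℂ] K).toRingHom.comp
      (Polynomial.mapRingHom (p : R →+* ℂ))) q
  congr 1
  refine Polynomial.ringHom_ext (fun r => ?_) ?_ <;> simp [fiberEval]

/-- The restriction of functions on the overlap to a fiber. -/
def overlapRestrict (h : PlaneModel (p ∘ a) t θ) : OverlapRing a →+* K :=
  CubicRing.lift (fiberEval p (Units.mk0 t (transcendental_ne_zero h.transcendental))) θ (by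
    simp only [fiberEval_toLaurent, map_coeffPoly]
    exact h.root)

theorem overlapRestrict_apply (h : PlaneModel (p ∘ a) t θ) (z : OverlapRing a) :
    overlapRestrict h z = fiberEval p (Units.mk0 t (transcendental_ne_zero h.transcendental)) z.c₀ +
      fiberEval p (Units.mk0 t (transcendental_ne_zero h.transcendental)) z.c₁ *
        (aeval t (coeffPoly (p ∘ a) 0) * θ) +
      fiberEval p (Units.mk0 t (transcendental_ne_zero h.transcendental)) z.c₂ *
        (aeval t (coeffPoly (p ∘ a) 0) * θ ^ 2 +
          aeval t (coeffPoly (p ∘ a) 1) * θ) := by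
  have hc : ∀ i, fiberEval p (Units.mk0 t (transcendental_ne_zero h.transcendental))
      (Polynomial.toLaurent (coeffPoly a i)) = aeval t (coeffPoly (p ∘ a) i) := fun i => by
    rw [fiberEval_toLaurent, map_coeffPoly]
    rfl
  rw [← hc 0, ← hc 1]
  rfl

theorem overlapRestrict_overlap₀ (h : PlaneModel (p ∘ a) t θ) (x : CubicRing (coeffPoly a)) :
    overlapRestrict h (overlap₀ a x) = h.hom (fiberMap a p x) := by
  rw [overlapRestrict_apply, overlap₀, CubicRing.scale_apply, h.hom_apply, one_mul, one_mul,
    fiberEval_toLaurent, fiberEval_toLaurent, fiberEval_toLaurent]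
  rfl

theorem PlaneModel.flip_comp (h : PlaneModel (p ∘ a) t θ) : PlaneModel (p ∘ flipU a) t⁻¹ θ := h.flip

theorem overlapRestrict_overlap₁ (h : PlaneModel (p ∘ a) t θ)
    (x : CubicRing (coeffPoly (flipU a))) :
    overlapRestrict h (overlap₁ a x) = h.flip_comp.hom (fiberMap (flipU a) p x) := by
  have ht := transcendental_ne_zero h.transcendental
  have hc : ∀ i, aeval t⁻¹ (coeffPoly (p ∘ flipU a) i) =
      t⁻¹ ^ 4 * aeval t (coeffPoly (p ∘ a) i) :=
    PlaneModel.aeval_inv_coeffPoly_flipU (a := p ∘ a) ht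
  have h4 : fiberEval p (Units.mk0 t ht) (LaurentPolynomial.T (-4)) = t⁻¹ ^ 4 := by
    rw [fiberEval, LaurentPolynomial.eval₂_T, Units.val_zpow_eq_zpow_val, inv_pow]
    exact (zpow_neg t 4).trans (by norm_cast)
  have hv : ∀ q : R[X], fiberEval p (Units.mk0 t ht) ((LaurentPolynomial.invert
      (R := R)).toRingEquiv.toRingHom.comp Polynomial.toLaurent q) =
      aeval t⁻¹ (q.map (p : R →+* ℂ)) := fun q => fiberEval_invert (Units.mk0 t ht) q
  have h0 : (fiberMap (flipU a) p x).c₀ = x.c₀.map (p : R →+* ℂ) := rfl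
  have h1 : (fiberMap (flipU a) p x).c₁ = x.c₁.map (p : R →+* ℂ) := rfl
  have h2 : (fiberMap (flipU a) p x).c₂ = x.c₂.map (p : R →+* ℂ) := rfl
  rw [overlapRestrict_apply, overlap₁, CubicRing.scale_apply, h.flip_comp.hom_apply, h0, h1, h2,
    hc, hc, map_mul, map_mul, h4, hv, hv, hv]
  ring

end Restrict

/-- The universal family of trigonal curves over a ring with a form of bidegree `(3,4)` that
is smooth at all points. -/
theorem exists_trigonalFamily [Algebra ℂ R] (ha : ∀ p : R →ₐ[ℂ] ℂ, IsSmooth (p ∘ a)) :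
    ∃ 𝒯 : TrigonalFamily R, ∀ p : R →ₐ[ℂ] ℂ, ∃ θ, PlaneModel (p ∘ a) (𝒯.fiber p).t θ := by
  choose K hK hA t θ h using fun p : R →ₐ[ℂ] ℂ => (ha p).exists_planeModel
  refine ⟨{
    L := OverlapRing a
    tower := IsScalarTower.of_algebraMap_eq fun c => by
      rw [CubicRing.algebraMap_eq, CubicRing.algebraMap_eq, ← IsScalarTower.algebraMap_apply]
    t := overlapCoord a
    A₀ := chartRange (overlap₀ a) (overlap₀_C a)
    A₁ := chartRange (overlap₁ a) (overlap₁_C a)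
    t_mem := ⟨_, overlap₀_X a⟩
    t_inv_mem := ⟨_, overlap₁_X a⟩
    localize₀ := exists_overlap₀_eq
    localize₁ := exists_overlap₁_eq
    finite₀ := finite_chartRange _ _ (overlap₀_injective a) _ (overlap₀_X a)
    finite₁ := finite_chartRange _ _ (overlap₁_injective a) _ (overlap₁_X a)
    flat₀ := flat_chartRange _ _ (overlap₀_injective a) _ (overlap₀_X a)
    flat₁ := flat_chartRange _ _ (overlap₁_injective a) _ (overlap₁_X a)
    fiber := fun p => (h p).curve
    restrict := fun p =>
      { toRingHom := overlapRestrict (h p)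
        commutes' := fun c => by
          change overlapRestrict (h p) (CubicRing.base (algebraMap ℂ _ c)) = _
          rw [overlapRestrict, CubicRing.lift_base, IsScalarTower.algebraMap_apply ℂ R,
            ← LaurentPolynomial.C_eq_algebraMap, fiberEval, LaurentPolynomial.eval₂_C]
          simp
          rfl }
    restrict_base := fun p r => by
      change overlapRestrict (h p) (CubicRing.base (algebraMap R _ r)) = _
      rw [overlapRestrict, CubicRing.lift_base, ← LaurentPolynomial.C_eq_algebraMap, fiberEval,
        LaurentPolynomial.eval₂_C]
      rfl
    restrict_t := fun p => by
      change overlapRestrict (h p) (CubicRing.base (LaurentPolynomial.T 1)) = t p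
      rw [overlapRestrict, CubicRing.lift_base, fiberEval, LaurentPolynomial.eval₂_T, zpow_one,
        Units.val_mk0]
    range₀ := fun p => image_chartRange _ _ (h p) _ (overlapRestrict_overlap₀ (h p))
    range₁ := fun p => image_chartRange _ _ (h p).flip_comp _ (overlapRestrict_overlap₁ (h p))
    ker₀ := fun p => ker_chartRange _ _ (h p) _ (overlap₀_injective a)
      (overlapRestrict_overlap₀ (h p))
    ker₁ := fun p => ker_chartRange _ _ (h p).flip_comp _ (overlap₁_injective a)
      (overlapRestrict_overlap₁ (h p)) }, fun p => ⟨θ p, h p⟩⟩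

end UniversalFamily

/-! ### Nakayama's lemma over the two charts of a line -/

section Nakayama

/-- Nakayama's lemma for the submodule that the `z j` generate in the quotient by `N`. -/
theorem exists_smul_mem_of_le {A V : Type*} [CommRing A] [AddCommGroup V] [Module A V] (I : Ideal A)
    (N : Submodule A V) {ι : Type*} [Finite ι] (z : ι → V)
    (h : ∀ j, z j ∈ N ⊔ I • Submodule.span A (Set.range z)) :
    ∃ r, r - 1 ∈ I ∧ ∀ j, r • z j ∈ N := by
  obtain ⟨r, hr, hr0⟩ := Submodule.exists_sub_one_mem_and_smul_eq_zero_of_fg_of_le_smul I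
    ((Submodule.span A (Set.range z)).map N.mkQ)
    ((Submodule.fg_span (Set.finite_range z)).map _) (by
      rw [← Submodule.map_smul'', Submodule.map_le_iff_le_comap, Submodule.span_le]
      rintro _ ⟨j, rfl⟩
      obtain ⟨x, hx, y, hy, hxy⟩ := Submodule.mem_sup.1 (h j)
      refine ⟨y, hy, ?_⟩
      rw [← hxy, map_add, N.mkQ_apply x, (Submodule.Quotient.mk_eq_zero N).2 hx, zero_add])
  refine ⟨r, hr, fun j => ?_⟩
  rw [← Submodule.Quotient.mk_eq_zero]
  exact hr0 _ ⟨z j, Submodule.subset_span ⟨j, rfl⟩, rfl⟩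

variable {R L : Type*} [CommRing R] [CommRing L] [Algebra R L]

/-- The combinations of the elements `v i` with coefficients in `R[τ]`. -/
def polySpan (τ : L) {k : ℕ} (v : Fin k → L) : Submodule R L :=
  LinearMap.range (∑ i, (LinearMap.mulRight R (v i)).comp
    ((aeval (R := R) τ).toLinearMap.comp (LinearMap.proj i)) :
      (Fin k → R[X]) →ₗ[R] L)

variable {τ : L} {k : ℕ} {v : Fin k → L}

theorem mem_polySpan {z : L} : z ∈ polySpan (R := R) τ v ↔
    ∃ P : Fin k → R[X], z = ∑ i, aeval τ (P i) * v i := by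
  simp [polySpan, LinearMap.mem_range, eq_comm]

theorem self_mem_polySpan (i : Fin k) : v i ∈ polySpan (R := R) τ v :=
  mem_polySpan.2 ⟨Pi.single i 1, by
    rw [Finset.sum_eq_single i (fun j _ hj => by simp [hj]) (by simp)]
    simp⟩

theorem aeval_mul_mem_polySpan (Q : R[X]) {z : L} (hz : z ∈ polySpan (R := R) τ v) :
    aeval τ Q * z ∈ polySpan (R := R) τ v := by
  obtain ⟨P, rfl⟩ := mem_polySpan.1 hz
  exact mem_polySpan.2 ⟨fun i => Q * P i, by simp [Finset.mul_sum, mul_assoc]⟩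

/-- Nakayama's lemma over `R[τ]`. -/
theorem exists_aeval_mul_mem_polySpan (I : Ideal R) {n : ℕ} (g : Fin n → L)
    (h : ∀ j, ∃ M : Fin n → R[X], (∀ i, M i ∈ I.map Polynomial.C) ∧
      g j - ∑ i, aeval τ (M i) * g i ∈ polySpan (R := R) τ v) :
    ∃ G : R[X], G - 1 ∈ I.map Polynomial.C ∧
      ∀ z ∈ polySpan (R := R) τ g, aeval τ G * z ∈ polySpan (R := R) τ v := by
  let _ : Module R[X] L := Module.compHom L (aeval (R := R) τ).toRingHom
  let N : Submodule R[X] L :=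
    { polySpan (R := R) τ v with smul_mem' := fun Q _ hz => aeval_mul_mem_polySpan Q hz }
  obtain ⟨G, hG, hGz⟩ := exists_smul_mem_of_le (I.map Polynomial.C) N g fun j => by
    obtain ⟨M, hM, hMj⟩ := h j
    rw [← sub_add_cancel (g j) (∑ i, aeval τ (M i) * g i)]
    exact Submodule.add_mem_sup hMj (Submodule.sum_mem _ fun i _ =>
      Submodule.smul_mem_smul (hM i) (Submodule.subset_span ⟨i, rfl⟩))
  refine ⟨G, hG, fun z hz => ?_⟩
  obtain ⟨P, rfl⟩ := mem_polySpan.1 hz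
  rw [Finset.mul_sum]
  refine Submodule.sum_mem _ fun i _ => ?_
  rw [mul_left_comm]
  exact aeval_mul_mem_polySpan _ (hGz i)

theorem sub_mem_map_C_iff {I : Ideal R} {P Q : R[X]} : P - Q ∈ I.map Polynomial.C ↔
    P.map (Ideal.Quotient.mk I) = Q.map (Ideal.Quotient.mk I) := by
  rw [Ideal.mem_map_C_iff, Polynomial.ext_iff]
  simp only [Polynomial.coeff_map, Polynomial.coeff_sub, Ideal.Quotient.eq]

/-- The ideal generated by a polynomial that reduces to `1` and a polynomial that reduces to
a monomial contains a constant that reduces to `1`. -/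
theorem exists_mul_add_mul_eq_C (I : Ideal R) {G H : R[X]} {M : ℕ} (hG : G - 1 ∈ I.map Polynomial.C)
    (hH : H - Polynomial.X ^ M ∈ I.map Polynomial.C) (hM : H.natDegree ≤ M) :
    ∃ (b : R) (p q : R[X]), b - 1 ∈ I ∧ G * p + H * q = Polynomial.C b := by
  -- The constant is a resultant, and it reduces to the resultant of a monomial and `1`. The formal
  -- degree of `G` is raised by one to make it positive.
  obtain ⟨q, p, -, -, h⟩ := Polynomial.exists_mul_add_mul_eq_C_resultant (m := M)
    (n := G.natDegree + 1) H G hM (Nat.le_succ _) (Or.inr (Nat.succ_ne_zero _))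
  refine ⟨_, p, q, ?_, (add_comm _ _).trans h⟩
  rw [sub_mem_map_C_iff] at hG hH
  rw [← Ideal.Quotient.eq, map_one, ← Polynomial.resultant_map_map, hG, hH, Polynomial.map_one,
    Polynomial.map_pow, Polynomial.map_X, Polynomial.resultant_one_right]
  simp

theorem aeval_reflect_unit (t : Lˣ) (P : R[X]) {M : ℕ} (hM : P.natDegree ≤ M) :
    aeval (t : L) (P.reflect M) =
      (t : L) ^ M * aeval ((t⁻¹ : Lˣ) : L) P := by
  let _ : Invertible ((t⁻¹ : Lˣ) : L) := ⟨t, by simp, by simp⟩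
  have h := Polynomial.eval₂_reflect_mul_pow (algebraMap R L) ((t⁻¹ : Lˣ) : L) M P hM
  change aeval (t : L) (P.reflect M) * ((t⁻¹ : Lˣ) : L) ^ M =
    aeval ((t⁻¹ : Lˣ) : L) P at h
  rw [← h, mul_left_comm, ← mul_pow, Units.mul_inv, one_pow, mul_one]

/-- A large power of `t` turns the polynomials in `t⁻¹` into polynomials in `t` and moves the
generators `v' i` into the span of the `v i`. -/
theorem eventually_pow_mul_mem_polySpan {t : Lˣ} {v v' : Fin k → L}
    (hv : ∀ i, ∃ n : ℕ, (t : L) ^ n * v' i ∈ polySpan (R := R) (t : L) v) {z : L}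
    (hz : z ∈ polySpan (R := R) ((t⁻¹ : Lˣ) : L) v') :
    ∀ᶠ M in Filter.atTop, (t : L) ^ M * z ∈ polySpan (R := R) (t : L) v := by
  obtain ⟨P, rfl⟩ := mem_polySpan.1 hz
  choose n hn using hv
  have h : ∀ᶠ M in Filter.atTop, ∀ i, (P i).natDegree + n i ≤ M :=
    Filter.eventually_all.2 fun i => Filter.eventually_ge_atTop _
  filter_upwards [h] with M hM
  rw [Finset.mul_sum]
  refine Submodule.sum_mem _ fun i _ => ?_
  obtain ⟨r, hr⟩ := Nat.exists_eq_add_of_le (hM i)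
  have h1 := aeval_mul_mem_polySpan (Polynomial.X ^ r * (P i).reflect (P i).natDegree) (hn i)
  rw [map_mul, map_pow, Polynomial.aeval_X, aeval_reflect_unit t (P i) le_rfl] at h1
  convert h1 using 1
  rw [hr, pow_add, pow_add]
  ring

/-- Two lattices over the two charts of the line that agree up to polynomials that reduce
to `1`, agree up to a constant that reduces to `1`. -/
theorem exists_algebraMap_mul_mem_polySpan (I : Ideal R) {t : Lˣ} {A : Submodule R L}
    {v v' : Fin k → L} (hv : ∀ i, ∃ n : ℕ, (t : L) ^ n * v' i ∈ polySpan (R := R) (t : L) v)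
    {n : ℕ} {g : Fin n → L} {G G' : R[X]} (hG : G - 1 ∈ I.map Polynomial.C)
    (hG' : G' - 1 ∈ I.map Polynomial.C)
    (hGA : ∀ z ∈ polySpan (R := R) (t : L) g, aeval (t : L) G * z ∈
      polySpan (R := R) (t : L) v)
    (hGA' : ∀ z ∈ A, aeval ((t⁻¹ : Lˣ) : L) G' * z ∈
      polySpan (R := R) ((t⁻¹ : Lˣ) : L) v')
    (hA : ∀ j, ∃ n : ℕ, ((t⁻¹ : Lˣ) : L) ^ n * g j ∈ A) :
    ∃ b : R, b - 1 ∈ I ∧ ∀ z ∈ polySpan (R := R) (t : L) g,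
      algebraMap R L b * z ∈ polySpan (R := R) (t : L) v := by
  have h1 : ∀ j, ∀ᶠ M in Filter.atTop, (t : L) ^ M *
      (aeval ((t⁻¹ : Lˣ) : L) G' * g j) ∈ polySpan (R := R) (t : L) v := by
    intro j
    obtain ⟨n, hn⟩ := hA j
    filter_upwards [(Filter.tendsto_add_atTop_nat n).eventually
      (eventually_pow_mul_mem_polySpan hv (hGA' _ hn))] with M hM
    convert hM using 1
    have h2 : (t : L) ^ n * ((t⁻¹ : Lˣ) : L) ^ n = 1 := by rw [← mul_pow, Units.mul_inv, one_pow]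
    rw [pow_add]
    linear_combination -(t : L) ^ M * aeval ((t⁻¹ : Lˣ) : L) G' * g j * h2
  obtain ⟨M, hM, hMd⟩ := ((Filter.eventually_all.2 h1).and
    (Filter.eventually_ge_atTop G'.natDegree)).exists
  -- The multiplier `G` works on the first chart. The multiplier `G'` of the second chart, reflected
  -- into the first, also works and reduces to `X ^ M`. Together they generate a constant.
  obtain ⟨b, p, q, hb, hpq⟩ := exists_mul_add_mul_eq_C I (H := G'.reflect M) (M := M) hG (by
      rw [sub_mem_map_C_iff] at hG' ⊢
      rw [← Polynomial.reflect_map, hG', Polynomial.map_one, Polynomial.map_pow, Polynomial.map_X,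
        Polynomial.reflect_one])
    ((Polynomial.natDegree_reflect_le).trans (max_le le_rfl hMd))
  refine ⟨b, hb, fun z hz => ?_⟩
  rw [← Polynomial.aeval_C (t : L), ← hpq, map_add, map_mul, map_mul, add_mul]
  refine add_mem ?_ ?_
  · rw [mul_comm (aeval (t : L) G), mul_assoc]
    exact aeval_mul_mem_polySpan _ (hGA z hz)
  · rw [mul_comm (aeval (t : L) (G'.reflect M)), mul_assoc]
    refine aeval_mul_mem_polySpan _ ?_
    obtain ⟨P, rfl⟩ := mem_polySpan.1 hz
    rw [Finset.mul_sum]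
    refine Submodule.sum_mem _ fun j _ => ?_
    rw [mul_left_comm, aeval_reflect_unit t G' hMd, mul_assoc]
    exact aeval_mul_mem_polySpan _ (hM j)

/-- A finite algebra over `R[τ]` is generated by finitely many elements. -/
theorem exists_polySpan_eq {A : Subalgebra R L} (hτ : τ ∈ A)
    (hfin : (aeval (R := R) (⟨τ, hτ⟩ : A)).toRingHom.Finite) :
    ∃ (n : ℕ) (g : Fin n → L), polySpan (R := R) τ g = Subalgebra.toSubmodule A := by
  have hc : ∀ P : R[X], ((aeval (R := R) (⟨τ, hτ⟩ : A) P : A) : L) =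
      aeval τ P := fun P => Polynomial.aeval_algHom_apply A.val (⟨τ, hτ⟩ : A) P |>.symm
  let _ : Algebra R[X] A := (aeval (R := R) (⟨τ, hτ⟩ : A)).toRingHom.toAlgebra
  have : Module.Finite R[X] A := hfin
  obtain ⟨n, g, hg⟩ := Module.Finite.exists_fin (R := R[X]) (M := A)
  refine ⟨n, fun j => g j, le_antisymm ?_ fun z hz => ?_⟩
  · intro z hz
    obtain ⟨P, rfl⟩ := mem_polySpan.1 hz
    change _ ∈ A
    exact sum_mem fun i _ => mul_mem (hc (P i) ▸ SetLike.coe_mem _) (g i).2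
  · obtain ⟨P, hP⟩ := (Submodule.mem_span_range_iff_exists_fun R[X]).1
      (hg.ge (Submodule.mem_top : (⟨z, hz⟩ : A) ∈ _))
    refine mem_polySpan.2 ⟨P, ?_⟩
    have h := congrArg A.val hP.symm
    rw [map_sum] at h
    refine h.trans (Finset.sum_congr rfl fun i _ => ?_)
    rw [← hc]
    rfl

theorem exists_map_C_of_mem_map {A : Subalgebra R L} {n : ℕ} {g : Fin n → L}
    (hg : polySpan (R := R) τ g = Subalgebra.toSubmodule A) {I : Ideal R} {z : A}
    (hz : z ∈ I.map (algebraMap R A)) :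
    ∃ M : Fin n → R[X], (∀ i, M i ∈ I.map Polynomial.C) ∧
      (z : L) = ∑ i, aeval τ (M i) * g i := by
  induction hz using Submodule.span_induction with
  | mem x hx =>
    obtain ⟨r, hr, rfl⟩ := hx
    obtain ⟨P, hP⟩ := mem_polySpan.1 (hg.ge (one_mem A))
    refine ⟨fun i => Polynomial.C r * P i, fun i => Ideal.mul_mem_right _ _
      (Ideal.mem_map_of_mem _ hr), ?_⟩
    simp only [map_mul, mul_assoc, ← Finset.mul_sum, ← hP, Polynomial.aeval_C, mul_one]
    rfl
  | zero => exact ⟨0, fun _ => zero_mem _, by simp⟩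
  | add x y _ _ hx hy =>
    obtain ⟨M, hM, hx⟩ := hx
    obtain ⟨M', hM', hy⟩ := hy
    exact ⟨M + M', fun i => add_mem (hM i) (hM' i), by
      simp [hx, hy, add_mul, Finset.sum_add_distrib]⟩
  | smul a x _ hx =>
    obtain ⟨M, hM, hx⟩ := hx
    choose P hP using fun i => mem_polySpan.1 (hg.ge (mul_mem a.2
      (hg.le (self_mem_polySpan (R := R) (τ := τ) (v := g) i) : g i ∈ A) : (a : L) * g i ∈ A))
    refine ⟨fun j => ∑ i, M i * P i j, fun j => sum_mem fun i _ => Ideal.mul_mem_right _ _ (hM i), ?_⟩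
    rw [smul_eq_mul, MulMemClass.coe_mul, hx, Finset.mul_sum]
    simp only [map_sum, map_mul, Finset.sum_mul]
    rw [Finset.sum_comm]
    refine Finset.sum_congr rfl fun i _ => ?_
    rw [mul_left_comm, hP, Finset.mul_sum]
    simp only [mul_assoc]

end Nakayama

/-! ### Lattices of functions on a single curve -/

section ScrollLattice

variable {K : Type} [Field K] [Algebra ℂ K] {t : K} {w : Fin 2 → K}

theorem exists_aeval_mul_mem_integralOver (ht : Transcendental ℂ t)
    (hd : Module.finrank (IntermediateField.adjoin ℂ {t}) K = 3) (z : K) :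
    ∃ d : ℂ[X], d ≠ 0 ∧ aeval t d * z ∈ integralOver {t} := by
  obtain ⟨P, hP0, hP⟩ := exists_aeval_relation hd (by norm_num) (fun i => z ^ (i : ℕ))
  have hmem : ∀ p : ℂ[X], aeval t p ∈ Algebra.adjoin ℂ {t} := fun p => by
    rw [Algebra.adjoin_singleton_eq_range_aeval]
    exact ⟨p, rfl⟩
  let G : (Algebra.adjoin ℂ {t})[X] :=
    ∑ i : Fin 4, Polynomial.C ⟨aeval t (P i), hmem _⟩ * Polynomial.X ^ (i : ℕ)
  have hG : IsAlgebraic (Algebra.adjoin ℂ {t}) z := by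
    refine ⟨G, fun hG0 => hP0 (funext fun i => ?_), ?_⟩
    · have h := congrArg (fun Q => Q.coeff (i : ℕ)) hG0
      simp only [G, Polynomial.finsetSum_coeff, Polynomial.coeff_C_mul_X_pow,
        Polynomial.coeff_zero] at h
      rw [Finset.sum_eq_single i (fun j _ hj => if_neg fun h => hj (Fin.ext h.symm)) (by simp),
        if_pos rfl] at h
      exact aeval_eq_zero_of_transcendental ht (congrArg Subtype.val h)
    · simp only [G, map_sum, map_mul, map_pow, Polynomial.aeval_C, Polynomial.aeval_X]
      exact hP
  obtain ⟨⟨y, hy⟩, hy0, hint⟩ := hG.exists_integral_multiple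
  rw [Algebra.adjoin_singleton_eq_range_aeval] at hy
  obtain ⟨d, rfl⟩ := hy
  exact ⟨d, fun h0 => hy0 (Subtype.ext (by simp [h0])), hint⟩

/-- Three generators of the integral functions are independent. -/
theorem indep_of_forall_mem_integralOver (ht : Transcendental ℂ t)
    (hd : Module.finrank (IntermediateField.adjoin ℂ {t}) K = 3)
    (h : ∀ z ∈ integralOver {t}, ∃ (P : ℂ[X]) (Q : Fin 2 → ℂ[X]),
      z = aeval t P + ∑ i, aeval t (Q i) * w i) (P : ℂ[X]) (Q : Fin 2 → ℂ[X])
    (h0 : aeval t P + ∑ i, aeval t (Q i) * w i = 0) : P = 0 ∧ Q = 0 := by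
  have hfin : FiniteDimensional (IntermediateField.adjoin ℂ {t}) K :=
    FiniteDimensional.of_finrank_pos (by omega)
  let c : ℂ[X] → IntermediateField.adjoin ℂ {t} := fun p => ⟨_, aeval_mem_adjoin t p⟩
  have hspan : ⊤ ≤ Submodule.span (IntermediateField.adjoin ℂ {t})
      (Set.range ![1, w 0, w 1]) := by
    intro z _
    obtain ⟨d, hd0, hdz⟩ := exists_aeval_mul_mem_integralOver ht hd z
    obtain ⟨P, Q, hPQ⟩ := h _ hdz
    have hd1 : aeval t d ≠ 0 := fun h => hd0 (aeval_eq_zero_of_transcendental ht h)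
    rw [Submodule.mem_span_range_iff_exists_fun]
    refine ⟨![(c d)⁻¹ * c P, (c d)⁻¹ * c (Q 0), (c d)⁻¹ * c (Q 1)], ?_⟩
    rw [Fin.sum_univ_three]
    change (aeval t d)⁻¹ * aeval t P * 1 +
      (aeval t d)⁻¹ * aeval t (Q 0) * w 0 +
      (aeval t d)⁻¹ * aeval t (Q 1) * w 1 = z
    rw [Fin.sum_univ_two] at hPQ
    field_simp
    linear_combination -hPQ
  have hli := linearIndependent_of_top_le_span_of_card_eq_finrank hspan (by rw [hd]; rfl)
  have h1 := Fintype.linearIndependent_iff.1 hli ![c P, c (Q 0), c (Q 1)] (by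
    rw [Fin.sum_univ_three, ← h0, Fin.sum_univ_two]
    change aeval t P * 1 + aeval t (Q 0) * w 0 +
      aeval t (Q 1) * w 1 = _
    ring)
  refine ⟨aeval_eq_zero_of_transcendental ht (congrArg Subtype.val (h1 0)), funext fun i => ?_⟩
  fin_cases i
  exacts [aeval_eq_zero_of_transcendental ht (congrArg Subtype.val (h1 1)),
    aeval_eq_zero_of_transcendental ht (congrArg Subtype.val (h1 2))]

theorem ScrollBasis.notMem (h : ScrollBasis t w) (i : Fin 2) :
    w i ∉ IntermediateField.adjoin ℂ {t} := by
  intro hw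
  obtain ⟨r, s, hs, hrs⟩ := exists_denom ⟨w i, hw⟩
  have h1 := (h.indep (-r) (Pi.single i s) (by
    rw [Finset.sum_eq_single i (fun j _ hj => by simp [hj]) (by simp), Pi.single_eq_same, hrs]
    simp)).2
  refine hs ?_
  rw [← Pi.single_eq_same (M := fun _ => ℂ[X]) i s, h1, Pi.zero_apply, map_zero]

theorem ScrollBasis.natDegree_le (h : ScrollBasis t w) {P : ℂ[X]} {Q : Fin 2 → ℂ[X]} {n : ℕ}
    (h1 : t⁻¹ ^ (n + 4) * (aeval t P + ∑ i, aeval t (Q i) * w i) ∈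
      integralOver {t⁻¹}) (i : Fin 2) : (Q i).natDegree ≤ n := by
  obtain ⟨P', Q', hQ', hPQ⟩ := h.exists_coeff ((h.mem₀ _).2 ⟨P, Q, rfl⟩) h1
  have h2 := (h.indep (P - P') (Q - Q') (by
    simp only [Pi.sub_apply, map_sub, sub_mul, Finset.sum_sub_distrib]
    linear_combination hPQ)).2
  rw [sub_eq_zero.1 h2]
  exact hQ' i

/-- Functions without poles outside the poles and zeros of `t` decompose. -/
theorem ScrollBasis.exists_eq_add (h : ScrollBasis t w) {z : K} {n : ℕ}
    (hz : t ^ n * z ∈ integralOver {t}) :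
    ∃ x ∈ integralOver {t}, ∃ y ∈ integralOver {t⁻¹}, z = x + t ^ 4 * y := by
  let S : Submodule ℂ K := Subalgebra.toSubmodule (integralOver {t}) ⊔
    (Subalgebra.toSubmodule (integralOver {t⁻¹})).map (LinearMap.mulLeft ℂ (t ^ 4))
  have h4 : t ^ 4 * t⁻¹ ^ 4 = 1 := by rw [← mul_pow, mul_inv_cancel₀ h.ne_zero, one_pow]
  -- After the twist by four the summands are `𝒪(4)` and two copies of `𝒪`, which have no `H¹`: each
  -- power of `t` times a generator belongs to one of the two parts.
  have key : ∀ u ∈ integralOver {t}, t⁻¹ ^ 4 * u ∈ integralOver {t⁻¹} → ∀ P : ℂ[X],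
      t⁻¹ ^ n * (aeval t P * u) ∈ S := by
    intro u hu hu' P
    induction P using Polynomial.induction_on' with
    | add P P' hP hP' => rw [map_add, add_mul, mul_add]; exact add_mem hP hP'
    | monomial k c =>
      rw [Polynomial.aeval_monomial, mul_assoc, ← Algebra.smul_def, mul_smul_comm]
      refine S.smul_mem c ?_
      rcases le_total n k with hk | hk
      · obtain ⟨r, rfl⟩ := Nat.exists_eq_add_of_le hk
        refine Submodule.mem_sup_left ?_
        rw [pow_add, mul_assoc, ← mul_assoc, ← mul_pow, inv_mul_cancel₀ h.ne_zero, one_pow, one_mul]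
        exact (integralOver {t}).mul_mem (pow_mem (self_mem_integralOver t) r) hu
      · obtain ⟨r, rfl⟩ := Nat.exists_eq_add_of_le hk
        refine Submodule.mem_sup_right ⟨t⁻¹ ^ r * (t⁻¹ ^ 4 * u),
          (integralOver {t⁻¹}).mul_mem (pow_mem (self_mem_integralOver _) r) hu', ?_⟩
        rw [LinearMap.mulLeft_apply]
        have hk1 : t⁻¹ ^ k * t ^ k = 1 := by rw [← mul_pow, inv_mul_cancel₀ h.ne_zero, one_pow]
        rw [pow_add]
        linear_combination t⁻¹ ^ r * u * h4 - t⁻¹ ^ r * u * hk1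
  have hS : z ∈ S := by
    obtain ⟨P, Q, hPQ⟩ := (h.mem₀ _).1 hz
    have h1 : z = t⁻¹ ^ n * (aeval t P * 1) +
        ∑ i, t⁻¹ ^ n * (aeval t (Q i) * w i) := by
      rw [← Finset.mul_sum, ← mul_add, mul_one, ← hPQ, ← mul_assoc, ← mul_pow,
        inv_mul_cancel₀ h.ne_zero, one_pow, one_mul]
    rw [h1]
    refine add_mem (key 1 (one_mem _) ?_ P) (sum_mem fun i _ => key _ (h.w_mem₀ i) (h.w_mem₁ i) _)
    rw [mul_one]
    exact pow_mem (self_mem_integralOver _) 4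
  obtain ⟨x, hx, _, ⟨y, hy, rfl⟩, hxy⟩ := Submodule.mem_sup.1 hS
  exact ⟨x, hx, y, hy, hxy.symm⟩

theorem coeffPoly_coeff {S : Type*} [CommSemiring S] {f : Fin 4 → S[X]} {i : Fin 4}
    (hf : (f i).natDegree ≤ 4) : coeffPoly (fun k => (f k.1).coeff (4 - (k.2 : ℕ))) i = f i := by
  have h := Polynomial.as_sum_range_C_mul_X_pow' (f i) (Nat.lt_succ_of_le hf)
  simp only [Finset.sum_range_succ, Finset.sum_range_zero, zero_add] at h
  conv_rhs => rw [h]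
  simp only [coeffPoly, Fin.sum_univ_five]
  simp
  ring

/-- The plane model given by the multiplication table of a scroll basis. -/
theorem ScrollBasis.exists_planeModel (h : ScrollBasis t w)
    (hd : Module.finrank (IntermediateField.adjoin ℂ {t}) K = 3) {c : ℂ} (hc : c ≠ 0)
    {A B C : Fin 3 → ℂ[X]}
    (hA : algebraMap ℂ K c * (w 0 * w 0) = aeval t (A 0) +
      aeval t (A 1) * w 0 + aeval t (A 2) * w 1)
    (hB : algebraMap ℂ K c * (w 0 * w 1) = aeval t (B 0) +
      aeval t (B 1) * w 0 + aeval t (B 2) * w 1)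
    (hC : algebraMap ℂ K c * (w 1 * w 1) = aeval t (C 0) +
      aeval t (C 1) * w 0 + aeval t (C 2) * w 1)
    {a : Fin 4 × Fin 5 → ℂ} (ha : IsSmooth a) (h0 : coeffPoly a 0 = A 2)
    (h1 : coeffPoly a 1 = 2 * B 2 - A 1) (h2 : coeffPoly a 2 = C 2 - 2 * B 1)
    (h3 : coeffPoly a 3 = -C 1) : ∃ θ, PlaneModel a t θ := by
  have hs : ∀ p : ℂ[X], aeval t (Polynomial.C c⁻¹ * p) =
      (algebraMap ℂ K c)⁻¹ * aeval t p := fun p => by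
    rw [map_mul, Polynomial.aeval_C, map_inv₀]
  have hc' : algebraMap ℂ K c ≠ 0 := (_root_.map_ne_zero _).2 hc
  obtain ⟨θ, hA2, hθ, hroot⟩ := sum_aeval_eq_zero_of_table (w := w) h.indep
    (A := fun i => Polynomial.C c⁻¹ * A i) (B := fun i => Polynomial.C c⁻¹ * B i)
    (C := fun i => Polynomial.C c⁻¹ * C i)
    (by simp only [hs]; field_simp; linear_combination hA)
    (by simp only [hs]; field_simp; linear_combination hB)
    (by simp only [hs]; field_simp; linear_combination hC)
  refine ⟨θ, ha, h.transcendental, ?_, adjoin_pair_eq_top hd fun hmem => h.notMem 0 ?_⟩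
  · rw [h0, h1, h2, h3]
    simp only [map_sub, map_neg, map_mul, map_inv₀, map_ofNat, Polynomial.aeval_C] at hroot ⊢
    have h5 := congrArg (algebraMap ℂ K c * ·) hroot
    field_simp at h5
    linear_combination h5
  · rw [eq_add_of_sub_eq hθ.symm]
    exact add_mem (mul_mem (aeval_mem_adjoin t _) hmem) (aeval_mem_adjoin t _)

end ScrollLattice

/-! ### Lifting sections from a fiber to a family -/

namespace TrigonalFamily

variable {R : Type} [CommRing R] [Algebra ℂ R] (𝒯 : TrigonalFamily R) (p : R →ₐ[ℂ] ℂ)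

theorem restrict_smul (r : R) (z : 𝒯.L) :
    𝒯.restrict p (r • z) = algebraMap ℂ _ (p r) * 𝒯.restrict p z := by
  rw [Algebra.smul_def, map_mul, restrict_base]

theorem restrict_aeval (τ : 𝒯.L) (P : R[X]) : 𝒯.restrict p (aeval τ P) =
    aeval (𝒯.restrict p τ) (P.map (p : R →+* ℂ)) := by
  induction P using Polynomial.induction_on' with
  | add P Q hP hQ => simp only [map_add, Polynomial.map_add, hP, hQ]
  | monomial n r =>
    rw [Polynomial.aeval_monomial, map_mul, map_pow, restrict_base, Polynomial.map_monomial,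
      Polynomial.aeval_monomial]
    rfl

theorem restrict_t_inv : 𝒯.restrict p ((𝒯.t⁻¹ : 𝒯.Lˣ) : 𝒯.L) = (𝒯.fiber p).t⁻¹ := by
  refine eq_inv_of_mul_eq_one_left ?_
  rw [← 𝒯.restrict_t p, ← map_mul, Units.inv_mul, map_one]

theorem mul_inv_pow (n : ℕ) : (𝒯.t : 𝒯.L) ^ n * ((𝒯.t⁻¹ : 𝒯.Lˣ) : 𝒯.L) ^ n = 1 := by
  rw [← mul_pow, Units.mul_inv, one_pow]

theorem mem_map_of_restrict_eq_zero {z : 𝒯.L} (hz : 𝒯.restrict p z = 0) :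
    z ∈ (RingHom.ker p).map (algebraMap R 𝒯.L) := by
  obtain ⟨n, hn⟩ := 𝒯.localize₀ z
  have h1 := (𝒯.ker₀ p ⟨_, hn⟩).1 (by rw [map_mul, hz, mul_zero])
  have h2 := Ideal.mem_map_of_mem 𝒯.A₀.val.toRingHom h1
  rw [Ideal.map_map] at h2
  have h3 : ((𝒯.t⁻¹ : 𝒯.Lˣ) : 𝒯.L) ^ n * ((𝒯.t : 𝒯.L) ^ n * z) ∈
      (RingHom.ker p).map (algebraMap R 𝒯.L) := Ideal.mul_mem_left _ _ h2
  rwa [← mul_assoc, mul_comm (_ ^ n), mul_inv_pow, one_mul] at h3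

/-- The sums of functions on the first chart and functions on the second chart with a pole of
order at most four along `t = ∞`. -/
def twistSum : Submodule R 𝒯.L := Subalgebra.toSubmodule 𝒯.A₀ ⊔
  (Subalgebra.toSubmodule 𝒯.A₁).map (LinearMap.mulLeft R ((𝒯.t : 𝒯.L) ^ 4))

variable {p}

/-- On the fiber this is `ScrollBasis.exists_eq_add`, and both parts lift because the charts of the
family restrict onto the charts of the fiber. -/
theorem exists_mem_twistSum {w : Fin 2 → (𝒯.fiber p).K} (h : ScrollBasis (𝒯.fiber p).t w)
    (z : 𝒯.L) : ∃ s ∈ 𝒯.twistSum, 𝒯.restrict p (z - s) = 0 := by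
  obtain ⟨n, hn⟩ := 𝒯.localize₀ z
  have h1 : (𝒯.fiber p).t ^ n * 𝒯.restrict p z ∈ integralOver {(𝒯.fiber p).t} := by
    rw [← SetLike.mem_coe, ← 𝒯.range₀ p]
    exact ⟨_, hn, by rw [map_mul, map_pow, restrict_t]⟩
  obtain ⟨x, hx, y, hy, hxy⟩ := h.exists_eq_add h1
  rw [← SetLike.mem_coe, ← 𝒯.range₀ p] at hx
  rw [← SetLike.mem_coe, ← 𝒯.range₁ p] at hy
  obtain ⟨a, ha, rfl⟩ := hx
  obtain ⟨b, hb, rfl⟩ := hy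
  exact ⟨_, Submodule.add_mem_sup ha ⟨b, hb, rfl⟩, by
    rw [map_sub, hxy, map_add, LinearMap.mulLeft_apply, map_mul, map_pow, restrict_t, sub_self]⟩

/-- The quotient of `L` by `twistSum` is the `H¹` of the twisted structure sheaf. It is generated
over `R` by finitely many classes `t⁻ⁱ g j`, since those with large `i` come from the second chart,
and it vanishes on the fiber. By Nakayama's lemma it is killed by an element with value `1` at `p`.
-/
theorem exists_smul_mem_twistSum {w : Fin 2 → (𝒯.fiber p).K} (h : ScrollBasis (𝒯.fiber p).t w) :
    ∃ r : R, p r = 1 ∧ ∀ z, r • z ∈ 𝒯.twistSum := by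
  obtain ⟨n, g, hg⟩ := exists_polySpan_eq 𝒯.t_mem 𝒯.finite₀
  choose N hN using fun j => 𝒯.localize₁ (g j)
  let z : Fin (∑ j, N j) × Fin n → 𝒯.L := fun k => ((𝒯.t⁻¹ : 𝒯.Lˣ) : 𝒯.L) ^ (k.1 : ℕ) * g k.2
  have hz : ∀ i j, ((𝒯.t⁻¹ : 𝒯.Lˣ) : 𝒯.L) ^ i * g j ∈
      𝒯.twistSum ⊔ Submodule.span R (Set.range z) := by
    intro i j
    rcases lt_or_ge i (∑ j, N j) with hi | hi
    · exact Submodule.mem_sup_right (Submodule.subset_span ⟨(⟨i, hi⟩, j), rfl⟩)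
    · have hNj : N j ≤ i := (Finset.single_le_sum (f := N) (fun _ _ => Nat.zero_le _)
        (Finset.mem_univ j)).trans hi
      obtain ⟨r, rfl⟩ := Nat.exists_eq_add_of_le hNj
      refine Submodule.mem_sup_left (Submodule.mem_sup_right
        ⟨((𝒯.t⁻¹ : 𝒯.Lˣ) : 𝒯.L) ^ (r + 4) * (((𝒯.t⁻¹ : 𝒯.Lˣ) : 𝒯.L) ^ N j * g j),
          𝒯.A₁.mul_mem (pow_mem 𝒯.t_inv_mem _) (hN j), ?_⟩)
      rw [LinearMap.mulLeft_apply, pow_add, pow_add]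
      linear_combination ((𝒯.t⁻¹ : 𝒯.Lˣ) : 𝒯.L) ^ r * ((𝒯.t⁻¹ : 𝒯.Lˣ) : 𝒯.L) ^ N j * g j *
        𝒯.mul_inv_pow 4
  have htop : 𝒯.twistSum ⊔ Submodule.span R (Set.range z) = ⊤ := by
    refine eq_top_iff.2 fun x _ => ?_
    obtain ⟨m, hm⟩ := 𝒯.localize₀ x
    obtain ⟨P, hP⟩ := mem_polySpan.1 (hg.ge hm)
    have hx : x = ∑ j, ((𝒯.t⁻¹ : 𝒯.Lˣ) : 𝒯.L) ^ m * (aeval (𝒯.t : 𝒯.L) (P j) * g j) := by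
      rw [← Finset.mul_sum, ← hP]
      linear_combination -x * 𝒯.mul_inv_pow m
    rw [hx]
    refine sum_mem fun j _ => ?_
    generalize P j = Q
    induction Q using Polynomial.induction_on' with
    | add Q Q' hQ hQ' => rw [map_add, add_mul, mul_add]; exact add_mem hQ hQ'
    | monomial k c =>
      rw [Polynomial.aeval_monomial, mul_assoc, ← Algebra.smul_def, mul_smul_comm]
      refine Submodule.smul_mem _ c ?_
      rcases le_total m k with hk | hk
      · obtain ⟨r, rfl⟩ := Nat.exists_eq_add_of_le hk
        refine Submodule.mem_sup_left (Submodule.mem_sup_left ?_)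
        have h1 : ((𝒯.t⁻¹ : 𝒯.Lˣ) : 𝒯.L) ^ m * ((𝒯.t : 𝒯.L) ^ (m + r) * g j) =
            (𝒯.t : 𝒯.L) ^ r * g j := by
          rw [pow_add]
          linear_combination (𝒯.t : 𝒯.L) ^ r * g j * 𝒯.mul_inv_pow m
        rw [h1]
        exact 𝒯.A₀.mul_mem (pow_mem 𝒯.t_mem _) (hg.le (self_mem_polySpan j))
      · obtain ⟨r, rfl⟩ := Nat.exists_eq_add_of_le hk
        have h1 : ((𝒯.t⁻¹ : 𝒯.Lˣ) : 𝒯.L) ^ (k + r) * ((𝒯.t : 𝒯.L) ^ k * g j) =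
            ((𝒯.t⁻¹ : 𝒯.Lˣ) : 𝒯.L) ^ r * g j := by
          rw [pow_add]
          linear_combination ((𝒯.t⁻¹ : 𝒯.Lˣ) : 𝒯.L) ^ r * g j * 𝒯.mul_inv_pow k
        rw [h1]
        exact hz r j
  obtain ⟨r, hr, hrz⟩ := exists_smul_mem_of_le (RingHom.ker p) 𝒯.twistSum z fun j => by
    obtain ⟨s, hs, hzs⟩ := 𝒯.exists_mem_twistSum h (z j)
    have h1 : z j - s ∈ RingHom.ker p • (⊤ : Submodule R 𝒯.L) := by
      rw [Ideal.smul_top_eq_map]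
      exact 𝒯.mem_map_of_restrict_eq_zero p hzs
    rw [← htop, Submodule.smul_sup] at h1
    rw [← add_sub_cancel s (z j)]
    obtain ⟨x, hx, y, hy, hxy⟩ := Submodule.mem_sup.1 h1
    rw [← hxy]
    exact add_mem (Submodule.mem_sup_left hs)
      (Submodule.add_mem_sup (Submodule.smul_le_right hx) hy)
  refine ⟨r, sub_eq_zero.1 (by rw [← map_one p, ← map_sub]; exact hr), fun x => ?_⟩
  have hx := htop.ge (Submodule.mem_top : x ∈ ⊤)
  refine (sup_le (fun s hs => Submodule.smul_mem _ r hs) (Submodule.span_le.2 ?_) :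
    𝒯.twistSum ⊔ Submodule.span R (Set.range z) ≤
      𝒯.twistSum.comap (r • (LinearMap.id : 𝒯.L →ₗ[R] 𝒯.L))) hx
  rintro _ ⟨j, rfl⟩
  exact hrz j

/-- The sections of the twisted bundle lift to a family. -/
theorem exists_lift {w : Fin 2 → (𝒯.fiber p).K} (h : ScrollBasis (𝒯.fiber p).t w) (i : Fin 2) :
    ∃ Ω ∈ 𝒯.A₀, ((𝒯.t⁻¹ : 𝒯.Lˣ) : 𝒯.L) ^ 4 * Ω ∈ 𝒯.A₁ ∧ 𝒯.restrict p Ω = w i := by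
  obtain ⟨r, hr, hrS⟩ := 𝒯.exists_smul_mem_twistSum h
  obtain ⟨W, hW, hWw⟩ := (𝒯.range₀ p).ge (h.w_mem₀ i)
  obtain ⟨V, hV, hVw⟩ := (𝒯.range₁ p).ge (h.w_mem₁ i)
  have h4 : (𝒯.fiber p).t ^ 4 * (𝒯.fiber p).t⁻¹ ^ 4 = 1 := by
    rw [← mul_pow, mul_inv_cancel₀ h.ne_zero, one_pow]
  -- The lifts `W` and `t⁴ V` on the two charts agree on the fiber. After multiplication by `r`
  -- their difference splits as `x + t⁴ y` with `x` zero on the fiber, so `r • W - x` is a section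
  -- on both charts with the same restriction.
  have hz : W - (𝒯.t : 𝒯.L) ^ 4 * V ∈ RingHom.ker p • (⊤ : Submodule R 𝒯.L) := by
    rw [Ideal.smul_top_eq_map]
    refine 𝒯.mem_map_of_restrict_eq_zero p ?_
    rw [map_sub, map_mul, map_pow, restrict_t, hWw, hVw]
    linear_combination -w i * h4
  have key : ∀ z ∈ RingHom.ker p • (⊤ : Submodule R 𝒯.L), ∃ x ∈ 𝒯.A₀, ∃ y ∈ 𝒯.A₁,
      r • z = x + (𝒯.t : 𝒯.L) ^ 4 * y ∧ 𝒯.restrict p x = 0 := by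
    intro z hz
    induction hz using Submodule.smul_induction_on' with
    | smul m hm z _ =>
      obtain ⟨x, hx, _, ⟨y, hy, rfl⟩, hxy⟩ := Submodule.mem_sup.1 (hrS z)
      refine ⟨m • x, Subalgebra.smul_mem _ hx m, m • y, Subalgebra.smul_mem _ hy m, ?_, ?_⟩
      · rw [smul_comm, ← hxy, smul_add, LinearMap.mulLeft_apply, mul_smul_comm]
      · rw [restrict_smul, (hm : p m = 0), map_zero, zero_mul]
    | add z _ z' _ hz hz' =>
      obtain ⟨x, hx, y, hy, hxy, hx0⟩ := hz
      obtain ⟨x', hx', y', hy', hxy', hx0'⟩ := hz'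
      exact ⟨x + x', add_mem hx hx', y + y', add_mem hy hy', by rw [smul_add, hxy, hxy']; ring,
        by rw [map_add, hx0, hx0', add_zero]⟩
  obtain ⟨x, hx, y, hy, hxy, hx0⟩ := key _ hz
  refine ⟨r • W - x, sub_mem (Subalgebra.smul_mem _ hW r) hx, ?_, ?_⟩
  · have h1 : ((𝒯.t⁻¹ : 𝒯.Lˣ) : 𝒯.L) ^ 4 * (r • W - x) = r • V + y := by
      rw [smul_sub] at hxy
      have h2 : r • ((𝒯.t : 𝒯.L) ^ 4 * V) = (𝒯.t : 𝒯.L) ^ 4 * r • V := (mul_smul_comm _ _ _).symm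
      linear_combination ((𝒯.t⁻¹ : 𝒯.Lˣ) : 𝒯.L) ^ 4 * hxy + ((𝒯.t⁻¹ : 𝒯.Lˣ) : 𝒯.L) ^ 4 * h2 +
        (r • V + y) * 𝒯.mul_inv_pow 4
    rw [h1]
    exact add_mem (Subalgebra.smul_mem _ hV r) hy
  · rw [map_sub, hx0, sub_zero, restrict_smul, hr, map_one, one_mul, hWw]

/-- A lattice in the functions on a chart that agrees with all functions in a fiber agrees with
them up to a polynomial that reduces to `1`. -/
theorem exists_lattice {τ : 𝒯.L} {A : Subalgebra R 𝒯.L} (hτ : τ ∈ A)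
    (hfin : (aeval (R := R) (⟨τ, hτ⟩ : A)).toRingHom.Finite)
    (hker : ∀ a : A, 𝒯.restrict p a = 0 → a ∈ (RingHom.ker p).map (algebraMap R A))
    {k : ℕ} {v : Fin k → 𝒯.L} (hv : ∀ i, v i ∈ A)
    (hspan : ∀ a ∈ A, ∃ P : Fin k → ℂ[X], 𝒯.restrict p a =
      ∑ i, aeval (𝒯.restrict p τ) (P i) * 𝒯.restrict p (v i)) :
    ∃ G : R[X], G - 1 ∈ (RingHom.ker p).map Polynomial.C ∧
      ∀ z ∈ A, aeval τ G * z ∈ polySpan (R := R) τ v := by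
  obtain ⟨n, g, hg⟩ := exists_polySpan_eq hτ hfin
  have hp : Function.Surjective (p : R →+* ℂ) := fun z => ⟨algebraMap ℂ R z, by simp⟩
  have haev : ∀ Q : R[X], aeval τ Q ∈ A := fun Q =>
    Polynomial.aeval_algHom_apply A.val (⟨τ, hτ⟩ : A) Q ▸ SetLike.coe_mem _
  obtain ⟨G, hG, hGz⟩ := exists_aeval_mul_mem_polySpan (τ := τ) (v := v) (RingHom.ker p) g
    fun j => by
      have hgj : g j ∈ A := hg.le (self_mem_polySpan j)
      obtain ⟨P, hP⟩ := hspan _ hgj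
      choose Q hQ using fun i => Polynomial.map_surjective _ hp (P i)
      have hmem : ∑ i, aeval τ (Q i) * v i ∈ A :=
        sum_mem fun i _ => mul_mem (haev _) (hv i)
      obtain ⟨M, hM, hMz⟩ := exists_map_C_of_mem_map hg
        (hker ⟨g j - ∑ i, aeval τ (Q i) * v i, sub_mem hgj hmem⟩ (by
          change 𝒯.restrict p (g j - _) = 0
          rw [map_sub, hP, map_sum, sub_eq_zero]
          refine Finset.sum_congr rfl fun i _ => ?_
          rw [map_mul, restrict_aeval, hQ]))
      refine ⟨M, hM, ?_⟩
      rw [← hMz, sub_sub_cancel]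
      exact mem_polySpan.2 ⟨Q, rfl⟩
  exact ⟨G, hG, fun z hz => hGz z (hg.ge hz)⟩

end TrigonalFamily

/-! ### Equations of bidegree `(3, 4)` for the fibers of a family -/

namespace TrigonalFamily

variable {R : Type} [CommRing R] [Algebra ℂ R] (𝒯 : TrigonalFamily R)

/-- Sections `Ω` of a family that form, together with `1`, bases of the functions on the two
charts, up to the denominator `b`. -/
structure LocalBasis (Ω : Fin 2 → 𝒯.L) (b : R) : Prop where
  mem₀ : ∀ i, Ω i ∈ 𝒯.A₀
  mem₁ : ∀ i, ((𝒯.t⁻¹ : 𝒯.Lˣ) : 𝒯.L) ^ 4 * Ω i ∈ 𝒯.A₁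
  span₀ : ∀ z ∈ 𝒯.A₀, algebraMap R 𝒯.L b * z ∈ polySpan (R := R) (𝒯.t : 𝒯.L) ![1, Ω 0, Ω 1]
  span₁ : ∀ z ∈ 𝒯.A₁, algebraMap R 𝒯.L b * z ∈ polySpan (R := R) ((𝒯.t⁻¹ : 𝒯.Lˣ) : 𝒯.L)
    ![1, ((𝒯.t⁻¹ : 𝒯.Lˣ) : 𝒯.L) ^ 4 * Ω 0, ((𝒯.t⁻¹ : 𝒯.Lˣ) : 𝒯.L) ^ 4 * Ω 1]

variable {𝒯} {p : R →ₐ[ℂ] ℂ}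

/-- On each chart the lifted sections and `1` span all functions up to a polynomial that reduces to
`1`. By `exists_algebraMap_mul_mem_polySpan`, applied from both charts, constants `b₀` and `b₁`
suffice, and their product serves both. -/
theorem exists_localBasis {w : Fin 2 → (𝒯.fiber p).K} (h : ScrollBasis (𝒯.fiber p).t w) :
    ∃ (Ω : Fin 2 → 𝒯.L) (b : R), p b = 1 ∧ (∀ i, 𝒯.restrict p (Ω i) = w i) ∧
      𝒯.LocalBasis Ω b := by
  choose Ω h₀ h₁ hw using 𝒯.exists_lift h
  set s : 𝒯.L := ((𝒯.t⁻¹ : 𝒯.Lˣ) : 𝒯.L) with hs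
  have hsp : 𝒯.restrict p s = (𝒯.fiber p).t⁻¹ := 𝒯.restrict_t_inv p
  obtain ⟨G, hG, hGA⟩ := 𝒯.exists_lattice (v := ![1, Ω 0, Ω 1]) 𝒯.t_mem 𝒯.finite₀
    (fun a => (𝒯.ker₀ p a).1)
    (by intro i; fin_cases i; exacts [𝒯.A₀.one_mem, h₀ 0, h₀ 1])
    (fun a ha => by
      obtain ⟨P, Q, hPQ⟩ := (h.mem₀ _).1 ((𝒯.range₀ p).le ⟨a, ha, rfl⟩)
      refine ⟨![P, Q 0, Q 1], ?_⟩
      rw [hPQ, Fin.sum_univ_three, Fin.sum_univ_two, restrict_t]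
      simp [hw, add_assoc])
  obtain ⟨G', hG', hGA'⟩ := 𝒯.exists_lattice (v := ![1, s ^ 4 * Ω 0, s ^ 4 * Ω 1]) 𝒯.t_inv_mem
    𝒯.finite₁ (fun a => (𝒯.ker₁ p a).1)
    (by intro i; fin_cases i; exacts [𝒯.A₁.one_mem, h₁ 0, h₁ 1])
    (fun a ha => by
      obtain ⟨P, Q, hPQ⟩ := (h.mem₁ _).1 ((𝒯.range₁ p).le ⟨a, ha, rfl⟩)
      refine ⟨![P, Q 0, Q 1], ?_⟩
      rw [hPQ, Fin.sum_univ_three, Fin.sum_univ_two, ← hs, hsp]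
      simp [hw, hsp, add_assoc])
  obtain ⟨n, g, hg⟩ := exists_polySpan_eq 𝒯.t_mem 𝒯.finite₀
  obtain ⟨n', g', hg'⟩ := exists_polySpan_eq 𝒯.t_inv_mem 𝒯.finite₁
  obtain ⟨b₀, hb₀, hbA₀⟩ := exists_algebraMap_mul_mem_polySpan (RingHom.ker p) (t := 𝒯.t)
    (A := Subalgebra.toSubmodule 𝒯.A₁) (v := ![1, Ω 0, Ω 1])
    (v' := ![1, s ^ 4 * Ω 0, s ^ 4 * Ω 1]) (g := g) (by
      have h4 : ∀ z, (𝒯.t : 𝒯.L) ^ 4 * (s ^ 4 * z) = z := fun z => by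
        rw [← mul_assoc, 𝒯.mul_inv_pow, one_mul]
      intro i
      fin_cases i
      · exact ⟨0, by rw [pow_zero, one_mul]; exact self_mem_polySpan (0 : Fin 3)⟩
      · exact ⟨4, (h4 (Ω 0)).symm ▸ self_mem_polySpan (1 : Fin 3)⟩
      · exact ⟨4, (h4 (Ω 1)).symm ▸ self_mem_polySpan (2 : Fin 3)⟩)
    hG hG' (fun z hz => hGA z (hg.le hz)) hGA' (fun j => 𝒯.localize₁ _)
  obtain ⟨b₁, hb₁, hbA₁⟩ := exists_algebraMap_mul_mem_polySpan (RingHom.ker p) (t := 𝒯.t⁻¹)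
    (A := Subalgebra.toSubmodule 𝒯.A₀) (v := ![1, s ^ 4 * Ω 0, s ^ 4 * Ω 1])
    (v' := ![1, Ω 0, Ω 1]) (g := g') (by
      intro i
      fin_cases i
      · exact ⟨0, by rw [pow_zero, one_mul]; exact self_mem_polySpan (0 : Fin 3)⟩
      · exact ⟨4, self_mem_polySpan (v := ![1, s ^ 4 * Ω 0, s ^ 4 * Ω 1]) (1 : Fin 3)⟩
      · exact ⟨4, self_mem_polySpan (v := ![1, s ^ 4 * Ω 0, s ^ 4 * Ω 1]) (2 : Fin 3)⟩)
    hG' hG (fun z hz => hGA' z (hg'.le hz)) (by rw [inv_inv]; exact hGA)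
    (fun j => by rw [inv_inv]; exact 𝒯.localize₀ _)
  have hb : ∀ {b : R}, b - 1 ∈ RingHom.ker p → p b = 1 := fun {b} hb =>
    sub_eq_zero.1 (by rw [← map_one p, ← map_sub]; exact hb)
  refine ⟨Ω, b₀ * b₁, by rw [map_mul, hb hb₀, hb hb₁, one_mul], hw, h₀, h₁, fun z hz => ?_,
    fun z hz => ?_⟩
  · rw [map_mul, mul_comm (algebraMap R 𝒯.L b₀), mul_assoc, ← Algebra.smul_def]
    exact Submodule.smul_mem _ _ (hbA₀ z (hg.ge hz))
  · rw [map_mul, mul_assoc, ← Algebra.smul_def]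
    exact Submodule.smul_mem _ _ (hbA₁ z (hg'.ge hz))

theorem exists_restrict_eq (q : R →ₐ[ℂ] ℂ) {τ x y z : 𝒯.L}
    (hz : z ∈ polySpan (R := R) τ ![1, x, y]) :
    ∃ P : Fin 3 → R[X], 𝒯.restrict q z =
      aeval (𝒯.restrict q τ) ((P 0).map (q : R →+* ℂ)) +
      aeval (𝒯.restrict q τ) ((P 1).map (q : R →+* ℂ)) * 𝒯.restrict q x +
      aeval (𝒯.restrict q τ) ((P 2).map (q : R →+* ℂ)) * 𝒯.restrict q y := by
  obtain ⟨P, rfl⟩ := mem_polySpan.1 hz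
  exact ⟨P, by simp [Fin.sum_univ_three, restrict_aeval]⟩

/-- Where `b` is nonzero it can be inverted on the fiber, so `1` and the restricted sections
generate the functions on both charts. Three generators of a lattice of rank three are independent.
-/
theorem LocalBasis.scrollBasis {Ω : Fin 2 → 𝒯.L} {b : R} (hΩ : 𝒯.LocalBasis Ω b) {q : R →ₐ[ℂ] ℂ}
    (hq : q b ≠ 0) : ScrollBasis (𝒯.fiber q).t fun i => 𝒯.restrict q (Ω i) := by
  have hc : algebraMap ℂ (𝒯.fiber q).K (q b) ≠ 0 := (_root_.map_ne_zero _).2 hq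
  have key : ∀ {τ x y z : 𝒯.L}, algebraMap R 𝒯.L b * z ∈ polySpan (R := R) τ ![1, x, y] →
      ∃ (P : ℂ[X]) (Q : Fin 2 → ℂ[X]), 𝒯.restrict q z = aeval (𝒯.restrict q τ) P +
        ∑ i, aeval (𝒯.restrict q τ) (Q i) * ![𝒯.restrict q x, 𝒯.restrict q y] i := by
    intro τ x y z hz
    obtain ⟨P, hP⟩ := exists_restrict_eq q hz
    refine ⟨Polynomial.C (q b)⁻¹ * (P 0).map (q : R →+* ℂ),
      ![Polynomial.C (q b)⁻¹ * (P 1).map (q : R →+* ℂ),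
        Polynomial.C (q b)⁻¹ * (P 2).map (q : R →+* ℂ)], ?_⟩
    rw [map_mul, restrict_base] at hP
    simp only [Fin.sum_univ_two, Matrix.cons_val_zero, Matrix.cons_val_one, map_mul,
      Polynomial.aeval_C, map_inv₀]
    field_simp
    linear_combination hP
  have hmem₀ : ∀ z ∈ integralOver {(𝒯.fiber q).t}, ∃ (P : ℂ[X]) (Q : Fin 2 → ℂ[X]),
      z = aeval (𝒯.fiber q).t P +
        ∑ i, aeval (𝒯.fiber q).t (Q i) * 𝒯.restrict q (Ω i) := by
    intro z hz
    obtain ⟨a, ha, rfl⟩ := (𝒯.range₀ q).ge hz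
    obtain ⟨P, Q, h⟩ := key (hΩ.span₀ a ha)
    rw [restrict_t] at h
    exact ⟨P, Q, h.trans (by rw [Fin.sum_univ_two, Fin.sum_univ_two]; rfl)⟩
  refine ⟨indep_of_forall_mem_integralOver (𝒯.fiber q).transcendental (𝒯.fiber q).degree hmem₀,
    fun z => ⟨hmem₀ z, ?_⟩, fun z => ⟨fun hz => ?_, ?_⟩⟩
  · rintro ⟨P, Q, rfl⟩
    exact add_mem (aeval_mem_integralOver _ _) (sum_mem fun i _ => mul_mem
      (aeval_mem_integralOver _ _) ((𝒯.range₀ q).le ⟨_, hΩ.mem₀ i, rfl⟩))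
  · obtain ⟨a, ha, rfl⟩ := (𝒯.range₁ q).ge hz
    obtain ⟨P, Q, h⟩ := key (hΩ.span₁ a ha)
    rw [restrict_t_inv, map_mul, map_mul, map_pow, restrict_t_inv] at h
    exact ⟨P, Q, h.trans (by rw [Fin.sum_univ_two, Fin.sum_univ_two]; rfl)⟩
  · rintro ⟨P, Q, rfl⟩
    refine add_mem (aeval_mem_integralOver _ _) (sum_mem fun i _ => mul_mem
      (aeval_mem_integralOver _ _) ((𝒯.range₁ q).le ⟨_, hΩ.mem₁ i, ?_⟩))
    rw [map_mul, map_pow, restrict_t_inv]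

/-- Near a fiber that is a smooth curve of bidegree `(3,4)`, the fibers of a family are the smooth
curves given by a form over the base. -/
theorem exists_form {a : Fin 4 × Fin 5 → ℂ} {θ : (𝒯.fiber p).K}
    (h : PlaneModel a (𝒯.fiber p).t θ) :
    ∃ (e : R) (α : Fin 4 × Fin 5 → R), p e ≠ 0 ∧
      ∀ q : R →ₐ[ℂ] ℂ, q e ≠ 0 → ∃ θ, PlaneModel (q ∘ α) (𝒯.fiber q).t θ := by
  obtain ⟨Ω, b, hb, hw, hΩ⟩ := exists_localBasis h.scrollBasis
  have hprod : ∀ i j, ∃ P : Fin 3 → R[X], ∀ q : R →ₐ[ℂ] ℂ,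
      algebraMap ℂ _ (q b) * (𝒯.restrict q (Ω i) * 𝒯.restrict q (Ω j)) =
        aeval (𝒯.fiber q).t ((P 0).map (q : R →+* ℂ)) +
        aeval (𝒯.fiber q).t ((P 1).map (q : R →+* ℂ)) * 𝒯.restrict q (Ω 0) +
        aeval (𝒯.fiber q).t ((P 2).map (q : R →+* ℂ)) * 𝒯.restrict q (Ω 1) := by
    intro i j
    obtain ⟨P, hP⟩ := mem_polySpan.1 (hΩ.span₀ _ (mul_mem (hΩ.mem₀ i) (hΩ.mem₀ j)))
    refine ⟨P, fun q => ?_⟩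
    rw [← map_mul, ← restrict_base, ← map_mul, hP]
    simp [Fin.sum_univ_three, restrict_aeval, restrict_t]
  choose P hP using hprod
  -- The product of two sections has a pole of order at most eight along `t = ∞`, so the
  -- coefficients of `Ω 0` and `Ω 1` in it have degree at most `8 - 4`.
  have hdeg : ∀ q : R →ₐ[ℂ] ℂ, q b ≠ 0 → ∀ i j, ((P i j 1).map (q : R →+* ℂ)).natDegree ≤ 4 ∧
      ((P i j 2).map (q : R →+* ℂ)).natDegree ≤ 4 := by
    intro q hq i j
    have hmem : (𝒯.fiber q).t⁻¹ ^ (4 + 4) * (aeval (𝒯.fiber q).t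
        ((P i j 0).map (q : R →+* ℂ)) + ∑ k, aeval (𝒯.fiber q).t
          (![(P i j 1).map (q : R →+* ℂ), (P i j 2).map (q : R →+* ℂ)] k) *
            𝒯.restrict q (Ω k)) ∈ integralOver {(𝒯.fiber q).t⁻¹} := by
      have h1 := mul_mem ((hΩ.scrollBasis hq).w_mem₁ i) ((hΩ.scrollBasis hq).w_mem₁ j)
      have h2 := (integralOver {(𝒯.fiber q).t⁻¹}).smul_mem h1 (q b)
      rw [Algebra.smul_def] at h2
      convert h2 using 1
      simp only [Fin.sum_univ_two, Matrix.cons_val_zero, Matrix.cons_val_one]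
      linear_combination -(𝒯.fiber q).t⁻¹ ^ 8 * hP i j q
    exact ⟨(hΩ.scrollBasis hq).natDegree_le hmem 0, (hΩ.scrollBasis hq).natDegree_le hmem 1⟩
  -- The cubic form of the multiplication table, as in `sum_aeval_eq_zero_of_table`. The degree
  -- bound is known only after evaluation at points, so `α` records the coefficients up to degree
  -- four and `hα` compares pointwise.
  let f : Fin 4 → R[X] :=
    ![P 0 0 2, 2 * P 0 1 2 - P 0 0 1, P 1 1 2 - 2 * P 0 1 1, -P 1 1 1]
  let α : Fin 4 × Fin 5 → R := fun k => (f k.1).coeff (4 - (k.2 : ℕ))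
  have hα : ∀ q : R →ₐ[ℂ] ℂ, q b ≠ 0 → ∀ i, coeffPoly (q ∘ α) i = (f i).map (q : R →+* ℂ) := by
    intro q hq i
    have hf : ((f i).map (q : R →+* ℂ)).natDegree ≤ 4 := by
      have h2 : ∀ Q : ℂ[X], (2 * Q).natDegree = Q.natDegree := fun Q => by
        rw [show (2 : ℂ[X]) = Polynomial.C 2 from rfl, Polynomial.natDegree_C_mul two_ne_zero]
      fin_cases i
      · exact (hdeg q hq 0 0).2
      · change ((2 * P 0 1 2 - P 0 0 1).map (q : R →+* ℂ)).natDegree ≤ 4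
        simp only [Polynomial.map_sub, Polynomial.map_mul, Polynomial.map_ofNat]
        exact (Polynomial.natDegree_sub_le _ _).trans (max_le ((h2 _).le.trans (hdeg q hq 0 1).2)
          (hdeg q hq 0 0).1)
      · change ((P 1 1 2 - 2 * P 0 1 1).map (q : R →+* ℂ)).natDegree ≤ 4
        simp only [Polynomial.map_sub, Polynomial.map_mul, Polynomial.map_ofNat]
        exact (Polynomial.natDegree_sub_le _ _).trans (max_le (hdeg q hq 1 1).2
          ((h2 _).le.trans (hdeg q hq 0 1).1))
      · change ((-P 1 1 1).map (q : R →+* ℂ)).natDegree ≤ 4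
        rw [Polynomial.map_neg, Polynomial.natDegree_neg]
        exact (hdeg q hq 1 1).1
    rw [← coeffPoly_coeff (f := fun i => (f i).map (q : R →+* ℂ)) hf]
    congr 1
    funext k
    exact (Polynomial.coeff_map (q : R →+* ℂ) _).symm
  -- At `p` the sections are the standard basis of the cubic ring of `a`, and its multiplication
  -- table returns `a`. Hence the form is smooth at `p`, and the polynomial `Δ` keeps it smooth
  -- nearby.
  have hpa : p ∘ α = a := by
    have hpb : p b ≠ 0 := hb ▸ one_ne_zero
    have hind : ∀ i j (A : ℂ[X]) (B : Fin 2 → ℂ[X]), 𝒯.restrict p (Ω i) * 𝒯.restrict p (Ω j) =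
        aeval (𝒯.fiber p).t A + ∑ k, aeval (𝒯.fiber p).t (B k) *
          𝒯.restrict p (Ω k) → (P i j 1).map (p : R →+* ℂ) = B 0 ∧
            (P i j 2).map (p : R →+* ℂ) = B 1 := by
      intro i j A B hAB
      have h1 := ((hΩ.scrollBasis hpb).indep ((P i j 0).map (p : R →+* ℂ) - A)
        (![(P i j 1).map (p : R →+* ℂ), (P i j 2).map (p : R →+* ℂ)] - B) (by
          have h2 := hP i j p
          rw [hb, map_one, one_mul, hAB] at h2
          simp only [Fin.sum_univ_two, Pi.sub_apply, map_sub, Matrix.cons_val_zero,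
            Matrix.cons_val_one] at h2 ⊢
          linear_combination -h2)).2
      exact ⟨sub_eq_zero.1 (congrFun h1 0), sub_eq_zero.1 (congrFun h1 1)⟩
    have hw0 := hw 0
    have hw1 := hw 1
    have hr := h.root
    simp only [Matrix.cons_val_zero, Matrix.cons_val_one] at hw0 hw1
    obtain ⟨h001, h002⟩ := hind 0 0 0 ![-coeffPoly a 1, coeffPoly a 0] (by
      simp only [Fin.sum_univ_two, Matrix.cons_val_zero, Matrix.cons_val_one, hw0, hw1, map_neg,
        map_zero]
      ring)
    obtain ⟨h011, h012⟩ := hind 0 1 (-(coeffPoly a 0 * coeffPoly a 3)) ![-coeffPoly a 2, 0] (by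
      simp only [Fin.sum_univ_two, Matrix.cons_val_zero, Matrix.cons_val_one, hw0, hw1, map_neg,
        map_zero, map_mul]
      linear_combination aeval (𝒯.fiber p).t (coeffPoly a 0) * hr)
    obtain ⟨h111, h112⟩ := hind 1 1 (-(coeffPoly a 1 * coeffPoly a 3))
      ![-coeffPoly a 3, -coeffPoly a 2] (by
      simp only [Fin.sum_univ_two, Matrix.cons_val_zero, Matrix.cons_val_one, hw0, hw1, map_neg,
        map_mul]
      linear_combination (aeval (𝒯.fiber p).t (coeffPoly a 0) * θ +
        aeval (𝒯.fiber p).t (coeffPoly a 1)) * hr)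
    have hcoeff : ∀ i, coeffPoly (p ∘ α) i = coeffPoly a i := by
      intro i
      rw [hα p hpb]
      fin_cases i
      · exact h002
      · simp [f, h012, h001]
      · simp [f, h112, h011]
        ring
      · simp [f, h111]
    have hval : ∀ (c : Fin 4 × Fin 5 → ℂ) i (j : Fin 5), (coeffPoly c i).coeff (4 - (j : ℕ)) =
        c (i, j) := by
      intro c i j
      simp only [coeffPoly, Polynomial.finsetSum_coeff, Polynomial.coeff_C_mul_X_pow]
      rw [Finset.sum_eq_single j (fun k _ hk => if_neg (by omega)) (by simp), if_pos rfl]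
    funext ⟨i, j⟩
    exact (hval _ i j).symm.trans ((congrArg (Polynomial.coeff · _) (hcoeff i)).trans (hval _ i j))
  obtain ⟨Δ, hΔ, hΔs⟩ := h.smooth.exists_eval_ne_zero
  have hev : ∀ q : R →ₐ[ℂ] ℂ, q (MvPolynomial.aeval α Δ) = MvPolynomial.eval (q ∘ α) Δ := fun q => by
    rw [← AlgHom.comp_apply, MvPolynomial.comp_aeval]
    rfl
  refine ⟨b * MvPolynomial.aeval α Δ, α, ?_, fun q hq => ?_⟩
  · rw [map_mul, hb, one_mul, hev, hpa]
    exact hΔ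
  · rw [map_mul, hev] at hq
    have hqb := left_ne_zero_of_mul hq
    exact (hΩ.scrollBasis hqb).exists_planeModel (𝒯.fiber q).degree hqb
      (A := fun k => (P 0 0 k).map (q : R →+* ℂ)) (B := fun k => (P 0 1 k).map (q : R →+* ℂ))
      (C := fun k => (P 1 1 k).map (q : R →+* ℂ)) (hP 0 0 q) (hP 0 1 q) (hP 1 1 q) (hΔs _ (right_ne_zero_of_mul hq)) (hα q hqb 0)
      ((hα q hqb 1).trans (by simp [f])) ((hα q hqb 2).trans (by simp [f]))
      ((hα q hqb 3).trans (by simp [f]))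

end TrigonalFamily

/-! ### Invariance of models under linear substitutions -/

section Substitution

variable {K : Type} [Field K] [Algebra ℂ K] {t θ : K} {a b : Fin 4 × Fin 5 → ℂ}

/-- This applies the inverse Möbius transformation; since `z` is outside `E`, no denominator
vanishes. It is used with `E = ℂ(t)` for the root `θ`, and with the elements algebraic over `ℂ` for
the coordinate `t`. -/
theorem exists_moebius_notMem (M : GL (Fin 2) ℂ) {E : IntermediateField ℂ K} {z : K} (hz : z ∉ E) :
    ∃ z' ∉ E, z * (algebraMap ℂ K (M.1 1 0) * z' + algebraMap ℂ K (M.1 1 1)) =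
      algebraMap ℂ K (M.1 0 0) * z' + algebraMap ℂ K (M.1 0 1) ∧
      algebraMap ℂ K (M.1 1 0) * z' + algebraMap ℂ K (M.1 1 1) ≠ 0 := by
  have hdet : M.1 0 0 * M.1 1 1 - M.1 0 1 * M.1 1 0 ≠ 0 := by
    rw [← Matrix.det_fin_two]
    exact ((Matrix.isUnit_iff_isUnit_det _).1 M.isUnit).ne_zero
  have hdet' := (_root_.map_ne_zero (algebraMap ℂ K)).2 hdet
  simp only [map_sub, map_mul] at hdet'
  have hD : algebraMap ℂ K (M.1 0 0) - algebraMap ℂ K (M.1 1 0) * z ≠ 0 := by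
    intro h0
    by_cases h1 : M.1 1 0 = 0
    · rw [h1, map_zero, zero_mul, sub_zero] at h0
      exact hdet' (by rw [h0, h1, map_zero, zero_mul, mul_zero, sub_zero])
    · refine hz ?_
      rw [eq_div_of_mul_eq ((_root_.map_ne_zero (algebraMap ℂ K)).2 h1)
        ((mul_comm _ _).trans (sub_eq_zero.1 h0).symm)]
      exact div_mem (algebraMap_mem _ _) (algebraMap_mem _ _)
  set z' := (algebraMap ℂ K (M.1 1 1) * z - algebraMap ℂ K (M.1 0 1)) /
    (algebraMap ℂ K (M.1 0 0) - algebraMap ℂ K (M.1 1 0) * z)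
  have hz' : z' * (algebraMap ℂ K (M.1 0 0) - algebraMap ℂ K (M.1 1 0) * z) =
      algebraMap ℂ K (M.1 1 1) * z - algebraMap ℂ K (M.1 0 1) := div_mul_cancel₀ _ hD
  have h1 : z * (algebraMap ℂ K (M.1 1 0) * z' + algebraMap ℂ K (M.1 1 1)) =
      algebraMap ℂ K (M.1 0 0) * z' + algebraMap ℂ K (M.1 0 1) := by
    linear_combination -hz'
  have h2 : algebraMap ℂ K (M.1 1 0) * z' + algebraMap ℂ K (M.1 1 1) ≠ 0 := by
    have : algebraMap ℂ K (M.1 1 0) * z' + algebraMap ℂ K (M.1 1 1) =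
        (algebraMap ℂ K (M.1 0 0) * algebraMap ℂ K (M.1 1 1) -
          algebraMap ℂ K (M.1 0 1) * algebraMap ℂ K (M.1 1 0)) /
          (algebraMap ℂ K (M.1 0 0) - algebraMap ℂ K (M.1 1 0) * z) :=
      eq_div_of_mul_eq hD (by linear_combination algebraMap ℂ K (M.1 1 0) * hz')
    rw [this]
    exact div_ne_zero hdet' hD
  refine ⟨z', fun hmem => hz ?_, h1, h2⟩
  rw [eq_div_of_mul_eq h2 h1]
  exact div_mem (add_mem (mul_mem (algebraMap_mem _ _) hmem) (algebraMap_mem _ _))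
    (add_mem (mul_mem (algebraMap_mem _ _) hmem) (algebraMap_mem _ _))

theorem PlaneModel.substitution {M : GL (Fin 2) ℂ}
    (hb : ∀ x u, evalForm b x u = evalForm a (M.1.mulVec x) u) (h : PlaneModel a t θ) :
    ∃ θ', PlaneModel b t θ' := by
  obtain ⟨θ', hθ', h1, h2⟩ := exists_moebius_notMem M h.notMem
  refine ⟨θ', smooth_of_evalForm_eq M 1 (fun x u => by simpa using hb x u) h.smooth,
    h.transcendental, ?_, adjoin_pair_eq_top h.finrank hθ'⟩
  let f := coeffPoly a
  let c : Matrix (Fin 2) (Fin 2) ℂ[X] := M.1.map Polynomial.C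
  have hB : coeffPoly b = ![
      f 0 * c 0 0 ^ 3 + f 1 * (c 0 0 ^ 2 * c 1 0) + f 2 * (c 0 0 * c 1 0 ^ 2) + f 3 * c 1 0 ^ 3,
      f 0 * (3 * c 0 0 ^ 2 * c 0 1) + f 1 * (2 * c 0 0 * c 0 1 * c 1 0 + c 0 0 ^ 2 * c 1 1) +
        f 2 * (c 0 1 * c 1 0 ^ 2 + 2 * c 0 0 * c 1 0 * c 1 1) + f 3 * (3 * c 1 0 ^ 2 * c 1 1),
      f 0 * (3 * c 0 0 * c 0 1 ^ 2) + f 1 * (c 0 1 ^ 2 * c 1 0 + 2 * c 0 0 * c 0 1 * c 1 1) +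
        f 2 * (2 * c 0 1 * c 1 0 * c 1 1 + c 0 0 * c 1 1 ^ 2) + f 3 * (3 * c 1 0 * c 1 1 ^ 2),
      f 0 * c 0 1 ^ 3 + f 1 * (c 0 1 ^ 2 * c 1 1) + f 2 * (c 0 1 * c 1 1 ^ 2) +
        f 3 * c 1 1 ^ 3] := by
    funext i
    refine Polynomial.funext fun s => ?_
    refine congrFun (eq_of_forall_sum_fin_four (c := fun i => (coeffPoly b i).eval s)
      (d := fun i => Polynomial.eval s (Matrix.vecCons _ _ i)) fun x => ?_) i
    have h3 := hb ![x, 1] ![s, 1]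
    rw [evalForm_chart, evalForm_chart] at h3
    simp only [Fin.sum_univ_four, Matrix.mulVec, dotProduct, Fin.sum_univ_two] at h3 ⊢
    simp [c, f] at h3 ⊢
    rw [h3]
    ring
  have hc : ∀ i j, aeval t (c i j) = algebraMap ℂ K (M.1 i j) := fun i j =>
    Polynomial.aeval_C _ _
  simp only [hB, Matrix.cons_val_zero, Matrix.cons_val_one, Matrix.cons_val, map_add, map_mul,
    map_pow, map_ofNat, hc, f]
  generalize hN : algebraMap ℂ K (M.1 0 0) * θ' + algebraMap ℂ K (M.1 0 1) = N at h1
  generalize hD : algebraMap ℂ K (M.1 1 0) * θ' + algebraMap ℂ K (M.1 1 1) = D at h1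
  have hr : aeval t (coeffPoly a 0) * N ^ 3 +
      aeval t (coeffPoly a 1) * (N ^ 2 * D) +
      aeval t (coeffPoly a 2) * (N * D ^ 2) +
      aeval t (coeffPoly a 3) * D ^ 3 = 0 := by
    rw [← h1]
    linear_combination D ^ 3 * h.root
  rw [← hN, ← hD] at hr
  linear_combination hr

theorem IsModel.congr {F F' : SmoothForm} {T : TrigonalCurve} (h : IsModel F T)
    (hF : C34.mk F = C34.mk F') : IsModel F' T := by
  obtain ⟨g, M, rfl⟩ := (SmoothForm.mk_eq_iff_exists_act F F').1 hF
  obtain ⟨t, θ, hm⟩ := (isModel_iff F T).1 h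
  obtain ⟨θ', hm'⟩ := hm.substitution (M := g) (b := (F.act g 1).coeff) fun x u => by
    rw [F.evalForm_act, Units.val_one, Matrix.one_mulVec]
  obtain ⟨s, hs, h1, -⟩ := exists_moebius_notMem M (E := algebraicClosure ℂ T.K) (z := t)
    fun ht => hm.transcendental (mem_algebraicClosure_iff.1 ht)
  refine (isModel_iff _ T).2 ⟨s, θ', hm'.moebius (M := M) (fun x u => ?_)
    (fun hs' => hs (mem_algebraicClosure_iff.2 hs')) h1⟩
  rw [F.evalForm_act, F.evalForm_act, Units.val_one, Matrix.one_mulVec]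

end Substitution

/-- A trigonal curve isomorphic to a smooth curve of bidegree `(3,4)`, with the covering that
belongs to a trigonal curve `T'` isomorphic to it. -/
theorem exists_planeModel_of_isModel {F : SmoothForm} {T T' : TrigonalCurve} (h : IsModel F T)
    (hT : M6trig.mk T = M6trig.mk T') :
    ∃ (F' : SmoothForm) (θ : T'.K), C34.mk F' = C34.mk F ∧ PlaneModel F'.coeff T'.t θ := by
  obtain ⟨e⟩ : Nonempty (T.K ≃ₐ[ℂ] T'.K) := Quotient.exact hT
  obtain ⟨s, θ, hm⟩ := (isModel_iff F T).1 h
  have hm' := hm.map e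
  obtain ⟨p, q, r, u, hdet, hM⟩ := exists_moebius T'.transcendental hm'.transcendental T'.degree
    hm'.finrank T'.genus
  let M : GL (Fin 2) ℂ := Matrix.GeneralLinearGroup.mkOfDetNeZero !![p, q; r, u]
    (by rwa [Matrix.det_fin_two_of])
  exact ⟨F.act 1 M, e θ, F.mk_act 1 M, hm'.moebius (M := M) (fun x y => by
    rw [F.evalForm_act, Units.val_one, Matrix.one_mulVec]) T'.transcendental hM⟩

/-! ### The open embedding into the trigonal locus -/

theorem SmoothForm.exists_isModel (F : SmoothForm) : ∃ T, IsModel F T := by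
  obtain ⟨K, _, _, t, θ, h⟩ := F.isSmooth.exists_planeModel
  exact ⟨h.curve, (isModel_iff _ _).2 ⟨t, θ, h⟩⟩

/-- The inverse of the rational map: the class of the curve of a form. -/
def C34.toM6trig (c : C34) : M6trig :=
  M6trig.mk (Quotient.out c).exists_isModel.choose

/-- Equivalent forms have the same models (`IsModel.congr`), and two curves with the same form have
isomorphic function fields, so the choice of a representative does not matter. -/
theorem C34.ratMap_iff {m : M6trig} {c : C34} : ratMap m c ↔ c.toM6trig = m := by
  have hc : C34.mk (Quotient.out c) = c := Quotient.out_eq c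
  have h := (Quotient.out c).exists_isModel.choose_spec
  constructor
  · rintro ⟨F, T, hF, rfl, hT⟩
    obtain ⟨t, θ, hm⟩ := (isModel_iff _ T).1 (hT.congr (hF.trans hc.symm))
    obtain ⟨t', θ', hm'⟩ := (isModel_iff _ _).1 h
    exact Quotient.sound (hm'.nonempty_algEquiv hm)
  · rintro rfl
    exact ⟨_, _, hc, rfl, h⟩

theorem C34.toM6trig_mk {F : SmoothForm} {T : TrigonalCurve} (h : IsModel F T) :
    (C34.mk F).toM6trig = M6trig.mk T :=
  C34.ratMap_iff.1 ⟨F, T, rfl, rfl, h⟩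

theorem C34.toM6trig_injective : Function.Injective C34.toM6trig := by
  intro c c' h
  obtain ⟨F, T, rfl, hT, hF⟩ := C34.ratMap_iff.2 h
  obtain ⟨F', T', rfl, hT', hF'⟩ := C34.ratMap_iff.2 (rfl : c'.toM6trig = _)
  exact C34.mk_eq_of_isModel hF hF' (hT.trans hT'.symm)

theorem M6trig.isOpen_iff (O : Set M6trig) : IsOpen O ↔ ∀ (R : Type) [CommRing R] [Algebra ℂ R]
    [Algebra.FiniteType ℂ R] (𝒯 : TrigonalFamily R), ∀ p, 𝒯.classify p ∈ O →
      ∃ e : R, p e ≠ 0 ∧ ∀ q : R →ₐ[ℂ] ℂ, q e ≠ 0 → 𝒯.classify q ∈ O := by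
  simp only [isOpen_iSup_iff, isOpen_coinduced]
  refine forall₅_congr fun R _ _ _ 𝒯 => ?_
  rw [isOpen_zariski_iff]
  rfl

/-- Near a smooth form there is a family of trigonal curves of genus six over an open set of the
space of forms. -/
theorem SmoothForm.exists_family (F : SmoothForm) : ∃ (Δ : CoeffRing) (R : Type) (_ : CommRing R)
    (_ : Algebra ℂ R) (_ : Algebra.FiniteType ℂ R) (𝒯 : TrigonalFamily R) (φ : CoeffRing →ₐ[ℂ] R),
    F.point Δ ≠ 0 ∧ (∀ F' : SmoothForm, F'.point Δ ≠ 0 → ∃ q : R →ₐ[ℂ] ℂ, q.comp φ = F'.point ∧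
      𝒯.classify q = (C34.mk F').toM6trig) ∧
    ∀ r : R, ∃ (n : ℕ) (x : CoeffRing), ∀ m ≥ n, r * φ Δ ^ m = φ (x * Δ ^ (m - n)) := by
  obtain ⟨Δ, hΔ, hs⟩ := F.isSmooth.exists_eval_ne_zero
  let R := Localization.Away Δ
  let φ : CoeffRing →ₐ[ℂ] R := IsScalarTower.toAlgHom ℂ CoeffRing R
  have hp : ∀ q : R →ₐ[ℂ] ℂ, MvPolynomial.aeval (q ∘ fun k => φ (MvPolynomial.X k)) = q.comp φ :=
    fun q => MvPolynomial.algHom_ext fun k => MvPolynomial.aeval_X _ _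
  have hsm : ∀ q : R →ₐ[ℂ] ℂ, IsSmooth (q ∘ fun k => φ (MvPolynomial.X k)) := fun q => hs _ (by
    change MvPolynomial.aeval _ Δ ≠ 0
    rw [hp]
    exact ((IsLocalization.Away.algebraMap_isUnit (S := R) Δ).map q).ne_zero)
  obtain ⟨𝒯, h𝒯⟩ := exists_trigonalFamily hsm
  have : Algebra.FiniteType CoeffRing R := IsLocalization.finiteType_of_monoid_fg (Submonoid.powers Δ) R
  refine ⟨Δ, R, inferInstance, inferInstance, Algebra.FiniteType.trans (S := CoeffRing)
    inferInstance inferInstance, 𝒯, φ, hΔ, fun F' hF' => ?_, fun r => ?_⟩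
  · let q : R →ₐ[ℂ] ℂ := IsLocalization.liftAlgHom (M := Submonoid.powers Δ) (f := F'.point) (by
      rintro ⟨_, n, rfl⟩
      exact (map_pow F'.point Δ n).symm ▸ (isUnit_iff_ne_zero.2 hF').pow n)
    have hq : q.comp φ = F'.point := AlgHom.ext fun x => IsLocalization.lift_eq _ x
    have hqa : (q ∘ fun k => φ (MvPolynomial.X k)) = F'.coeff := funext fun k =>
      (DFunLike.congr_fun hq (MvPolynomial.X k)).trans (MvPolynomial.aeval_X _ _)
    obtain ⟨θ, hθ⟩ := h𝒯 q
    rw [hqa] at hθ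
    exact ⟨q, hq, (C34.toM6trig_mk ((isModel_iff _ _).2 ⟨_, θ, hθ⟩)).symm⟩
  · obtain ⟨⟨x, ⟨_, n, rfl⟩⟩, hx⟩ := IsLocalization.surj (Submonoid.powers Δ) r
    refine ⟨n, x, fun m hm => ?_⟩
    obtain ⟨k, rfl⟩ := Nat.exists_eq_add_of_le hm
    have hx' : r * φ Δ ^ n = φ x := by rw [← map_pow]; exact hx
    rw [pow_add, ← mul_assoc, hx', Nat.add_sub_cancel_left, map_mul, map_pow]

/-- Near `F` the curves of smooth forms make up a family over the localization of the coefficient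
ring at `Δ`, and openness can be tested on this family. A power of `Δ` turns the resulting element
into a polynomial in the coefficients. -/
theorem C34.continuous_toM6trig : Continuous C34.toM6trig := by
  refine continuous_def.2 fun O hO => ?_
  rw [C34.isOpen_iff, SmoothForm.isOpen_iff]
  intro F hF
  obtain ⟨Δ, R, _, _, _, 𝒯, φ, hΔ, hq, hr⟩ := F.exists_family
  obtain ⟨p, hp, hpF⟩ := hq F hΔ
  obtain ⟨e, he, hes⟩ := (M6trig.isOpen_iff O).1 hO R 𝒯 p (hpF ▸ hF)
  obtain ⟨n, x, hx⟩ := hr e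
  have hx' : ∀ (F' : SmoothForm) (q : R →ₐ[ℂ] ℂ), q.comp φ = F'.point →
      q e * F'.point Δ ^ n = F'.point x := by
    rintro F' q hqF
    rw [← hqF, AlgHom.comp_apply, ← map_pow, ← map_mul, hx n le_rfl, Nat.sub_self, pow_zero, mul_one]
    rfl
  refine ⟨x * Δ, ?_, fun F' hF' => ?_⟩
  · rw [map_mul, ← hx' F p hp]
    exact mul_ne_zero (mul_ne_zero he (pow_ne_zero _ hΔ)) hΔ
  · rw [map_mul] at hF'
    obtain ⟨q, hqF, hqc⟩ := hq F' (right_ne_zero_of_mul hF')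
    have := left_ne_zero_of_mul hF'
    rw [← hx' F' q hqF] at this
    change (C34.mk F').toM6trig ∈ O
    rw [← hqc]
    exact hes q (left_ne_zero_of_mul this)

/-- A fraction on the family over the localization at `Δ` is expanded by a power of `Δ` until
numerator and denominator are polynomials. The additional factor `Δ` confines the fraction to forms
that occur in the family. -/
theorem C34.comp_toM6trig_mem_reg {W : Set M6trig} {f : M6trig → ℂ} (hf : f ∈ M6trig.reg W) :
    f ∘ C34.toM6trig ∈ C34.reg (C34.toM6trig ⁻¹' W) := by
  intro F hF
  obtain ⟨Δ, R, _, _, _, 𝒯, φ, hΔ, hq, hr⟩ := F.exists_family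
  obtain ⟨p, hp, hpF⟩ := hq F hΔ
  obtain ⟨a, b, hb, hab⟩ := hf R 𝒯 p (hpF ▸ hF)
  obtain ⟨n, x, hx⟩ := hr a
  obtain ⟨n', y, hy⟩ := hr b
  have key : ∀ (r : R) (n : ℕ) (x : CoeffRing), (∀ m ≥ n, r * φ Δ ^ m = φ (x * Δ ^ (m - n))) →
      ∀ N ≥ n, ∀ (F' : SmoothForm) (q : R →ₐ[ℂ] ℂ), q.comp φ = F'.point →
        F'.point (x * Δ ^ (N - n) * Δ) = q r * F'.point Δ ^ (N + 1) := by
    intro r n x hx N hN F' q hqF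
    rw [map_mul, ← hqF, AlgHom.comp_apply, ← hx N hN, map_mul, map_pow, AlgHom.comp_apply, pow_succ,
      mul_assoc]
  have hX := key a n x hx (n + n') (Nat.le_add_right _ _)
  have hY := key b n' y hy (n + n') (Nat.le_add_left _ _)
  refine ⟨x * Δ ^ (n + n' - n) * Δ, y * Δ ^ (n + n' - n') * Δ, ?_, fun F' hF' hF'W => ?_⟩
  · rw [hY F p hp]
    exact mul_ne_zero hb (pow_ne_zero _ hΔ)
  · have hΔ' : F'.point Δ ≠ 0 := by
      rw [map_mul] at hF'
      exact right_ne_zero_of_mul hF'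
    obtain ⟨q, hqF, hqc⟩ := hq F' hΔ'
    rw [hY F' q hqF] at hF'
    rw [hX F' q hqF, hY F' q hqF, mul_div_mul_right _ _ (pow_ne_zero _ hΔ'), Function.comp_apply,
      ← hqc]
    exact hab q (left_ne_zero_of_mul hF') (hqc ▸ hF'W)

/-- By `TrigonalFamily.exists_form`, a family with one fiber in the image is near this fiber given
by a form `α` over the base. Membership in `O` is then guaranteed by the nonvanishing of a
polynomial in the coefficients `α`. -/
theorem C34.isOpenMap_toM6trig : IsOpenMap C34.toM6trig := by
  intro O hO
  rw [M6trig.isOpen_iff]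
  rintro R _ _ _ 𝒯 p ⟨c, hc, hcp⟩
  obtain ⟨F, T, rfl, hT, hF⟩ := C34.ratMap_iff.2 hcp
  obtain ⟨F₁, θ, hF₁, hm⟩ := exists_planeModel_of_isModel hF hT
  obtain ⟨e, α, he, hα⟩ := TrigonalFamily.exists_form hm
  have hmk : ∀ (q : R →ₐ[ℂ] ℂ) (F' : SmoothForm), F'.coeff = q ∘ α → q e ≠ 0 →
      (C34.mk F').toM6trig = 𝒯.classify q := by
    intro q F' hF' hq
    obtain ⟨θ', hm'⟩ := hα q hq
    rw [← hF'] at hm'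
    exact C34.toM6trig_mk ((isModel_iff _ _).2 ⟨_, θ', hm'⟩)
  let F₂ : SmoothForm := ⟨p ∘ α, (hα p he).choose_spec.smooth⟩
  -- The form `F₂` obtained at `p` need not be the chosen representative of `c`, but it has the same
  -- class by injectivity.
  have hF₂ : C34.mk F₂ ∈ O := by
    rwa [C34.toM6trig_injective ((hmk p F₂ rfl he).trans hcp.symm)]
  obtain ⟨ε, hε, hεs⟩ := (SmoothForm.isOpen_iff _).1 (hO.preimage C34.continuous_mk) F₂ hF₂
  have hev : ∀ q : R →ₐ[ℂ] ℂ, q (MvPolynomial.aeval α ε) = MvPolynomial.aeval (q ∘ α) ε := fun q => by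
    rw [← AlgHom.comp_apply, MvPolynomial.comp_aeval]
    rfl
  refine ⟨e * MvPolynomial.aeval α ε, ?_, fun q hq => ?_⟩
  · rw [map_mul, hev]
    exact mul_ne_zero he hε
  · rw [map_mul, hev] at hq
    have hqe := left_ne_zero_of_mul hq
    let F' : SmoothForm := ⟨q ∘ α, (hα q hqe).choose_spec.smooth⟩
    exact ⟨C34.mk F', hεs F' (right_ne_zero_of_mul hq), hmk q F' rfl hqe⟩

theorem C34.isOpenEmbedding_toM6trig : Topology.IsOpenEmbedding C34.toM6trig :=
  .of_continuous_injective_isOpenMap C34.continuous_toM6trig C34.toM6trig_injective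
    C34.isOpenMap_toM6trig

/-! ### The divisor in the trigonal locus -/

theorem preimageCb_eq : preimageCb = closure (C34.toM6trig '' Cb) := by
  simp only [preimageCb, C34.ratMap_iff]
  rfl

theorem preimage_preimageCb : C34.toM6trig ⁻¹' preimageCb = Cb := by
  rw [preimageCb_eq, C34.isOpenMap_toM6trig.preimage_closure_eq_closure_preimage
    C34.continuous_toM6trig, Set.preimage_image_eq _ C34.toM6trig_injective]
  exact isClosed_closure.closure_eq

theorem isIrreducible_preimageCb : IsIrreducible preimageCb := by
  rw [preimageCb_eq]
  exact (isIrreducible_Cb.image _ C34.continuous_toM6trig.continuousOn).closure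

theorem image_Cb_subset_preimageCb : C34.toM6trig '' Cb ⊆ preimageCb :=
  preimageCb_eq ▸ subset_closure

/-- The set `Y` meets the open image of `C34.toM6trig` and is the closure of the part inside it. The
preimage of `Y` is irreducible, closed and strictly larger than `Cb`, so it is all of `C34`. -/
theorem eq_closure_range_of_preimageCb_ssubset {Y : Set M6trig} (hY : IsClosed Y)
    (hirr : IsIrreducible Y) (hsub : preimageCb ⊂ Y) : Y = closure (Set.range C34.toM6trig) := by
  have hopen : IsOpen (Set.range C34.toM6trig) := C34.isOpenEmbedding_toM6trig.isOpen_range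
  obtain ⟨c, hc⟩ := isIrreducible_Cb.nonempty
  have hcY : c.toM6trig ∈ Y := hsub.1 (image_Cb_subset_preimageCb ⟨c, hc, rfl⟩)
  have hYd : Y ⊆ closure (Y ∩ Set.range C34.toM6trig) := by
    have := subset_closure_diff hirr hopen.isClosed_compl fun h => h hcY ⟨c, rfl⟩
    rwa [Set.sdiff_compl] at this
  have hCb : Cb ⊆ C34.toM6trig ⁻¹' Y := fun d hd => hsub.1 (image_Cb_subset_preimageCb ⟨d, hd, rfl⟩)
  have hne : ¬ C34.toM6trig ⁻¹' Y ⊆ Cb := by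
    intro h
    refine hsub.2 (hYd.trans (closure_minimal ?_ isClosed_closure))
    rintro _ ⟨hy, d, rfl⟩
    exact image_Cb_subset_preimageCb ⟨d, h hy, rfl⟩
  have huniv := eq_univ_of_Cb_ssubset (hY.preimage C34.continuous_toM6trig)
    ⟨⟨c, hcY⟩, hirr.2.preimage C34.isOpenEmbedding_toM6trig⟩ ⟨hCb, hne⟩
  refine subset_antisymm (hYd.trans (closure_mono Set.inter_subset_right))
    (closure_minimal ?_ hY)
  rintro _ ⟨d, rfl⟩
  exact huniv.ge (Set.mem_univ d)

theorem one_mem_reg (W : Set M6trig) : (1 : M6trig → ℂ) ∈ M6trig.reg W := by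
  intro R _ _ _ 𝒯 p _
  exact ⟨1, 1, by simp, by simp⟩

theorem isGenericallyReducedDivisor_preimageCb :
    IsGenericallyReducedDivisor M6trig.reg preimageCb.ideal preimageCb := by
  have hT : IsIrreducible (closure (Set.range C34.toM6trig)) := by
    rw [← Set.image_univ]
    exact (isIrreducible_univ_C34.image _ C34.continuous_toM6trig.continuousOn).closure
  have hlt : preimageCb ⊂ closure (Set.range C34.toM6trig) := by
    refine ⟨?_, fun h => Cb_ne_univ (Set.eq_univ_of_forall fun c => ?_)⟩
    · rw [preimageCb_eq]
      exact closure_mono (Set.image_subset_range _ _)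
    · rw [← preimage_preimageCb]
      exact h (subset_closure ⟨c, rfl⟩)
  have hU : IsOpen (C34.toM6trig '' cyclicLocus) := C34.isOpenMap_toM6trig _ isOpen_cyclicLocus
  refine ⟨isClosed_closure, isIrreducible_preimageCb.nonempty, fun Y hY =>
    coheight_of_irreducible isIrreducible_preimageCb hT isClosed_closure hlt
      (fun Y hY hYi h => eq_closure_range_of_preimageCb_ssubset hY hYi h) Y isClosed_closure hY,
    _, hU, ?_, fun W hW hWU f hf => ⟨?_, fun h m hm => ?_⟩⟩
  · have := subset_closure_diff isIrreducible_preimageCb hU.isClosed_compl (fun h => by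
      obtain ⟨z, hz, hzc⟩ := Cb_inter_cyclicLocus_nonempty
      exact h (image_Cb_subset_preimageCb ⟨z, hz, rfl⟩) ⟨z, hzc, rfl⟩)
    rwa [Set.sdiff_compl] at this
  · rintro h _ ⟨hzC, hzW⟩
    obtain ⟨c, -, rfl⟩ := hWU hzW
    obtain ⟨W', -, hm, -, V, n, k, g, -, -, hg, hsum⟩ := h _ hzW
    obtain ⟨hcV, hfc⟩ := (hsum _ hm).2 c (C34.ratMap_iff.2 rfl)
    rw [hfc]
    refine Finset.sum_eq_zero fun i _ => ?_
    rw [eq_zero_of_mem_ideal (hg i) ⟨preimage_preimageCb.le hzC, hcV⟩, mul_zero]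
  · have hWo := hW.preimage C34.continuous_toM6trig
    -- One generator with coefficient `1` suffices: the pullback of `f` to `C34` vanishes on `Cb`,
    -- and over `cyclicLocus` it is therefore a section of the ideal sheaf.
    refine ⟨W, hW, hm, subset_rfl, C34.toM6trig ⁻¹' W, 1, fun _ => 1,
      fun _ => f ∘ C34.toM6trig, hWo, fun _ => one_mem_reg W, fun _ => ?_, fun m' hm' => ?_⟩
    · refine mem_ideal_of_forall_eq_zero hWo (fun c hc => ?_) (C34.comp_toM6trig_mem_reg hf)
        fun c hc => h _ ⟨image_Cb_subset_preimageCb ⟨c, hc.1, rfl⟩, hc.2⟩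
      obtain ⟨d, hd, hdc⟩ := hWU hc
      rwa [← C34.toM6trig_injective hdc]
    · obtain ⟨c, -, rfl⟩ := hWU hm'
      refine ⟨⟨c, C34.ratMap_iff.2 rfl⟩, fun d hd => ?_⟩
      rw [C34.toM6trig_injective (C34.ratMap_iff.1 hd)]
      exact ⟨hm', by simp⟩

end Bitangent34

end

/-- The locus of smooth curves of bidegree `(3,4)` with a vertical fiber `2 x + 2 y`, and its
preimage in the trigonal locus of `ℳ₆`, are generically reduced divisors. -/
theorem mainTheorem8 :
    Bitangent34.IsGenericallyReducedDivisor
      Bitangent34.C34.reg Bitangent34.Cb.ideal Bitangent34.Cb ∧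
    Bitangent34.IsGenericallyReducedDivisor
      Bitangent34.M6trig.reg Bitangent34.preimageCb.ideal Bitangent34.preimageCb := by
  exact ⟨Bitangent34.isGenericallyReducedDivisor_Cb,
    Bitangent34.isGenericallyReducedDivisor_preimageCb⟩
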